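/- Let $d\ge 1$, $s\ge 0$, $\frac{d}{d+1}<p\le\infty$, and let $f(z)=\lambda|z|^{2k}z$ with $k\in\mathbb N=\{0,1,2,\dots\}$, $\lambda\in\mathbb R$, or $f(z)=\lambda(e^{\rho|z|^2}-1)z$ with $\lambda,\rho\in\mathbb R$. Fix $\beta>0$ and a Schwartz function $\chi$ on $\mathbb R^d$ with $\operatorname{supp}\hat\chi\subset\{|\xi|\le 1\}$ and $\sum_{k\in\mathbb Z^d}\hat\chi(\xi-\beta k)=1$ for all $\xi\in\mathbb R^d$, where $\hat\chi(\xi)=\int\chi(x)e^{-2\pi i x\cdot\xi}\,dx$. The weighted modulation space $M^{p,1}_{0,s}(\mathbb R^d)$ is the set of all tempered distributions $v$ with $$\|v\|_{M^{p,1}_{0,s}}=\sum_{k\in\mathbb Z^d}\langle\beta k\rangle^{s}\,\big\|v*(M_{\beta k}\chi)\big\|_{L^p(\mathbb R^d)}<\infty,$$ where $M_\omega\chi(x)=e^{2\pi i\omega\cdot x}\chi(x)$ and $\langle x\rangle=(1+|x|^2)^{1/2}$; this is a norm for $p\ge1$ and a quasi-norm for $p<1$. Its elements are bounded continuous functions.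 For $u_0\in M^{p,1}_{0,s}(\mathbb R^d)$ consider the Cauchy problem $$i\,\partial_tu+\Delta u+f(u)=0,\qquad u(0)=u_0.\tag{NLS}$$ For an interval $J\ni 0$ in $[0,\infty)$, a solution of (NLS) in $C(J,M^{p,1}_{0,s})$ is a continuous map $u:J\to M^{p,1}_{0,s}(\mathbb R^d)$ with $u(0)=u_0$ such that at every $t\in J$ the equation holds in the sense of tempered distributions: for every Schwartz function $\varphi$, the function $\tau\mapsto\langle u(\tau),\varphi\rangle$ is differentiable at $t$ (one-sidedly at an end point of $J$), with $i\frac{d}{dt}\langle u(t),\varphi\rangle+\langle\Delta u(t),\varphi\rangle+\langle f(u(t)),\varphi\rangle=0$. Then there is a positive nonincreasing function $T_0$ on $[0,\infty)$, depending only on $d,p,s,f$ and the chosen $(\beta,\chi)$, such that for every $u_0\in M^{p,1}_{0,s}(\mathbb R^d)$ there are a maximal time $T^*\in(0,\infty]$ with $$T^*>T_0\big(\|u_0\|_{M^{p,1}_{0,s}}\big)$$ and a solution $u\in C([0,T^*),M^{p,1}_{0,s}(\mathbb R^d))$ of (NLS). It is unique and maximal: if $0<T<\infty$ and $v\in C([0,T],M^{p,1}_{0,s}(\mathbb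 R^d))$ is a solution of (NLS), then $T<T^*$ and $v=u$ on $[0,T]$. (In particular, (NLS) has a unique solution in $C([0,T],M^{p,1}_{0,s})$ for $T=T_0(\|u_0\|_{M^{p,1}_{0,s}})$.) Moreover, if $T^*<\infty$, then $$\limsup_{t\to T^*,\ t<T^*}\|u(t)\|_{M^{p,1}_{0,s}}=\infty.$$ -/

import Mathlib

open MeasureTheory Filter Topology
open scoped SchwartzMap BoundedContinuousFunction ENNReal NNReal FourierTransform Laplacian

noncomputable section

namespace NLSMod

/-- `ℝ^d` with its Euclidean norm. -/
abbrev Rd (d : ℕ) : Type := EuclideanSpace ℝ (Fin d)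

/-- The power nonlinearity `p_k(z) = a |z|^{2k} z`. -/
def powNl (a : ℝ) (k : ℕ) (z : ℂ) : ℂ := ((a * ‖z‖ ^ (2 * k) : ℝ) : ℂ) * z

/-- The exponential nonlinearity `e_ρ(z) = a (e^{ρ |z|^2} - 1) z`. -/
def expNl (a ρ : ℝ) (z : ℂ) : ℂ := ((a * (Real.exp (ρ * ‖z‖ ^ 2) - 1) : ℝ) : ℂ) * z

/-- The lattice point `β k`, for `k ∈ ℤ^d`. -/
def latticePt {d : ℕ} (β : ℝ) (k : Fin d → ℤ) : Rd d := WithLp.toLp 2 fun i => β * (k i : ℝ)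

/-- The character `y ↦ e^{2π i ω·y}`. -/
def character {d : ℕ} (ω : Rd d) (y : Rd d) : ℂ :=
  Complex.exp (2 * Real.pi * Complex.I * (inner ℝ ω y : ℝ))

/-- The modulation `M_ω φ(y) = e^{2π i ω·y} φ(y)` (see `modulate_apply`). -/
def modulate {d : ℕ} (ω : Rd d) (φ : 𝓢(Rd d, ℂ)) : 𝓢(Rd d, ℂ) :=
  SchwartzMap.smulLeftCLM ℂ (character ω) φ

theorem character_hasTemperateGrowth {d : ℕ} (ω : Rd d) :
    (character ω).HasTemperateGrowth := by
  set c : ℂ := 2 * Real.pi * Complex.I with hc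
  have hd : ∀ t : ℝ, HasDerivAt (fun t : ℝ => Complex.exp (c * t)) (c * Complex.exp (c * t)) t := by
    intro t
    have h := ((Complex.ofRealCLM.hasDerivAt (x := t)).const_mul c).cexp
    simpa [mul_comm] using h
  have hit : ∀ n : ℕ, iteratedDeriv n (fun t : ℝ => Complex.exp (c * t)) =
      fun t : ℝ => c ^ n * Complex.exp (c * t) := by
    intro n
    induction n with
    | zero => simp
    | succ n ih =>
      rw [iteratedDeriv_succ, ih]
      funext t
      rw [((hd t).const_mul (c ^ n)).deriv]
      ring
  have he : Function.HasTemperateGrowth (fun t : ℝ => Complex.exp (c * t)) := by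
    refine ⟨?_, fun n => ⟨0, ‖c‖ ^ n, fun t => ?_⟩⟩
    · exact (contDiff_const.mul Complex.ofRealCLM.contDiff).cexp
    · rw [norm_iteratedFDeriv_eq_norm_iteratedDeriv, hit n, norm_mul, norm_pow, Complex.norm_exp]
      simp [hc]
  exact he.comp (Function.hasTemperateGrowth_inner_right ω)

theorem modulate_apply {d : ℕ} (ω : Rd d) (φ : 𝓢(Rd d, ℂ)) (y : Rd d) :
    modulate ω φ y = Complex.exp (2 * Real.pi * Complex.I * (inner ℝ ω y : ℝ)) * φ y := by
  rw [modulate, SchwartzMap.smulLeftCLM_apply_apply (character_hasTemperateGrowth ω)]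
  rfl

/-- The Schwartz function `y ↦ φ(x - y)`. -/
def reflectAt {d : ℕ} (x : Rd d) (φ : 𝓢(Rd d, ℂ)) : 𝓢(Rd d, ℂ) :=
  SchwartzMap.compCLMOfAntilipschitz ℂ (g := fun y : Rd d => x - y) (K := 1) (by fun_prop)
    (fun _ _ => by simp [edist_dist, dist_eq_norm, norm_sub_rev]) φ

theorem reflectAt_apply {d : ℕ} (x y : Rd d) (φ : 𝓢(Rd d, ℂ)) :
    reflectAt x φ y = φ (x - y) := rfl

/-- The convolution `(v ∗ φ)(x) = ⟨v, φ(x - ·)⟩` of a tempered distribution and a Schwartz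
function; it is a (smooth) function. -/
def conv {d : ℕ} (v : 𝓢'(Rd d, ℂ)) (φ : 𝓢(Rd d, ℂ)) (x : Rd d) : ℂ := v (reflectAt x φ)

/-- The data `(β, χ)` entering the definition of the modulation spaces: `β > 0` and a Schwartz
function `χ` whose Fourier transform is supported in the closed unit ball and satisfies
`∑_{k ∈ ℤ^d} χ̂(ξ - β k) = 1` for every `ξ`. -/
structure Window (d : ℕ) where
  β : ℝ
  β_pos : 0 < β
  χ : 𝓢(Rd d, ℂ)
  supp : tsupport (𝓕 χ : 𝓢(Rd d, ℂ)) ⊆ Metric.closedBall 0 1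
  partition : ∀ ξ : Rd d, HasSum (fun k : Fin d → ℤ => (𝓕 χ : 𝓢(Rd d, ℂ)) (ξ - latticePt β k)) 1

/-- The (quasi-)norm of `M^{p,1}_{0,s}(ℝ^d)`, with values in `[0,∞]`:
`∑_{k ∈ ℤ^d} ⟨β k⟩^s ‖v ∗ (M_{β k} χ)‖_{L^p}`, where `⟨x⟩ = (1 + |x|²)^{1/2}`. -/
def modNorm {d : ℕ} (W : Window d) (p : ℝ≥0∞) (s : ℝ) (v : 𝓢'(Rd d, ℂ)) : ℝ≥0∞ :=
  ∑' k : Fin d → ℤ,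
    ENNReal.ofReal ((1 + ‖latticePt W.β k‖ ^ 2) ^ (s / 2)) *
      eLpNorm (conv v (modulate (latticePt W.β k) W.χ)) p volume

/-- Membership in the modulation space `M^{p,1}_{0,s}(ℝ^d)`. -/
def MemMod {d : ℕ} (W : Window d) (p : ℝ≥0∞) (s : ℝ) (v : 𝓢'(Rd d, ℂ)) : Prop :=
  modNorm W p s v < ∞

/-- `u ∈ C(J, M^{p,1}_{0,s})` solves `i u_t + Δu + F(u) = 0`, `u(0) = u₀` on the time set `J`.
The equation holds in the sense of tempered distributions at every time `t ∈ J` (with the one-sided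
time derivative at an end point of `J`): for every Schwartz function `φ`, the function
`τ ↦ ⟨u(τ), φ⟩` has a derivative `D` at `t`, and `i D + ⟨Δu(t), φ⟩ + ⟨F(u(t)), φ⟩ = 0`. The
elements of `M^{p,1}_{0,s}`, `s ≥ 0`, are bounded continuous functions, and `F(u(t))` is the
composition of `F` with the bounded continuous function `g` that represents `u(t)`. -/
structure IsSolution {d : ℕ} (W : Window d) (p : ℝ≥0∞) (s : ℝ) (F : ℂ → ℂ)
    (u₀ : 𝓢'(Rd d, ℂ)) (J : Set ℝ) (u : ℝ → 𝓢'(Rd d, ℂ)) : Prop where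
  mem : ∀ t ∈ J, MemMod W p s (u t)
  cont : ∀ t ∈ J, Tendsto (fun τ => modNorm W p s (u τ - u t)) (𝓝[J] t) (𝓝 0)
  init : u 0 = u₀
  eqn : ∀ t ∈ J, ∃ g : Rd d →ᵇ ℂ, (∀ φ : 𝓢(Rd d, ℂ), u t φ = ∫ x, g x * φ x) ∧
    ∀ φ : 𝓢(Rd d, ℂ), ∃ D : ℂ, HasDerivWithinAt (fun τ => u τ φ) D J t ∧
      Complex.I * D + (Δ (u t)) φ + ∫ x, F (g x) * φ x = 0

end NLSMod

end

/-! Let `S(t)` be the free Schrödinger group and `v_k = 4πβk` the group velocity of the block of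
frequency `βk`. For `w(t) = S(-t)u(t)` the equation becomes the ordinary differential equation `w' =
i S(-t) f(S(t)w)`.

Let `p ≥ 1`. The modulation space is then a Banach space of bounded continuous functions. The group
is bounded on it, locally uniformly in time: up to a unimodular factor it moves the kernel of the
`k`-th block with velocity `v_k` and spreads it by a rapidly decaying function
(`norm_propS_modulate`, `norm_propS_decay`). Products and conjugates are bounded too, because a
product of blocks has its spectrum near the signed sum of their frequencies, so it meets boundedly
many output blocks (`exists_modNorm_prod_le`). Hence `f`, a series in `|z|^{2m} z` with infinite
radius of convergence, is locally Lipschitz. Picard–Lindelöf with a step that depends only on bounds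
for the datum and the time gives the maximal solution, the lower bound for its lifespan and the
blow-up alternative (`exists_maximal_odeSol`). Solutions in the sense of distributions and solutions
of the differential equation correspond to each other (`ModSpace.weak_eqn`,
`ModSpace.exists_isOdeSol`), which gives uniqueness without auxiliary spaces.

Let `p ≤ 1`. As `d ≥ 1`, the hypothesis gives `p > 1/2`. By Bernstein's inequality `M^{p,1}` embeds
into `M^{1,1}`, where the equation has been solved; what remains is that membership in `M^{p,1}`
persists for the whole lifespan (`ModSpace.persistence`). This rests on a gain of integrability: the
Duhamel terms made of at least three factors lie in `M^{1/2,1}`. The blocks of a solution in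
`M^{1,1}` stay below tubes `a_k(y - τ v_k)` with integrable, slowly varying profiles
(`ModSpace.exists_envelope`). Let `m_k(x)` be the mass of all tubes met by a particle of velocity
`v_k` starting at `x` (`tubeMass`); its integral is the same for every `k`. Cauchy–Schwarz bounds
the `L^{1/2}` norm of an output block below `b_k` by `∫ m_k · ∫ b_k / m_k` (`eLpNorm_half_le`). In a
product of tubes, pick two factors whose frequency distance controls the spread of all the others,
and a third factor. The third factor divided by `m_k` sums to a quantity of the size of the velocity
difference of the first two, since the output particle stays in the cluster for a time inverse to
its spread (`exists_tsum_tsum_div_tubeMass_le`). The transversality of these two tubes gains the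
same velocity difference back (`exists_lintegral_prod_le`).

A linear term of `f` has too few factors and is removed by a phase rotation. Interpolation between
`L^{1/2}` and `L^∞` makes the solution a continuous curve in `M^{p,1}` for `p > 1/2`. Uniqueness,
lifespan and blow-up then come from `M^{1,1}` through the embedding. -/

noncomputable section

namespace NLSMod

/-! ### Maximal solutions of ordinary differential equations in Banach spaces -/

section MaximalSolutions

variable {E : Type*} [NormedAddCommGroup E] [NormedSpace ℝ E]

/-- `w` solves `w' = G(t, w)` on `[0, T]` with `w(0) = x₀`. -/
structure IsOdeSol (G : ℝ → E → E) (x₀ : E) (T : ℝ) (w : ℝ → E) : Prop where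
  init : w 0 = x₀
  deriv : ∀ t ∈ Set.Icc 0 T, HasDerivWithinAt w (G t (w t)) (Set.Icc 0 T) t

theorem IsOdeSol.mono {G : ℝ → E → E} {x₀ : E} {T T' : ℝ} {w : ℝ → E}
    (h : IsOdeSol G x₀ T w) (hT : T' ≤ T) : IsOdeSol G x₀ T' w :=
  ⟨h.init, fun t ht => (h.deriv t ⟨ht.1, ht.2.trans hT⟩).mono (Set.Icc_subset_Icc_right hT)⟩

theorem IsOdeSol.continuousOn {G : ℝ → E → E} {x₀ : E} {T : ℝ} {w : ℝ → E}
    (h : IsOdeSol G x₀ T w) : ContinuousOn w (Set.Icc 0 T) :=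
  fun t ht => (h.deriv t ht).continuousWithinAt

/-- Both solutions have compact range, hence stay in one ball, where the field is Lipschitz
uniformly in time; Gronwall applies. -/
theorem IsOdeSol.eqOn {G : ℝ → E → E}
    (hLip : ∀ R T : ℝ, ∃ K : ℝ≥0, ∀ t ∈ Set.Icc 0 T, LipschitzOnWith K (G t) (Metric.closedBall 0 R))
    {x₀ : E} {T : ℝ} {w v : ℝ → E}
    (hw : IsOdeSol G x₀ T w) (hv : IsOdeSol G x₀ T v) : Set.EqOn v w (Set.Icc 0 T) := by
  obtain ⟨R₁, h₁⟩ := (isCompact_Icc.image_of_continuousOn hw.continuousOn).isBounded.subset_closedBall 0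
  obtain ⟨R₂, h₂⟩ := (isCompact_Icc.image_of_continuousOn hv.continuousOn).isBounded.subset_closedBall 0
  obtain ⟨K, hK⟩ := hLip (max R₁ R₂) T
  have key : ∀ {u : ℝ → E}, IsOdeSol G x₀ T u → ∀ t ∈ Set.Ico 0 T,
      HasDerivWithinAt u (G t (u t)) (Set.Ici t) t := fun {u} hu t ht =>
    (hu.deriv t ⟨ht.1, ht.2.le⟩).mono_of_mem_nhdsWithin
      (mem_of_superset (Icc_mem_nhdsGE ht.2) (Set.Icc_subset_Icc_left ht.1))
  refine ODE_solution_unique_of_mem_Icc_right (v := G) (K := K)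
    (s := fun _ => Metric.closedBall 0 (max R₁ R₂))
    (fun t ht => hK t ⟨ht.1, ht.2.le⟩) hv.continuousOn (key hv) (fun t ht => ?_)
    hw.continuousOn (key hw) (fun t ht => ?_) (hv.init.trans hw.init.symm)
  · exact Metric.closedBall_subset_closedBall (le_max_right _ _)
      (h₂ (Set.mem_image_of_mem v ⟨ht.1, ht.2.le⟩))
  · exact Metric.closedBall_subset_closedBall (le_max_left _ _)
      (h₁ (Set.mem_image_of_mem w ⟨ht.1, ht.2.le⟩))

/-- The point is that the step `δ` depends only on the bounds `R` and `T`. This uniformity yields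
both the lower bound for the lifespan and the blow-up alternative. -/
theorem exists_local_odeSol [CompleteSpace E] {G : ℝ → E → E}
    (hLip : ∀ R T : ℝ, ∃ K : ℝ≥0, ∀ t ∈ Set.Icc 0 T, LipschitzOnWith K (G t) (Metric.closedBall 0 R))
    (hcont : ∀ x, Continuous fun t => G t x) (R T : ℝ) :
    ∃ δ : ℝ, 0 < δ ∧ ∀ t₀ ∈ Set.Icc 0 T, ∀ x : E, ‖x‖ ≤ R → ∃ α : ℝ → E, α t₀ = x ∧
      ∀ t ∈ Set.Icc t₀ (t₀ + δ), HasDerivWithinAt α (G t (α t)) (Set.Icc t₀ (t₀ + δ)) t := by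
  obtain ⟨K, hK⟩ := hLip (|R| + 1) (T + 1)
  obtain ⟨M, hM⟩ := (isCompact_Icc (a := (0 : ℝ)) (b := T + 1)).exists_bound_of_continuousOn
    (hcont 0).continuousOn
  -- `L` bounds the field on the ball of radius `|R| + 1`, which contains the unit ball about any
  -- admissible `x`. The step `1/(L+1)` keeps the solution in that unit ball.
  set L : ℝ≥0 := ⟨|M| + K * (|R| + 1), by positivity⟩ with hL
  have hLc : (L : ℝ) = |M| + K * (|R| + 1) := rfl
  refine ⟨1 / (L + 1), by positivity, fun t₀ ht₀ x hx => ?_⟩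
  have hδ : 1 / ((L : ℝ) + 1) ≤ 1 := by
    rw [div_le_one (by positivity)]; have := L.coe_nonneg; linarith
  have hδ0 : 0 < 1 / ((L : ℝ) + 1) := by positivity
  have hsub : Set.Icc t₀ (t₀ + 1 / ((L : ℝ) + 1)) ⊆ Set.Icc 0 (T + 1) :=
    Set.Icc_subset_Icc ht₀.1 (by linarith [ht₀.2])
  have hball : Metric.closedBall x ((1 : ℝ≥0) : ℝ) ⊆ Metric.closedBall 0 (|R| + 1) := by
    intro y hy
    rw [Metric.mem_closedBall, dist_eq_norm] at hy
    rw [mem_closedBall_zero_iff]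
    have := norm_add_le (y - x) x
    rw [sub_add_cancel] at this
    have := le_abs_self R
    push_cast at hy
    linarith
  have hpl : IsPicardLindelof G (tmin := t₀) (tmax := t₀ + 1 / ((L : ℝ) + 1))
      ⟨t₀, le_rfl, by linarith⟩ x 1 0 L K := by
    refine ⟨fun t ht => (hK t (hsub ht)).mono hball, fun y _ => (hcont y).continuousOn,
      fun t ht y hy => ?_, ?_⟩
    · have h1 := (hK t (hsub ht)).dist_le_mul y (hball hy) 0
        (Metric.mem_closedBall_self (by positivity))
      have h2 := hM t (hsub ht)
      have h3 : ‖y‖ ≤ |R| + 1 := mem_closedBall_zero_iff.1 (hball hy)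
      rw [dist_eq_norm, dist_zero_right] at h1
      have h4 := norm_add_le (G t y - G t 0) (G t 0)
      rw [sub_add_cancel] at h4
      have h5 : (K : ℝ) * ‖y‖ ≤ K * (|R| + 1) := by gcongr
      rw [hLc]
      linarith [le_abs_self M]
    · simp only [add_sub_cancel_left, sub_self, NNReal.coe_one, NNReal.coe_zero, sub_zero]
      rw [max_eq_left hδ0.le, mul_one_div, div_le_one (by positivity)]
      linarith
  obtain ⟨α, h0, h1⟩ := hpl.exists_eq_forall_mem_Icc_hasDerivWithinAt₀
  exact ⟨α, h0, h1⟩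

theorem IsOdeSol.glue {G : ℝ → E → E} {x₀ : E} {t₀ t₁ : ℝ} {w α : ℝ → E}
    (hw : IsOdeSol G x₀ t₀ w) (h0 : 0 ≤ t₀) (h01 : t₀ < t₁) (hα : α t₀ = w t₀)
    (hα' : ∀ t ∈ Set.Icc t₀ t₁, HasDerivWithinAt α (G t (α t)) (Set.Icc t₀ t₁) t) :
    IsOdeSol G x₀ t₁ (fun t => if t ≤ t₀ then w t else α t) := by
  set u : ℝ → E := fun t => if t ≤ t₀ then w t else α t with hu
  have hu1 : ∀ t, t ≤ t₀ → u t = w t := fun t ht => if_pos ht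
  have hu2 : ∀ t, t₀ ≤ t → u t = α t := by
    intro t ht
    rcases ht.eq_or_lt with rfl | h
    · rw [hu1 _ le_rfl, hα]
    · exact if_neg (not_le.2 h)
  refine ⟨by rw [hu1 0 h0, hw.init], fun t ht => ?_⟩
  have hunion : Set.Icc 0 t₁ = Set.Icc 0 t₀ ∪ Set.Icc t₀ t₁ :=
    (Set.Icc_union_Icc_eq_Icc h0 h01.le).symm
  have hL : ∀ s ∈ Set.Icc 0 t₀, HasDerivWithinAt u (G s (u s)) (Set.Icc 0 t₀) s := by
    intro s hs
    rw [hu1 s hs.2]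
    exact (hw.deriv s hs).congr (fun y hy => hu1 y hy.2) (hu1 s hs.2)
  have hR : ∀ s ∈ Set.Icc t₀ t₁, HasDerivWithinAt u (G s (u s)) (Set.Icc t₀ t₁) s := by
    intro s hs
    rw [hu2 s hs.1]
    exact (hα' s hs).congr (fun y hy => hu2 y hy.1) (hu2 s hs.1)
  rcases lt_trichotomy t t₀ with h | h | h
  · refine (hL t ⟨ht.1, h.le⟩).mono_of_mem_nhdsWithin ?_
    filter_upwards [self_mem_nhdsWithin, mem_nhdsWithin_of_mem_nhds (Iio_mem_nhds h)] with y hy hy'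
    exact ⟨hy.1, le_of_lt hy'⟩
  -- At the junction the two one-sided derivatives agree because `α t₀ = w t₀`.
  · subst h
    rw [hunion]
    exact (hL t ⟨ht.1, le_rfl⟩).union (hR t ⟨le_rfl, ht.2⟩)
  · refine (hR t ⟨h.le, ht.2⟩).mono_of_mem_nhdsWithin ?_
    filter_upwards [self_mem_nhdsWithin, mem_nhdsWithin_of_mem_nhds (Ioi_mem_nhds h)] with y hy hy'
    exact ⟨le_of_lt hy', hy.2⟩

/-- The running minimum of `δ` up to `⌈r⌉` is monotone in `r` and, being over a finite set,
positive. -/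
theorem exists_antitone_lower (δ : ℕ → ℝ) (hδ : ∀ n, 0 < δ n) :
    ∃ T₀ : ℝ≥0 → ℝ, Antitone T₀ ∧ (∀ r, 0 < T₀ r) ∧ ∀ r, T₀ r ≤ δ ⌈r⌉₊ := by
  refine ⟨fun r => (Finset.range (⌈r⌉₊ + 1)).inf' Finset.nonempty_range_add_one δ, fun a b hab => ?_, fun r => ?_,
    fun r => Finset.inf'_le _ (by simp)⟩
  · refine Finset.inf'_mono _ ?_ _
    intro n hn
    have := Nat.ceil_le_ceil hab
    simp only [Finset.mem_range] at hn ⊢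
    omega
  · exact (Finset.lt_inf'_iff _).2 fun n _ => hδ n

/-- `Tmax` is the supremum of all existence times. It is not attained, because every solution can be
prolonged by a step that only depends on its size and time. The same prolongation shows that a
solution cannot remain bounded near a finite `Tmax`. -/
theorem exists_maximal_odeSol [CompleteSpace E] {G : ℝ → E → E}
    (hLip : ∀ R T : ℝ, ∃ K : ℝ≥0, ∀ t ∈ Set.Icc 0 T, LipschitzOnWith K (G t) (Metric.closedBall 0 R))
    (hcont : ∀ x, Continuous fun t => G t x) :
    ∃ T₀ : ℝ≥0 → ℝ, Antitone T₀ ∧ (∀ r, 0 < T₀ r) ∧ ∀ x₀ : E,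
      ∃ Tmax : ℝ≥0∞, ENNReal.ofReal (T₀ ‖x₀‖₊) < Tmax ∧ ∃ w : ℝ → E,
        (∀ T, ENNReal.ofReal T < Tmax → IsOdeSol G x₀ T w) ∧
        (∀ T, 0 < T → ∀ v, IsOdeSol G x₀ T v → ENNReal.ofReal T < Tmax ∧
          Set.EqOn v w (Set.Icc 0 T)) ∧
        (Tmax < ∞ → ∀ C : ℝ, ∃ᶠ t in 𝓝[<] Tmax.toReal, C < ‖w t‖) := by
  choose δ hδ hloc using exists_local_odeSol hLip hcont
  obtain ⟨T₀, hanti, hpos, hle⟩ := exists_antitone_lower (fun n => δ n 0 / 2)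
    (fun n => half_pos (hδ n 0))
  refine ⟨T₀, hanti, hpos, fun x₀ => ?_⟩
  -- every solution extends
  have hext : ∀ (R T : ℝ) (w : ℝ → E) (t : ℝ), t ∈ Set.Icc 0 T → IsOdeSol G x₀ t w → ‖w t‖ ≤ R →
      ∃ w', IsOdeSol G x₀ (t + δ R T) w' := by
    intro R T w t ht hw hR
    obtain ⟨α, hα, hα'⟩ := hloc R T t ht (w t) hR
    exact ⟨_, hw.glue ht.1 (by linarith [hδ R T]) hα hα'⟩
  set Tmax : ℝ≥0∞ := ⨆ (T : ℝ) (_ : ∃ w, IsOdeSol G x₀ T w), ENNReal.ofReal T with hTm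
  have hlt : ∀ T, 0 ≤ T → ∀ v, IsOdeSol G x₀ T v → ENNReal.ofReal T < Tmax := by
    intro T hT v hv
    obtain ⟨w', hw'⟩ := hext ‖v T‖ T v T ⟨hT, le_rfl⟩ hv le_rfl
    refine lt_of_lt_of_le ?_ (le_iSup₂_of_le (T + δ ‖v T‖ T) ⟨w', hw'⟩ le_rfl)
    have := hδ ‖v T‖ T
    exact (ENNReal.ofReal_lt_ofReal_iff (by linarith)).2 (by linarith)
  have hex : ∀ T, ENNReal.ofReal T < Tmax → ∃ v, IsOdeSol G x₀ T v := by
    intro T hT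
    obtain ⟨S, hS⟩ := lt_iSup_iff.1 hT
    obtain ⟨⟨v, hv⟩, hS'⟩ := lt_iSup_iff.1 hS
    exact ⟨v, hv.mono (ENNReal.ofReal_lt_ofReal_iff'.1 hS').1.le⟩
  choose! v hv using hex
  -- The solutions `v T` chosen for different `T` agree on common intervals, so the diagonal is one
  -- solution on `[0, Tmax)`.
  have hw : ∀ T, ENNReal.ofReal T < Tmax → Set.EqOn (fun t => v t t) (v T) (Set.Icc 0 T) := by
    intro T hT t ht
    have ht' : ENNReal.ofReal t < Tmax := (ENNReal.ofReal_le_ofReal ht.2).trans_lt hT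
    exact ((hv t ht').eqOn hLip ((hv T hT).mono ht.2) ⟨ht.1, le_rfl⟩).symm
  have hwsol : ∀ T, ENNReal.ofReal T < Tmax → IsOdeSol G x₀ T (fun t => v t t) := by
    intro T hT
    have h0 : (0 : ℝ≥0∞) < Tmax := lt_of_le_of_lt zero_le hT
    refine ⟨(hv 0 (by simpa using h0)).init, fun t ht => ?_⟩
    have := ((hv T hT).deriv t ht).congr (hw T hT) (hw T hT ht)
    rwa [← hw T hT ht] at this
  refine ⟨Tmax, ?_, fun t => v t t, hwsol, ?_, ?_⟩
  · have hc : ‖x₀‖ ≤ ⌈‖x₀‖₊⌉₊ := by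
      have := Nat.le_ceil ‖x₀‖₊
      exact_mod_cast this
    obtain ⟨α, hα, hα'⟩ := hloc ⌈‖x₀‖₊⌉₊ 0 0 ⟨le_rfl, le_rfl⟩ x₀ hc
    rw [zero_add] at hα'
    refine lt_of_le_of_lt (ENNReal.ofReal_le_ofReal ?_) (hlt _ (hδ _ _).le α ⟨hα, hα'⟩)
    have := hδ ⌈‖x₀‖₊⌉₊ 0
    exact (hle _).trans (by linarith)
  · intro T hT u hu
    have h := hlt T hT.le u hu
    exact ⟨h, (hwsol T h).eqOn hLip hu⟩
  · intro hfin C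
    by_contra hcon
    rw [not_frequently] at hcon
    have hTpos : 0 < Tmax.toReal := by
      refine ENNReal.toReal_pos ?_ hfin.ne
      have h := hlt 0 le_rfl (fun _ => x₀) ⟨rfl, fun t ht => ?_⟩
      · exact (lt_of_le_of_lt zero_le h).ne'
      · obtain rfl : t = 0 := le_antisymm ht.2 ht.1
        rw [Set.Icc_self]
        exact hasDerivWithinAt_iff_hasFDerivWithinAt.2 (.of_subsingleton Set.subsingleton_singleton)
    set S := Tmax.toReal with hS
    have hd := hδ C S
    -- Restarting less than `δ/2` before `S` with norm at most `C`, a step of length `δ` passes `S`,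
    -- a contradiction.
    have hev : ∀ᶠ t in 𝓝[<] S, t ∈ Set.Ioo (max 0 (S - δ C S / 2)) S :=
      Ioo_mem_nhdsLT (max_lt hTpos (by linarith))
    obtain ⟨t, ht1, ht2⟩ := (hcon.and hev).exists
    have htS : ENNReal.ofReal t < Tmax := by
      rw [← ENNReal.ofReal_toReal hfin.ne]
      exact (ENNReal.ofReal_lt_ofReal_iff hTpos).2 ht2.2
    have ht0 : 0 ≤ t := (le_max_left _ _).trans ht2.1.le
    obtain ⟨w', hw'⟩ := hext C S _ t ⟨ht0, ht2.2.le⟩ (hwsol t htS) (not_lt.1 ht1)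
    have h := hlt _ (by linarith) w' hw'
    rw [← ENNReal.ofReal_toReal hfin.ne, ENNReal.ofReal_lt_ofReal_iff hTpos] at h
    have := (le_max_right _ _).trans_lt ht2.1
    linarith

end MaximalSolutions

/-! ### Fourier calculus on Schwartz functions and the free Schrödinger group -/

section FourierBasics

variable {d : ℕ}

theorem fourier_apply_eq (φ : 𝓢(Rd d, ℂ)) (ξ : Rd d) :
    (𝓕 φ : 𝓢(Rd d, ℂ)) ξ = ∫ x, Complex.exp (-(2 * Real.pi * Complex.I * (inner ℝ x ξ : ℝ))) * φ x := by
  rw [SchwartzMap.fourier_coe, Real.fourier_eq']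
  refine integral_congr_ae (Eventually.of_forall fun x => ?_)
  simp only [smul_eq_mul]
  congr 2
  push_cast
  ring

theorem fourierInv_apply_eq (φ : 𝓢(Rd d, ℂ)) (x : Rd d) :
    (𝓕⁻ φ : 𝓢(Rd d, ℂ)) x = ∫ ξ, Complex.exp (2 * Real.pi * Complex.I * (inner ℝ ξ x : ℝ)) * φ ξ := by
  rw [SchwartzMap.fourierInv_coe, Real.fourierInv_eq']
  refine integral_congr_ae (Eventually.of_forall fun x => ?_)
  simp only [smul_eq_mul]
  congr 2
  push_cast
  ring

theorem schwartz_eq_fourierInv (φ : 𝓢(Rd d, ℂ)) (x : Rd d) :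
    φ x = ∫ ξ, Complex.exp (2 * Real.pi * Complex.I * (inner ℝ ξ x : ℝ)) * (𝓕 φ : 𝓢(Rd d, ℂ)) ξ := by
  rw [← fourierInv_apply_eq, FourierTransform.fourierInv_fourier_eq]

theorem fourier_ext {φ ψ : 𝓢(Rd d, ℂ)}
    (h : ∀ ξ, (𝓕 φ : 𝓢(Rd d, ℂ)) ξ = (𝓕 ψ : 𝓢(Rd d, ℂ)) ξ) : φ = ψ := by
  have h' : (𝓕 φ : 𝓢(Rd d, ℂ)) = 𝓕 ψ := SchwartzMap.ext h
  rw [← FourierTransform.fourierInv_fourier_eq (F := 𝓢(Rd d, ℂ)) φ, h',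
    FourierTransform.fourierInv_fourier_eq]

theorem fourier_sub' (φ ψ : 𝓢(Rd d, ℂ)) : (𝓕 (φ - ψ) : 𝓢(Rd d, ℂ)) = 𝓕 φ - 𝓕 ψ :=
  map_sub (FourierTransform.fourierCLM ℂ 𝓢(Rd d, ℂ)) φ ψ

theorem fourier_modulate (ω : Rd d) (φ : 𝓢(Rd d, ℂ)) (ξ : Rd d) :
    (𝓕 (modulate ω φ) : 𝓢(Rd d, ℂ)) ξ = (𝓕 φ : 𝓢(Rd d, ℂ)) (ξ - ω) := by
  rw [fourier_apply_eq, fourier_apply_eq]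
  refine integral_congr_ae (Eventually.of_forall fun x => ?_)
  simp only [modulate_apply]
  rw [← mul_assoc, ← Complex.exp_add, inner_sub_right, real_inner_comm ω x]
  congr 2
  push_cast
  ring

theorem norm_modulate_apply (ω : Rd d) (φ : 𝓢(Rd d, ℂ)) (x : Rd d) :
    ‖modulate ω φ x‖ = ‖φ x‖ := by
  rw [modulate_apply, norm_mul, Complex.norm_exp]
  simp

theorem fourier_reflectAt (x : Rd d) (φ : 𝓢(Rd d, ℂ)) (ξ : Rd d) :
    (𝓕 (reflectAt x φ) : 𝓢(Rd d, ℂ)) ξ =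
      Complex.exp (-(2 * Real.pi * Complex.I * (inner ℝ x ξ : ℝ))) * (𝓕 φ : 𝓢(Rd d, ℂ)) (-ξ) := by
  rw [fourier_apply_eq, fourier_apply_eq, ← integral_const_mul,
    ← integral_sub_left_eq_self (fun y => _ * (_ * _)) volume x]
  refine integral_congr_ae (Eventually.of_forall fun y => ?_)
  simp only [reflectAt_apply]
  rw [← mul_assoc, ← Complex.exp_add, inner_sub_left, inner_neg_right, inner_neg_right]
  congr 2
  push_cast
  ring

/-- Convolution of two Schwartz functions. -/
def sconv (φ ψ : 𝓢(Rd d, ℂ)) : 𝓢(Rd d, ℂ) :=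
  SchwartzMap.convolution (ContinuousLinearMap.mul ℂ ℂ) φ ψ

theorem sconv_apply (φ ψ : 𝓢(Rd d, ℂ)) (x : Rd d) :
    sconv φ ψ x = ∫ y, φ y * ψ (x - y) := by
  rw [sconv, SchwartzMap.convolution_apply]
  rfl

theorem fourier_sconv (φ ψ : 𝓢(Rd d, ℂ)) (ξ : Rd d) :
    (𝓕 (sconv φ ψ) : 𝓢(Rd d, ℂ)) ξ = (𝓕 φ : 𝓢(Rd d, ℂ)) ξ * (𝓕 ψ : 𝓢(Rd d, ℂ)) ξ := by
  rw [sconv, SchwartzMap.fourier_convolution]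
  rfl

theorem sconv_eq_self {φ ψ : 𝓢(Rd d, ℂ)}
    (h : ∀ ξ, (𝓕 φ : 𝓢(Rd d, ℂ)) ξ ≠ 0 → (𝓕 ψ : 𝓢(Rd d, ℂ)) ξ = 1) : sconv φ ψ = φ :=
  fourier_ext fun ξ => by
    rw [fourier_sconv]
    by_cases h0 : (𝓕 φ : 𝓢(Rd d, ℂ)) ξ = 0
    · rw [h0, zero_mul]
    · rw [h ξ h0, mul_one]

theorem sconv_eq_zero {φ ψ : 𝓢(Rd d, ℂ)}
    (h : ∀ ξ, (𝓕 φ : 𝓢(Rd d, ℂ)) ξ ≠ 0 → (𝓕 ψ : 𝓢(Rd d, ℂ)) ξ = 0) : sconv φ ψ = 0 :=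
  fourier_ext fun ξ => by
    have h0 : (𝓕 (0 : 𝓢(Rd d, ℂ)) : 𝓢(Rd d, ℂ)) ξ = 0 := by
      rw [fourier_apply_eq]; simp
    rw [fourier_sconv, h0]
    by_cases h0 : (𝓕 φ : 𝓢(Rd d, ℂ)) ξ = 0
    · rw [h0, zero_mul]
    · rw [h ξ h0, mul_zero]

theorem exists_fourier_eq (ψ : 𝓢(Rd d, ℂ)) :
    ∃ φ : 𝓢(Rd d, ℂ), (𝓕 φ : 𝓢(Rd d, ℂ)) = ψ :=
  ⟨𝓕⁻ ψ, FourierTransform.fourier_fourierInv_eq ψ⟩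

theorem exists_cutoff (r : ℝ) : ∃ ψ : 𝓢(Rd d, ℂ),
    (∀ ξ, ‖ξ‖ ≤ r → (𝓕 ψ : 𝓢(Rd d, ℂ)) ξ = 1) ∧
      ∀ ξ, r + 1 ≤ ‖ξ‖ → (𝓕 ψ : 𝓢(Rd d, ℂ)) ξ = 0 := by
  rcases lt_or_ge r 0 with hr | hr
  · refine ⟨0, fun ξ hξ => absurd (norm_nonneg ξ) (not_le.2 (hξ.trans_lt hr)), fun ξ _ => ?_⟩
    rw [fourier_apply_eq]; simp
  · let b : ContDiffBump (0 : Rd d) := ⟨r + 1 / 2, r + 1, by linarith, by linarith⟩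
    have hc : HasCompactSupport (fun x => (b x : ℂ)) :=
      b.hasCompactSupport.comp_left (g := fun y : ℝ => (y : ℂ)) Complex.ofReal_zero
    have hs : ContDiff ℝ ((⊤ : ℕ∞) : WithTop ℕ∞) (fun x => (b x : ℂ)) :=
      Complex.ofRealCLM.contDiff.comp b.contDiff
    obtain ⟨ψ, hψ⟩ := exists_fourier_eq (hc.toSchwartzMap hs)
    have hval : ∀ ξ, (𝓕 ψ : 𝓢(Rd d, ℂ)) ξ = (b ξ : ℂ) := fun ξ => by rw [hψ]; rfl
    refine ⟨ψ, fun ξ hξ => ?_, fun ξ hξ => ?_⟩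
    · rw [hval, b.one_of_mem_closedBall]
      · simp
      · rw [mem_closedBall_zero_iff]; change ‖ξ‖ ≤ r + 1 / 2; linarith
    · rw [hval, b.zero_of_le_dist]
      · simp
      · rw [dist_zero_right]; exact hξ

theorem cexp_mul_hasTemperateGrowth {c : ℂ} (hc : c.re = 0) :
    Function.HasTemperateGrowth (fun t : ℝ => Complex.exp (c * t)) := by
  have hd : ∀ t : ℝ, HasDerivAt (fun t : ℝ => Complex.exp (c * t)) (c * Complex.exp (c * t)) t := by
    intro t
    have h := ((Complex.ofRealCLM.hasDerivAt (x := t)).const_mul c).cexp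
    simpa [mul_comm] using h
  have hit : ∀ n : ℕ, iteratedDeriv n (fun t : ℝ => Complex.exp (c * t)) =
      fun t : ℝ => c ^ n * Complex.exp (c * t) := by
    intro n
    induction n with
    | zero => simp
    | succ n ih =>
      rw [iteratedDeriv_succ, ih]
      funext t
      rw [((hd t).const_mul (c ^ n)).deriv]
      ring
  refine ⟨?_, fun n => ⟨0, ‖c‖ ^ n, fun t => ?_⟩⟩
  · exact (contDiff_const.mul Complex.ofRealCLM.contDiff).cexp
  · rw [norm_iteratedFDeriv_eq_norm_iteratedDeriv, hit n, norm_mul, norm_pow, Complex.norm_exp]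
    simp [hc]

/-- The symbol `e^{-4π² i t |ξ|²}` of the free Schrödinger group. -/
def schrSymbol (t : ℝ) (ξ : Rd d) : ℂ :=
  Complex.exp (-(4 * Real.pi ^ 2 * t) * Complex.I * ((‖ξ‖ ^ 2 : ℝ) : ℂ))

theorem schrSymbol_hasTemperateGrowth (t : ℝ) :
    (schrSymbol t : Rd d → ℂ).HasTemperateGrowth := by
  have h1 : Function.HasTemperateGrowth (fun ξ : Rd d => ‖ξ‖ ^ 2) := by fun_prop
  refine (cexp_mul_hasTemperateGrowth (c := -(4 * Real.pi ^ 2 * t) * Complex.I) ?_).comp h1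
  rw [show (-(4 * (Real.pi : ℂ) ^ 2 * t)) = ((-(4 * Real.pi ^ 2 * t) : ℝ) : ℂ) by push_cast; ring,
    Complex.re_ofReal_mul, Complex.I_re, mul_zero]

theorem norm_schrSymbol (t : ℝ) (ξ : Rd d) : ‖schrSymbol t ξ‖ = 1 := by
  rw [schrSymbol, show (-(4 * (Real.pi : ℂ) ^ 2 * t)) * Complex.I * ((‖ξ‖ ^ 2 : ℝ) : ℂ) =
    ((-(4 * Real.pi ^ 2 * t) * ‖ξ‖ ^ 2 : ℝ) : ℂ) * Complex.I by push_cast; ring,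
    Complex.norm_exp_ofReal_mul_I]

/-- The free Schrödinger group on Schwartz functions. -/
def propS (t : ℝ) : 𝓢(Rd d, ℂ) →L[ℂ] 𝓢(Rd d, ℂ) :=
  SchwartzMap.fourierMultiplierCLM ℂ (schrSymbol t)

theorem fourier_propS (t : ℝ) (φ : 𝓢(Rd d, ℂ)) (ξ : Rd d) :
    (𝓕 (propS t φ) : 𝓢(Rd d, ℂ)) ξ = schrSymbol t ξ * (𝓕 φ : 𝓢(Rd d, ℂ)) ξ := by
  rw [propS, SchwartzMap.fourierMultiplierCLM_apply, FourierTransform.fourier_fourierInv_eq,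
    SchwartzMap.smulLeftCLM_apply_apply (schrSymbol_hasTemperateGrowth t), smul_eq_mul]

theorem propS_apply (t : ℝ) (φ : 𝓢(Rd d, ℂ)) (x : Rd d) :
    propS t φ x = ∫ ξ, Complex.exp (2 * Real.pi * Complex.I * (inner ℝ ξ x : ℝ)) *
      (schrSymbol t ξ * (𝓕 φ : 𝓢(Rd d, ℂ)) ξ) := by
  rw [schwartz_eq_fourierInv]
  simp_rw [fourier_propS]

theorem propS_zero (φ : 𝓢(Rd d, ℂ)) : propS 0 φ = φ :=
  fourier_ext fun ξ => by rw [fourier_propS]; simp [schrSymbol]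

theorem propS_add (t t' : ℝ) (φ : 𝓢(Rd d, ℂ)) : propS (t + t') φ = propS t (propS t' φ) :=
  fourier_ext fun ξ => by
    rw [fourier_propS, fourier_propS, fourier_propS, ← mul_assoc, schrSymbol, schrSymbol,
      schrSymbol, ← Complex.exp_add]
    congr 2
    push_cast
    ring

/-- The symbol is even, so the group commutes with reflections as well as with translations. -/
theorem propS_reflectAt (t : ℝ) (x : Rd d) (φ : 𝓢(Rd d, ℂ)) :
    propS t (reflectAt x φ) = reflectAt x (propS t φ) :=
  fourier_ext fun ξ => by
    rw [fourier_propS, fourier_reflectAt, fourier_reflectAt, fourier_propS]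
    simp only [schrSymbol, norm_neg]
    ring

theorem propS_sconv (t : ℝ) (φ ψ : 𝓢(Rd d, ℂ)) :
    propS t (sconv φ ψ) = sconv φ (propS t ψ) :=
  fourier_ext fun ξ => by
    rw [fourier_propS, fourier_sconv, fourier_sconv, fourier_propS]
    ring

/-- Galilean invariance: shifting `ξ` by `ω` and expanding `|ξ + ω|²`, the cross term is a
translation by `4πtω` and all other new factors are unimodular and independent of `ξ`. -/
theorem norm_propS_modulate (t : ℝ) (ω : Rd d) (φ : 𝓢(Rd d, ℂ)) (x : Rd d) :
    ‖propS t (modulate ω φ) x‖ = ‖propS t φ (x - (4 * Real.pi * t) • ω)‖ := by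
  rw [propS_apply, propS_apply,
    ← integral_add_right_eq_self (fun ξ => _ * (schrSymbol t ξ * (𝓕 (modulate ω φ) : 𝓢(Rd d, ℂ)) ξ)) ω]
  have : ∀ ξ : Rd d, Complex.exp (2 * Real.pi * Complex.I * (inner ℝ (ξ + ω) x : ℝ)) *
      (schrSymbol t (ξ + ω) * (𝓕 (modulate ω φ) : 𝓢(Rd d, ℂ)) (ξ + ω)) =
      (Complex.exp (2 * Real.pi * Complex.I * (inner ℝ ω x : ℝ)) * schrSymbol t ω) *
      (Complex.exp (2 * Real.pi * Complex.I * (inner ℝ ξ (x - (4 * Real.pi * t) • ω) : ℝ)) *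
      (schrSymbol t ξ * (𝓕 φ : 𝓢(Rd d, ℂ)) ξ)) := by
    intro ξ
    rw [fourier_modulate, add_sub_cancel_right]
    simp only [schrSymbol, ← mul_assoc, ← Complex.exp_add]
    congr 2
    rw [inner_add_left, inner_sub_right, inner_smul_right, norm_add_sq_real]
    push_cast
    ring
  simp_rw [this]
  rw [integral_const_mul, norm_mul, norm_mul, norm_schrSymbol, Complex.norm_exp]
  simp

end FourierBasics

/-! ### Decay of evolved Schwartz functions, locally uniform in time -/

section Decay

variable {d : ℕ}

theorem norm_propS_le (t : ℝ) (φ : 𝓢(Rd d, ℂ)) (x : Rd d) :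
    ‖propS t φ x‖ ≤ ∫ ξ, ‖(𝓕 φ : 𝓢(Rd d, ℂ)) ξ‖ := by
  rw [propS_apply]
  refine (norm_integral_le_integral_norm _).trans_eq ?_
  refine integral_congr_ae (Eventually.of_forall fun ξ => ?_)
  simp only [norm_mul, norm_schrSymbol, Complex.norm_exp]
  simp

theorem innerC_hasTemperateGrowth (m : Rd d) :
    (fun y : Rd d => ((inner ℝ y m : ℝ) : ℂ)).HasTemperateGrowth :=
  (Complex.ofRealCLM.hasTemperateGrowth).comp
    (((innerSL ℝ).flip m).hasTemperateGrowth)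

open LineDeriv in
theorem fourier_inner_mul (φ : 𝓢(Rd d, ℂ)) (m ξ : Rd d) :
    (∂_{m} (𝓕 φ : 𝓢(Rd d, ℂ)) : 𝓢(Rd d, ℂ)) ξ = -(2 * Real.pi * Complex.I) *
      (𝓕 (SchwartzMap.smulLeftCLM ℂ (fun y : Rd d => ((inner ℝ y m : ℝ) : ℂ)) φ) : 𝓢(Rd d, ℂ)) ξ := by
  rw [SchwartzMap.lineDerivOp_fourier_eq, FourierTransform.fourier_smul, _root_.smul_apply, smul_eq_mul]
  congr 3
  ext y
  rw [SchwartzMap.smulLeftCLM_apply_apply (innerC_hasTemperateGrowth m),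
    SchwartzMap.smulLeftCLM_apply_apply (by fun_prop)]
  simp

theorem hasDerivAt_schrSymbol_line (t : ℝ) (ξ m : Rd d) :
    HasDerivAt (fun s : ℝ => (schrSymbol t (ξ + s • m) : ℂ))
      (-(8 * Real.pi ^ 2 * t) * Complex.I * ((inner ℝ ξ m : ℝ) : ℂ) * schrSymbol t ξ) 0 := by
  have h1 : HasDerivAt (fun s : ℝ => ‖ξ + s • m‖ ^ 2) (2 * inner ℝ ξ m) 0 := by
    have h := ((hasDerivAt_id (0 : ℝ)).smul_const m).const_add ξ
    have h2 := h.norm_sq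
    simpa using h2
  have h3 := (h1.ofReal_comp.const_mul (-(4 * Real.pi ^ 2 * t) * Complex.I)).cexp
  refine h3.congr_deriv ?_
  simp only [schrSymbol, zero_smul, add_zero]
  push_cast
  ring

open LineDeriv in
-- Multiplication by `y·m` is a derivative on the Fourier side. By the product rule it hits either
-- `φ̂` or the symbol, and in the second case it produces `t` times a derivative of `φ`.
theorem inner_mul_propS (t : ℝ) (φ : 𝓢(Rd d, ℂ)) (m : Rd d) :
    SchwartzMap.smulLeftCLM ℂ (fun y : Rd d => ((inner ℝ y m : ℝ) : ℂ)) (propS t φ) =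
      propS t (SchwartzMap.smulLeftCLM ℂ (fun y : Rd d => ((inner ℝ y m : ℝ) : ℂ)) φ)
        - (2 * t * Complex.I) • propS t (∂_{m} φ) := by
  refine fourier_ext fun ξ => ?_
  have hpi : (2 * Real.pi * Complex.I : ℂ) ≠ 0 := by simp [Real.pi_ne_zero]
  apply mul_left_cancel₀ (neg_ne_zero.2 hpi)
  rw [← fourier_inner_mul, fourier_sub', _root_.sub_apply,
    FourierTransform.fourier_smul, _root_.smul_apply, fourier_propS, fourier_propS, mul_sub,
    ← mul_assoc, mul_comm (-(2 * Real.pi * Complex.I : ℂ)), mul_assoc, ← fourier_inner_mul,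
    SchwartzMap.fourier_lineDerivOp_eq, _root_.smul_apply,
    SchwartzMap.smulLeftCLM_apply_apply (by fun_prop),
    SchwartzMap.lineDerivOp_apply, SchwartzMap.lineDerivOp_apply, lineDeriv]
  have h1 : HasDerivAt (fun s : ℝ => (𝓕 φ : 𝓢(Rd d, ℂ)) (ξ + s • m))
      (lineDeriv ℝ (𝓕 φ : 𝓢(Rd d, ℂ)) ξ m) 0 :=
    ((𝓕 φ : 𝓢(Rd d, ℂ)).differentiable ξ).lineDifferentiableAt.hasLineDerivAt
  have h2 := (hasDerivAt_schrSymbol_line t ξ m).mul h1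
  have h3 : (fun s : ℝ => (𝓕 (propS t φ) : 𝓢(Rd d, ℂ)) (ξ + s • m)) =
      fun s : ℝ => (schrSymbol t (ξ + s • m) : ℂ) * (𝓕 φ : 𝓢(Rd d, ℂ)) (ξ + s • m) :=
    funext fun s => fourier_propS _ _ _
  rw [h3]
  refine h2.deriv.trans ?_
  simp only [zero_smul, add_zero, smul_eq_mul, Complex.real_smul]
  linear_combination (-8 * (Real.pi : ℂ) ^ 2 * t * Complex.I * (inner ℝ ξ m : ℝ) * schrSymbol t ξ *
    (𝓕 φ : 𝓢(Rd d, ℂ)) ξ) * Complex.I_sq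

open LineDeriv in
-- Each power of `|x|` is spent on a coordinate function, which is commuted past the group by
-- `inner_mul_propS`. The induction runs over all `φ` at once because it returns to `x_i φ` and `∂_i
-- φ`.
theorem norm_pow_mul_propS_le (N : ℕ) (T : ℝ) : ∀ φ : 𝓢(Rd d, ℂ), ∃ C : ℝ, ∀ t : ℝ, |t| ≤ T →
    ∀ x, ‖x‖ ^ N * ‖propS t φ x‖ ≤ C := by
  induction N with
  | zero => exact fun φ => ⟨_, fun t _ x => by rw [pow_zero, one_mul]; exact norm_propS_le t φ x⟩
  | succ N ih =>
    intro φ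
    let e : Fin d → Rd d := fun i => EuclideanSpace.single i 1
    choose C₁ h₁ using fun i => ih (SchwartzMap.smulLeftCLM ℂ (fun y : Rd d => ((inner ℝ y (e i) : ℝ) : ℂ)) φ)
    choose C₂ h₂ using fun i => ih (∂_{e i} φ)
    refine ⟨∑ i, (C₁ i + 2 * T * C₂ i), fun t ht x => ?_⟩
    have hx : ‖x‖ ≤ ∑ i, |inner ℝ x (e i)| := by
      rw [EuclideanSpace.norm_eq]
      refine (Real.sqrt_le_sqrt (?_ : _ ≤ (∑ i, |inner ℝ x (e i)|) ^ 2)).trans_eq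
        (Real.sqrt_sq (Finset.sum_nonneg fun i _ => abs_nonneg _))
      have : ∀ i, |inner ℝ x (e i)| = ‖x i‖ := fun i => by simp [e, EuclideanSpace.inner_single_right]
      simp_rw [this]
      exact Finset.sum_sq_le_sq_sum_of_nonneg fun i _ => norm_nonneg _
    calc ‖x‖ ^ (N + 1) * ‖propS t φ x‖ = ‖x‖ * (‖x‖ ^ N * ‖propS t φ x‖) := by ring
      _ ≤ (∑ i, |inner ℝ x (e i)|) * (‖x‖ ^ N * ‖propS t φ x‖) := by gcongr
      _ = ∑ i, ‖x‖ ^ N * (|inner ℝ x (e i)| * ‖propS t φ x‖) := by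
        rw [Finset.sum_mul]; exact Finset.sum_congr rfl fun i _ => by ring
      _ ≤ _ := Finset.sum_le_sum fun i _ => ?_
    have h := congrArg (fun f : 𝓢(Rd d, ℂ) => f x) (inner_mul_propS t φ (e i))
    simp only [_root_.sub_apply, _root_.smul_apply,
      SchwartzMap.smulLeftCLM_apply_apply (innerC_hasTemperateGrowth (e i)), smul_eq_mul] at h
    have h' : |inner ℝ x (e i)| * ‖propS t φ x‖ = ‖((inner ℝ x (e i) : ℝ) : ℂ) * propS t φ x‖ := by
      rw [norm_mul, Complex.norm_real, Real.norm_eq_abs]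
    rw [h', h]
    have hT : ‖(2 * t * Complex.I : ℂ)‖ ≤ 2 * T := by simpa using ht
    calc _ ≤ ‖x‖ ^ N * (‖propS t (SchwartzMap.smulLeftCLM ℂ (fun y : Rd d => ((inner ℝ y (e i) : ℝ) : ℂ)) φ) x‖
          + ‖(2 * t * Complex.I : ℂ)‖ * ‖propS t (∂_{e i} φ) x‖) := by
          gcongr
          exact (norm_sub_le _ _).trans_eq (by rw [norm_mul])
      _ = ‖x‖ ^ N * ‖propS t (SchwartzMap.smulLeftCLM ℂ (fun y : Rd d => ((inner ℝ y (e i) : ℝ) : ℂ)) φ) x‖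
          + ‖(2 * t * Complex.I : ℂ)‖ * (‖x‖ ^ N * ‖propS t (∂_{e i} φ) x‖) := by ring
      _ ≤ _ := by
          have := h₂ i t ht x
          exact add_le_add (h₁ i t ht x)
            (mul_le_mul hT this (by positivity) ((norm_nonneg _).trans hT))

theorem norm_propS_decay (N : ℕ) (T : ℝ) (φ : 𝓢(Rd d, ℂ)) : ∃ C : ℝ, 0 ≤ C ∧ ∀ t : ℝ, |t| ≤ T →
    ∀ x, ‖propS t φ x‖ ≤ C * ((1 + ‖x‖) ^ N)⁻¹ := by
  obtain ⟨C₁, h₁⟩ := norm_pow_mul_propS_le 0 T φ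
  obtain ⟨C₂, h₂⟩ := norm_pow_mul_propS_le N T φ
  refine ⟨2 ^ N * (|C₁| + |C₂|), by positivity, fun t ht x => ?_⟩
  rw [← div_eq_mul_inv, le_div_iff₀ (by positivity), mul_comm]
  have h := add_pow_le (zero_le_one (α := ℝ)) (norm_nonneg x) N
  calc (1 + ‖x‖) ^ N * ‖propS t φ x‖ ≤ (2 ^ N * (1 + ‖x‖ ^ N)) * ‖propS t φ x‖ := by
        gcongr
        refine h.trans ?_
        rw [one_pow]
        gcongr
        · norm_num
        · omega
    _ = 2 ^ N * (‖x‖ ^ 0 * ‖propS t φ x‖ + ‖x‖ ^ N * ‖propS t φ x‖) := by ring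
    _ ≤ _ := by
      gcongr
      · exact (h₁ t ht x).trans (le_abs_self _)
      · exact (h₂ t ht x).trans (le_abs_self _)

end Decay

/-! ### Control of tempered distributions by finitely many weighted derivatives -/

section Jets

variable {d : ℕ}

/-- The bounded function `x ↦ |x|^k D^n φ(x)` attached to a Schwartz function. -/
def jet (k n : ℕ) : 𝓢(Rd d, ℂ) →ₗ[ℝ] (Rd d →ᵇ (Rd d [×n]→L[ℝ] ℂ)) where
  toFun φ := BoundedContinuousFunction.ofNormedAddCommGroup
    (fun x => ‖x‖ ^ k • iteratedFDeriv ℝ n φ x)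
    ((continuous_norm.pow k).smul ((φ.smooth ⊤).continuous_iteratedFDeriv (mod_cast le_top)))
    (SchwartzMap.seminorm ℝ k n φ) (fun x => by
      rw [norm_smul, norm_pow, norm_norm]; exact SchwartzMap.le_seminorm ℝ k n φ x)
  map_add' φ ψ := by
    ext1 x
    simp only [BoundedContinuousFunction.coe_ofNormedAddCommGroup, BoundedContinuousFunction.coe_add,
      Pi.add_apply]
    rw [← smul_add, ← iteratedFDeriv_add_apply ((φ.smooth n).contDiffAt) ((ψ.smooth n).contDiffAt)]
    rfl
  map_smul' c φ := by
    ext1 x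
    simp only [BoundedContinuousFunction.coe_ofNormedAddCommGroup, BoundedContinuousFunction.coe_smul,
      RingHom.id_apply]
    rw [smul_comm, ← iteratedFDeriv_const_smul_apply ((φ.smooth n).contDiffAt)]
    rfl

/-- The target of a finite collection of jets. -/
def JetSpace (d : ℕ) (s : Finset (ℕ × ℕ)) : Type :=
  ∀ i : s, Rd d →ᵇ (Rd d [×i.1.2]→L[ℝ] ℂ)

instance (s : Finset (ℕ × ℕ)) : NormedAddCommGroup (JetSpace d s) :=
  inferInstanceAs (NormedAddCommGroup (∀ i : s, Rd d →ᵇ (Rd d [×i.1.2]→L[ℝ] ℂ)))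

instance (s : Finset (ℕ × ℕ)) : NormedSpace ℝ (JetSpace d s) :=
  inferInstanceAs (NormedSpace ℝ (∀ i : s, Rd d →ᵇ (Rd d [×i.1.2]→L[ℝ] ℂ)))

instance (s : Finset (ℕ × ℕ)) : CompleteSpace (JetSpace d s) :=
  inferInstanceAs (CompleteSpace (∀ i : s, Rd d →ᵇ (Rd d [×i.1.2]→L[ℝ] ℂ)))

/-- The value of one of the jets at a point. -/
def JetSpace.at {s : Finset (ℕ × ℕ)} (f : JetSpace d s) (i : s) (y : Rd d) :
    Rd d [×i.1.2]→L[ℝ] ℂ :=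
  (show Rd d →ᵇ (Rd d [×i.1.2]→L[ℝ] ℂ) from f i) y

theorem JetSpace.norm_le {s : Finset (ℕ × ℕ)} {f : JetSpace d s} {C : ℝ} (hC : 0 ≤ C) :
    ‖f‖ ≤ C ↔ ∀ i y, ‖f.at i y‖ ≤ C :=
  (pi_norm_le_iff_of_nonneg (ι := s) (G := fun i : s => Rd d →ᵇ (Rd d [×i.1.2]→L[ℝ] ℂ)) (x := f) hC).trans
    (forall_congr' fun _ => BoundedContinuousFunction.norm_le hC)

theorem JetSpace.norm_at_le {s : Finset (ℕ × ℕ)} (f : JetSpace d s) (i : s) (y : Rd d) :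
    ‖f.at i y‖ ≤ ‖f‖ :=
  (JetSpace.norm_le (norm_nonneg f)).1 le_rfl i y

/-- Evaluation of one of the jets at a point, along given directions. -/
def JetSpace.eval {s : Finset (ℕ × ℕ)} (i : s) (y : Rd d) (m : Fin i.1.2 → Rd d) :
    JetSpace d s →L[ℝ] ℂ :=
  (ContinuousMultilinearMap.apply ℝ _ ℂ m).comp
    ((BoundedContinuousFunction.evalCLM ℝ y).comp
      (ContinuousLinearMap.proj (R := ℝ) (φ := fun i : s => Rd d →ᵇ (Rd d [×i.1.2]→L[ℝ] ℂ)) i))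

theorem JetSpace.ext {s : Finset (ℕ × ℕ)} {f g : JetSpace d s}
    (h : ∀ i y m, JetSpace.eval i y m f = JetSpace.eval i y m g) : f = g :=
  funext fun i => BoundedContinuousFunction.ext fun y => ContinuousMultilinearMap.ext fun m => h i y m

/-- The finite collection of jets controlling a tempered distribution. -/
def jets (s : Finset (ℕ × ℕ)) : 𝓢(Rd d, ℂ) →ₗ[ℝ] JetSpace d s where
  toFun φ := fun i => jet i.1.1 i.1.2 φ
  map_add' φ ψ := funext fun i => map_add (jet i.1.1 i.1.2) φ ψ
  map_smul' c φ := funext fun i => map_smul (jet i.1.1 i.1.2) c φ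

theorem at_jets (s : Finset (ℕ × ℕ)) (φ : 𝓢(Rd d, ℂ)) (i : s) (y : Rd d) :
    (jets s φ).at i y = ‖y‖ ^ i.1.1 • iteratedFDeriv ℝ i.1.2 φ y := rfl

theorem eval_jets (s : Finset (ℕ × ℕ)) (φ : 𝓢(Rd d, ℂ)) (i : s) (y : Rd d) (m : Fin i.1.2 → Rd d) :
    JetSpace.eval i y m (jets s φ) = (‖y‖ ^ i.1.1 • iteratedFDeriv ℝ i.1.2 φ y) m := rfl

/-- A continuous functional is bounded by finitely many Schwartz seminorms, packed here into the
norm of one Banach space. Vector-valued integrals can then be taken in that Banach space. -/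
theorem exists_jets_bound (v : 𝓢'(Rd d, ℂ)) :
    ∃ (s : Finset (ℕ × ℕ)) (C : ℝ), 0 ≤ C ∧ ∀ φ, ‖v φ‖ ≤ C * ‖jets s φ‖ := by
  let q : Seminorm ℝ 𝓢(Rd d, ℂ) := (normSeminorm ℝ ℂ).comp (v.toLinearMap.restrictScalars ℝ)
  have hq : Continuous q := continuous_norm.comp v.continuous
  obtain ⟨s, C, -, h⟩ := Seminorm.bound_of_continuous (schwartz_withSeminorms ℝ (Rd d) ℂ) q hq
  refine ⟨s, C, C.2, fun φ => ?_⟩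
  have h1 := h φ
  refine h1.trans ?_
  change (C : ℝ) * (s.sup (schwartzSeminormFamily ℝ (Rd d) ℂ)) φ ≤ _
  gcongr
  refine Seminorm.finset_sup_apply_le (norm_nonneg _) fun i hi => ?_
  refine SchwartzMap.seminorm_le_bound ℝ i.1 i.2 φ (norm_nonneg (jets s φ)) fun x => ?_
  have := (jets s φ).norm_at_le ⟨i, hi⟩ x
  rwa [at_jets, norm_smul, norm_pow, norm_norm] at this

theorem one_add_norm_pow_iteratedFDeriv_le (φ : 𝓢(Rd d, ℂ)) (k n : ℕ) :
    ∃ C : ℝ, 0 ≤ C ∧ ∀ x, (1 + ‖x‖) ^ k * ‖iteratedFDeriv ℝ n φ x‖ ≤ C := by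
  refine ⟨2 ^ k * (Finset.Iic (k, n)).sup (fun m => SchwartzMap.seminorm ℝ m.1 m.2) φ,
    by positivity, fun x => ?_⟩
  exact SchwartzMap.one_add_le_sup_seminorm_apply (𝕜 := ℝ) (m := (k, n)) le_rfl le_rfl φ x

theorem norm_pow_le_mul {k : ℕ} (y z : Rd d) : ‖y‖ ^ k ≤ (1 + ‖y - z‖) ^ k * (1 + ‖z‖) ^ k := by
  rw [← mul_pow]
  refine pow_le_pow_left₀ (norm_nonneg _) ?_ k
  have := norm_add_le (y - z) z
  rw [sub_add_cancel] at this
  nlinarith [norm_nonneg (y - z), norm_nonneg z, mul_nonneg (norm_nonneg (y - z)) (norm_nonneg z)]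

theorem iteratedFDeriv_reflectAt (n : ℕ) (φ : 𝓢(Rd d, ℂ)) (z y : Rd d) :
    iteratedFDeriv ℝ n (reflectAt z φ) y = iteratedFDeriv ℝ n (reflectAt 0 φ) (y - z) := by
  have : (reflectAt z φ : Rd d → ℂ) = fun y => (reflectAt 0 φ) (y - z) := by
    funext y; simp [reflectAt_apply]
  rw [this, iteratedFDeriv_comp_sub]

/-- The weight `|y|^k` splits into a power of `1 + |y - z|`, absorbed by the decay of the reflected
`φ`, and a power of `1 + |z|`. -/
theorem exists_norm_jets_reflectAt_le (s : Finset (ℕ × ℕ)) (φ : 𝓢(Rd d, ℂ)) :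
    ∃ (C : ℝ) (N : ℕ), 0 ≤ C ∧ ∀ z, ‖jets s (reflectAt z φ)‖ ≤ C * (1 + ‖z‖) ^ N := by
  choose C hC h using one_add_norm_pow_iteratedFDeriv_le (reflectAt 0 φ)
  refine ⟨∑ i ∈ s, C i.1 i.2, s.sup Prod.fst, Finset.sum_nonneg fun i _ => hC _ _, fun z => ?_⟩
  have hnn : 0 ≤ (∑ i ∈ s, C i.1 i.2) * (1 + ‖z‖) ^ (s.sup Prod.fst) :=
    mul_nonneg (Finset.sum_nonneg fun i _ => hC _ _) (by positivity)
  refine (JetSpace.norm_le hnn).2 fun i y => ?_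
  rw [at_jets, norm_smul, norm_pow, norm_norm, iteratedFDeriv_reflectAt]
  calc ‖y‖ ^ i.1.1 * ‖iteratedFDeriv ℝ i.1.2 (reflectAt 0 φ) (y - z)‖
      ≤ ((1 + ‖y - z‖) ^ i.1.1 * (1 + ‖z‖) ^ i.1.1) *
          ‖iteratedFDeriv ℝ i.1.2 (reflectAt 0 φ) (y - z)‖ := by gcongr; exact norm_pow_le_mul y z
    _ = ((1 + ‖y - z‖) ^ i.1.1 * ‖iteratedFDeriv ℝ i.1.2 (reflectAt 0 φ) (y - z)‖) *
          (1 + ‖z‖) ^ i.1.1 := by ring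
    _ ≤ C i.1.1 i.1.2 * (1 + ‖z‖) ^ i.1.1 := by gcongr; exact h _ _ _
    _ ≤ _ := by
      refine mul_le_mul ?_ ?_ (by positivity) (Finset.sum_nonneg fun i _ => hC _ _)
      · exact Finset.single_le_sum (f := fun i : ℕ × ℕ => C i.1 i.2) (fun i _ => hC _ _) i.2
      · exact pow_le_pow_right₀ (by linarith [norm_nonneg z]) (Finset.le_sup (f := Prod.fst) i.2)

/-- The mean value inequality on unit balls, where the weights `1 + |w|` and `1 + |y - z₀|` are
comparable, gives a Lipschitz bound near `z₀`. -/
theorem continuous_jets_reflectAt (s : Finset (ℕ × ℕ)) (φ : 𝓢(Rd d, ℂ)) :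
    Continuous fun z => jets s (reflectAt z φ) := by
  refine continuous_iff_continuousAt.2 fun z₀ => ?_
  set η := reflectAt 0 φ with hη
  choose C hC0 hC using one_add_norm_pow_iteratedFDeriv_le η
  set D := ∑ i ∈ s, 2 ^ i.1 * C i.1 (i.2 + 1) * (1 + ‖z₀‖) ^ i.1 with hD
  have hterm : ∀ i ∈ s, 0 ≤ 2 ^ i.1 * C i.1 (i.2 + 1) * (1 + ‖z₀‖) ^ i.1 := fun i _ =>
    mul_nonneg (mul_nonneg (by positivity) (hC0 _ _)) (by positivity)
  have hD0 : 0 ≤ D := Finset.sum_nonneg hterm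
  have key : ∀ z, ‖z - z₀‖ ≤ 1 →
      ‖jets s (reflectAt z φ) - jets s (reflectAt z₀ φ)‖ ≤ D * ‖z - z₀‖ := by
    intro z hz
    refine (JetSpace.norm_le (by positivity)).2 fun i y => ?_
    set k := i.1.1 with hk
    set n := i.1.2 with hn
    refine le_trans ?_ (mul_le_mul_of_nonneg_right (Finset.single_le_sum hterm i.2) (norm_nonneg _))
    have hC := hC k (n + 1)
    have hC0 := hC0 k (n + 1)
    change ‖(jets s (reflectAt z φ)).at i y - (jets s (reflectAt z₀ φ)).at i y‖ ≤
      (2 ^ k * C k (n + 1) * (1 + ‖z₀‖) ^ k) * ‖z - z₀‖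
    generalize C k (n + 1) = C at hC hC0 ⊢
    rw [at_jets, at_jets]
    change ‖‖y‖ ^ k • iteratedFDeriv ℝ n (reflectAt z φ) y -
      ‖y‖ ^ k • iteratedFDeriv ℝ n (reflectAt z₀ φ) y‖ ≤ _
    rw [← smul_sub, norm_smul, norm_pow, norm_norm, iteratedFDeriv_reflectAt n φ z,
      iteratedFDeriv_reflectAt n φ z₀]
    have hmv : ‖iteratedFDeriv ℝ n η (y - z) - iteratedFDeriv ℝ n η (y - z₀)‖ ≤
        (2 ^ k * C * ((1 + ‖y - z₀‖) ^ k)⁻¹) * ‖(y - z) - (y - z₀)‖ := by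
      refine (convex_closedBall (y - z₀) 1).norm_image_sub_le_of_norm_fderiv_le (𝕜 := ℝ)
        (fun w _ => ((η.smooth (n + 1)).differentiable_iteratedFDeriv
          (by exact_mod_cast Nat.lt_succ_self n) w)) (fun w hw => ?_)
        (Metric.mem_closedBall_self zero_le_one) ?_
      · rw [norm_fderiv_iteratedFDeriv]
        have h1 := hC w
        rw [← div_eq_mul_inv, le_div_iff₀ (by positivity)]
        rw [Metric.mem_closedBall, dist_eq_norm] at hw
        have h2 : (1 + ‖y - z₀‖) ≤ 2 * (1 + ‖w‖) := by
          have h3 := norm_sub_le w (w - (y - z₀))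
          rw [sub_sub_cancel] at h3
          linarith [norm_nonneg w]
        calc _ ≤ ‖iteratedFDeriv ℝ (n + 1) η w‖ * (2 * (1 + ‖w‖)) ^ k := by gcongr
          _ = 2 ^ k * ((1 + ‖w‖) ^ k * ‖iteratedFDeriv ℝ (n + 1) η w‖) := by rw [mul_pow]; ring
          _ ≤ _ := by gcongr
      · rw [Metric.mem_closedBall, dist_eq_norm, sub_sub_sub_cancel_left, norm_sub_rev]
        exact hz
    rw [sub_sub_sub_cancel_left, norm_sub_rev z₀] at hmv
    calc ‖y‖ ^ k * _ ≤ ((1 + ‖y - z₀‖) ^ k * (1 + ‖z₀‖) ^ k) *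
          ((2 ^ k * C * ((1 + ‖y - z₀‖) ^ k)⁻¹) * ‖z - z₀‖) := by
          gcongr
          exact norm_pow_le_mul y z₀
      _ = _ := by field_simp
  refine tendsto_iff_norm_sub_tendsto_zero.2 ?_
  refine squeeze_zero' (Eventually.of_forall fun _ => norm_nonneg _)
    (eventually_of_mem (Metric.closedBall_mem_nhds z₀ one_pos) fun z hz => key z ?_) ?_
  · rwa [Metric.mem_closedBall, dist_eq_norm] at hz
  · have : Tendsto (fun z : Rd d => D * ‖z - z₀‖) (𝓝 z₀)
        (𝓝 (D * ‖z₀ - z₀‖)) := by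
      refine Continuous.tendsto ?_ z₀
      fun_prop
    simpa using this

open LineDeriv in
theorem iteratedLineDerivOp_sconv {n : ℕ} (m : Fin n → Rd d) (ψ η : 𝓢(Rd d, ℂ)) :
    (∂^{m} (sconv ψ η) : 𝓢(Rd d, ℂ)) = sconv ψ (∂^{m} η) := by
  induction n with
  | zero => simp
  | succ n ih =>
    rw [iteratedLineDerivOp_succ_left, ih, iteratedLineDerivOp_succ_left]
    refine fourier_ext fun ξ => ?_
    rw [fourier_sconv, SchwartzMap.fourier_lineDerivOp_eq, SchwartzMap.fourier_lineDerivOp_eq,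
      _root_.smul_apply, _root_.smul_apply, SchwartzMap.smulLeftCLM_apply_apply (by fun_prop),
      SchwartzMap.smulLeftCLM_apply_apply (by fun_prop), fourier_sconv]
    simp only [smul_eq_mul, Complex.real_smul]
    ring

end Jets

/-! ### Convolving a tempered distribution twice -/

section Exchange

variable {d : ℕ}

theorem exists_conv_le (v : 𝓢'(Rd d, ℂ)) (φ : 𝓢(Rd d, ℂ)) :
    ∃ (C : ℝ) (N : ℕ), 0 ≤ C ∧ ∀ z, ‖conv v φ z‖ ≤ C * (1 + ‖z‖) ^ N := by
  obtain ⟨s, C, hC, hv⟩ := exists_jets_bound v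
  obtain ⟨C', N, hC', h⟩ := exists_norm_jets_reflectAt_le s φ
  refine ⟨C * C', N, by positivity, fun z => (hv _).trans ?_⟩
  rw [mul_assoc]
  exact mul_le_mul_of_nonneg_left (h z) hC

theorem continuous_conv (v : 𝓢'(Rd d, ℂ)) (φ : 𝓢(Rd d, ℂ)) : Continuous (conv v φ) := by
  obtain ⟨s, C, hC, hv⟩ := exists_jets_bound v
  refine continuous_iff_continuousAt.2 fun z₀ => ?_
  refine tendsto_iff_norm_sub_tendsto_zero.2 ?_
  have h := tendsto_iff_norm_sub_tendsto_zero.1 ((continuous_jets_reflectAt s φ).tendsto z₀)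
  refine squeeze_zero (fun _ => norm_nonneg _) (fun z => ?_) (by simpa using h.const_mul C)
  rw [conv, conv, ← map_sub, ← map_sub]
  exact hv _

theorem integrable_pow_mul_schwartz {E : Type*} [NormedAddCommGroup E] [NormedSpace ℝ E]
    {f : Rd d → E} (hf : Continuous f) {C : ℝ} {N : ℕ}
    (hb : ∀ z, ‖f z‖ ≤ C * (1 + ‖z‖) ^ N) (ψ : 𝓢(Rd d, ℂ)) :
    Integrable (fun z => ‖ψ z‖ * ‖f z‖) := by
  have h1 : Integrable (fun z => 2 ^ N * C * (‖z‖ ^ 0 * ‖ψ z‖ + ‖z‖ ^ N * ‖ψ z‖)) :=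
    ((ψ.integrable_pow_mul volume 0).add (ψ.integrable_pow_mul volume N)).const_mul _
  refine h1.mono' (by fun_prop) (Eventually.of_forall fun z => ?_)
  have hC : 0 ≤ C := by
    have := (norm_nonneg _).trans (hb 0)
    simpa using this
  rw [norm_mul, norm_norm, norm_norm]
  calc ‖ψ z‖ * ‖f z‖ ≤ ‖ψ z‖ * (C * (2 ^ N * (1 + ‖z‖ ^ N))) := by
        gcongr
        refine (hb z).trans ?_
        gcongr
        refine (add_pow_le (zero_le_one (α := ℝ)) (norm_nonneg z) N).trans ?_
        rw [one_pow]
        gcongr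
        · norm_num
        · omega
    _ = _ := by ring

theorem reflectAt_sconv_eq (φ ψ : 𝓢(Rd d, ℂ)) (x : Rd d) :
    reflectAt x (sconv φ ψ) = sconv (reflectAt x ψ) (reflectAt 0 φ) :=
  fourier_ext fun ξ => by
    rw [fourier_reflectAt, fourier_sconv, fourier_sconv, fourier_reflectAt, fourier_reflectAt]
    simp only [inner_zero_left, Complex.ofReal_zero, mul_zero, neg_zero, Complex.exp_zero, one_mul]
    ring

/-- The bound for `v` passes to the closure `Γ` of the set of pairs `(J φ, v φ)`, so `Γ` is still a
graph. The integral of the curve `(J Y, v Y)` stays in `Γ`; it has the same first component as `(J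
Ψ, v Ψ)`, hence the same second one. -/
theorem eq_integral_of_norm_le {B S : Type*} [NormedAddCommGroup B] [NormedSpace ℝ B]
    [CompleteSpace B] [AddCommGroup S] [Module ℝ S] (J : S →ₗ[ℝ] B) (v : S →ₗ[ℝ] ℂ) {C : ℝ}
    (hv : ∀ φ, ‖v φ‖ ≤ C * ‖J φ‖) {Y : Rd d → S} (hJ : Integrable fun z => J (Y z))
    (hI : Integrable fun z => v (Y z)) {Ψ : S} (hΨ : ∫ z, J (Y z) = J Ψ) :
    v Ψ = ∫ z, v (Y z) := by
  let L : S →ₗ[ℝ] B × ℂ := J.prod v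
  let Γ : Submodule ℝ (B × ℂ) := (LinearMap.range L).topologicalClosure
  have hΓ : ∀ p ∈ Γ, ‖p.2‖ ≤ C * ‖p.1‖ := by
    intro p hp
    have hcl : IsClosed {p : B × ℂ | ‖p.2‖ ≤ C * ‖p.1‖} :=
      isClosed_le (by fun_prop) (by fun_prop)
    refine closure_minimal (t := {p : B × ℂ | ‖p.2‖ ≤ C * ‖p.1‖}) ?_ hcl hp
    rintro _ ⟨φ, rfl⟩
    exact hv φ
  have hclosed : IsClosed (Γ : Set (B × ℂ)) := Submodule.isClosed_topologicalClosure _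
  let X : Rd d → B × ℂ := fun z => (J (Y z), v (Y z))
  have hXΓ : ∀ z, X z ∈ Γ := fun z => subset_closure ⟨Y z, rfl⟩
  have hX : Integrable X := hJ.prodMk hI
  -- The quotient map by the closed subspace `Γ` commutes with the integral and kills the integrand.
  have hint : ∫ z, X z ∈ Γ := by
    have h0 : Γ.mkQL (∫ z, X z) = 0 := by
      rw [← ContinuousLinearMap.integral_comp_comm _ hX]
      have : ∀ z, Γ.mkQL (X z) = 0 := fun z => (Submodule.Quotient.mk_eq_zero _).2 (hXΓ z)
      simp [this]
    exact (Submodule.Quotient.mk_eq_zero _).1 h0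
  have hfst : (∫ z, X z).1 = J Ψ :=
    ((ContinuousLinearMap.fst ℝ B ℂ).integral_comp_comm hX).symm.trans hΨ
  have hsnd : (∫ z, X z).2 = ∫ z, v (Y z) :=
    ((ContinuousLinearMap.snd ℝ B ℂ).integral_comp_comm hX).symm
  have hL : L Ψ ∈ Γ := subset_closure ⟨_, rfl⟩
  have h := hΓ _ (Γ.sub_mem hL hint)
  rw [Prod.fst_sub, Prod.snd_sub, hfst, hsnd] at h
  change ‖v Ψ - _‖ ≤ C * ‖J Ψ - _‖ at h
  rw [sub_self, norm_zero, mul_zero] at h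
  exact sub_eq_zero.1 (norm_le_zero_iff.1 h)

theorem jets_smul (s : Finset (ℕ × ℕ)) (c : ℂ) (φ : 𝓢(Rd d, ℂ)) (i : s) (y : Rd d)
    (m : Fin i.1.2 → Rd d) :
    JetSpace.eval i y m (jets s (c • φ)) = c * JetSpace.eval i y m (jets s φ) := by
  rw [eval_jets, eval_jets]
  change (‖y‖ ^ i.1.1 • iteratedFDeriv ℝ i.1.2 (c • (φ : Rd d → ℂ)) y) m = _
  rw [iteratedFDeriv_const_smul_apply ((φ.smooth _).contDiffAt)]
  simp only [_root_.smul_apply, Complex.real_smul]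
  ring

theorem norm_jets_smul_le (s : Finset (ℕ × ℕ)) (c : ℂ) (φ : 𝓢(Rd d, ℂ)) :
    ‖jets s (c • φ)‖ ≤ ‖c‖ * ‖jets s φ‖ := by
  have hnn : 0 ≤ ‖c‖ * ‖jets s φ‖ := by positivity
  refine (JetSpace.norm_le hnn).2 fun i y => ?_
  have h := (jets s φ).norm_at_le i y
  rw [at_jets] at h ⊢
  change ‖(‖y‖ ^ i.1.1 • iteratedFDeriv ℝ i.1.2 (c • (φ : Rd d → ℂ)) y)‖ ≤ _
  rw [iteratedFDeriv_const_smul_apply ((φ.smooth _).contDiffAt), smul_comm, norm_smul]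
  gcongr

theorem continuous_jets_smul_reflectAt (s : Finset (ℕ × ℕ)) (φ ψ : 𝓢(Rd d, ℂ)) :
    Continuous fun z => jets s (ψ z • reflectAt z φ) := by
  refine continuous_iff_continuousAt.2 fun z₀ => tendsto_iff_norm_sub_tendsto_zero.2 ?_
  have h1 : Tendsto (fun z => ‖ψ z‖ * ‖jets s (reflectAt z φ) - jets s (reflectAt z₀ φ)‖ +
      ‖ψ z - ψ z₀‖ * ‖jets s (reflectAt z₀ φ)‖) (𝓝 z₀)
      (𝓝 (‖ψ z₀‖ * ‖jets s (reflectAt z₀ φ) - jets s (reflectAt z₀ φ)‖ +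
      ‖ψ z₀ - ψ z₀‖ * ‖jets s (reflectAt z₀ φ)‖)) := by
    refine Continuous.tendsto ?_ z₀
    have := continuous_jets_reflectAt s φ
    fun_prop
  rw [sub_self, sub_self, norm_zero, norm_zero, mul_zero, zero_mul, add_zero] at h1
  refine squeeze_zero (fun _ => norm_nonneg _) (fun z => ?_) h1
  have : jets s (ψ z • reflectAt z φ) - jets s (ψ z₀ • reflectAt z₀ φ) =
      jets s (ψ z • (reflectAt z φ - reflectAt z₀ φ)) + jets s ((ψ z - ψ z₀) • reflectAt z₀ φ) := by
    rw [← map_sub, ← map_add]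
    congr 1
    rw [smul_sub, sub_smul]
    abel
  rw [this]
  refine (norm_add_le _ _).trans (add_le_add ?_ (norm_jets_smul_le _ _ _))
  refine (norm_jets_smul_le _ _ _).trans_eq ?_
  rw [map_sub]

/-- Pairing a tempered distribution with a convolution amounts to integrating its mollification. -/
theorem apply_sconv_eq_integral (v : 𝓢'(Rd d, ℂ)) (φ ψ : 𝓢(Rd d, ℂ)) :
    v (sconv ψ (reflectAt 0 φ)) = ∫ z, ψ z * conv v φ z := by
  obtain ⟨s, C, hC, hv⟩ := exists_jets_bound v
  obtain ⟨C₁, N₁, -, h₁⟩ := exists_norm_jets_reflectAt_le s φ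
  obtain ⟨C₂, N₂, -, h₂⟩ := exists_conv_le v φ
  have hX₁ : Integrable (fun z => jets s (ψ z • reflectAt z φ)) :=
    (integrable_pow_mul_schwartz (continuous_jets_reflectAt s φ) h₁ ψ).mono'
      (continuous_jets_smul_reflectAt s φ ψ).aestronglyMeasurable
      (Eventually.of_forall fun z => norm_jets_smul_le _ _ _)
  have hval : ∀ z, v (ψ z • reflectAt z φ) = ψ z * conv v φ z := fun z => map_smul v _ _
  have hX₂ : Integrable (fun z => v (ψ z • reflectAt z φ)) := by
    simp_rw [hval]
    refine (integrable_pow_mul_schwartz (continuous_conv v φ) h₂ ψ).mono'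
      (ψ.continuous.mul (continuous_conv v φ)).aestronglyMeasurable
      (Eventually.of_forall fun z => ?_)
    exact (norm_mul _ _).le
  have := eq_integral_of_norm_le (jets s) (v.toLinearMap.restrictScalars ℝ) hv hX₁ hX₂
    (Ψ := sconv ψ (reflectAt 0 φ)) ?_
  · refine this.trans (integral_congr_ae (Eventually.of_forall hval))
  -- Point evaluations of the jets are continuous functionals, so the vector-valued identity reduces
  -- to the scalar formula for a derivative of the convolution.
  · refine JetSpace.ext fun i y m => ?_
    rw [← (JetSpace.eval i y m).integral_comp_comm hX₁]
    rw [eval_jets, _root_.smul_apply, ← SchwartzMap.iteratedLineDerivOp_eq_iteratedFDeriv,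
      iteratedLineDerivOp_sconv, sconv_apply, ← integral_smul]
    refine integral_congr_ae (Eventually.of_forall fun z => ?_)
    refine (jets_smul s (ψ z) (reflectAt z φ) i y m).trans ?_
    rw [eval_jets, iteratedFDeriv_reflectAt]
    simp only [SchwartzMap.iteratedLineDerivOp_eq_iteratedFDeriv, _root_.smul_apply, Complex.real_smul]
    ring

/-- Associativity of convolution, the source of all reproducing formulas for frequency blocks. -/
theorem conv_sconv (v : 𝓢'(Rd d, ℂ)) (φ ψ : 𝓢(Rd d, ℂ)) (x : Rd d) :
    conv v (sconv φ ψ) x = ∫ z, conv v φ z * ψ (x - z) := by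
  rw [conv, reflectAt_sconv_eq, apply_sconv_eq_integral]
  exact integral_congr_ae (Eventually.of_forall fun z => mul_comm _ _)

end Exchange

/-! ### Band-limited test functions determine a tempered distribution -/

section Cutoff

variable {d : ℕ}

theorem exists_smooth_cutoff (d : ℕ) : ∃ β : 𝓢(Rd d, ℂ),
    (∀ x, ‖x‖ ≤ 1 → β x = 1) ∧ (∀ x, 2 ≤ ‖x‖ → β x = 0) := by
  obtain ⟨ψ, h1, h2⟩ := exists_cutoff (d := d) 1
  exact ⟨𝓕 ψ, h1, fun x hx => h2 x (by norm_num; exact hx)⟩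

/-- Dilation `x ↦ φ(x / R)` of a Schwartz function. -/
def dilate (R : ℝ) (hR : R ≠ 0) (φ : 𝓢(Rd d, ℂ)) : 𝓢(Rd d, ℂ) :=
  SchwartzMap.compCLMOfContinuousLinearEquiv ℂ
    (ContinuousLinearEquiv.smulLeft (R₁ := ℝ) (M₁ := Rd d) (Units.mk0 R⁻¹ (inv_ne_zero hR))) φ

theorem dilate_apply (R : ℝ) (hR : R ≠ 0) (φ : 𝓢(Rd d, ℂ)) (x : Rd d) :
    dilate R hR φ x = φ (R⁻¹ • x) := rfl

/-- The truncation error vanishes for `|x| < R`. For `|x| ≥ R` one more power of the weight on `F`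
pays for the factor `1/R`, and the derivatives of the dilated cutoff are bounded since `R ≥ 1`. -/
theorem exists_seminorm_cutoff_le (β F : 𝓢(Rd d, ℂ)) (hβ : ∀ x, ‖x‖ ≤ 1 → β x = 1) (k n : ℕ) :
    ∃ C : ℝ, ∀ R : ℝ, 1 ≤ R → ∀ x : Rd d,
      ‖x‖ ^ k * ‖iteratedFDeriv ℝ n (fun y => (1 - β (R⁻¹ • y)) * F y) x‖ ≤ C / R := by
  set K : ℕ → ℝ := fun i => 1 + SchwartzMap.seminorm ℝ 0 i β with hK
  have hK0 : ∀ i, 0 ≤ K i := fun i => by positivity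
  refine ⟨∑ i ∈ Finset.range (n + 1), (n.choose i : ℝ) * K i * SchwartzMap.seminorm ℝ (k + 1) (n - i) F,
    fun R hR x => ?_⟩
  have hR0 : 0 < R := by linarith
  have hC0 : 0 ≤ ∑ i ∈ Finset.range (n + 1), (n.choose i : ℝ) * K i *
      SchwartzMap.seminorm ℝ (k + 1) (n - i) F :=
    Finset.sum_nonneg fun i _ => mul_nonneg (mul_nonneg (by positivity) (hK0 i)) (by positivity)
  rcases lt_or_ge ‖x‖ R with hx | hx
  · have : (fun y => (1 - β (R⁻¹ • y)) * F y) =ᶠ[𝓝 x] fun _ => 0 := by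
      filter_upwards [(isOpen_lt continuous_norm continuous_const).mem_nhds hx] with y hy
      rw [hβ, sub_self, zero_mul]
      rw [norm_smul, norm_inv, Real.norm_of_nonneg hR0.le, inv_mul_le_iff₀ hR0, mul_one]
      exact le_of_lt hy
    rw [(EventuallyEq.iteratedFDeriv ℝ this n).eq_of_nhds]
    simp only [iteratedFDeriv_fun_zero, Pi.zero_apply, norm_zero, mul_zero]
    positivity
  · have hβs : ContDiff ℝ ((⊤ : ℕ∞) : WithTop ℕ∞) (fun y => 1 - β y) := contDiff_const.sub (β.smooth ⊤)
    have hgs : ContDiff ℝ ((⊤ : ℕ∞) : WithTop ℕ∞) (fun y => 1 - β (R⁻¹ • y)) :=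
      hβs.comp (contDiff_const_smul _)
    have hbase : ∀ i y, ‖iteratedFDeriv ℝ i (fun y => 1 - β y) y‖ ≤ K i := by
      intro i y
      have h1 : iteratedFDeriv ℝ i (fun y => 1 - β y) y =
          iteratedFDeriv ℝ i (fun _ : Rd d => (1 : ℂ)) y - iteratedFDeriv ℝ i β y :=
        iteratedFDeriv_sub_apply contDiffAt_const ((β.smooth i).contDiffAt)
      rw [h1]
      refine (norm_sub_le _ _).trans (add_le_add ?_ (SchwartzMap.norm_iteratedFDeriv_le_seminorm ℝ β i y))
      rcases i with _ | i
      · simp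
      · rw [iteratedFDeriv_const_of_ne (Nat.succ_ne_zero i)]; simp
    have hg : ∀ i, ‖iteratedFDeriv ℝ i (fun y => 1 - β (R⁻¹ • y)) x‖ ≤ K i := by
      intro i
      have h1 := iteratedFDeriv_comp_const_smul (𝕜 := ℝ) (i := i) (f := fun y => 1 - β y) R⁻¹
        (hβs.of_le (by exact_mod_cast le_top))
      have h2 : iteratedFDeriv ℝ i (fun y => 1 - β (R⁻¹ • y)) x =
          R⁻¹ ^ i • iteratedFDeriv ℝ i (fun y => 1 - β y) (R⁻¹ • x) := congrFun h1 x
      rw [h2, norm_smul, norm_pow, norm_inv, Real.norm_of_nonneg hR0.le]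
      have h3 : R⁻¹ ^ i ≤ 1 := pow_le_one₀ (by positivity) (inv_le_one_of_one_le₀ hR)
      calc _ ≤ 1 * K i := by gcongr; exact hbase _ _
        _ = K i := one_mul _
    have hm := norm_iteratedFDeriv_mul_le hgs (F.smooth ⊤) x (n := n) (by exact_mod_cast le_top)
    rw [le_div_iff₀ hR0]
    calc ‖x‖ ^ k * ‖iteratedFDeriv ℝ n (fun y => (1 - β (R⁻¹ • y)) * F y) x‖ * R
        ≤ ‖x‖ ^ k * (∑ i ∈ Finset.range (n + 1), (n.choose i : ℝ) *
          ‖iteratedFDeriv ℝ i (fun y => 1 - β (R⁻¹ • y)) x‖ * ‖iteratedFDeriv ℝ (n - i) F x‖) * ‖x‖ := by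
          gcongr
      _ = ∑ i ∈ Finset.range (n + 1), (n.choose i : ℝ) *
          ‖iteratedFDeriv ℝ i (fun y => 1 - β (R⁻¹ • y)) x‖ *
            (‖x‖ ^ (k + 1) * ‖iteratedFDeriv ℝ (n - i) F x‖) := by
          rw [Finset.mul_sum, Finset.sum_mul]
          exact Finset.sum_congr rfl fun i _ => by ring
      _ ≤ _ := by
          refine Finset.sum_le_sum fun i _ => ?_
          refine mul_le_mul ?_ (SchwartzMap.le_seminorm ℝ (k + 1) (n - i) F x) (by positivity)
            (mul_nonneg (by positivity) (hK0 i))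
          gcongr
          exact hg i

theorem dist_eq_zero_of_compactSupport (V : 𝓢'(Rd d, ℂ))
    (h : ∀ (r : ℝ) (F : 𝓢(Rd d, ℂ)), (∀ x, r ≤ ‖x‖ → F x = 0) → V F = 0) : V = 0 := by
  obtain ⟨β, hβ1, hβ2⟩ := exists_smooth_cutoff d
  obtain ⟨s, C, hC, hV⟩ := exists_jets_bound V
  refine ContinuousLinearMap.ext fun F => ?_
  choose K hK using fun k n => exists_seminorm_cutoff_le β F hβ1 k n
  set D := ∑ i ∈ s, |K i.1 i.2| with hD
  have hD0 : 0 ≤ D := Finset.sum_nonneg fun _ _ => abs_nonneg _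
  have key : ∀ R : ℝ, 1 ≤ R → ‖V F‖ ≤ C * (D / R) := by
    intro R hR
    have hR0 : R ≠ 0 := by linarith
    have hRp : 0 < R := by linarith
    set G := SchwartzMap.smulLeftCLM ℂ (dilate R hR0 β) F with hG
    have hGx : ∀ x, G x = β (R⁻¹ • x) * F x := fun x => by
      rw [hG, SchwartzMap.smulLeftCLM_apply_apply (dilate R hR0 β).hasTemperateGrowth, dilate_apply,
        smul_eq_mul]
    have hV0 : V G = 0 := by
      refine h (2 * R) G fun x hx => ?_
      rw [hGx, hβ2, zero_mul]
      rw [norm_smul, norm_inv, Real.norm_of_nonneg hRp.le, le_inv_mul_iff₀ hRp]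
      linarith
    have h1 : V F = V (F - G) := by rw [map_sub, hV0, sub_zero]
    rw [h1]
    refine (hV _).trans ?_
    gcongr
    refine (JetSpace.norm_le (by positivity)).2 fun i x => ?_
    rw [at_jets, norm_smul, norm_pow, norm_norm]
    have h2 : ((F - G : 𝓢(Rd d, ℂ)) : Rd d → ℂ) = fun y => (1 - β (R⁻¹ • y)) * F y := by
      funext y
      rw [_root_.sub_apply, hGx]
      ring
    rw [h2]
    refine (hK _ _ R hR x).trans ?_
    gcongr
    exact (le_abs_self _).trans
      (Finset.single_le_sum (f := fun i : ℕ × ℕ => |K i.1 i.2|) (fun _ _ => abs_nonneg _) i.2)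
  have hlim : Tendsto (fun R : ℝ => C * (D / R)) atTop (𝓝 0) := by
    simpa using (tendsto_const_nhds (x := D)).div_atTop tendsto_id |>.const_mul C
  have := ge_of_tendsto hlim ((eventually_ge_atTop 1).mono key)
  exact norm_le_zero_iff.1 this

/-- The compact support statement is applied to the inverse Fourier transform of `v`. Against
band-limited test functions the frequency decomposition is a finite sum. -/
theorem dist_eq_zero_of_compact_fourier (v : 𝓢'(Rd d, ℂ))
    (h : ∀ (r : ℝ) (φ : 𝓢(Rd d, ℂ)), (∀ ξ, r ≤ ‖ξ‖ → (𝓕 φ : 𝓢(Rd d, ℂ)) ξ = 0) → v φ = 0) : v = 0 := by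
  have h0 : 𝓕⁻ v = 0 := dist_eq_zero_of_compactSupport _ fun r F hF => by
    rw [TemperedDistribution.fourierInv_apply]
    exact h r _ (by rwa [FourierTransform.fourier_fourierInv_eq])
  refine ContinuousLinearMap.ext fun φ => ?_
  have h1 : (𝓕⁻ v : 𝓢'(Rd d, ℂ)) (𝓕 φ) = 0 := by rw [h0]; rfl
  rwa [TemperedDistribution.fourierInv_apply, FourierTransform.fourierInv_fourier_eq] at h1

end Cutoff

/-! ### Polynomial weights, Young's inequality and the Peetre maximal function -/

section Weights

variable {d : ℕ}

/-- The polynomially decaying weight `(1 + |x|)^{-N}`. -/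
def bump (N : ℕ) (x : Rd d) : ℝ≥0∞ := ENNReal.ofReal ((1 + ‖x‖) ^ N)⁻¹

theorem bump_pos (N : ℕ) (x : Rd d) : 0 < bump N x :=
  ENNReal.ofReal_pos.2 (by positivity)

theorem bump_ne_top (N : ℕ) (x : Rd d) : bump N x ≠ ∞ := ENNReal.ofReal_ne_top

theorem bump_le_one (N : ℕ) (x : Rd d) : bump N x ≤ 1 := by
  rw [bump, ENNReal.ofReal_le_one]
  exact inv_le_one_of_one_le₀ (one_le_pow₀ (by linarith [norm_nonneg x]))

theorem bump_neg (N : ℕ) (x : Rd d) : bump N (-x) = bump N x := by simp [bump]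

theorem bump_sub_comm (N : ℕ) (x y : Rd d) : bump N (x - y) = bump N (y - x) := by
  rw [← bump_neg, neg_sub]

theorem continuous_bump (N : ℕ) : Continuous (bump N : Rd d → ℝ≥0∞) := by
  refine ENNReal.continuous_ofReal.comp (Continuous.inv₀ (by fun_prop) fun x => ?_)
  positivity

theorem measurable_bump (N : ℕ) : Measurable (bump N : Rd d → ℝ≥0∞) :=
  (continuous_bump N).measurable

/-- Peetre's inequality `1 + |x + y| ≤ (1 + |x|)(1 + |y|)`. -/
theorem bump_mul_le (N : ℕ) (x y : Rd d) : bump N x * bump N y ≤ bump N (x + y) := by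
  rw [bump, bump, bump, ← ENNReal.ofReal_mul (by positivity), ← mul_inv, ← mul_pow]
  refine ENNReal.ofReal_le_ofReal (inv_anti₀ (by positivity) (pow_le_pow_left₀ (by positivity) ?_ N))
  have := norm_add_le x y
  nlinarith [norm_nonneg x, norm_nonneg y, mul_nonneg (norm_nonneg x) (norm_nonneg y)]

theorem bump_anti {M N : ℕ} (h : M ≤ N) (x : Rd d) : bump N x ≤ bump M x :=
  ENNReal.ofReal_le_ofReal (inv_anti₀ (by positivity)
    (pow_le_pow_right₀ (by linarith [norm_nonneg x]) h))

theorem lintegral_bump_lt_top {N : ℕ} (h : d < N) : ∫⁻ x : Rd d, bump N x < ∞ := by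
  have := finite_integral_one_add_norm (E := Rd d) (μ := volume) (r := N) (by simpa using h)
  refine lt_of_le_of_lt (lintegral_mono fun x => le_of_eq ?_) this
  rw [bump, Real.rpow_neg (by positivity), Real.rpow_natCast]

theorem lintegral_bump_pos (N : ℕ) : 0 < ∫⁻ x : Rd d, bump N x := by
  refine (lintegral_pos_iff_support (measurable_bump N)).2 ?_
  have : Function.support (bump N : Rd d → ℝ≥0∞) = Set.univ :=
    Set.eq_univ_of_forall fun x => (bump_pos N x).ne'
  rw [this]
  exact Measure.measure_univ_pos.2 (NeZero.ne _)

/-- Doubling the decay leaves room for a power `q ≥ 1/2`; this fixes the exponent `dec d`. -/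
theorem bump_rpow_le {q : ℝ} (hq : 1 / 2 ≤ q) (N : ℕ) (x : Rd d) :
    bump (2 * N) x ^ q ≤ bump N x := by
  have h1 : bump (2 * N) x = bump N x ^ (2 : ℝ) := by
    rw [bump, bump, ENNReal.ofReal_rpow_of_nonneg (by positivity) (by norm_num)]
    congr 1
    rw [Real.rpow_ofNat, inv_pow, ← pow_mul, mul_comm]
  rw [h1, ← ENNReal.rpow_mul]
  calc bump N x ^ (2 * q) ≤ bump N x ^ (1 : ℝ) :=
        ENNReal.rpow_le_rpow_of_exponent_ge (bump_le_one N x) (by linarith)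
    _ = _ := ENNReal.rpow_one _

theorem two_pow_mul_bump_ge {N : ℕ} {x : Rd d} (hx : ‖x‖ ≤ 1) : 1 ≤ 2 ^ N * bump N x := by
  have h2 : (2 : ℝ≥0∞) ^ N = ENNReal.ofReal (2 ^ N) := by
    rw [ENNReal.ofReal_pow (by norm_num)]; simp
  rw [bump, h2, ← ENNReal.ofReal_mul (by positivity), ENNReal.one_le_ofReal,
    ← div_eq_mul_inv, le_div_iff₀ (by positivity), one_mul]
  exact pow_le_pow_left₀ (by positivity) (by linarith) N

theorem lintegral_comp_sub_left (f : Rd d → ℝ≥0∞) (x : Rd d) : ∫⁻ z, f (x - z) = ∫⁻ z, f z :=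
  lintegral_sub_left_eq_self f x

theorem lintegral_comp_sub_right (f : Rd d → ℝ≥0∞) (x : Rd d) : ∫⁻ z, f (z - x) = ∫⁻ z, f z :=
  lintegral_sub_right_eq_self f x

theorem lintegral_lintegral_mul_sub {f g : Rd d → ℝ≥0∞} (hf : Measurable f) (hg : Measurable g) :
    ∫⁻ x, ∫⁻ z, f z * g (x - z) = (∫⁻ z, f z) * ∫⁻ z, g z := by
  rw [lintegral_lintegral_swap]
  · rw [← lintegral_mul_const _ hf]
    refine lintegral_congr fun z => ?_
    have hm : Measurable fun x => g (x - z) := hg.comp (measurable_id.sub_const z)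
    rw [lintegral_const_mul _ hm, lintegral_comp_sub_right]
  · exact ((hf.comp measurable_snd).mul (hg.comp (measurable_fst.sub measurable_snd))).aemeasurable

/-- Young's inequality for convolution with an integrable kernel. -/
theorem eLpNorm_lintegral_mul_sub_le {p : ℝ≥0∞} (hp : 1 ≤ p) {a g : Rd d → ℝ≥0∞}
    (ha : Measurable a) (hg : Measurable g) :
    eLpNorm (fun x => ∫⁻ z, a z * g (x - z)) p volume ≤ (∫⁻ z, g z) * eLpNorm a p volume := by
  have hm : Measurable fun q : Rd d × Rd d => a q.2 * g (q.1 - q.2) :=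
    (ha.comp measurable_snd).mul (hg.comp (measurable_fst.sub measurable_snd))
  rcases eq_or_ne p ∞ with rfl | hp'
  · rw [eLpNorm_exponent_top, eLpNorm_exponent_top]
    refine essSup_le_of_ae_le _ (Eventually.of_forall fun x => ?_)
    change ∫⁻ z, a z * g (x - z) ≤ _
    have h : ∀ᵐ z : Rd d, a z ≤ eLpNormEssSup a volume := ae_le_eLpNormEssSup (f := a)
    calc ∫⁻ z, a z * g (x - z) ≤ ∫⁻ z, eLpNormEssSup a volume * g (x - z) :=
          lintegral_mono_ae (h.mono fun z hz => by gcongr)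
      _ = (∫⁻ z, g z) * eLpNormEssSup a volume := by
        have hm : Measurable fun z => g (x - z) := hg.comp (measurable_const.sub measurable_id)
        rw [lintegral_const_mul _ hm, lintegral_comp_sub_left, mul_comm]
  have hp0 : p ≠ 0 := (zero_lt_one.trans_le hp).ne'
  have hr : 1 ≤ p.toReal := by
    rwa [← ENNReal.ofReal_le_iff_le_toReal hp', ENNReal.ofReal_one]
  set r := p.toReal with hrdef
  have hr0 : 0 < r := by linarith
  rw [eLpNorm_eq_lintegral_rpow_enorm_toReal hp0 hp', eLpNorm_eq_lintegral_rpow_enorm_toReal hp0 hp',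
    ← hrdef]
  simp only [enorm_eq_self]
  set G := ∫⁻ z, g z with hG
  -- Hölder for the splitting `a g = (a g^{1/r}) · g^{1/r'}`.
  have key : ∀ x, (∫⁻ z, a z * g (x - z)) ^ r ≤ G ^ (r - 1) * ∫⁻ z, a z ^ r * g (x - z) := by
    intro x
    rcases hr.eq_or_lt with h1 | h1
    · rw [← h1]; simp
    have hconj : r.HolderConjugate (r / (r - 1)) := Real.HolderConjugate.conjExponent h1
    have hgx : Measurable fun z => g (x - z) := hg.comp (measurable_const.sub measurable_id)
    have h2 := ENNReal.lintegral_mul_le_Lp_mul_Lq volume hconj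
      (f := fun z => a z * g (x - z) ^ (1 / r)) (g := fun z => g (x - z) ^ (1 / (r / (r - 1))))
      (ha.mul (hgx.pow_const _)).aemeasurable (hgx.pow_const _).aemeasurable
    have hsum : 1 / r + 1 / (r / (r - 1)) = 1 := by field_simp; ring
    have h3 : ∀ z, ((fun z => a z * g (x - z) ^ (1 / r)) * fun z => g (x - z) ^ (1 / (r / (r - 1)))) z
        = a z * g (x - z) := by
      intro z
      simp only [Pi.mul_apply]
      rw [mul_assoc, ← ENNReal.rpow_add_of_nonneg _ _ (by positivity)
        (by have := sub_pos.2 h1; positivity), hsum, ENNReal.rpow_one]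
    have h4 : ∀ z, (a z * g (x - z) ^ (1 / r)) ^ r = a z ^ r * g (x - z) := by
      intro z
      rw [ENNReal.mul_rpow_of_nonneg _ _ hr0.le, ← ENNReal.rpow_mul, one_div_mul_cancel hr0.ne',
        ENNReal.rpow_one]
    have h5 : ∀ z, (g (x - z) ^ (1 / (r / (r - 1)))) ^ (r / (r - 1)) = g (x - z) := by
      intro z
      rw [← ENNReal.rpow_mul, one_div_mul_cancel (by have := sub_pos.2 h1; positivity), ENNReal.rpow_one]
    simp_rw [h3, h4, h5, lintegral_comp_sub_left] at h2
    calc (∫⁻ z, a z * g (x - z)) ^ r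
        ≤ ((∫⁻ z, a z ^ r * g (x - z)) ^ (1 / r) * G ^ (1 / (r / (r - 1)))) ^ r := by gcongr
      _ = _ := by
        rw [ENNReal.mul_rpow_of_nonneg _ _ hr0.le, ← ENNReal.rpow_mul, ← ENNReal.rpow_mul,
          one_div_mul_cancel hr0.ne', ENNReal.rpow_one, mul_comm]
        congr 2
        field_simp
  calc (∫⁻ x, (∫⁻ z, a z * g (x - z)) ^ r) ^ (1 / r)
      ≤ (∫⁻ x, G ^ (r - 1) * ∫⁻ z, a z ^ r * g (x - z)) ^ (1 / r) := by
        gcongr with x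
        exact key x
    _ = (G ^ r * ∫⁻ z, a z ^ r) ^ (1 / r) := by
        rw [lintegral_const_mul, lintegral_lintegral_mul_sub (ha.pow_const _) hg,
          mul_comm (∫⁻ z, a z ^ r), ← mul_assoc, ← hG]
        · congr 2
          nth_rw 2 [← ENNReal.rpow_one G]
          rw [← ENNReal.rpow_add_of_nonneg _ _ (by linarith) zero_le_one, sub_add_cancel]
        · exact (((ha.pow_const r).comp measurable_snd).mul
            (hg.comp (measurable_fst.sub measurable_snd))).lintegral_prod_right'
    _ = _ := by
        rw [ENNReal.mul_rpow_of_nonneg _ _ (by positivity), ← ENNReal.rpow_mul,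
          mul_one_div_cancel hr0.ne', ENNReal.rpow_one]

/-- The Peetre maximal function. -/
def peetre (N : ℕ) (a : Rd d → ℝ≥0∞) (x : Rd d) : ℝ≥0∞ := ⨆ y, a y * bump N (x - y)

theorem mul_bump_le_peetre (N : ℕ) (a : Rd d → ℝ≥0∞) (x y : Rd d) :
    a y * bump N (x - y) ≤ peetre N a x :=
  le_iSup (fun y => a y * bump N (x - y)) y

theorem measurable_peetre (N : ℕ) {a : Rd d → ℝ≥0∞} (ha : ∀ y, a y ≠ ∞) :
    Measurable (peetre N a) := by
  refine LowerSemicontinuous.measurable (lowerSemicontinuous_iSup fun y => ?_)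
  refine Continuous.lowerSemicontinuous ?_
  exact (ENNReal.continuous_const_mul (ha y)).comp
    ((continuous_bump N).comp (continuous_id.sub continuous_const))

/-- `a ≤ C · a ∗ (1 + |·|)^{-N}`. -/
def SelfBounded (N : ℕ) (C : ℝ≥0∞) (a : Rd d → ℝ≥0∞) : Prop :=
  ∀ x, a x ≤ C * ∫⁻ z, a z * bump N (x - z)

/-- The kernel is submultiplicative, so a self-bounded function controls its own maximal function at
no cost. -/
theorem SelfBounded.peetre_le {N : ℕ} {C : ℝ≥0∞} {a : Rd d → ℝ≥0∞} (h : SelfBounded N C a)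
    (ha : Measurable a) (x : Rd d) : peetre N a x ≤ C * ∫⁻ z, a z * bump N (x - z) := by
  refine iSup_le fun y => ?_
  have hm : Measurable fun z => a z * bump N (y - z) :=
    ha.mul ((measurable_bump N).comp (measurable_const.sub measurable_id))
  calc a y * bump N (x - y) ≤ (C * ∫⁻ z, a z * bump N (y - z)) * bump N (x - y) := by
        gcongr; exact h y
    _ = C * ∫⁻ z, a z * bump N (y - z) * bump N (x - y) := by
        rw [lintegral_mul_const _ hm, mul_assoc]
    _ ≤ _ := by
        refine mul_le_mul_right (lintegral_mono fun z => ?_) C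
        rw [mul_assoc]
        refine mul_le_mul_right ?_ _
        refine (bump_mul_le _ _ _).trans_eq ?_
        congr 1; abel

/-- The substitute for Young's inequality when `q < 1`. Write the integrand as its power `q` times
its power `1 - q`, bound the latter by the maximal function `P` and divide by `P^{1-q}`. The
division requires `P` to be finite. -/
theorem SelfBounded.peetre_rpow_le {N : ℕ} {C : ℝ≥0∞} {a : Rd d → ℝ≥0∞} (h : SelfBounded N C a)
    (ha : Measurable a) {q : ℝ} (hq : 0 < q) (hq1 : q ≤ 1) {x : Rd d} (hx : peetre N a x ≠ ∞) :
    peetre N a x ^ q ≤ C * ∫⁻ z, a z ^ q * bump N (x - z) ^ q := by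
  set P := peetre N a x with hP
  rcases eq_or_ne P 0 with h0 | h0
  · rw [h0, ENNReal.zero_rpow_of_pos hq]; exact zero_le
  have hm : Measurable fun z => a z ^ q * bump N (x - z) ^ q :=
    (ha.pow_const q).mul (((measurable_bump N).comp (measurable_const.sub measurable_id)).pow_const q)
  have h1 : P ≤ C * ((∫⁻ z, a z ^ q * bump N (x - z) ^ q) * P ^ (1 - q)) := by
    refine (h.peetre_le ha x).trans ?_
    rw [← lintegral_mul_const _ hm]
    refine mul_le_mul_right (lintegral_mono fun z => ?_) C
    rw [← ENNReal.mul_rpow_of_nonneg _ _ hq.le]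
    calc a z * bump N (x - z) = (a z * bump N (x - z)) ^ (q + (1 - q)) := by
          rw [add_sub_cancel, ENNReal.rpow_one]
      _ = (a z * bump N (x - z)) ^ q * (a z * bump N (x - z)) ^ (1 - q) :=
          ENNReal.rpow_add_of_nonneg _ _ hq.le (by linarith)
      _ ≤ _ := by
          refine mul_le_mul_right (ENNReal.rpow_le_rpow ?_ (by linarith)) _
          exact mul_bump_le_peetre N a x z
  have h2 : P = P ^ q * P ^ (1 - q) := by
    rw [← ENNReal.rpow_add_of_nonneg _ _ hq.le (by linarith), add_sub_cancel, ENNReal.rpow_one]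
  have h3 : P ^ (1 - q) ≠ 0 := (ENNReal.rpow_pos (pos_iff_ne_zero.2 h0) hx).ne'
  have h4 : P ^ (1 - q) ≠ ∞ := ENNReal.rpow_ne_top_of_nonneg (by linarith) hx
  rw [← mul_assoc] at h1
  nth_rw 1 [h2] at h1
  exact (ENNReal.mul_le_mul_iff_left h3 h4).1 h1

/-- The decay exponent used for kernels. -/
def dec (d : ℕ) : ℕ := 2 * (d + 1)

theorem lt_dec (d : ℕ) : d < dec d := by unfold dec; omega

/-- Young's inequality for `p ≥ 1`. For `1/2 ≤ p < 1` the pointwise bound for the `p`-th power is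
integrated; the `p`-th power of the kernel still decays with exponent `d + 1`. Only this second case
needs the a priori finiteness. -/
theorem eLpNorm_peetre_le_of_ne_top {N : ℕ} (hN : dec d ≤ N) {p : ℝ≥0∞} (hp : 1 / 2 ≤ p) {C : ℝ≥0∞}
    (hC : C ≠ ∞) : ∃ C' : ℝ≥0∞, C' ≠ ∞ ∧ 1 ≤ C' ∧ ∀ a : Rd d → ℝ≥0∞, Measurable a →
      SelfBounded N C a → (1 ≤ p ∨ ∀ x, peetre N a x ≠ ∞) →
      eLpNorm (peetre N a) p volume ≤ C' * eLpNorm a p volume := by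
  have hI : ∫⁻ x : Rd d, bump N x ≠ ∞ := (lintegral_bump_lt_top ((lt_dec d).trans_le hN)).ne
  by_cases hp1 : 1 ≤ p
  · refine ⟨C * (∫⁻ x : Rd d, bump N x) + 1, by finiteness, le_add_self, fun a ha h _ => ?_⟩
    calc eLpNorm (peetre N a) p volume
        ≤ eLpNorm (C • fun x => ∫⁻ z, a z * bump N (x - z)) p volume :=
          eLpNorm_mono_enorm fun x => h.peetre_le ha x
      _ ≤ C * ((∫⁻ x : Rd d, bump N x) * eLpNorm a p volume) := by
          have := eLpNorm_lintegral_mul_sub_le hp1 ha (measurable_bump (d := d) N)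
          lift C to ℝ≥0 using hC
          refine le_trans ?_ (mul_le_mul_right this (C : ℝ≥0∞))
          refine (eLpNorm_le_nnreal_smul_eLpNorm_of_ae_le_mul' (c := C)
            (g := fun x => ∫⁻ z, a z * bump N (x - z)) (Eventually.of_forall fun x => ?_) p).trans_eq ?_
          · exact le_rfl
          · rfl
      _ ≤ _ := by rw [← mul_assoc]; gcongr; exact le_self_add
  · rw [not_le] at hp1
    have hp' : p ≠ ∞ := (hp1.trans ENNReal.one_lt_top).ne
    have hp0 : p ≠ 0 := by
      rintro rfl
      simp at hp
    have hr1 : p.toReal ≤ 1 := by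
      have := ENNReal.toReal_mono ENNReal.one_ne_top hp1.le
      simpa using this
    have hr : 1 / 2 ≤ p.toReal := by
      have := ENNReal.toReal_mono hp' hp
      simpa using this
    set r := p.toReal with hrdef
    have hr0 : 0 < r := by linarith
    set I := ∫⁻ x : Rd d, bump (d + 1) x with hIdef
    have hI' : I ≠ ∞ := (lintegral_bump_lt_top (Nat.lt_succ_self d)).ne
    refine ⟨(C * I) ^ (1 / r) + 1, ?_, le_add_self, fun a ha h hfin => ?_⟩
    · have : (C * I) ^ (1 / r) ≠ ∞ := ENNReal.rpow_ne_top_of_nonneg (by positivity) (by finiteness)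
      finiteness
    have hfin := hfin.resolve_left (not_le.2 hp1)
    refine le_trans ?_ (mul_le_mul_left (le_self_add (a := (C * I) ^ (1 / r)) (b := 1)) _)
    rw [eLpNorm_eq_lintegral_rpow_enorm_toReal hp0 hp', eLpNorm_eq_lintegral_rpow_enorm_toReal hp0 hp',
      ← hrdef, ← ENNReal.mul_rpow_of_nonneg _ _ (by positivity)]
    simp only [enorm_eq_self]
    gcongr
    calc ∫⁻ x, peetre N a x ^ r ≤ ∫⁻ x, C * ∫⁻ z, a z ^ r * bump (d + 1) (x - z) := by
          refine lintegral_mono fun x => (h.peetre_rpow_le ha hr0 hr1 (hfin x)).trans ?_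
          gcongr with z
          refine (ENNReal.rpow_le_rpow (bump_anti hN _) hr0.le).trans ?_
          exact bump_rpow_le hr (d + 1) _
      _ = _ := by
          rw [lintegral_const_mul, lintegral_lintegral_mul_sub (ha.pow_const _) (measurable_bump _),
            mul_comm (∫⁻ z, a z ^ r), mul_assoc]
          exact (((ha.pow_const r).comp measurable_snd).mul
            ((measurable_bump _).comp (measurable_fst.sub measurable_snd))).lintegral_prod_right'

/-- On the unit ball about `x` the maximal function is at least `2^{-N} a x`. -/
theorem le_mul_eLpNorm_peetre (N : ℕ) {p : ℝ≥0∞} (hp : p ≠ 0) : ∃ C : ℝ≥0∞, C ≠ ∞ ∧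
    ∀ (a : Rd d → ℝ≥0∞) (x : Rd d), a x ≤ C * eLpNorm (peetre N a) p volume := by
  set B := volume (Metric.closedBall (0 : Rd d) 1) ^ (1 / p.toReal) with hB
  have hB0 : B ≠ 0 := (ENNReal.rpow_pos (Metric.measure_closedBall_pos _ _ one_pos)
    (measure_closedBall_lt_top).ne).ne'
  have hBt : B ≠ ∞ := ENNReal.rpow_ne_top_of_nonneg (by positivity) (measure_closedBall_lt_top).ne
  refine ⟨B⁻¹ * 2 ^ N, by finiteness, fun a x => ?_⟩
  have h1 : eLpNorm ((Metric.closedBall x 1).indicator fun _ => a x) p volume ≤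
      2 ^ N * eLpNorm (peetre N a) p volume := by
    have h2 := eLpNorm_le_nnreal_smul_eLpNorm_of_ae_le_mul' (c := 2 ^ N) (μ := volume)
      (f := (Metric.closedBall x 1).indicator fun _ => a x)
      (g := peetre N a) (Eventually.of_forall fun y => ?_) p
    · refine h2.trans_eq ?_
      rw [ENNReal.smul_def, smul_eq_mul]; norm_cast
    · by_cases hy : y ∈ Metric.closedBall x 1
      · rw [Set.indicator_of_mem hy]
        change a x ≤ ((2 ^ N : ℝ≥0) : ℝ≥0∞) * peetre N a y
        have h3 := two_pow_mul_bump_ge (N := N) (x := y - x) (by rwa [← mem_closedBall_iff_norm])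
        calc a x = a x * 1 := (mul_one _).symm
          _ ≤ a x * (2 ^ N * bump N (y - x)) := by gcongr
          _ = 2 ^ N * (a x * bump N (y - x)) := by ring
          _ ≤ _ := by push_cast; gcongr; exact mul_bump_le_peetre N a y x
      · rw [Set.indicator_of_notMem hy]; simp
  rw [eLpNorm_indicator_const' measurableSet_closedBall
    (Metric.measure_closedBall_pos _ _ one_pos).ne' hp,
    Measure.addHaar_closedBall_center, enorm_eq_self, ← hB] at h1
  rw [mul_assoc]
  calc a x = B⁻¹ * (a x * B) := by
        rw [mul_comm (a x), ← mul_assoc, ENNReal.inv_mul_cancel hB0 hBt, one_mul]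
    _ ≤ _ := by gcongr

end Weights

/-! ### Frequency blocks and their evolution -/

section Kernels

variable {d : ℕ}

theorem enorm_propS_decay (N : ℕ) (T : ℝ) (φ : 𝓢(Rd d, ℂ)) : ∃ C : ℝ≥0∞, C ≠ ∞ ∧ ∀ t : ℝ, |t| ≤ T →
    ∀ x, ‖propS t φ x‖ₑ ≤ C * bump N x := by
  obtain ⟨C, hC, h⟩ := norm_propS_decay N T φ
  refine ⟨ENNReal.ofReal C, ENNReal.ofReal_ne_top, fun t ht x => ?_⟩
  rw [bump, ← ENNReal.ofReal_mul hC, ← ofReal_norm]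
  exact ENNReal.ofReal_le_ofReal (h t ht x)

theorem enorm_schwartz_decay (N : ℕ) (φ : 𝓢(Rd d, ℂ)) : ∃ C : ℝ≥0∞, C ≠ ∞ ∧
    ∀ x, ‖φ x‖ₑ ≤ C * bump N x := by
  obtain ⟨C, hC, h⟩ := enorm_propS_decay N 0 φ
  exact ⟨C, hC, fun x => by simpa [propS_zero] using h 0 (by simp) x⟩

theorem bump_add (M N : ℕ) (x : Rd d) : bump (M + N) x = bump M x * bump N x := by
  rw [bump, bump, bump, ← ENNReal.ofReal_mul (by positivity), pow_add, mul_inv]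

theorem lintegral_mul_bump_le_peetre (N M : ℕ) (a : Rd d → ℝ≥0∞) (x : Rd d) :
    ∫⁻ z, a z * bump (N + M) (x - z) ≤ peetre N a x * ∫⁻ z : Rd d, bump M z := by
  have hm : Measurable fun z : Rd d => bump M (x - z) :=
    (measurable_bump M).comp (measurable_const.sub measurable_id)
  rw [← lintegral_comp_sub_left (bump M) x, ← lintegral_const_mul _ hm]
  refine lintegral_mono fun z => ?_
  rw [bump_add, ← mul_assoc]
  exact mul_le_mul_left (mul_bump_le_peetre N a x z) _

/-- A reproducing kernel for the frequencies in the unit ball. -/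
def fat (d : ℕ) : 𝓢(Rd d, ℂ) := (exists_cutoff (d := d) 1).choose

theorem fourier_fat {ξ : Rd d} (h : ‖ξ‖ ≤ 1) : (𝓕 (fat d) : 𝓢(Rd d, ℂ)) ξ = 1 :=
  (exists_cutoff (d := d) 1).choose_spec.1 ξ h

theorem Window.fourier_eq_zero (W : Window d) {ξ : Rd d} (h : 1 < ‖ξ‖) :
    (𝓕 W.χ : 𝓢(Rd d, ℂ)) ξ = 0 := by
  by_contra h0
  have := W.supp (subset_tsupport _ h0)
  rw [mem_closedBall_zero_iff] at this
  linarith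

/-- The centre of a frequency block. -/
abbrev Window.pt (W : Window d) (k : Fin d → ℤ) : Rd d := latticePt W.β k

/-- A frequency block `v ∗ M_{βk}χ`. -/
def block (W : Window d) (v : 𝓢'(Rd d, ℂ)) (k : Fin d → ℤ) : Rd d → ℂ :=
  conv v (modulate (W.pt k) W.χ)

theorem Window.sconv_fat (W : Window d) (ω : Rd d) :
    sconv (modulate ω W.χ) (modulate ω (fat d)) = modulate ω W.χ :=
  sconv_eq_self fun ξ h => by
    rw [fourier_modulate] at h ⊢
    refine fourier_fat ?_
    by_contra h1
    exact h (W.fourier_eq_zero (not_le.1 h1))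

theorem block_eq_integral (W : Window d) (v : 𝓢'(Rd d, ℂ)) (k : Fin d → ℤ) (x : Rd d) :
    block W v k x = ∫ z, block W v k z * modulate (W.pt k) (fat d) (x - z) := by
  conv_lhs => rw [block, ← W.sconv_fat]
  exact conv_sconv _ _ _ _

theorem continuous_block (W : Window d) (v : 𝓢'(Rd d, ℂ)) (k : Fin d → ℤ) :
    Continuous (block W v k) := continuous_conv _ _

theorem block_add (W : Window d) (u v : 𝓢'(Rd d, ℂ)) (k : Fin d → ℤ) :
    block W (u + v) k = block W u k + block W v k := rfl

theorem block_sub (W : Window d) (u v : 𝓢'(Rd d, ℂ)) (k : Fin d → ℤ) :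
    block W (u - v) k = block W u k - block W v k := rfl

theorem block_smul (W : Window d) (c : ℂ) (v : 𝓢'(Rd d, ℂ)) (k : Fin d → ℤ) :
    block W (c • v) k = c • block W v k := rfl

/-- The modulus of a frequency block. -/
def absBlock (W : Window d) (v : 𝓢'(Rd d, ℂ)) (k : Fin d → ℤ) (x : Rd d) : ℝ≥0∞ :=
  ‖block W v k x‖ₑ

theorem measurable_absBlock (W : Window d) (v : 𝓢'(Rd d, ℂ)) (k : Fin d → ℤ) :
    Measurable (absBlock W v k) := (continuous_block W v k).measurable.enorm

theorem absBlock_ne_top (W : Window d) (v : 𝓢'(Rd d, ℂ)) (k : Fin d → ℤ) (x : Rd d) :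
    absBlock W v k x ≠ ∞ := enorm_ne_top

theorem eLpNorm_absBlock (W : Window d) (v : 𝓢'(Rd d, ℂ)) (k : Fin d → ℤ) (p : ℝ≥0∞) :
    eLpNorm (absBlock W v k) p volume = eLpNorm (block W v k) p volume := eLpNorm_enorm _

theorem enorm_modulate_apply (ω : Rd d) (φ : 𝓢(Rd d, ℂ)) (x : Rd d) :
    ‖modulate ω φ x‖ₑ = ‖φ x‖ₑ := by
  rw [← ofReal_norm, norm_modulate_apply, ofReal_norm]

theorem enorm_propS_modulate (t : ℝ) (ω : Rd d) (φ : 𝓢(Rd d, ℂ)) (x : Rd d) :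
    ‖propS t (modulate ω φ) x‖ₑ = ‖propS t φ (x - (4 * Real.pi * t) • ω)‖ₑ := by
  rw [← ofReal_norm, norm_propS_modulate, ofReal_norm]

/-- A block reproduces itself under convolution with the modulated kernel `fat d`. Modulation does
not change absolute values, so one constant serves all frequencies and all windows. -/
theorem exists_selfBounded_absBlock (d N : ℕ) : ∃ C : ℝ≥0∞, C ≠ ∞ ∧ ∀ (W : Window d)
    (v : 𝓢'(Rd d, ℂ)) (k : Fin d → ℤ), SelfBounded N C (absBlock W v k) := by
  obtain ⟨C, hC, h⟩ := enorm_schwartz_decay N (fat d)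
  refine ⟨C, hC, fun W v k x => ?_⟩
  rw [absBlock, block_eq_integral]
  refine (enorm_integral_le_lintegral_enorm _).trans ?_
  rw [← lintegral_const_mul]
  · refine lintegral_mono fun z => ?_
    rw [enorm_mul, enorm_modulate_apply, ← mul_assoc, mul_comm C, mul_assoc]
    exact mul_le_mul_right (h _) _
  · exact (measurable_absBlock W v k).mul
      ((measurable_bump N).comp (measurable_const.sub measurable_id))

theorem peetre_ne_top_of_le {N : ℕ} {a : Rd d → ℝ≥0∞} {C : ℝ≥0∞} (hC : C ≠ ∞) (h : ∀ x, a x ≤ C)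
    (x : Rd d) : peetre N a x ≠ ∞ := by
  refine ne_top_of_le_ne_top hC (iSup_le fun y => ?_)
  exact (mul_le_mul' (h y) (bump_le_one _ _)).trans_eq (mul_one _)

/-- A block grows at most polynomially, so it has a finite maximal function for some decay exponent.
The exponent depends on `v`, so this is only qualitative information. -/
theorem exists_peetre_ne_top (W : Window d) (v : 𝓢'(Rd d, ℂ)) (k : Fin d → ℤ) :
    ∃ N, dec d ≤ N ∧ ∀ x, peetre N (absBlock W v k) x ≠ ∞ := by
  obtain ⟨C, N, hC, h⟩ := exists_conv_le v (modulate (W.pt k) W.χ)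
  refine ⟨N + dec d, le_add_self, fun x => ?_⟩
  have hx : ENNReal.ofReal (C * (1 + ‖x‖) ^ (N + dec d)) ≠ ∞ := ENNReal.ofReal_ne_top
  refine ne_top_of_le_ne_top hx (iSup_le fun y => ?_)
  rw [absBlock, ← ofReal_norm, bump, ← ENNReal.ofReal_mul (norm_nonneg _)]
  refine ENNReal.ofReal_le_ofReal ?_
  rw [← div_eq_mul_inv, div_le_iff₀ (by positivity), mul_assoc, ← mul_pow]
  calc ‖block W v k y‖ ≤ C * (1 + ‖y‖) ^ N := h y
    _ ≤ C * (1 + ‖y‖) ^ (N + dec d) := by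
      gcongr
      · linarith [norm_nonneg y]
      · omega
    _ ≤ _ := by
      gcongr
      have := norm_sub_le x (x - y)
      rw [sub_sub_cancel] at this
      nlinarith [norm_nonneg x, norm_nonneg (x - y), mul_nonneg (norm_nonneg x) (norm_nonneg (x - y))]

/-- Bernstein's inequality for frequency blocks. -/
theorem exists_absBlock_le (d : ℕ) {p : ℝ≥0∞} (hp : 1 / 2 ≤ p) : ∃ C : ℝ≥0∞, C ≠ ∞ ∧
    ∀ (W : Window d) (v : 𝓢'(Rd d, ℂ)) (k : Fin d → ℤ) (x : Rd d),
      absBlock W v k x ≤ C * eLpNorm (block W v k) p volume := by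
  have hp0 : p ≠ 0 := by rintro rfl; simp at hp
  obtain ⟨C₁, hC₁, hs₁⟩ := exists_selfBounded_absBlock d (dec d)
  obtain ⟨C₂, hC₂, h12, h₂⟩ := eLpNorm_peetre_le_of_ne_top (d := d) le_rfl hp hC₁
  obtain ⟨C₃, hC₃, h₃⟩ := le_mul_eLpNorm_peetre (d := d) (dec d) hp0
  -- The summand `1` keeps the constant positive, so that the right-hand side is infinite when the
  -- norm is.
  refine ⟨C₃ * C₂ + 1, by finiteness, fun W v k x => ?_⟩
  rcases eq_or_ne (eLpNorm (block W v k) p volume) ∞ with htop | htop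
  · rw [htop, ENNReal.mul_top (by positivity)]
    exact le_top
  -- Two passes: the exponent `N` depending on `v` only shows that the block is bounded. Boundedness
  -- makes the maximal function with exponent `dec d` finite, and the second pass has uniform
  -- constants.
  obtain ⟨N, hN, hfin⟩ := exists_peetre_ne_top W v k
  obtain ⟨C₄, hC₄, hs₄⟩ := exists_selfBounded_absBlock d N
  obtain ⟨C₅, hC₅, -, h₅⟩ := eLpNorm_peetre_le_of_ne_top hN hp hC₄
  obtain ⟨C₆, hC₆, h₆⟩ := le_mul_eLpNorm_peetre (d := d) N hp0
  have hb : ∀ x, absBlock W v k x ≤ C₆ * (C₅ * eLpNorm (block W v k) p volume) := fun x => by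
    refine (h₆ _ x).trans (mul_le_mul_right ?_ _)
    rw [← eLpNorm_absBlock]
    exact h₅ _ (measurable_absBlock W v k) (hs₄ W v k) (Or.inr hfin)
  have hfin' := peetre_ne_top_of_le (N := dec d) (by finiteness) hb
  refine (h₃ _ x).trans ?_
  calc C₃ * eLpNorm (peetre (dec d) (absBlock W v k)) p volume
      ≤ C₃ * (C₂ * eLpNorm (block W v k) p volume) := by
        gcongr
        rw [← eLpNorm_absBlock]
        exact h₂ _ (measurable_absBlock W v k) (hs₁ W v k) (Or.inr hfin')
    _ ≤ _ := by rw [← mul_assoc]; gcongr; exact le_self_add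

theorem exists_eLpNorm_peetre_le (d : ℕ) {p : ℝ≥0∞} (hp : 1 / 2 ≤ p) : ∃ C : ℝ≥0∞, C ≠ ∞ ∧
    ∀ (W : Window d) (v : 𝓢'(Rd d, ℂ)) (k : Fin d → ℤ),
      eLpNorm (peetre (dec d) (absBlock W v k)) p volume ≤ C * eLpNorm (block W v k) p volume := by
  obtain ⟨C₁, hC₁, hs₁⟩ := exists_selfBounded_absBlock d (dec d)
  obtain ⟨C₂, hC₂, h12, h₂⟩ := eLpNorm_peetre_le_of_ne_top (d := d) le_rfl hp hC₁
  obtain ⟨C₃, hC₃, h₃⟩ := exists_absBlock_le d hp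
  refine ⟨C₂, hC₂, fun W v k => ?_⟩
  rcases eq_or_ne (eLpNorm (block W v k) p volume) ∞ with htop | htop
  · rw [htop, ENNReal.mul_top (by positivity)]
    exact le_top
  rw [← eLpNorm_absBlock]
  exact h₂ _ (measurable_absBlock W v k) (hs₁ W v k)
    (Or.inr (peetre_ne_top_of_le (by finiteness) (h₃ W v k)))

/-- The frequency blocks in `L^p`, `p ≤ 1`, are controlled in `L^1`. -/
theorem exists_eLpNorm_one_le (d : ℕ) {p : ℝ≥0∞} (hp : 1 / 2 ≤ p) (hp1 : p ≤ 1) :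
    ∃ C : ℝ≥0∞, C ≠ ∞ ∧ ∀ (W : Window d) (v : 𝓢'(Rd d, ℂ)) (k : Fin d → ℤ),
      eLpNorm (block W v k) 1 volume ≤ C * eLpNorm (block W v k) p volume := by
  have hp0 : p ≠ 0 := by rintro rfl; simp at hp
  have hp' : p ≠ ∞ := (hp1.trans_lt ENNReal.one_lt_top).ne
  have hr1 : p.toReal ≤ 1 := by simpa using ENNReal.toReal_mono ENNReal.one_ne_top hp1
  have hr : 1 / 2 ≤ p.toReal := by simpa using ENNReal.toReal_mono hp' hp
  obtain ⟨C, hC, h⟩ := exists_absBlock_le d hp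
  refine ⟨C ^ (1 - p.toReal), ENNReal.rpow_ne_top_of_nonneg (by linarith) hC, fun W v k => ?_⟩
  set r := p.toReal with hrdef
  set X := eLpNorm (block W v k) p volume with hX
  have hXp : ∫⁻ x, absBlock W v k x ^ r = X ^ r := by
    rw [hX, eLpNorm_eq_lintegral_rpow_enorm_toReal hp0 hp', ← ENNReal.rpow_mul, ← hrdef,
      one_div_mul_cancel (by linarith), ENNReal.rpow_one]
    rfl
  calc eLpNorm (block W v k) 1 volume = ∫⁻ x, absBlock W v k x := eLpNorm_one_eq_lintegral_enorm
    _ ≤ ∫⁻ x, (C * X) ^ (1 - r) * absBlock W v k x ^ r := by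
      refine lintegral_mono fun x => ?_
      calc absBlock W v k x = absBlock W v k x ^ ((1 - r) + r) := by
            rw [sub_add_cancel, ENNReal.rpow_one]
        _ = absBlock W v k x ^ (1 - r) * absBlock W v k x ^ r :=
            ENNReal.rpow_add_of_nonneg _ _ (by linarith) (by linarith)
        _ ≤ _ := mul_le_mul_left (ENNReal.rpow_le_rpow (h W v k x) (by linarith)) _
    _ = (C * X) ^ (1 - r) * X ^ r := by
      rw [lintegral_const_mul _ ((measurable_absBlock W v k).pow_const r), hXp]
    _ = C ^ (1 - r) * X := by
      rw [ENNReal.mul_rpow_of_nonneg _ _ (by linarith), mul_assoc,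
        ← ENNReal.rpow_add_of_nonneg _ _ (by linarith) (by linarith), sub_add_cancel, ENNReal.rpow_one]

/-- The Schrödinger group on tempered distributions. -/
def prop (t : ℝ) (v : 𝓢'(Rd d, ℂ)) : 𝓢'(Rd d, ℂ) := PointwiseConvergenceCLM.precomp ℂ (propS t) v

theorem prop_apply (t : ℝ) (v : 𝓢'(Rd d, ℂ)) (φ : 𝓢(Rd d, ℂ)) : prop t v φ = v (propS t φ) := rfl

theorem prop_zero (v : 𝓢'(Rd d, ℂ)) : prop 0 v = v :=
  DFunLike.ext _ _ fun φ => by rw [prop_apply, propS_zero]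

theorem prop_add (t t' : ℝ) (v : 𝓢'(Rd d, ℂ)) : prop (t + t') v = prop t (prop t' v) :=
  DFunLike.ext _ _ fun φ => by rw [prop_apply, prop_apply, prop_apply, add_comm, propS_add]

theorem block_prop (W : Window d) (t : ℝ) (v : 𝓢'(Rd d, ℂ)) (k : Fin d → ℤ) (x : Rd d) :
    block W (prop t v) k x =
      ∫ z, block W v k z * propS t (modulate (W.pt k) (fat d)) (x - z) := by
  rw [block, conv, prop_apply, propS_reflectAt]
  conv_lhs => rw [← W.sconv_fat, propS_sconv]
  exact conv_sconv _ _ _ _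

/-- The propagator acts on the reproducing kernel, which by Galilean invariance travels with the
group velocity and decays uniformly for bounded times. Translation invariance of `L^p` then makes
the group bounded with a constant independent of the frequency. -/
theorem exists_absBlock_prop_le (d : ℕ) (T : ℝ) : ∃ C : ℝ≥0∞, C ≠ ∞ ∧
    ∀ (W : Window d) (v : 𝓢'(Rd d, ℂ)) (k : Fin d → ℤ) (t : ℝ), |t| ≤ T → ∀ x,
      absBlock W (prop t v) k x ≤
        C * peetre (dec d) (absBlock W v k) (x - (4 * Real.pi * t) • W.pt k) := by
  obtain ⟨C, hC, h⟩ := enorm_propS_decay (dec d + (d + 1)) T (fat d)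
  have hI := (lintegral_bump_lt_top (Nat.lt_succ_self d)).ne
  refine ⟨C * ∫⁻ z : Rd d, bump (d + 1) z, by finiteness, fun W v k t ht x => ?_⟩
  rw [absBlock, block_prop]
  refine (enorm_integral_le_lintegral_enorm _).trans ?_
  set y := x - (4 * Real.pi * t) • W.pt k with hy
  calc _ ≤ ∫⁻ z, C * (absBlock W v k z * bump (dec d + (d + 1)) (y - z)) := by
        refine lintegral_mono fun z => ?_
        rw [enorm_mul, enorm_propS_modulate, mul_left_comm]
        refine mul_le_mul_right ((h t ht _).trans_eq ?_) _
        rw [hy, sub_right_comm]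
    _ = C * ∫⁻ z, (absBlock W v k z * bump (dec d + (d + 1)) (y - z)) := by
        rw [lintegral_const_mul]
        exact (measurable_absBlock W v k).mul
          ((measurable_bump _).comp (measurable_const.sub measurable_id))
    _ ≤ C * (peetre (dec d) (absBlock W v k) y * ∫⁻ z : Rd d, bump (d + 1) z) := by
        gcongr
        exact lintegral_mul_bump_le_peetre _ _ _ _
    _ = _ := by ring

theorem eLpNorm_comp_sub_right (f : Rd d → ℝ≥0∞) (hf : Measurable f) (p : ℝ≥0∞) (y : Rd d) :
    eLpNorm (fun x => f (x - y)) p volume = eLpNorm f p volume :=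
  eLpNorm_comp_measurePreserving hf.aestronglyMeasurable (measurePreserving_sub_right volume y)

theorem eLpNorm_le_mul_of_le {f : Rd d → ℂ} {g : Rd d → ℝ≥0∞} {C : ℝ≥0∞} (hC : C ≠ ∞)
    (h : ∀ x, ‖f x‖ₑ ≤ C * g x) (p : ℝ≥0∞) : eLpNorm f p volume ≤ C * eLpNorm g p volume := by
  lift C to ℝ≥0 using hC
  exact (eLpNorm_le_nnreal_smul_eLpNorm_of_ae_le_mul' (Eventually.of_forall h) p).trans_eq rfl

theorem exists_eLpNorm_block_prop_le (d : ℕ) (T : ℝ) {p : ℝ≥0∞} (hp : 1 / 2 ≤ p) :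
    ∃ C : ℝ≥0∞, C ≠ ∞ ∧ ∀ (W : Window d) (v : 𝓢'(Rd d, ℂ)) (k : Fin d → ℤ) (t : ℝ), |t| ≤ T →
      eLpNorm (block W (prop t v) k) p volume ≤ C * eLpNorm (block W v k) p volume := by
  obtain ⟨C₁, hC₁, h₁⟩ := exists_absBlock_prop_le d T
  obtain ⟨C₂, hC₂, h₂⟩ := exists_eLpNorm_peetre_le d hp
  refine ⟨C₁ * C₂, by finiteness, fun W v k t ht => ?_⟩
  refine (eLpNorm_le_mul_of_le hC₁ (h₁ W v k t ht) p).trans ?_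
  rw [eLpNorm_comp_sub_right _ (measurable_peetre _ (absBlock_ne_top W v k)), mul_assoc]
  exact mul_le_mul_right (h₂ W v k) _

end Kernels

/-! ### Bounded continuous functions as tempered distributions -/

section BoundedFunctions

variable {d : ℕ}

theorem memLp_top_bcf (g : Rd d →ᵇ ℂ) : MemLp g ∞ volume :=
  memLp_top_of_bound g.continuous.aestronglyMeasurable ‖g‖
    (Eventually.of_forall fun x => g.norm_coe_le_norm x)

/-- The tempered distribution given by a bounded continuous function. -/
def ofBdd (g : Rd d →ᵇ ℂ) : 𝓢'(Rd d, ℂ) := Lp.toTemperedDistribution ((memLp_top_bcf g).toLp g)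

theorem ofBdd_apply (g : Rd d →ᵇ ℂ) (φ : 𝓢(Rd d, ℂ)) : ofBdd g φ = ∫ x, g x * φ x := by
  rw [ofBdd, Lp.toTemperedDistribution_apply]
  refine integral_congr_ae ((memLp_top_bcf g).coeFn_toLp.mono fun x hx => ?_)
  simp only [hx, smul_eq_mul, mul_comm]

theorem integrable_bcf_mul (g : Rd d →ᵇ ℂ) (φ : 𝓢(Rd d, ℂ)) : Integrable fun x => g x * φ x :=
  φ.integrable.bdd_mul g.continuous.aestronglyMeasurable
    (Eventually.of_forall fun x => g.norm_coe_le_norm x)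

theorem ofBdd_add (f g : Rd d →ᵇ ℂ) : ofBdd (f + g) = ofBdd f + ofBdd g := by
  refine DFunLike.ext _ _ fun φ => ?_
  change ofBdd (f + g) φ = ofBdd f φ + ofBdd g φ
  rw [ofBdd_apply, ofBdd_apply, ofBdd_apply,
    ← integral_add (integrable_bcf_mul f φ) (integrable_bcf_mul g φ)]
  simp [add_mul]

theorem ofBdd_smul (c : ℂ) (g : Rd d →ᵇ ℂ) : ofBdd (c • g) = c • ofBdd g := by
  refine DFunLike.ext _ _ fun φ => ?_
  change ofBdd (c • g) φ = c • ofBdd g φ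
  rw [ofBdd_apply, ofBdd_apply, ← integral_smul]
  simp [mul_assoc]

/-- `ofBdd` as a linear map. -/
def ofBddₗ : (Rd d →ᵇ ℂ) →ₗ[ℂ] 𝓢'(Rd d, ℂ) where
  toFun := ofBdd
  map_add' := ofBdd_add
  map_smul' := ofBdd_smul

theorem ofBdd_sub (f g : Rd d →ᵇ ℂ) : ofBdd (f - g) = ofBdd f - ofBdd g := map_sub ofBddₗ f g

theorem ofBdd_zero : ofBdd (0 : Rd d →ᵇ ℂ) = 0 := map_zero ofBddₗ

theorem ofBdd_injective : Function.Injective (ofBdd : (Rd d →ᵇ ℂ) → 𝓢'(Rd d, ℂ)) := by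
  refine (injective_iff_map_eq_zero (ofBddₗ (d := d))).2 fun g hg => ?_
  have h1 : (memLp_top_bcf g).toLp g = 0 := by
    have := Lp.ker_toTemperedDistributionCLM_eq_bot (F := ℂ) (μ := (volume : Measure (Rd d))) (p := ∞)
    exact LinearMap.ker_eq_bot'.1 this _ hg
  have h2 : (g : Rd d → ℂ) =ᵐ[volume] 0 :=
    (memLp_top_bcf g).coeFn_toLp.symm.trans (by rw [h1]; exact Lp.coeFn_zero _ _ _)
  have h3 := (Continuous.ae_eq_iff_eq volume g.continuous continuous_const).1 h2
  exact BoundedContinuousFunction.ext fun x => congrFun h3 x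

theorem norm_ofBdd_apply_le (g : Rd d →ᵇ ℂ) (φ : 𝓢(Rd d, ℂ)) :
    ‖ofBdd g φ‖ ≤ ‖g‖ * ∫ x, ‖φ x‖ := by
  rw [ofBdd_apply, ← integral_const_mul]
  refine norm_integral_le_of_norm_le (φ.integrable.norm.const_mul _) (Eventually.of_forall fun x => ?_)
  rw [norm_mul]
  exact mul_le_mul_of_nonneg_right (g.norm_coe_le_norm x) (norm_nonneg _)

/-- Pairing with a fixed Schwartz function. -/
def pairing (φ : 𝓢(Rd d, ℂ)) : (Rd d →ᵇ ℂ) →L[ℂ] ℂ :=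
  LinearMap.mkContinuous
    { toFun := fun g => ofBdd g φ
      map_add' := fun f g => by rw [ofBdd_add]; rfl
      map_smul' := fun c g => by rw [ofBdd_smul]; rfl } (∫ x, ‖φ x‖) fun g => by
    rw [mul_comm]; exact norm_ofBdd_apply_le g φ

theorem pairing_apply (φ : 𝓢(Rd d, ℂ)) (g : Rd d →ᵇ ℂ) : pairing φ g = ofBdd g φ := rfl

theorem conv_ofBdd (g : Rd d →ᵇ ℂ) (φ : 𝓢(Rd d, ℂ)) (x : Rd d) :
    conv (ofBdd g) φ x = ∫ y, g y * φ (x - y) := by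
  rw [conv, ofBdd_apply]
  rfl

end BoundedFunctions

/-! ### The modulation norm: reconstruction from blocks, embedding, lower semicontinuity -/

section ModNorm

variable {d : ℕ}

/-- The weight `⟨βk⟩^s`. -/
def wt (W : Window d) (s : ℝ) (k : Fin d → ℤ) : ℝ≥0∞ :=
  ENNReal.ofReal ((1 + ‖W.pt k‖ ^ 2) ^ (s / 2))

theorem one_le_wt (W : Window d) {s : ℝ} (hs : 0 ≤ s) (k : Fin d → ℤ) : 1 ≤ wt W s k := by
  rw [wt, ENNReal.one_le_ofReal]
  exact Real.one_le_rpow (by nlinarith [sq_nonneg ‖W.pt k‖]) (by linarith)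

theorem wt_ne_top (W : Window d) (s : ℝ) (k : Fin d → ℤ) : wt W s k ≠ ∞ := ENNReal.ofReal_ne_top

theorem modNorm_eq (W : Window d) (p : ℝ≥0∞) (s : ℝ) (v : 𝓢'(Rd d, ℂ)) :
    modNorm W p s v = ∑' k, wt W s k * eLpNorm (block W v k) p volume := rfl

theorem modNorm_add_le' (W : Window d) (p : ℝ≥0∞) (s : ℝ) (u v : 𝓢'(Rd d, ℂ)) :
    modNorm W p s (u + v) ≤ ENNReal.LpAddConst p * (modNorm W p s u + modNorm W p s v) := by
  rw [modNorm_eq, modNorm_eq, modNorm_eq, ← ENNReal.tsum_add, ← ENNReal.tsum_mul_left]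
  refine ENNReal.tsum_le_tsum fun k => ?_
  rw [block_add, ← mul_add, mul_left_comm]
  exact mul_le_mul_right (eLpNorm_add_le' (continuous_block W u k).aestronglyMeasurable
    (continuous_block W v k).aestronglyMeasurable p) _

theorem modNorm_add_le (W : Window d) {p : ℝ≥0∞} (hp : 1 ≤ p) (s : ℝ) (u v : 𝓢'(Rd d, ℂ)) :
    modNorm W p s (u + v) ≤ modNorm W p s u + modNorm W p s v := by
  simpa [ENNReal.LpAddConst_of_one_le hp] using modNorm_add_le' W p s u v

theorem modNorm_smul (W : Window d) (p : ℝ≥0∞) (s : ℝ) (c : ℂ) (v : 𝓢'(Rd d, ℂ)) :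
    modNorm W p s (c • v) = ‖c‖ₑ * modNorm W p s v := by
  rw [modNorm_eq, modNorm_eq, ← ENNReal.tsum_mul_left]
  refine tsum_congr fun k => ?_
  rw [block_smul, eLpNorm_const_smul, mul_left_comm]

theorem modNorm_zero (W : Window d) (p : ℝ≥0∞) (s : ℝ) : modNorm W p s 0 = 0 := by
  have := modNorm_smul W p s 0 0
  have h0 : (0 : ℂ) • (0 : 𝓢'(Rd d, ℂ)) = 0 := DFunLike.ext _ _ fun φ => by
    change (0 : ℂ) * (0 : ℂ) = 0
    ring
  rwa [h0, enorm_zero, zero_mul] at this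

theorem exists_modNorm_prop_le (W : Window d) (T : ℝ) {p : ℝ≥0∞} (hp : 1 / 2 ≤ p) (s : ℝ) :
    ∃ C : ℝ≥0∞, C ≠ ∞ ∧ ∀ (v : 𝓢'(Rd d, ℂ)) (t : ℝ), |t| ≤ T →
      modNorm W p s (prop t v) ≤ C * modNorm W p s v := by
  obtain ⟨C, hC, h⟩ := exists_eLpNorm_block_prop_le d T hp
  refine ⟨C, hC, fun v t ht => ?_⟩
  rw [modNorm_eq, modNorm_eq, ← ENNReal.tsum_mul_left]
  refine ENNReal.tsum_le_tsum fun k => ?_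
  rw [mul_left_comm]
  exact mul_le_mul_right (h W v k t ht) _

theorem exists_modNorm_one_le (W : Window d) {p : ℝ≥0∞} (hp : 1 / 2 ≤ p) (hp1 : p ≤ 1) (s : ℝ) :
    ∃ C : ℝ≥0∞, C ≠ ∞ ∧ ∀ v : 𝓢'(Rd d, ℂ), modNorm W 1 s v ≤ C * modNorm W p s v := by
  obtain ⟨C, hC, h⟩ := exists_eLpNorm_one_le d hp hp1
  refine ⟨C, hC, fun v => ?_⟩
  rw [modNorm_eq, modNorm_eq, ← ENNReal.tsum_mul_left]
  refine ENNReal.tsum_le_tsum fun k => ?_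
  rw [mul_left_comm]
  exact mul_le_mul_right (h W v k) _

theorem exists_tsum_absBlock_le (W : Window d) {p : ℝ≥0∞} (hp : 1 / 2 ≤ p) (s : ℝ) :
    ∃ C : ℝ≥0∞, C ≠ ∞ ∧ ∀ v : 𝓢'(Rd d, ℂ),
      ∑' k, wt W s k * ⨆ x, absBlock W v k x ≤ C * modNorm W p s v := by
  obtain ⟨C, hC, h⟩ := exists_absBlock_le d hp
  refine ⟨C, hC, fun v => ?_⟩
  rw [modNorm_eq, ← ENNReal.tsum_mul_left]
  refine ENNReal.tsum_le_tsum fun k => ?_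
  rw [mul_left_comm]
  exact mul_le_mul_right (iSup_le (h W v k)) _

theorem finite_latticePt (W : Window d) (R : ℝ) : {k : Fin d → ℤ | ‖W.pt k‖ ≤ R}.Finite := by
  refine (Set.finite_Icc (fun _ : Fin d => -⌈R / W.β⌉) (fun _ => ⌈R / W.β⌉)).subset fun k hk => ?_
  have h : ∀ i, |(k i : ℝ)| ≤ R / W.β := fun i => by
    have h1 := PiLp.norm_apply_le (W.pt k) i
    have h2 : ‖(W.pt k) i‖ = W.β * |(k i : ℝ)| := by
      change ‖W.β * (k i : ℝ)‖ = _
      rw [norm_mul, Real.norm_of_nonneg W.β_pos.le, Real.norm_eq_abs]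
    rw [le_div_iff₀ W.β_pos, mul_comm, ← h2]
    exact h1.trans hk
  refine ⟨fun i => ?_, fun i => ?_⟩
  · have := (abs_le.1 (h i)).1
    have h3 := Int.le_ceil (R / W.β)
    have : (-⌈R / W.β⌉ : ℝ) ≤ k i := by linarith
    exact_mod_cast this
  · have := (abs_le.1 (h i)).2
    have h3 := Int.le_ceil (R / W.β)
    have : (k i : ℝ) ≤ ⌈R / W.β⌉ := by linarith
    exact_mod_cast this

theorem fourier_sum {ι : Type*} (S : Finset ι) (f : ι → 𝓢(Rd d, ℂ)) :
    (𝓕 (∑ i ∈ S, f i) : 𝓢(Rd d, ℂ)) = ∑ i ∈ S, 𝓕 (f i) :=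
  map_sum (FourierTransform.fourierCLM ℂ 𝓢(Rd d, ℂ)) f S

/-- On the spectrum of `φ` only lattice points of norm at most `r + 1` contribute to the partition
of unity, and all of them lie in `S`. -/
theorem sum_sconv_modulate_eq (W : Window d) {r : ℝ} {φ : 𝓢(Rd d, ℂ)}
    (hφ : ∀ ξ, r ≤ ‖ξ‖ → (𝓕 φ : 𝓢(Rd d, ℂ)) ξ = 0) {S : Finset (Fin d → ℤ)}
    (hS : ∀ k, ‖W.pt k‖ ≤ r + 1 → k ∈ S) : ∑ k ∈ S, sconv (modulate (W.pt k) W.χ) φ = φ := by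
  refine fourier_ext fun ξ => ?_
  rw [fourier_sum, _root_.sum_apply]
  simp_rw [fourier_sconv, fourier_modulate]
  rw [← Finset.sum_mul]
  rcases lt_or_ge ‖ξ‖ r with h | h
  · have h1 : ∑ k ∈ S, (𝓕 W.χ : 𝓢(Rd d, ℂ)) (ξ - W.pt k) = 1 := by
      refine (hasSum_sum_of_ne_finset_zero fun k hk => W.fourier_eq_zero ?_).unique (W.partition ξ)
      by_contra h2
      refine hk (hS k ?_)
      have := norm_sub_le ξ (ξ - W.pt k)
      rw [sub_sub_cancel] at this
      linarith [not_lt.1 h2]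
    rw [h1, one_mul]
  · rw [hφ ξ h, mul_zero]

theorem reflectAt_zero_reflectAt_zero (φ : 𝓢(Rd d, ℂ)) : reflectAt 0 (reflectAt 0 φ) = φ :=
  SchwartzMap.ext fun x => by simp [reflectAt_apply]

theorem sconv_modulate_eq_zero (W : Window d) {r : ℝ} {φ : 𝓢(Rd d, ℂ)}
    (hφ : ∀ ξ, r ≤ ‖ξ‖ → (𝓕 φ : 𝓢(Rd d, ℂ)) ξ = 0) {k : Fin d → ℤ}
    (hk : r + 1 < ‖W.pt k‖) : sconv (modulate (W.pt k) W.χ) φ = 0 := by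
  refine sconv_eq_zero fun ξ h => hφ ξ ?_
  rw [fourier_modulate] at h
  have h1 : ‖ξ - W.pt k‖ ≤ 1 := by
    by_contra h1
    exact h (W.fourier_eq_zero (not_le.1 h1))
  have := norm_sub_le ξ (ξ - W.pt k)
  rw [sub_sub_cancel] at this
  linarith

/-- A distribution with uniformly summable frequency blocks is a bounded continuous function. -/
theorem eq_ofBdd_tsum (W : Window d) (v : 𝓢'(Rd d, ℂ)) (b : (Fin d → ℤ) → (Rd d →ᵇ ℂ))
    (hb : ∀ k x, b k x = block W v k x) (hs : Summable b) : v = ofBdd (∑' k, b k) := by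
  rw [← sub_eq_zero]
  -- For a band-limited `φ` all but finitely many blocks pair to zero, and the remaining windows sum
  -- to one on its spectrum.
  refine dist_eq_zero_of_compact_fourier _ fun r φ hφ => ?_
  change v φ - ofBdd (∑' k, b k) φ = 0
  rw [sub_eq_zero]
  set η := reflectAt 0 φ with hη
  have hη' : reflectAt 0 η = φ := reflectAt_zero_reflectAt_zero φ
  have hFη : ∀ ξ, r ≤ ‖ξ‖ → (𝓕 η : 𝓢(Rd d, ℂ)) ξ = 0 := fun ξ hξ => by
    rw [hη, fourier_reflectAt, hφ _ (by rwa [norm_neg]), mul_zero]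
  set S := (finite_latticePt W (r + 1)).toFinset with hS
  have hterm : ∀ k, pairing φ (b k) = conv v (sconv (modulate (W.pt k) W.χ) η) 0 := by
    intro k
    rw [conv_sconv, pairing_apply, ofBdd_apply]
    refine integral_congr_ae (Eventually.of_forall fun x => ?_)
    simp only [hb, zero_sub]
    rw [← hη', reflectAt_apply, zero_sub]
    rfl
  have h1 : ofBdd (∑' k, b k) φ = ∑' k, pairing φ (b k) := (pairing φ).map_tsum hs
  have h2 : ∑' k, pairing φ (b k) = ∑ k ∈ S, pairing φ (b k) := by
    refine tsum_eq_sum fun k hk => ?_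
    rw [hterm, sconv_modulate_eq_zero W hFη]
    · have : reflectAt (0 : Rd d) (0 : 𝓢(Rd d, ℂ)) = 0 := SchwartzMap.ext fun x => rfl
      rw [conv, this, map_zero]
    · by_contra hk'
      exact hk (by simpa [hS] using not_lt.1 hk')
  rw [h1, h2]
  simp_rw [hterm, conv]
  rw [← map_sum]
  have h3 : ∑ k ∈ S, reflectAt 0 (sconv (modulate (W.pt k) W.χ) η) = φ := by
    have h4 := sum_sconv_modulate_eq W hFη (S := S) (fun k hk => by simpa [hS] using hk)
    refine SchwartzMap.ext fun x => ?_
    rw [_root_.sum_apply]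
    simp_rw [reflectAt_apply]
    rw [← _root_.sum_apply, h4, hη, reflectAt_apply]
    simp
  rw [h3]

/-- The frequency blocks as bounded continuous functions. -/
theorem exists_bcf_blocks (W : Window d) {p : ℝ≥0∞} (hp : 1 / 2 ≤ p) {s : ℝ} (hs : 0 ≤ s)
    {v : 𝓢'(Rd d, ℂ)} (hv : MemMod W p s v) : ∃ b : (Fin d → ℤ) → (Rd d →ᵇ ℂ),
      (∀ k x, b k x = block W v k x) ∧ (Summable fun k => ‖b k‖) ∧ v = ofBdd (∑' k, b k) := by
  obtain ⟨C, hC, h⟩ := exists_tsum_absBlock_le W hp s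
  set B : (Fin d → ℤ) → ℝ≥0∞ := fun k => ⨆ x, absBlock W v k x with hB
  have hBfin : ∑' k, B k ≠ ∞ := by
    refine ne_top_of_le_ne_top (ENNReal.mul_ne_top hC hv.ne)
      (le_trans (ENNReal.tsum_le_tsum fun k => ?_) (h v))
    calc B k = 1 * B k := (one_mul _).symm
      _ ≤ _ := mul_le_mul_left (one_le_wt W hs k) _
  have hle : ∀ k x, ‖block W v k x‖ ≤ (B k).toReal := fun k x => by
    rw [← toReal_enorm]
    exact ENNReal.toReal_mono (ENNReal.ne_top_of_tsum_ne_top hBfin k) (le_iSup (absBlock W v k) x)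
  obtain ⟨b, hbx, hbn⟩ : ∃ b : (Fin d → ℤ) → (Rd d →ᵇ ℂ), (∀ k x, b k x = block W v k x) ∧
      ∀ k, ‖b k‖ ≤ (B k).toReal :=
    ⟨fun k => BoundedContinuousFunction.ofNormedAddCommGroup (block W v k)
      (continuous_block W v k) _ (hle k), fun k x => rfl,
      fun k => BoundedContinuousFunction.norm_ofNormedAddCommGroup_le _ ENNReal.toReal_nonneg (hle k)⟩
  have hsb : Summable fun k => ‖b k‖ := Summable.of_nonneg_of_le (fun k => norm_nonneg _) hbn
    (ENNReal.summable_toReal hBfin)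
  exact ⟨b, hbx, hsb, eq_ofBdd_tsum W v b hbx hsb.of_norm⟩

/-- Bernstein's inequality bounds the sup norm of each block, and the weights are at least one since
`s ≥ 0`. -/
theorem exists_enorm_bcf_le (W : Window d) {p : ℝ≥0∞} (hp : 1 / 2 ≤ p) {s : ℝ} (hs : 0 ≤ s) :
    ∃ C : ℝ≥0∞, C ≠ ∞ ∧ ∀ g : Rd d →ᵇ ℂ, MemMod W p s (ofBdd g) →
      ‖g‖ₑ ≤ C * modNorm W p s (ofBdd g) := by
  obtain ⟨C, hC, h⟩ := exists_tsum_absBlock_le W hp s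
  refine ⟨C, hC, fun g hg => ?_⟩
  obtain ⟨b, hb, hbs, hgb⟩ := exists_bcf_blocks W hp hs hg
  rw [ofBdd_injective hgb]
  nth_rw 2 [← ofBdd_injective hgb]
  refine (enorm_tsum_le_tsum_enorm (f := b)).trans ((ENNReal.tsum_le_tsum fun k => ?_).trans (h _))
  refine le_trans ?_ (mul_le_mul_left (one_le_wt W hs k) _)
  rw [one_mul]
  have hfin : ⨆ x, absBlock W (ofBdd g) k x ≠ ∞ := by
    refine ne_top_of_le_ne_top (b := ‖b k‖ₑ) enorm_ne_top (iSup_le fun x => ?_)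
    rw [absBlock, ← hb, ← ofReal_norm, ← ofReal_norm]
    exact ENNReal.ofReal_le_ofReal ((b k).norm_coe_le_norm x)
  rw [← ofReal_norm]
  refine ENNReal.ofReal_le_of_le_toReal ((BoundedContinuousFunction.norm_le ENNReal.toReal_nonneg).2
    fun x => ?_)
  rw [← toReal_enorm, hb]
  exact ENNReal.toReal_mono hfin (le_iSup (absBlock W (ofBdd g) k) x)

/-- Fatou's lemma for the modulation norms. -/
theorem modNorm_le_of_tendsto (W : Window d) (p : ℝ≥0∞) (s : ℝ) {v : 𝓢'(Rd d, ℂ)}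
    {w : ℕ → 𝓢'(Rd d, ℂ)} (h : ∀ φ, Tendsto (fun n => w n φ) atTop (𝓝 (v φ))) :
    modNorm W p s v ≤ liminf (fun n => modNorm W p s (w n)) atTop := by
  have h1 : ∀ k, eLpNorm (block W v k) p volume ≤
      liminf (fun n => eLpNorm (block W (w n) k) p volume) atTop := fun k =>
    Lp.eLpNorm_lim_le_liminf_eLpNorm (fun n => (continuous_block W (w n) k).aestronglyMeasurable) _
      (Eventually.of_forall fun x => h _)
  -- The sum over frequencies is an integral for the counting measure, so Fatou is used twice: for
  -- each block and for the sum.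
  simp_rw [modNorm_eq, ← MeasureTheory.lintegral_count]
  refine le_trans (lintegral_mono fun k => ?_) (lintegral_liminf_le fun n => measurable_of_countable _)
  refine (mul_le_mul_right (h1 k) _).trans ?_
  exact (Monotone.map_liminf_of_continuousAt (f := fun x => wt W s k * x)
    (fun _ _ h => mul_le_mul_right h _) (fun n => eLpNorm (block W (w n) k) p volume)
    (ENNReal.continuous_const_mul (wt_ne_top W s k)).continuousAt).le

end ModNorm

/-! ### Spectral supports of bounded functions and of their products -/

section BandLimited

variable {d : ℕ}

/-- The bounded continuous function `f` has its Fourier transform supported in the closed ball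
of centre `c` and radius `r`. -/
def BandLimited (c : Rd d) (r : ℝ) (f : Rd d →ᵇ ℂ) : Prop :=
  ∀ φ : 𝓢(Rd d, ℂ), (∀ ξ, ‖ξ - c‖ ≤ r → (𝓕 φ : 𝓢(Rd d, ℂ)) (-ξ) = 0) → ∫ y, f y * φ y = 0

theorem BandLimited.mono {c : Rd d} {r r' : ℝ} {f : Rd d →ᵇ ℂ} (h : BandLimited c r f)
    (hr : r ≤ r') : BandLimited c r' f :=
  fun φ hφ => h φ fun ξ hξ => hφ ξ (hξ.trans hr)

theorem bandLimited_one {r : ℝ} (hr : 0 ≤ r) : BandLimited (0 : Rd d) r 1 := by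
  intro φ hφ
  have h0 := hφ 0 (by simpa using hr)
  rw [neg_zero, fourier_apply_eq] at h0
  simpa using h0

theorem bandLimited_of_block (W : Window d) (v : 𝓢'(Rd d, ℂ)) (k : Fin d → ℤ) (b : Rd d →ᵇ ℂ)
    (hb : ∀ x, b x = block W v k x) : BandLimited (W.pt k) 1 b := by
  intro φ hφ
  have h1 : sconv (modulate (W.pt k) W.χ) (reflectAt 0 φ) = 0 := sconv_eq_zero fun ξ hξ => by
    rw [fourier_modulate] at hξ
    rw [fourier_reflectAt, hφ, mul_zero]
    by_contra h2
    exact hξ (W.fourier_eq_zero (not_le.1 h2))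
  have h2 := conv_sconv v (modulate (W.pt k) W.χ) (reflectAt 0 φ) 0
  have h3 : reflectAt (0 : Rd d) (0 : 𝓢(Rd d, ℂ)) = 0 := SchwartzMap.ext fun x => rfl
  rw [h1, conv, h3, map_zero] at h2
  rw [h2]
  refine integral_congr_ae (Eventually.of_forall fun y => ?_)
  simp only [hb, reflectAt_apply, zero_sub, neg_neg]
  rfl

/-- The window at `βk` lives in the unit ball about `βk`, which misses the spectrum of `f`. -/
theorem BandLimited.conv_eq_zero {c : Rd d} {r : ℝ} {f : Rd d →ᵇ ℂ} (h : BandLimited c r f)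
    (W : Window d) {k : Fin d → ℤ} (hk : r + 1 < ‖W.pt k - c‖) (x : Rd d) :
    block W (ofBdd f) k x = 0 := by
  rw [block, conv, ofBdd_apply]
  refine h _ fun ξ hξ => ?_
  rw [fourier_reflectAt, neg_neg, fourier_modulate, W.fourier_eq_zero, mul_zero]
  have := norm_sub_norm_le (W.pt k - c) (W.pt k - ξ)
  rw [sub_sub_sub_cancel_left] at this
  rw [norm_sub_rev]
  linarith

/-- Complex conjugation of Schwartz functions. -/
def sconj (φ : 𝓢(Rd d, ℂ)) : 𝓢(Rd d, ℂ) :=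
  SchwartzMap.postcompCLM (𝕜 := ℝ) (Complex.conjCLE : ℂ →L[ℝ] ℂ) φ

theorem sconj_apply (φ : 𝓢(Rd d, ℂ)) (x : Rd d) : sconj φ x = (starRingEnd ℂ) (φ x) := rfl

theorem fourier_sconj (φ : 𝓢(Rd d, ℂ)) (ξ : Rd d) :
    (𝓕 (sconj φ) : 𝓢(Rd d, ℂ)) ξ = (starRingEnd ℂ) ((𝓕 φ : 𝓢(Rd d, ℂ)) (-ξ)) := by
  rw [fourier_apply_eq, fourier_apply_eq, ← integral_conj]
  refine integral_congr_ae (Eventually.of_forall fun x => ?_)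
  simp only [sconj_apply, map_mul, ← Complex.exp_conj, map_neg, Complex.conj_ofReal, Complex.conj_I,
    map_ofNat, inner_neg_right, Complex.ofReal_neg]
  congr 2
  ring

theorem BandLimited.star {c : Rd d} {r : ℝ} {f : Rd d →ᵇ ℂ} (h : BandLimited c r f) :
    BandLimited (-c) r (star f) := by
  intro φ hφ
  have h1 := h (sconj φ) fun ξ hξ => by
    rw [fourier_sconj, neg_neg]
    have := hφ (-ξ) (by rwa [sub_neg_eq_add, neg_add_eq_sub, norm_sub_rev])
    rw [neg_neg] at this
    rw [this, map_zero]
  have h2 := congrArg (starRingEnd ℂ) h1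
  rw [← integral_conj, map_zero] at h2
  rw [← h2]
  refine integral_congr_ae (Eventually.of_forall fun x => ?_)
  simp only [map_mul, sconj_apply, Complex.conj_conj]
  rfl

theorem fourier_dilate {R : ℝ} (hR : 0 < R) (φ : 𝓢(Rd d, ℂ)) (ξ : Rd d) :
    (𝓕 (dilate R hR.ne' φ) : 𝓢(Rd d, ℂ)) ξ = (R ^ d : ℝ) * (𝓕 φ : 𝓢(Rd d, ℂ)) (R • ξ) := by
  rw [fourier_apply_eq, fourier_apply_eq]
  have h := Measure.integral_comp_smul (μ := (volume : Measure (Rd d)))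
    (fun y => Complex.exp (-(2 * Real.pi * Complex.I * (inner ℝ y (R • ξ) : ℝ))) * φ y) R⁻¹
  have h1 : ∀ x : Rd d, inner ℝ (R⁻¹ • x) (R • ξ) = inner ℝ x ξ := fun x => by
    rw [inner_smul_left, inner_smul_right]
    simp only [conj_trivial]
    field_simp
  simp_rw [h1] at h
  rw [finrank_euclideanSpace_fin] at h
  refine (Eq.trans ?_ h).trans ?_
  · rfl
  · rw [inv_pow, inv_inv, abs_of_nonneg (by positivity), Complex.real_smul]

/-- Take a function with spectrum in the unit ball, translate and normalise it to have value `1` at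
the origin, and stretch it: stretching shrinks the spectrum and the pointwise limit is `1`. -/
theorem exists_bandLimited_approximate_unit (d : ℕ) : ∃ η : ℕ → 𝓢(Rd d, ℂ),
    (∀ n ξ, 1 ≤ ‖ξ‖ → (𝓕 (η n) : 𝓢(Rd d, ℂ)) ξ = 0) ∧ (∃ C, ∀ n x, ‖η n x‖ ≤ C) ∧
      ∀ x, Tendsto (fun n => η n x) atTop (𝓝 1) := by
  obtain ⟨η₀, h1, h0⟩ := exists_cutoff (d := d) 0
  have hne : ∃ x₀, η₀ x₀ ≠ 0 := by
    by_contra! h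
    have : η₀ = 0 := SchwartzMap.ext h
    have h2 := h1 0 (by simp)
    rw [this, fourier_apply_eq] at h2
    simp at h2
  obtain ⟨x₀, hx₀⟩ := hne
  set η₁ : 𝓢(Rd d, ℂ) := (η₀ x₀)⁻¹ • reflectAt 0 (reflectAt x₀ η₀) with hη₁
  have hη₁x : ∀ x, η₁ x = (η₀ x₀)⁻¹ * η₀ (x₀ + x) := fun x => by
    rw [hη₁, _root_.smul_apply, reflectAt_apply, reflectAt_apply, smul_eq_mul]
    congr 2; simp
  have hF : ∀ ξ, 1 ≤ ‖ξ‖ → (𝓕 η₁ : 𝓢(Rd d, ℂ)) ξ = 0 := fun ξ hξ => by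
    rw [hη₁, FourierTransform.fourier_smul, _root_.smul_apply, fourier_reflectAt, fourier_reflectAt,
      neg_neg, h0 ξ (by simpa using hξ)]
    simp
  have hpos : ∀ n : ℕ, (0 : ℝ) < n + 1 := fun n => by positivity
  refine ⟨fun n => dilate (n + 1) (hpos n).ne' η₁, fun n ξ hξ => ?_,
    ⟨SchwartzMap.seminorm ℝ 0 0 η₁, fun n x => ?_⟩, fun x => ?_⟩
  · rw [fourier_dilate (hpos n), hF, mul_zero]
    rw [norm_smul, Real.norm_of_nonneg (hpos n).le]
    have : (1 : ℝ) ≤ n + 1 := by linarith [Nat.cast_nonneg (α := ℝ) n]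
    nlinarith
  · exact SchwartzMap.norm_le_seminorm ℝ η₁ _
  · have h2 : η₁ 0 = 1 := by rw [hη₁x, add_zero, inv_mul_cancel₀ hx₀]
    have h3 : Tendsto (fun n : ℕ => ((n : ℝ) + 1)⁻¹ • x) atTop (𝓝 0) := by
      have := (tendsto_one_div_add_atTop_nhds_zero_nat (𝕜 := ℝ)).smul_const x
      simpa using this
    have h4 := (η₁.continuous.tendsto 0).comp h3
    rw [h2] at h4
    exact h4

theorem fourier_neg_modulate (ξ ξ' : Rd d) (φ : 𝓢(Rd d, ℂ)) :
    (𝓕 (modulate ξ φ) : 𝓢(Rd d, ℂ)) (-ξ') = (𝓕 φ : 𝓢(Rd d, ℂ)) (-(ξ + ξ')) := by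
  rw [fourier_modulate]
  congr 1
  abel

/-- The factor `η` makes `g η` integrable with continuous, compactly supported Fourier transform, so
`g η` is a superposition of characters of frequency within `r₂ + 1` of `c₂`. Against `f φ` each such
character pairs to zero by the hypothesis on `f`. -/
theorem BandLimited.integral_mul_mul_eq_zero {c₁ c₂ : Rd d} {r₁ r₂ : ℝ} {f g : Rd d →ᵇ ℂ}
    (hf : BandLimited c₁ r₁ f) (hg : BandLimited c₂ r₂ g) {η φ : 𝓢(Rd d, ℂ)}
    (hη : ∀ ξ, 1 ≤ ‖ξ‖ → (𝓕 η : 𝓢(Rd d, ℂ)) ξ = 0)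
    (hφ : ∀ ξ, ‖ξ - (c₁ + c₂)‖ ≤ r₁ + r₂ + 1 → (𝓕 φ : 𝓢(Rd d, ℂ)) (-ξ) = 0) :
    ∫ y, (g y * η y) * (f y * φ y) = 0 := by
  set h : Rd d → ℂ := fun y => g y * η y with hh
  have hint : Integrable h := integrable_bcf_mul g η
  have hcont : Continuous h := g.continuous.mul η.continuous
  have hFh : ∀ ξ, 𝓕 h ξ = ∫ y, g y * modulate (-ξ) η y := fun ξ => by
    rw [Real.fourier_eq']
    refine integral_congr_ae (Eventually.of_forall fun y => ?_)
    simp only [hh, modulate_apply, smul_eq_mul, inner_neg_left, real_inner_comm]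
    push_cast
    ring_nf
  have hsupp : ∀ ξ, r₂ + 1 < ‖ξ - c₂‖ → 𝓕 h ξ = 0 := fun ξ hξ => by
    rw [hFh]
    refine hg _ fun ξ' hξ' => ?_
    rw [fourier_neg_modulate]
    refine hη _ ?_
    have := norm_sub_norm_le (ξ - c₂) (ξ' - c₂)
    rw [sub_sub_sub_cancel_right] at this
    rw [neg_add, neg_neg, ← sub_eq_add_neg]
    linarith
  have hFcont : Continuous (𝓕 h) :=
    VectorFourier.fourierIntegral_continuous Real.continuous_fourierChar
      (innerSL ℝ).continuous₂ hint
  have hFint : Integrable (𝓕 h) := by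
    refine hFcont.integrable_of_hasCompactSupport
      (HasCompactSupport.intro (isCompact_closedBall c₂ (r₂ + 1)) fun ξ hξ => hsupp ξ ?_)
    rwa [Metric.mem_closedBall, dist_eq_norm, not_le] at hξ
  have hinv : 𝓕⁻ (𝓕 h) = h := hcont.fourierInv_fourier_eq hint hFint
  have hfφ : Integrable fun y => f y * φ y := integrable_bcf_mul f φ
  -- Fubini in the form of the self-adjointness of the Fourier transform; the sign of `L` makes it
  -- the inverse transform.
  have hflip := VectorFourier.integral_fourierIntegral_smul_eq_flip (L := -innerₗ (Rd d))
    (μ := volume) (ν := volume)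
    Real.continuous_fourierChar (by simpa using! continuous_inner.neg) hFint hfφ
  have hl : ∀ y, VectorFourier.fourierIntegral Real.fourierChar volume (-innerₗ (Rd d)) (𝓕 h) y = h y := by
    intro y
    rw [← congrFun hinv y]
    rfl
  have hr : ∀ ξ, 𝓕 h ξ • VectorFourier.fourierIntegral Real.fourierChar volume (-innerₗ (Rd d)).flip
      (fun y => f y * φ y) ξ = 0 := by
    intro ξ
    by_cases hξ : r₂ + 1 < ‖ξ - c₂‖
    · rw [hsupp ξ hξ, zero_smul]
    · have h0 : ∫ y, f y * modulate ξ φ y = 0 := by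
        refine hf _ fun ξ' hξ' => ?_
        rw [fourier_neg_modulate]
        refine hφ _ ?_
        have := norm_add_le (ξ - c₂) (ξ' - c₁)
        rw [show ξ - c₂ + (ξ' - c₁) = ξ + ξ' - (c₁ + c₂) by abel] at this
        linarith [not_lt.1 hξ]
      have h1 : VectorFourier.fourierIntegral Real.fourierChar volume (-innerₗ (Rd d)).flip
          (fun y => f y * φ y) ξ = ∫ y, f y * modulate ξ φ y := by
        refine integral_congr_ae (Eventually.of_forall fun y => ?_)
        simp only [modulate_apply, Circle.smul_def, Real.fourierChar_apply, smul_eq_mul]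
        have h2 : -((-innerₗ (Rd d)).flip y ξ) = inner ℝ ξ y := by
          change -(-(inner ℝ ξ y)) = _
          rw [neg_neg]
        rw [h2]
        push_cast
        ring_nf
      rw [h1, h0, smul_zero]
  simp_rw [hl, hr, integral_zero, smul_eq_mul] at hflip
  exact hflip

/-- The regularising factor is removed by dominated convergence. Its spectrum costs the additional
`1` in the radius, which is harmless later. -/
theorem BandLimited.mul {c₁ c₂ : Rd d} {r₁ r₂ : ℝ} {f g : Rd d →ᵇ ℂ}
    (hf : BandLimited c₁ r₁ f) (hg : BandLimited c₂ r₂ g) :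
    BandLimited (c₁ + c₂) (r₁ + r₂ + 1) (f * g) := by
  intro φ hφ
  obtain ⟨η, hη, ⟨C, hC⟩, hlim⟩ := exists_bandLimited_approximate_unit d
  have h0 : ∀ n, ∫ y, (g y * η n y) * (f y * φ y) = 0 := fun n =>
    hf.integral_mul_mul_eq_zero hg (hη n) hφ
  have h1 : Tendsto (fun n => ∫ y, (g y * η n y) * (f y * φ y)) atTop
      (𝓝 (∫ y, (f * g) y * φ y)) := by
    refine tendsto_integral_of_dominated_convergence (fun y => C * ‖(f * g) y * φ y‖) (fun n => ?_)
      ((integrable_bcf_mul (f * g) φ).norm.const_mul C) (fun n => Eventually.of_forall fun y => ?_)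
      (Eventually.of_forall fun y => ?_)
    · have := f.continuous
      have := g.continuous
      have := (η n).continuous
      have := φ.continuous
      exact Continuous.aestronglyMeasurable (by fun_prop)
    · have : g y * η n y * (f y * φ y) = η n y * ((f * g) y * φ y) := by
        rw [BoundedContinuousFunction.mul_apply]; ring
      rw [this, norm_mul]
      exact mul_le_mul_of_nonneg_right (hC n y) (norm_nonneg _)
    · have h2 := ((hlim y).const_mul (g y)).mul_const (f y * φ y)
      have h3 : (f * g) y * φ y = g y * 1 * (f y * φ y) := by
        rw [BoundedContinuousFunction.mul_apply]; ring
      rw [h3]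
      exact h2
  simp_rw [h0] at h1
  exact (tendsto_nhds_unique h1 tendsto_const_nhds)

theorem BandLimited.prod {ι : Type*} (S : Finset ι) {c : ι → Rd d} {r : ℝ}
    {f : ι → (Rd d →ᵇ ℂ)} (hf : ∀ i ∈ S, BandLimited (c i) r (f i)) :
    BandLimited (∑ i ∈ S, c i) (S.card * (r + 1)) (∏ i ∈ S, f i) := by
  classical
  induction S using Finset.induction_on with
  | empty => simpa using bandLimited_one (d := d) le_rfl
  | insert i S hi ih =>
    rw [Finset.sum_insert hi, Finset.prod_insert hi, Finset.card_insert_of_notMem hi]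
    refine ((hf i (Finset.mem_insert_self i S)).mul
      (ih fun j hj => hf j (Finset.mem_insert_of_mem hj))).mono ?_
    push_cast
    linarith

end BandLimited

/-! ### Products of series and Minkowski's inequality for countable sums -/

section Sums

theorem summable_prod_and_prod_tsum {R K : Type*} [NormedCommRing R] [CompleteSpace R] :
    ∀ (n : ℕ) (f : Fin n → K → R), (∀ i, Summable fun k => ‖f i k‖) →
      (Summable fun κ : Fin n → K => ‖∏ i, f i (κ i)‖) ∧
        ∏ i, ∑' k, f i k = ∑' κ : Fin n → K, ∏ i, f i (κ i) := by
  intro n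
  induction n with
  | zero =>
    intro f _
    refine ⟨summable_of_hasFiniteSupport (Set.toFinite _), ?_⟩
    rw [tsum_eq_single (default : Fin 0 → K) fun κ h => (h (Subsingleton.elim _ _)).elim]
    simp
  | succ n ih =>
    intro f hf
    obtain ⟨h1, h2⟩ := ih (fun i => f i.succ) fun i => hf i.succ
    have he : ∀ q : K × (Fin n → K), ∏ i, f i (Fin.consEquiv (fun _ => K) q i) =
        f 0 q.1 * ∏ i : Fin n, f i.succ (q.2 i) := fun q => by
      rw [Fin.prod_univ_succ]
      simp [Fin.consEquiv]
    refine ⟨?_, ?_⟩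
    · rw [← (Fin.consEquiv fun _ => K).summable_iff]
      simp only [Function.comp_def, he]
      exact Summable.mul_norm (f := f 0) (g := fun κ : Fin n → K => ∏ i : Fin n, f i.succ (κ i))
        (hf 0) h1
    · rw [Fin.prod_univ_succ, h2, tsum_mul_tsum_of_summable_norm (hf 0) h1,
        ← (Fin.consEquiv fun _ => K).tsum_eq]
      simp only [he]

theorem ennreal_tsum_pi_prod {K : Type*} : ∀ (n : ℕ) (f : Fin n → K → ℝ≥0∞),
    ∑' κ : Fin n → K, ∏ i, f i (κ i) = ∏ i, ∑' k, f i k := by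
  intro n
  induction n with
  | zero =>
    intro f
    rw [tsum_eq_single (default : Fin 0 → K) fun κ h => (h (Subsingleton.elim _ _)).elim]
    simp
  | succ n ih =>
    intro f
    have he : ∀ q : K × (Fin n → K), ∏ i, f i (Fin.consEquiv (fun _ => K) q i) =
        f 0 q.1 * ∏ i : Fin n, f i.succ (q.2 i) := fun q => by
      rw [Fin.prod_univ_succ]
      simp [Fin.consEquiv]
    rw [Fin.prod_univ_succ, ← ih, ← (Fin.consEquiv fun _ => K).tsum_eq]
    simp only [he]
    rw [ENNReal.tsum_prod (f := fun k (κ : Fin n → K) => f 0 k * ∏ i : Fin n, f i.succ (κ i))]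
    simp_rw [ENNReal.tsum_mul_left, ENNReal.tsum_mul_right]

/-- Finite sums obey Minkowski; for finite `p` monotone convergence along the directed set of finite
subsets gives the rest. -/
theorem eLpNorm_tsum_le {α ι : Type*} [MeasurableSpace α] {μ : Measure α} [Countable ι] {p : ℝ≥0∞}
    (hp : 1 ≤ p) {f : ι → α → ℝ≥0∞} (hf : ∀ i, Measurable (f i)) :
    eLpNorm (fun x => ∑' i, f i x) p μ ≤ ∑' i, eLpNorm (f i) p μ := by
  rcases eq_or_ne p ∞ with rfl | hp'
  · simp only [eLpNorm_exponent_top]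
    have h : ∀ᵐ x ∂μ, ∀ i, f i x ≤ eLpNormEssSup (f i) μ :=
      ae_all_iff.2 fun i => ae_le_eLpNormEssSup (f := f i)
    exact essSup_le_of_ae_le _ (h.mono fun x hx => ENNReal.tsum_le_tsum hx)
  have hp0 : p ≠ 0 := (zero_lt_one.trans_le hp).ne'
  have hr : 0 < p.toReal := ENNReal.toReal_pos hp0 hp'
  have hfin : ∀ S : Finset ι, eLpNorm (fun x => ∑ i ∈ S, f i x) p μ ≤ ∑' i, eLpNorm (f i) p μ := by
    intro S
    refine le_trans ?_ (ENNReal.sum_le_tsum S)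
    have := eLpNorm_sum_le (μ := μ) (s := S) (f := f) (fun i _ => (hf i).aestronglyMeasurable) hp
    refine le_trans (le_of_eq ?_) this
    congr 1
    ext x
    rw [Finset.sum_apply]
  rw [eLpNorm_eq_lintegral_rpow_enorm_toReal hp0 hp', one_div,
    ENNReal.rpow_inv_le_iff hr]
  simp only [enorm_eq_self]
  have hsup : ∀ x, (∑' i, f i x) ^ p.toReal = ⨆ S : Finset ι, (∑ i ∈ S, f i x) ^ p.toReal := by
    intro x
    rw [ENNReal.tsum_eq_iSup_sum]
    exact (ENNReal.orderIsoRpow p.toReal hr).map_iSup _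
  simp_rw [hsup]
  rw [lintegral_iSup_directed]
  · refine iSup_le fun S => ?_
    have := hfin S
    rw [eLpNorm_eq_lintegral_rpow_enorm_toReal hp0 hp', one_div, ENNReal.rpow_inv_le_iff hr] at this
    exact this
  · exact fun S => ((Finset.measurable_fun_sum S fun i _ => hf i).pow_const _).aemeasurable
  · refine directed_of_isDirected_le fun S T hST x => ?_
    exact ENNReal.rpow_le_rpow (Finset.sum_le_sum_of_subset hST) hr.le

end Sums

/-! ### Frequency localisation of products of blocks -/

section Products

variable {d : ℕ}

/-- Indicator of `|βk - c| ≤ ρ`. -/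
def near (W : Window d) (ρ : ℝ) (c : Rd d) (k : Fin d → ℤ) : ℝ≥0∞ :=
  {k | ‖W.pt k - c‖ ≤ ρ}.indicator 1 k

theorem near_of_le {W : Window d} {ρ : ℝ} {c : Rd d} {k : Fin d → ℤ} (h : ‖W.pt k - c‖ ≤ ρ) :
    near W ρ c k = 1 := Set.indicator_of_mem (s := {k | ‖W.pt k - c‖ ≤ ρ}) h _

theorem near_of_lt {W : Window d} {ρ : ℝ} {c : Rd d} {k : Fin d → ℤ} (h : ρ < ‖W.pt k - c‖) :
    near W ρ c k = 0 := Set.indicator_of_notMem (s := {k | ‖W.pt k - c‖ ≤ ρ}) (not_le.2 h) _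

theorem near_le_one (W : Window d) (ρ : ℝ) (c : Rd d) (k : Fin d → ℤ) : near W ρ c k ≤ 1 := by
  rcases le_or_gt ‖W.pt k - c‖ ρ with h | h
  · exact (near_of_le h).le
  · rw [near_of_lt h]; exact zero_le

/-- Counts lattice points in a cube of side `2R`; in each coordinate there are at most `2R/β + 1`.
-/
theorem exists_tsum_near_le (W : Window d) : ∃ C : ℝ≥0∞, C ≠ ∞ ∧ ∀ (R : ℝ) (c : Rd d), 0 ≤ R →
    ∑' k, near W R c k ≤ C * ENNReal.ofReal ((1 + R) ^ d) := by
  have hβ := W.β_pos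
  refine ⟨ENNReal.ofReal ((2 / W.β + 1) ^ d), ENNReal.ofReal_ne_top, fun R c hR => ?_⟩
  set S : Finset (Fin d → ℤ) :=
    Fintype.piFinset fun i => Finset.Icc ⌈(c i - R) / W.β⌉ ⌊(c i + R) / W.β⌋ with hS
  have h1 : ∑' k, near W R c k = ∑ k ∈ S, near W R c k := by
    refine tsum_eq_sum fun k hk => near_of_lt ?_
    by_contra h
    refine hk (Fintype.mem_piFinset.2 fun i => ?_)
    have h2 := (PiLp.norm_apply_le (W.pt k - c) i).trans (not_lt.1 h)
    have h3 : (W.pt k - c) i = W.β * (k i : ℝ) - c i := rfl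
    rw [h3, Real.norm_eq_abs, abs_le] at h2
    rw [Finset.mem_Icc, Int.ceil_le, Int.le_floor, div_le_iff₀ hβ, le_div_iff₀ hβ]
    constructor <;> linarith
  have h2 : (S.card : ℝ) ≤ ((2 / W.β + 1) * (1 + R)) ^ d := by
    rw [hS, Fintype.card_piFinset]
    push_cast
    calc _ ≤ ∏ _i : Fin d, ((2 / W.β + 1) * (1 + R)) := by
          refine Finset.prod_le_prod (fun _ _ => by positivity) fun i _ => ?_
          rw [Int.card_Icc]
          have h3 : (2 / W.β + 1) * (1 + R) ≥ 2 * R / W.β + 1 := by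
            have : 0 ≤ 2 / W.β := by positivity
            have h4 : 2 * R / W.β = 2 / W.β * R := by ring
            rw [h4]; nlinarith
          refine le_trans ?_ h3
          rcases le_or_gt 0 (⌊(c i + R) / W.β⌋ + 1 - ⌈(c i - R) / W.β⌉) with h0 | h0
          · have h5 : ((⌊(c i + R) / W.β⌋ + 1 - ⌈(c i - R) / W.β⌉).toNat : ℝ) =
                ((⌊(c i + R) / W.β⌋ + 1 - ⌈(c i - R) / W.β⌉ : ℤ) : ℝ) := by
              exact_mod_cast Int.toNat_of_nonneg h0
            rw [h5]
            push_cast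
            have h6 := Int.floor_le ((c i + R) / W.β)
            have h7 := Int.le_ceil ((c i - R) / W.β)
            have h8 : (c i + R) / W.β - (c i - R) / W.β = 2 * R / W.β := by ring
            linarith
          · rw [Int.toNat_of_nonpos h0.le]
            simp only [Nat.cast_zero]
            positivity
      _ = _ := by simp
  rw [h1]
  calc ∑ k ∈ S, near W R c k ≤ ∑ _k ∈ S, 1 := Finset.sum_le_sum fun k _ => near_le_one _ _ _ _
    _ = ENNReal.ofReal (S.card : ℝ) := by simp
    _ ≤ ENNReal.ofReal (((2 / W.β + 1) * (1 + R)) ^ d) := ENNReal.ofReal_le_ofReal h2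
    _ = _ := by rw [mul_pow, ENNReal.ofReal_mul (by positivity)]

/-- The number of output blocks met by a product of `n` blocks, weighted. -/
theorem wt_le_of_near (W : Window d) {s : ℝ} (hs : 0 ≤ s) : ∃ B : ℝ≥0∞, B ≠ ∞ ∧ 1 ≤ B ∧
    ∀ (n : ℕ) (σ : Fin n → ℝ) (κ : Fin n → Fin d → ℤ) (k : Fin d → ℤ), 1 ≤ n → (∀ i, |σ i| = 1) →
      ‖W.pt k - ∑ i, σ i • W.pt (κ i)‖ ≤ 2 * n + 1 → wt W s k ≤ B ^ n * ∏ i, wt W s (κ i) := by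
  refine ⟨ENNReal.ofReal (32 ^ (s / 2)), ENNReal.ofReal_ne_top,
    ENNReal.one_le_ofReal.2 (Real.one_le_rpow (by norm_num) (by linarith)), ?_⟩
  intro n σ κ k hn hσ hk
  have hsum : ‖∑ i, σ i • W.pt (κ i)‖ ≤ ∑ i, ‖W.pt (κ i)‖ :=
    (norm_sum_le _ _).trans_eq (Finset.sum_congr rfl fun i _ => by
      rw [norm_smul, Real.norm_eq_abs, hσ, one_mul])
  have hprod : ∀ S : Finset (Fin n), 1 + ∑ i ∈ S, ‖W.pt (κ i)‖ ≤ ∏ i ∈ S, (1 + ‖W.pt (κ i)‖) := by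
    intro S
    induction S using Finset.induction_on with
    | empty => simp
    | insert i S hi ih =>
      rw [Finset.sum_insert hi, Finset.prod_insert hi]
      have h1 : 0 ≤ ∑ i ∈ S, ‖W.pt (κ i)‖ := Finset.sum_nonneg fun _ _ => norm_nonneg _
      nlinarith [norm_nonneg (W.pt (κ i))]
  have h1 : ‖W.pt k‖ ≤ 2 * n + 1 + ∑ i, ‖W.pt (κ i)‖ := by
    have := norm_add_le (W.pt k - ∑ i, σ i • W.pt (κ i)) (∑ i, σ i • W.pt (κ i))
    rw [sub_add_cancel] at this
    linarith
  have hn1 : (1 : ℝ) ≤ n := by exact_mod_cast hn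
  have h2 : 1 + ‖W.pt k‖ ≤ (2 * n + 2) * ∏ i, (1 + ‖W.pt (κ i)‖) := by
    have h3 := hprod Finset.univ
    have h4 : 0 ≤ ∑ i, ‖W.pt (κ i)‖ := Finset.sum_nonneg fun _ _ => norm_nonneg _
    nlinarith
  -- Only geometric growth in `n` is affordable in power series. The base is `32 = 4² · 2`, from `2n
  -- + 2 ≤ 4^n` and one factor `2` for each weight.
  have hpow : ((2 * n + 2) ^ 2 * 2 ^ n : ℝ) ≤ 32 ^ n := by
    have h3 : ∀ m : ℕ, 1 ≤ m → 2 * (m : ℝ) + 2 ≤ 4 ^ m := by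
      intro m hm
      induction m, hm using Nat.le_induction with
      | base => norm_num
      | succ m hm ih => rw [pow_succ]; push_cast; linarith [one_le_pow₀ (n := m) (by norm_num : (1:ℝ) ≤ 4)]
    calc ((2 * n + 2) ^ 2 * 2 ^ n : ℝ) ≤ (4 ^ n) ^ 2 * 2 ^ n := by gcongr; exact h3 n hn
      _ = 32 ^ n := by rw [← pow_mul, mul_comm n 2, pow_mul, ← mul_pow]; norm_num
  have h5 : 1 + ‖W.pt k‖ ^ 2 ≤ 32 ^ n * ∏ i, (1 + ‖W.pt (κ i)‖ ^ 2) := by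
    calc 1 + ‖W.pt k‖ ^ 2 ≤ (1 + ‖W.pt k‖) ^ 2 := by nlinarith [norm_nonneg (W.pt k)]
      _ ≤ ((2 * n + 2) * ∏ i, (1 + ‖W.pt (κ i)‖)) ^ 2 := by gcongr
      _ = (2 * n + 2) ^ 2 * ∏ i, (1 + ‖W.pt (κ i)‖) ^ 2 := by rw [mul_pow, Finset.prod_pow]
      _ ≤ (2 * n + 2) ^ 2 * ∏ i, (2 * (1 + ‖W.pt (κ i)‖ ^ 2)) := by
          gcongr with i
          nlinarith [sq_nonneg (‖W.pt (κ i)‖ - 1)]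
      _ = ((2 * n + 2) ^ 2 * 2 ^ n) * ∏ i, (1 + ‖W.pt (κ i)‖ ^ 2) := by
          rw [Finset.prod_mul_distrib]; simp [mul_assoc]
      _ ≤ _ := by gcongr
  have h6 : (1 + ‖W.pt k‖ ^ 2) ^ (s / 2) ≤
      (32 ^ (s / 2)) ^ n * ∏ i, (1 + ‖W.pt (κ i)‖ ^ 2) ^ (s / 2) := by
    calc (1 + ‖W.pt k‖ ^ 2) ^ (s / 2) ≤ (32 ^ n * ∏ i, (1 + ‖W.pt (κ i)‖ ^ 2)) ^ (s / 2) := by gcongr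
      _ = _ := by
        rw [Real.mul_rpow (by positivity) (by positivity),
          ← Real.finsetProd_rpow _ _ (fun i _ => by positivity), ← Real.rpow_natCast,
          ← Real.rpow_mul (by norm_num), mul_comm (n : ℝ), Real.rpow_mul (by norm_num),
          Real.rpow_natCast]
  rw [wt, ← ENNReal.ofReal_pow (by positivity)]
  simp_rw [wt]
  rw [← ENNReal.ofReal_prod_of_nonneg fun i _ => by positivity, ← ENNReal.ofReal_mul (by positivity)]
  exact ENNReal.ofReal_le_ofReal h6

theorem absBlock_ofBdd_le (W : Window d) (f : Rd d →ᵇ ℂ) (k : Fin d → ℤ) (x : Rd d) :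
    absBlock W (ofBdd f) k x ≤ ∫⁻ y, ‖f y‖ₑ * ‖W.χ (x - y)‖ₑ := by
  rw [absBlock, block, conv_ofBdd]
  refine (enorm_integral_le_lintegral_enorm _).trans (lintegral_mono fun y => ?_)
  rw [enorm_mul, enorm_modulate_apply]

theorem bcf_prod_apply {ι : Type*} (S : Finset ι) (f : ι → (Rd d →ᵇ ℂ)) (x : Rd d) :
    (∏ i ∈ S, f i) x = ∏ i ∈ S, f i x := by
  classical
  induction S using Finset.induction_on with
  | empty => simp
  | insert i S hi ih =>
    rw [Finset.prod_insert hi, Finset.prod_insert hi, BoundedContinuousFunction.mul_apply, ih]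

/-- The blocks of a product of functions with absolutely summable blocks. -/
theorem absBlock_prod_le (W : Window d) {n : ℕ} {σ : Fin n → ℝ}
    {b : Fin n → (Fin d → ℤ) → (Rd d →ᵇ ℂ)}
    (hb : ∀ i κ, BandLimited (σ i • W.pt κ) 1 (b i κ)) (hs : ∀ i, Summable fun κ => ‖b i κ‖)
    (k : Fin d → ℤ) (x : Rd d) :
    absBlock W (ofBdd (∏ i, ∑' κ, b i κ)) k x ≤ ∑' κ : Fin n → Fin d → ℤ,
      near W (2 * n + 1) (∑ i, σ i • W.pt (κ i)) k *
        ∫⁻ y, (∏ i, ‖b i (κ i) y‖ₑ) * ‖W.χ (x - y)‖ₑ := by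
  obtain ⟨h1, h2⟩ := summable_prod_and_prod_tsum n b hs
  have h3 : block W (ofBdd (∏ i, ∑' κ, b i κ)) k x =
      ∑' κ : Fin n → Fin d → ℤ, block W (ofBdd (∏ i, b i (κ i))) k x := by
    rw [h2]
    exact (pairing (reflectAt x (modulate (W.pt k) W.χ))).map_tsum h1.of_norm
  rw [absBlock, h3]
  refine enorm_tsum_le_tsum_enorm.trans (ENNReal.tsum_le_tsum fun κ => ?_)
  rcases le_or_gt ‖W.pt k - ∑ i, σ i • W.pt (κ i)‖ (2 * n + 1) with h | h
  · rw [near_of_le h, one_mul]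
    refine (absBlock_ofBdd_le W _ k x).trans_eq (lintegral_congr fun y => ?_)
    rw [bcf_prod_apply]
    congr 1
    simp only [enorm, nnnorm_prod, ENNReal.ofNNReal_finsetProd]
  -- The product of `n` blocks has its spectrum within `2n` of the signed sum of frequencies, and
  -- the window adds `1`.
  · have h4 := BandLimited.prod Finset.univ fun i _ => hb i (κ i)
    rw [h4.conv_eq_zero W, enorm_zero]
    · exact zero_le
    · rw [Finset.card_univ, Fintype.card_fin]; linarith

end Products

/-! ### Multiplication and conjugation for `p ≥ 1` -/

section Algebra

variable {d : ℕ}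

theorem lintegral_schwartz_ne_top (φ : 𝓢(Rd d, ℂ)) : ∫⁻ y, ‖φ y‖ₑ ≠ ∞ :=
  (hasFiniteIntegral_iff_enorm.1 φ.integrable.2).ne

theorem eLpNorm_mul_le_of_le {p C : ℝ≥0∞} (hC : C ≠ ∞) {f g : Rd d → ℝ≥0∞} (h : ∀ x, f x ≤ C) :
    eLpNorm (fun x => f x * g x) p volume ≤ C * eLpNorm g p volume := by
  lift C to ℝ≥0 using hC
  exact (eLpNorm_le_nnreal_smul_eLpNorm_of_ae_le_mul'
    (Eventually.of_forall fun x => mul_le_mul_left (h x) _) p).trans_eq rfl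

theorem eLpNorm_prod_le {p : ℝ≥0∞} {ι : Type*} (S : Finset ι) (hS : S.Nonempty)
    {f : ι → Rd d → ℝ≥0∞} {N : ι → ℝ≥0∞} (hN : ∀ i ∈ S, N i ≠ ∞) (h : ∀ i ∈ S, ∀ x, f i x ≤ N i)
    (h' : ∀ i ∈ S, eLpNorm (f i) p volume ≤ N i) :
    eLpNorm (fun x => ∏ i ∈ S, f i x) p volume ≤ ∏ i ∈ S, N i := by
  classical
  induction hS using Finset.Nonempty.cons_induction with
  | singleton i => simpa using h' i (by simp)
  | cons i S hi hS ih =>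
    simp only [Finset.prod_cons]
    refine (eLpNorm_mul_le_of_le (hN i (by simp)) (h i (by simp))).trans
      (mul_le_mul_right (ih ?_ ?_ ?_) _)
    · exact fun j hj => hN j (Finset.mem_cons_of_mem hj)
    · exact fun j hj => h j (Finset.mem_cons_of_mem hj)
    · exact fun j hj => h' j (Finset.mem_cons_of_mem hj)

theorem measurable_bcf_enorm (f : Rd d →ᵇ ℂ) : Measurable fun y => ‖f y‖ₑ :=
  f.continuous.measurable.enorm

/-- Each choice of input blocks meets a bounded number of output blocks, where the weight is at most
a constant times the product of the input weights. `N` dominates both the sup norm and the `L^p`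
norm of a block, so all factors but one go to `L^∞`, and Young's inequality handles the window. The
signs `σ` allow for conjugated factors. -/
theorem exists_modNorm_prod_le (W : Window d) {p : ℝ≥0∞} (hp : 1 ≤ p) {s : ℝ} (hs : 0 ≤ s) {n : ℕ}
    (hn : 1 ≤ n) : ∃ D : ℝ≥0∞, D ≠ ∞ ∧ ∀ (σ : Fin n → ℝ) (b : Fin n → (Fin d → ℤ) → (Rd d →ᵇ ℂ))
      (N : Fin n → (Fin d → ℤ) → ℝ≥0∞), (∀ i, |σ i| = 1) →
      (∀ i κ, BandLimited (σ i • W.pt κ) 1 (b i κ)) → (∀ i, Summable fun κ => ‖b i κ‖) →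
      (∀ i κ, N i κ ≠ ∞) → (∀ i κ x, ‖b i κ x‖ₑ ≤ N i κ) →
      (∀ i κ, eLpNorm (b i κ) p volume ≤ N i κ) →
      modNorm W p s (ofBdd (∏ i, ∑' κ, b i κ)) ≤ D * ∏ i, ∑' κ, wt W s κ * N i κ := by
  obtain ⟨C, hC, hCn⟩ := exists_tsum_near_le W
  obtain ⟨B, hB, -, hBn⟩ := wt_le_of_near W hs
  set X := ∫⁻ y, ‖W.χ y‖ₑ with hX
  have hXt : X ≠ ∞ := lintegral_schwartz_ne_top _
  refine ⟨X * B ^ n * (C * ENNReal.ofReal ((1 + (2 * n + 1)) ^ d)), by finiteness, ?_⟩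
  intro σ b N hσ hb hbs hN hbN hbN'
  have hmχ : Measurable fun y => ‖W.χ y‖ₑ := W.χ.continuous.measurable.enorm
  have hmb : ∀ κ : Fin n → Fin d → ℤ, Measurable fun y => ∏ i, ‖b i (κ i) y‖ₑ := fun κ =>
    Finset.measurable_prod _ fun i _ => measurable_bcf_enorm _
  have hblock : ∀ k, eLpNorm (block W (ofBdd (∏ i, ∑' κ, b i κ)) k) p volume ≤
      ∑' κ : Fin n → Fin d → ℤ, near W (2 * n + 1) (∑ i, σ i • W.pt (κ i)) k *
        (X * ∏ i, N i (κ i)) := by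
    intro k
    rw [← eLpNorm_absBlock]
    refine (eLpNorm_mono_enorm (g := fun x => ∑' κ : Fin n → Fin d → ℤ,
      near W (2 * n + 1) (∑ i, σ i • W.pt (κ i)) k *
        ∫⁻ y, (∏ i, ‖b i (κ i) y‖ₑ) * ‖W.χ (x - y)‖ₑ) fun x => absBlock_prod_le W hb hbs k x).trans ?_
    have hmI : ∀ κ : Fin n → Fin d → ℤ,
        Measurable fun x => ∫⁻ y, (∏ i, ‖b i (κ i) y‖ₑ) * ‖W.χ (x - y)‖ₑ := fun κ =>
      (((hmb κ).comp measurable_snd).mul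
        (hmχ.comp (measurable_fst.sub measurable_snd))).lintegral_prod_right'
    refine (eLpNorm_tsum_le hp fun κ => (hmI κ).const_mul _).trans (ENNReal.tsum_le_tsum fun κ => ?_)
    refine (eLpNorm_mul_le_of_le (C := near W (2 * n + 1) (∑ i, σ i • W.pt (κ i)) k)
      (ne_top_of_le_ne_top ENNReal.one_ne_top (near_le_one _ _ _ _)) fun x => le_rfl).trans ?_
    refine mul_le_mul_right ?_ _
    refine (eLpNorm_lintegral_mul_sub_le hp (hmb κ) hmχ).trans (mul_le_mul_right ?_ _)
    refine eLpNorm_prod_le _ ?_ (fun i _ => hN i _) (fun i _ => hbN i _) fun i _ => ?_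
    · exact ⟨⟨0, hn⟩, Finset.mem_univ _⟩
    · exact (eLpNorm_enorm _).trans_le (hbN' i _)
  calc modNorm W p s (ofBdd (∏ i, ∑' κ, b i κ))
      ≤ ∑' k, ∑' κ : Fin n → Fin d → ℤ, near W (2 * n + 1) (∑ i, σ i • W.pt (κ i)) k *
          (B ^ n * X * ∏ i, (wt W s (κ i) * N i (κ i))) := by
        refine ENNReal.tsum_le_tsum fun k => ?_
        refine (mul_le_mul_right (hblock k) _).trans ?_
        rw [← ENNReal.tsum_mul_left]
        refine ENNReal.tsum_le_tsum fun κ => ?_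
        rcases le_or_gt ‖W.pt k - ∑ i, σ i • W.pt (κ i)‖ (2 * n + 1) with h | h
        · rw [near_of_le h, one_mul, one_mul, Finset.prod_mul_distrib]
          refine (mul_le_mul_left (hBn n σ κ k hn hσ h) _).trans_eq ?_
          ring
        · rw [near_of_lt h]; simp
    _ = ∑' κ : Fin n → Fin d → ℤ, (∑' k, near W (2 * n + 1) (∑ i, σ i • W.pt (κ i)) k) *
          (B ^ n * X * ∏ i, (wt W s (κ i) * N i (κ i))) := by
        rw [ENNReal.tsum_comm]
        simp_rw [ENNReal.tsum_mul_right]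
    _ ≤ ∑' κ : Fin n → Fin d → ℤ, (C * ENNReal.ofReal ((1 + (2 * n + 1)) ^ d)) *
          (B ^ n * X * ∏ i, (wt W s (κ i) * N i (κ i))) :=
        ENNReal.tsum_le_tsum fun κ => mul_le_mul_left (hCn _ _ (by positivity)) _
    _ = _ := by
        rw [ENNReal.tsum_mul_left, ENNReal.tsum_mul_left,
          ennreal_tsum_pi_prod n fun i κ => wt W s κ * N i κ]
        ring

theorem half_le_of_one_le {p : ℝ≥0∞} (hp : 1 ≤ p) : 1 / 2 ≤ p :=
  le_trans (by norm_num) hp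

theorem enorm_star_apply (f : Rd d →ᵇ ℂ) (x : Rd d) : ‖(star f) x‖ₑ = ‖f x‖ₑ := by
  rw [← ofReal_norm, ← ofReal_norm]
  congr 1
  exact norm_star (f x)

theorem exists_modNorm_mul_le (W : Window d) {p : ℝ≥0∞} (hp : 1 ≤ p) {s : ℝ} (hs : 0 ≤ s) :
    ∃ D : ℝ≥0∞, D ≠ ∞ ∧ ∀ f g : Rd d →ᵇ ℂ, MemMod W p s (ofBdd f) → MemMod W p s (ofBdd g) →
      modNorm W p s (ofBdd (f * g)) ≤ D * (modNorm W p s (ofBdd f) * modNorm W p s (ofBdd g)) := by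
  obtain ⟨D, hD, h⟩ := exists_modNorm_prod_le W hp hs (n := 2) (by norm_num)
  obtain ⟨C, hC, hb⟩ := exists_absBlock_le d (half_le_of_one_le hp)
  refine ⟨D * ((C + 1) * (C + 1)), by finiteness, fun f g hf hg => ?_⟩
  obtain ⟨b, hbx, hbs, hfb⟩ := exists_bcf_blocks W (half_le_of_one_le hp) hs hf
  obtain ⟨c, hcx, hcs, hgc⟩ := exists_bcf_blocks W (half_le_of_one_le hp) hs hg
  have hNtop : ∀ v : 𝓢'(Rd d, ℂ), MemMod W p s v → ∀ κ, eLpNorm (block W v κ) p volume ≠ ∞ := by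
    intro v hv κ h0
    have h1 := ENNReal.ne_top_of_tsum_ne_top hv.ne κ
    change wt W s κ * eLpNorm (block W v κ) p volume ≠ ∞ at h1
    rw [h0, ENNReal.mul_top (zero_lt_one.trans_le (one_le_wt W hs κ)).ne'] at h1
    exact h1 rfl
  -- In `C + 1` the summand `C` serves the sup norm (Bernstein) and `1` serves the `L^p` norm.
  have key := h (fun _ => 1) ![b, c] ![fun κ => (C + 1) * eLpNorm (block W (ofBdd f) κ) p volume,
      fun κ => (C + 1) * eLpNorm (block W (ofBdd g) κ) p volume] (by simp) ?_ ?_ ?_ ?_ ?_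
  · simp only [Fin.prod_univ_two, Matrix.cons_val_zero, Matrix.cons_val_one] at key
    rw [← ofBdd_injective hfb, ← ofBdd_injective hgc] at key
    refine key.trans_eq ?_
    rw [modNorm_eq, modNorm_eq]
    simp_rw [mul_left_comm (wt W s _)]
    rw [ENNReal.tsum_mul_left, ENNReal.tsum_mul_left]
    ring
  · intro i κ
    rw [one_smul]
    fin_cases i
    · exact bandLimited_of_block W _ κ _ (hbx κ)
    · exact bandLimited_of_block W _ κ _ (hcx κ)
  · intro i
    fin_cases i
    · exact hbs
    · exact hcs
  · intro i κ
    have := hNtop _ hf κ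
    have := hNtop _ hg κ
    fin_cases i <;> simp <;> finiteness
  · intro i κ x
    fin_cases i
    · simp only [Fin.zero_eta, Matrix.cons_val_zero, hbx]
      exact (hb W _ κ x).trans (mul_le_mul_left le_self_add _)
    · simp only [Fin.mk_one, Matrix.cons_val_one, Matrix.cons_val_zero, hcx]
      exact (hb W _ κ x).trans (mul_le_mul_left le_self_add _)
  · intro i κ
    fin_cases i
    · simp only [Fin.zero_eta, Matrix.cons_val_zero]
      rw [show (b κ : Rd d → ℂ) = block W (ofBdd f) κ from funext (hbx κ)]
      exact (one_mul _).symm.le.trans (mul_le_mul_left le_add_self _)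
    · simp only [Fin.mk_one, Matrix.cons_val_one, Matrix.cons_val_zero]
      rw [show (c κ : Rd d → ℂ) = block W (ofBdd g) κ from funext (hcx κ)]
      exact (one_mul _).symm.le.trans (mul_le_mul_left le_add_self _)

theorem tsum_star_bcf {ι : Type*} {b : ι → (Rd d →ᵇ ℂ)} : ∑' k, star (b k) = star (∑' k, b k) :=
  tsum_star.symm

/-- The product estimate with a single factor of sign `-1`: conjugation reflects the spectrum. -/
theorem exists_modNorm_star_le (W : Window d) {p : ℝ≥0∞} (hp : 1 ≤ p) {s : ℝ} (hs : 0 ≤ s) :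
    ∃ D : ℝ≥0∞, D ≠ ∞ ∧ ∀ f : Rd d →ᵇ ℂ, MemMod W p s (ofBdd f) →
      modNorm W p s (ofBdd (star f)) ≤ D * modNorm W p s (ofBdd f) := by
  obtain ⟨D, hD, h⟩ := exists_modNorm_prod_le W hp hs (n := 1) le_rfl
  obtain ⟨C, hC, hb⟩ := exists_absBlock_le d (half_le_of_one_le hp)
  refine ⟨D * (C + 1), by finiteness, fun f hf => ?_⟩
  obtain ⟨b, hbx, hbs, hfb⟩ := exists_bcf_blocks W (half_le_of_one_le hp) hs hf
  have key := h (fun _ => -1) (fun _ κ => star (b κ))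
    (fun _ κ => (C + 1) * eLpNorm (block W (ofBdd f) κ) p volume) (by simp) ?_ ?_ ?_ ?_ ?_
  · simp only [Finset.univ_unique, Finset.prod_singleton] at key
    rw [tsum_star_bcf, ← ofBdd_injective hfb] at key
    refine key.trans_eq ?_
    rw [modNorm_eq]
    simp_rw [mul_left_comm (wt W s _)]
    rw [ENNReal.tsum_mul_left]
    ring
  · intro i κ
    rw [neg_one_smul]
    exact (bandLimited_of_block W _ κ _ (hbx κ)).star
  · intro i
    simpa only [norm_star] using hbs
  · intro i κ h0
    have h1 := ENNReal.ne_top_of_tsum_ne_top hf.ne κ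
    change wt W s κ * eLpNorm (block W (ofBdd f) κ) p volume ≠ ∞ at h1
    rcases ENNReal.mul_eq_top.1 h0 with h2 | h2
    · rw [h2.2, ENNReal.mul_top (zero_lt_one.trans_le (one_le_wt W hs κ)).ne'] at h1
      exact h1 rfl
    · exact (ENNReal.add_ne_top.2 ⟨hC, ENNReal.one_ne_top⟩) h2.1
  · intro i κ x
    rw [enorm_star_apply, hbx]
    exact (hb W _ κ x).trans (mul_le_mul_left le_self_add _)
  · intro i κ
    have h1 : eLpNorm (star (b κ) : Rd d →ᵇ ℂ) p volume = eLpNorm (block W (ofBdd f) κ) p volume :=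
      eLpNorm_congr_enorm_ae (Eventually.of_forall fun x => by rw [enorm_star_apply, hbx])
    rw [h1]
    exact (one_mul _).symm.le.trans (mul_le_mul_left le_add_self _)

end Algebra

/-! ### Time derivatives of evolved Schwartz functions -/

section TimeDerivative

variable {d : ℕ}

theorem fourier_laplacian (φ : 𝓢(Rd d, ℂ)) (ξ : Rd d) :
    (𝓕 (Δ φ) : 𝓢(Rd d, ℂ)) ξ = -(4 * Real.pi ^ 2 * ‖ξ‖ ^ 2 : ℝ) * (𝓕 φ : 𝓢(Rd d, ℂ)) ξ := by
  rw [SchwartzMap.laplacian_eq_sum (EuclideanSpace.basisFun (Fin d) ℝ), fourier_sum, _root_.sum_apply]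
  have h : ∀ i, (𝓕 (LineDeriv.lineDerivOp (EuclideanSpace.basisFun (Fin d) ℝ i)
      (LineDeriv.lineDerivOp (EuclideanSpace.basisFun (Fin d) ℝ i) φ)) : 𝓢(Rd d, ℂ)) ξ =
      -(4 * Real.pi ^ 2 * ξ i ^ 2 : ℝ) * (𝓕 φ : 𝓢(Rd d, ℂ)) ξ := by
    intro i
    rw [SchwartzMap.fourier_lineDerivOp_eq, SchwartzMap.fourier_lineDerivOp_eq, _root_.smul_apply,
      SchwartzMap.smulLeftCLM_apply_apply (by fun_prop), _root_.smul_apply,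
      SchwartzMap.smulLeftCLM_apply_apply (by fun_prop)]
    have hi : inner ℝ ξ (EuclideanSpace.basisFun (Fin d) ℝ i) = ξ i := by
      rw [EuclideanSpace.basisFun_apply, EuclideanSpace.inner_single_right]
      simp
    rw [hi]
    simp only [smul_eq_mul, Complex.real_smul]
    push_cast
    linear_combination (4 * (Real.pi : ℂ) ^ 2 * (ξ i : ℂ) ^ 2 * (𝓕 φ : 𝓢(Rd d, ℂ)) ξ) * Complex.I_sq
  simp_rw [h]
  rw [← Finset.sum_mul]
  congr 1
  rw [EuclideanSpace.real_norm_sq_eq, Finset.mul_sum, Finset.sum_neg_distrib]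
  push_cast
  rfl

/-- The generator of the Schrödinger group on Schwartz functions. -/
def gen (φ : 𝓢(Rd d, ℂ)) : 𝓢(Rd d, ℂ) := Complex.I • Δ φ

theorem fourier_gen (φ : 𝓢(Rd d, ℂ)) (ξ : Rd d) : (𝓕 (gen φ) : 𝓢(Rd d, ℂ)) ξ =
    -(4 * Real.pi ^ 2 * ‖ξ‖ ^ 2 : ℝ) * Complex.I * (𝓕 φ : 𝓢(Rd d, ℂ)) ξ := by
  rw [gen, FourierTransform.fourier_smul, _root_.smul_apply, fourier_laplacian, smul_eq_mul]
  ring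

theorem hasDerivAt_propS (φ : 𝓢(Rd d, ℂ)) (x : Rd d) (t : ℝ) :
    HasDerivAt (fun t => propS t φ x) (propS t (gen φ) x) t := by
  simp_rw [propS_apply]
  set e : Rd d → ℂ := fun ξ => Complex.exp (2 * Real.pi * Complex.I * (inner ℝ ξ x : ℝ)) with he
  have hec : Continuous e := by rw [he]; fun_prop
  have hsc : ∀ t, Continuous (schrSymbol t : Rd d → ℂ) := fun t =>
    (schrSymbol_hasTemperateGrowth t).1.continuous
  have hen : ∀ ξ, ‖e ξ‖ = 1 := fun ξ => by
    rw [he]; simp only [Complex.norm_exp]; simp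
  refine (hasDerivAt_integral_of_dominated_loc_of_deriv_le (s := Set.univ)
    (F := fun t ξ => e ξ * (schrSymbol t ξ * (𝓕 φ : 𝓢(Rd d, ℂ)) ξ))
    (F' := fun t ξ => e ξ * (schrSymbol t ξ * (𝓕 (gen φ) : 𝓢(Rd d, ℂ)) ξ))
    (bound := fun ξ => ‖(𝓕 (gen φ) : 𝓢(Rd d, ℂ)) ξ‖) univ_mem ?_ ?_ ?_ ?_ ?_ ?_).2
  · exact Eventually.of_forall fun t =>
      (hec.mul ((hsc t).mul (𝓕 φ : 𝓢(Rd d, ℂ)).continuous)).aestronglyMeasurable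
  · refine (𝓕 φ : 𝓢(Rd d, ℂ)).integrable.norm.mono'
      (hec.mul ((hsc t).mul (𝓕 φ : 𝓢(Rd d, ℂ)).continuous)).aestronglyMeasurable
      (Eventually.of_forall fun ξ => ?_)
    rw [norm_mul, norm_mul, hen, norm_schrSymbol, one_mul, one_mul]
  · exact (hec.mul ((hsc t).mul (𝓕 (gen φ) : 𝓢(Rd d, ℂ)).continuous)).aestronglyMeasurable
  · refine Eventually.of_forall fun ξ t _ => ?_
    rw [norm_mul, norm_mul, hen, norm_schrSymbol, one_mul, one_mul]
  · exact (𝓕 (gen φ) : 𝓢(Rd d, ℂ)).integrable.norm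
  · refine Eventually.of_forall fun ξ t _ => ?_
    have h1 : HasDerivAt (fun t : ℝ => (schrSymbol t ξ : ℂ))
        (-(4 * Real.pi ^ 2 * ‖ξ‖ ^ 2 : ℝ) * Complex.I * schrSymbol t ξ) t := by
      have h2 : HasDerivAt (fun t : ℝ => -(4 * (Real.pi : ℂ) ^ 2 * t) * Complex.I * ((‖ξ‖ ^ 2 : ℝ) : ℂ))
          (-(4 * (Real.pi : ℂ) ^ 2) * Complex.I * ((‖ξ‖ ^ 2 : ℝ) : ℂ)) t := by
        have h3 := ((Complex.ofRealCLM.hasDerivAt (x := t)).const_mul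
          (-(4 * (Real.pi : ℂ) ^ 2) * Complex.I * ((‖ξ‖ ^ 2 : ℝ) : ℂ)))
        simp only [Complex.ofRealCLM_apply, Complex.ofReal_one, mul_one] at h3
        refine h3.congr_of_eventuallyEq (Eventually.of_forall fun t => ?_)
        ring
      refine h2.cexp.congr_deriv ?_
      rw [schrSymbol]
      push_cast
      ring
    refine ((h1.mul_const ((𝓕 φ : 𝓢(Rd d, ℂ)) ξ)).const_mul (e ξ)).congr_deriv ?_
    rw [fourier_gen]
    ring

theorem norm_propS_sub_le (N : ℕ) (T : ℝ) (φ : 𝓢(Rd d, ℂ)) : ∃ C : ℝ, 0 ≤ C ∧ ∀ t t' : ℝ,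
    |t| ≤ T → |t'| ≤ T → ∀ x, ‖propS t φ x - propS t' φ x‖ ≤ C * ((1 + ‖x‖) ^ N)⁻¹ * |t - t'| := by
  obtain ⟨C, hC, h⟩ := norm_propS_decay N T (gen φ)
  refine ⟨C, hC, fun t t' ht ht' x => ?_⟩
  exact (convex_Icc (-T) T).norm_image_sub_le_of_norm_hasDerivWithin_le
    (fun τ _ => (hasDerivAt_propS φ x τ).hasDerivWithinAt)
    (fun τ hτ => h τ (abs_le.2 hτ) x) (abs_le.1 ht') (abs_le.1 ht)

/-- After subtraction of the tangent, the derivative is an increment of the evolution of `gen φ`,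
which is itself of first order. The decay in `x` makes the remainder integrable against bounded
functions. -/
theorem norm_propS_taylor_le (N : ℕ) (T : ℝ) (φ : 𝓢(Rd d, ℂ)) : ∃ C : ℝ, 0 ≤ C ∧ ∀ t t' : ℝ,
    |t| ≤ T → |t'| ≤ T → ∀ x, ‖propS t φ x - propS t' φ x - (t - t') • propS t' (gen φ) x‖ ≤
      C * ((1 + ‖x‖) ^ N)⁻¹ * |t - t'| ^ 2 := by
  obtain ⟨C, hC, h⟩ := norm_propS_sub_le N T (gen φ)
  refine ⟨C, hC, fun t t' ht ht' x => ?_⟩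
  have hseg : ∀ τ ∈ segment ℝ t' t, |τ| ≤ T ∧ |τ - t'| ≤ |t - t'| := by
    intro τ hτ
    have h1 := (convex_Icc (-T) T).segment_subset (abs_le.1 ht') (abs_le.1 ht) hτ
    have h2 := norm_sub_le_of_mem_segment hτ
    exact ⟨abs_le.2 h1, by simpa [Real.norm_eq_abs] using h2⟩
  have hd : ∀ τ : ℝ, HasDerivAt (fun τ : ℝ => propS τ φ x - τ • propS t' (gen φ) x)
      (propS τ (gen φ) x - propS t' (gen φ) x) τ := fun τ => by
    have h1 := (hasDerivAt_propS φ x τ).sub ((hasDerivAt_id τ).smul_const (propS t' (gen φ) x))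
    rw [one_smul] at h1
    exact h1
  have h3 := (convex_segment t' t).norm_image_sub_le_of_norm_hasDerivWithin_le
    (fun τ _ => (hd τ).hasDerivWithinAt)
    (fun τ hτ => (h τ t' (hseg τ hτ).1 ht' x).trans
      (mul_le_mul_of_nonneg_left (hseg τ hτ).2 (by positivity)))
    (left_mem_segment ℝ t' t) (right_mem_segment ℝ t' t)
  rw [Real.norm_eq_abs] at h3
  refine le_trans (le_of_eq ?_) (h3.trans_eq (by ring))
  congr 1
  rw [sub_smul]
  abel

end TimeDerivative

/-! ### Strong continuity of the group in the modulation spaces -/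

section StrongContinuity

variable {d : ℕ}

theorem tendsto_tsum_zero_of_dominated {ι K : Type*} [Countable K] {l : Filter ι}
    [l.IsCountablyGenerated] {f : ι → K → ℝ≥0∞} {b : K → ℝ≥0∞} (hb : ∑' k, b k ≠ ∞)
    (hle : ∀ᶠ i in l, ∀ k, f i k ≤ b k) (hf : ∀ k, Tendsto (fun i => f i k) l (𝓝 0)) :
    Tendsto (fun i => ∑' k, f i k) l (𝓝 0) := by
  let _ : MeasurableSpace K := ⊤
  simp_rw [← lintegral_count] at hb ⊢
  have h := tendsto_lintegral_filter_of_dominated_convergence (μ := Measure.count) (l := l)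
    (F := f) (f := fun _ => 0) b
    (Eventually.of_forall fun _ => measurable_of_countable _)
    (hle.mono fun i hi => Eventually.of_forall hi) hb (Eventually.of_forall hf)
  simpa using h

theorem prop_smul (t : ℝ) (c : ℂ) (v : 𝓢'(Rd d, ℂ)) : prop t (c • v) = c • prop t v := rfl

theorem prop_add' (t : ℝ) (u v : 𝓢'(Rd d, ℂ)) : prop t (u + v) = prop t u + prop t v := rfl

theorem prop_sub (t : ℝ) (u v : 𝓢'(Rd d, ℂ)) : prop t (u - v) = prop t u - prop t v := rfl

theorem integrable_block_mul (W : Window d) (v : 𝓢'(Rd d, ℂ)) (k : Fin d → ℤ) (φ : 𝓢(Rd d, ℂ))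
    (x : Rd d) : Integrable fun z => block W v k z * φ (x - z) := by
  obtain ⟨C, N, -, h⟩ := exists_conv_le v (modulate (W.pt k) W.χ)
  have h1 := integrable_pow_mul_schwartz (continuous_block W v k) h (reflectAt x φ)
  refine h1.mono' ?_ (Eventually.of_forall fun z => ?_)
  · exact ((continuous_block W v k).mul (reflectAt x φ).continuous).aestronglyMeasurable
  · rw [norm_mul, mul_comm]; rfl

/-- The constant may depend on the frequency, because this is only used term by term under dominated
convergence. -/
theorem absBlock_prop_sub_le (W : Window d) (v : 𝓢'(Rd d, ℂ)) (k : Fin d → ℤ) : ∃ C : ℝ≥0∞,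
    C ≠ ∞ ∧ ∀ t : ℝ, |t| ≤ 1 → ∀ x, absBlock W (prop t v - v) k x ≤
      (C * ENNReal.ofReal |t|) * peetre (dec d) (absBlock W v k) x := by
  obtain ⟨C, hC, h⟩ := norm_propS_sub_le (dec d + (d + 1)) 1 (modulate (W.pt k) (fat d))
  have hI := (lintegral_bump_lt_top (Nat.lt_succ_self d)).ne
  refine ⟨ENNReal.ofReal C * ∫⁻ z : Rd d, bump (d + 1) z, by finiteness, fun t ht x => ?_⟩
  have h1 : block W (prop t v - v) k x = ∫ z, block W v k z *
      (propS t (modulate (W.pt k) (fat d)) (x - z) - modulate (W.pt k) (fat d) (x - z)) := by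
    have h2 : block W (prop t v - v) k x = block W (prop t v) k x - block W v k x := rfl
    rw [h2, block_prop, block_eq_integral W v k x, ← integral_sub (integrable_block_mul W v k _ x)
      (integrable_block_mul W v k _ x)]
    simp only [mul_sub]
  rw [absBlock, h1]
  refine (enorm_integral_le_lintegral_enorm _).trans ?_
  calc _ ≤ ∫⁻ z, (ENNReal.ofReal C * ENNReal.ofReal |t|) *
          (absBlock W v k z * bump (dec d + (d + 1)) (x - z)) := by
        refine lintegral_mono fun z => ?_
        rw [enorm_mul, mul_left_comm]
        refine mul_le_mul_right ?_ _
        have h3 := h t 0 ht (by simp) (x - z)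
        rw [propS_zero, sub_zero] at h3
        rw [← ofReal_norm, bump, ← ENNReal.ofReal_mul hC, ← ENNReal.ofReal_mul (by positivity)]
        exact ENNReal.ofReal_le_ofReal (h3.trans_eq (by ring))
    _ = (ENNReal.ofReal C * ENNReal.ofReal |t|) *
          ∫⁻ z, (absBlock W v k z * bump (dec d + (d + 1)) (x - z)) := by
        rw [lintegral_const_mul]
        exact (measurable_absBlock W v k).mul
          ((measurable_bump _).comp (measurable_const.sub measurable_id))
    _ ≤ (ENNReal.ofReal C * ENNReal.ofReal |t|) *
          (peetre (dec d) (absBlock W v k) x * ∫⁻ z : Rd d, bump (d + 1) z) := by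
        gcongr
        exact lintegral_mul_bump_le_peetre _ _ _ _
    _ = _ := by ring

theorem wt_mul_eLpNorm_ne_top {W : Window d} {p : ℝ≥0∞} {s : ℝ} {v : 𝓢'(Rd d, ℂ)}
    (hv : MemMod W p s v) (k : Fin d → ℤ) : wt W s k * eLpNorm (block W v k) p volume ≠ ∞ :=
  ENNReal.ne_top_of_tsum_ne_top (ne_of_lt hv) k

theorem eLpNorm_block_ne_top {W : Window d} {p : ℝ≥0∞} {s : ℝ} (hs : 0 ≤ s) {v : 𝓢'(Rd d, ℂ)}
    (hv : MemMod W p s v) (k : Fin d → ℤ) : eLpNorm (block W v k) p volume ≠ ∞ := by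
  refine ne_top_of_le_ne_top (wt_mul_eLpNorm_ne_top hv k) ?_
  exact (one_mul _).symm.le.trans (mul_le_mul_left (one_le_wt W hs k) _)

theorem LpAddConst_ne_top (p : ℝ≥0∞) : ENNReal.LpAddConst p ≠ ∞ := (ENNReal.LpAddConst_lt_top p).ne

/-- Dominated convergence over the frequencies: uniform boundedness of the group gives the majorant,
and each block converges in `L^p`. -/
theorem tendsto_modNorm_prop_sub (W : Window d) {p : ℝ≥0∞} (hp : 1 / 2 ≤ p) {s : ℝ} (hs : 0 ≤ s)
    {v : 𝓢'(Rd d, ℂ)} (hv : MemMod W p s v) :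
    Tendsto (fun t => modNorm W p s (prop t v - v)) (𝓝 0) (𝓝 0) := by
  obtain ⟨C, hC, h⟩ := exists_eLpNorm_block_prop_le d 1 hp
  have hA := LpAddConst_ne_top p
  simp_rw [modNorm_eq]
  have hev : ∀ᶠ t : ℝ in 𝓝 0, |t| ≤ 1 := by
    filter_upwards [Metric.closedBall_mem_nhds (0 : ℝ) one_pos] with t ht
    simpa using ht
  refine tendsto_tsum_zero_of_dominated
    (b := fun k => ENNReal.LpAddConst p * (C + 1) * (wt W s k * eLpNorm (block W v k) p volume)) ?_ ?_ ?_
  · rw [ENNReal.tsum_mul_left]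
    exact ENNReal.mul_ne_top (by finiteness) hv.ne
  · refine hev.mono fun t ht k => ?_
    rw [mul_left_comm]
    refine mul_le_mul_right ?_ _
    rw [block_sub]
    refine (eLpNorm_sub_le' (continuous_block W _ k).aestronglyMeasurable
      (continuous_block W _ k).aestronglyMeasurable p).trans ?_
    rw [mul_assoc, add_mul, one_mul]
    exact mul_le_mul_right (add_le_add (h W v k t ht) le_rfl) _
  · intro k
    obtain ⟨C₁, hC₁, h₁⟩ := absBlock_prop_sub_le W v k
    obtain ⟨C₂, hC₂, h₂⟩ := exists_eLpNorm_peetre_le d hp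
    have hX := eLpNorm_block_ne_top hs hv k
    have hlim : Tendsto (fun t : ℝ => wt W s k *
        (C₁ * ENNReal.ofReal |t| * (C₂ * eLpNorm (block W v k) p volume))) (𝓝 0) (𝓝 0) := by
      have hc : Continuous fun t : ℝ => wt W s k *
          (C₁ * ENNReal.ofReal |t| * (C₂ * eLpNorm (block W v k) p volume)) := by
        refine (ENNReal.continuous_const_mul (wt_ne_top W s k)).comp
          ((ENNReal.continuous_mul_const (by finiteness)).comp
            ((ENNReal.continuous_const_mul hC₁).comp ?_))
        exact ENNReal.continuous_ofReal.comp continuous_abs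
      simpa using hc.tendsto 0
    refine tendsto_of_tendsto_of_tendsto_of_le_of_le' tendsto_const_nhds hlim
      (Eventually.of_forall fun _ => zero_le) (hev.mono fun t ht => mul_le_mul_right ?_ _)
    refine (eLpNorm_le_mul_of_le (by finiteness) (h₁ t ht) p).trans (mul_le_mul_right (h₂ W v k) _)

theorem memMod_prop {W : Window d} {p : ℝ≥0∞} (hp : 1 / 2 ≤ p) {s : ℝ} {v : 𝓢'(Rd d, ℂ)}
    (hv : MemMod W p s v) (t : ℝ) : MemMod W p s (prop t v) := by
  obtain ⟨C, hC, h⟩ := exists_modNorm_prop_le W |t| hp s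
  exact (h v t le_rfl).trans_lt (ENNReal.mul_lt_top hC.lt_top hv)

end StrongContinuity

/-! ### The Banach space, the nonlinearity and the group acting on it -/

section ModSpace

variable {d : ℕ}

/-- The bounded continuous functions of finite modulation norm, as a submodule. -/
def modSub (W : Window d) (p : ℝ≥0∞) (s : ℝ) : Submodule ℂ (Rd d →ᵇ ℂ) where
  carrier := {g | MemMod W p s (ofBdd g)}
  add_mem' {f g} hf hg := by
    change modNorm W p s (ofBdd (f + g)) < ∞
    rw [ofBdd_add]
    exact (modNorm_add_le' W p s _ _).trans_lt
      (ENNReal.mul_lt_top (ENNReal.LpAddConst_lt_top p) (ENNReal.add_lt_top.2 ⟨hf, hg⟩))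
  zero_mem' := by
    change modNorm W p s (ofBdd 0) < ∞
    rw [ofBdd_zero, modNorm_zero]
    exact ENNReal.zero_lt_top
  smul_mem' c g hg := by
    change modNorm W p s (ofBdd (c • g)) < ∞
    rw [ofBdd_smul, modNorm_smul]
    exact ENNReal.mul_lt_top enorm_lt_top hg

/-- The modulation space `M^{p,1}_{0,s}`, realised as a space of bounded continuous functions. -/
def ModSpace (W : Window d) (p : ℝ≥0∞) (s : ℝ) : Type := modSub W p s

variable {W : Window d} {p : ℝ≥0∞} {s : ℝ}

instance : AddCommGroup (ModSpace W p s) := inferInstanceAs (AddCommGroup (modSub W p s))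

instance : Module ℂ (ModSpace W p s) := inferInstanceAs (Module ℂ (modSub W p s))

/-- The function underlying an element of the modulation space. -/
def ModSpace.bcf : ModSpace W p s →ₗ[ℂ] (Rd d →ᵇ ℂ) := (modSub W p s).subtype

/-- The element of the modulation space given by a function. -/
def ModSpace.of (g : Rd d →ᵇ ℂ) (hg : MemMod W p s (ofBdd g)) : ModSpace W p s := ⟨g, hg⟩

theorem ModSpace.bcf_injective : Function.Injective (ModSpace.bcf : ModSpace W p s → _) :=
  Subtype.val_injective

theorem ModSpace.ext {u v : ModSpace W p s} (h : ∀ x, u.bcf x = v.bcf x) : u = v :=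
  ModSpace.bcf_injective (BoundedContinuousFunction.ext h)

theorem ModSpace.mem (u : ModSpace W p s) : MemMod W p s (ofBdd u.bcf) := u.2

theorem ModSpace.eq_of_ofBdd {u v : ModSpace W p s} (h : ofBdd u.bcf = ofBdd v.bcf) : u = v :=
  ModSpace.bcf_injective (ofBdd_injective h)

variable [hp : Fact (1 ≤ p)] [hs : Fact (0 ≤ s)]

instance : NormedAddCommGroup (ModSpace W p s) :=
  AddGroupNorm.toNormedAddCommGroup
    { toFun := fun u => (modNorm W p s (ofBdd u.bcf)).toReal
      map_zero' := by
        rw [map_zero, ofBdd_zero, modNorm_zero]; rfl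
      add_le' := fun u v => by
        rw [map_add, ofBdd_add, ← ENNReal.toReal_add u.mem.ne v.mem.ne]
        exact ENNReal.toReal_mono (ENNReal.add_ne_top.2 ⟨u.mem.ne, v.mem.ne⟩)
          (modNorm_add_le W hp.out s _ _)
      neg' := fun u => by
        rw [← neg_one_smul ℂ u, map_smul, ofBdd_smul, modNorm_smul]
        simp
      eq_zero_of_map_eq_zero' := fun u hu => by
        obtain ⟨C, hC, h⟩ := exists_enorm_bcf_le W (half_le_of_one_le hp.out) hs.out
        have h1 := h u.bcf u.mem
        rw [((ENNReal.toReal_eq_zero_iff _).1 hu).resolve_right u.mem.ne, mul_zero] at h1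
        exact ModSpace.bcf_injective ((enorm_eq_zero.1 (le_antisymm h1 zero_le)).trans
          (map_zero ModSpace.bcf).symm) }

theorem ModSpace.norm_eq (u : ModSpace W p s) : ‖u‖ = (modNorm W p s (ofBdd u.bcf)).toReal := rfl

theorem ModSpace.enorm_eq (u : ModSpace W p s) : ‖u‖ₑ = modNorm W p s (ofBdd u.bcf) := by
  rw [← ofReal_norm, ModSpace.norm_eq, ENNReal.ofReal_toReal u.mem.ne]

instance : NormedSpace ℂ (ModSpace W p s) where
  norm_smul_le c u := by
    rw [ModSpace.norm_eq, ModSpace.norm_eq, map_smul, ofBdd_smul, modNorm_smul, ENNReal.toReal_mul,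
      toReal_enorm]

theorem ModSpace.norm_le_of_enorm_le {u : ModSpace W p s} {C : ℝ≥0∞} (hC : C ≠ ∞) {r : ℝ}
    (hr : 0 ≤ r) (h : modNorm W p s (ofBdd u.bcf) ≤ C * ENNReal.ofReal r) : ‖u‖ ≤ C.toReal * r := by
  rw [ModSpace.norm_eq]
  refine (ENNReal.toReal_mono (by finiteness) h).trans_eq ?_
  rw [ENNReal.toReal_mul, ENNReal.toReal_ofReal hr]

theorem ModSpace.modNorm_eq_ofReal (u : ModSpace W p s) :
    modNorm W p s (ofBdd u.bcf) = ENNReal.ofReal ‖u‖ := by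
  rw [← ModSpace.enorm_eq, ofReal_norm]

theorem ModSpace.exists_norm_bcf_le (W : Window d) (p : ℝ≥0∞) (s : ℝ) [hp : Fact (1 ≤ p)]
    [hs : Fact (0 ≤ s)] : ∃ C : ℝ, 0 ≤ C ∧ ∀ u : ModSpace W p s, ‖u.bcf‖ ≤ C * ‖u‖ := by
  obtain ⟨C, hC, h⟩ := exists_enorm_bcf_le W (half_le_of_one_le hp.out) hs.out
  refine ⟨C.toReal, ENNReal.toReal_nonneg, fun u => ?_⟩
  have h1 := h u.bcf u.mem
  rw [← toReal_enorm, ModSpace.norm_eq, ← ENNReal.toReal_mul]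
  exact ENNReal.toReal_mono (ENNReal.mul_ne_top hC u.mem.ne) h1

/-- The embedding into bounded continuous functions. -/
def ModSpace.toBCF (W : Window d) (p : ℝ≥0∞) (s : ℝ) [Fact (1 ≤ p)] [Fact (0 ≤ s)] :
    ModSpace W p s →L[ℂ] (Rd d →ᵇ ℂ) :=
  ModSpace.bcf.mkContinuousOfExistsBound
    ((ModSpace.exists_norm_bcf_le W p s).imp fun _ h => h.2)

/-- A Cauchy sequence converges uniformly by the embedding, and Fatou's lemma carries the Cauchy
estimate over to the limit. -/
instance : CompleteSpace (ModSpace W p s) := by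
  refine Metric.complete_of_cauchySeq_tendsto fun u hu => ?_
  have h0 : CauchySeq fun n => ModSpace.toBCF W p s (u n) :=
    (ModSpace.toBCF W p s).uniformContinuous.comp_cauchySeq hu
  obtain ⟨g, hg⟩ := cauchySeq_tendsto_of_complete h0
  have key : ∀ ε : ℝ, 0 < ε → ∃ N, ∀ n ≥ N,
      modNorm W p s (ofBdd (g - (u n).bcf)) ≤ ENNReal.ofReal ε := by
    intro ε hε
    obtain ⟨N, hN⟩ := Metric.cauchySeq_iff.1 hu ε hε
    refine ⟨N, fun n hn => ?_⟩
    have h1 := modNorm_le_of_tendsto W p s (v := ofBdd (g - (u n).bcf))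
      (w := fun m => ofBdd ((u m).bcf - (u n).bcf)) fun φ => by
        have h2 : Tendsto (fun m => (u m).bcf - (u n).bcf) atTop (𝓝 (g - (u n).bcf)) :=
          Tendsto.sub_const hg _
        exact ((pairing φ).continuous.tendsto _).comp h2
    refine h1.trans (liminf_le_of_le (by isBoundedDefault) fun b hb => ?_)
    obtain ⟨m, hm1, hm2⟩ := (hb.and (eventually_ge_atTop N)).exists
    refine hm1.trans ?_
    rw [← map_sub, ModSpace.modNorm_eq_ofReal]
    refine ENNReal.ofReal_le_ofReal ?_
    rw [← dist_eq_norm]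
    exact (hN m hm2 n hn).le
  obtain ⟨N, hN⟩ := key 1 one_pos
  have hmem : g ∈ modSub W p s := by
    have h1 : g - (u N).bcf ∈ modSub W p s := (hN N le_rfl).trans_lt ENNReal.ofReal_lt_top
    have h2 := (modSub W p s).add_mem h1 (u N).mem
    rwa [sub_add_cancel] at h2
  refine ⟨ModSpace.of g hmem, Metric.tendsto_atTop.2 fun ε hε => ?_⟩
  obtain ⟨N, hN⟩ := key (ε / 2) (by linarith)
  refine ⟨N, fun n hn => ?_⟩
  rw [dist_comm, dist_eq_norm]
  have h1 := hN n hn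
  have h2 : (ModSpace.of g hmem - u n).bcf = g - (u n).bcf := by rw [map_sub]; rfl
  rw [← h2, ModSpace.modNorm_eq_ofReal, ENNReal.ofReal_le_ofReal_iff (by linarith)] at h1
  linarith

/-- Pointwise multiplication on the modulation space. -/
def ModSpace.mul (u v : ModSpace W p s) : ModSpace W p s :=
  ModSpace.of (u.bcf * v.bcf) <| by
    obtain ⟨D, hD, h⟩ := exists_modNorm_mul_le W hp.out hs.out
    exact (h _ _ u.mem v.mem).trans_lt
      (ENNReal.mul_lt_top hD.lt_top (ENNReal.mul_lt_top u.mem v.mem))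

/-- Complex conjugation on the modulation space. -/
def ModSpace.conj (u : ModSpace W p s) : ModSpace W p s :=
  ModSpace.of (star u.bcf) <| by
    obtain ⟨D, hD, h⟩ := exists_modNorm_star_le W hp.out hs.out
    exact (h _ u.mem).trans_lt (ENNReal.mul_lt_top hD.lt_top u.mem)

theorem ModSpace.bcf_mul (u v : ModSpace W p s) : (u.mul v).bcf = u.bcf * v.bcf := rfl

theorem ModSpace.bcf_conj (u : ModSpace W p s) : u.conj.bcf = star u.bcf := rfl

theorem ModSpace.exists_norm_mul_conj_le (W : Window d) (p : ℝ≥0∞) (s : ℝ) [hp : Fact (1 ≤ p)]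
    [hs : Fact (0 ≤ s)] : ∃ D : ℝ, 0 ≤ D ∧ (∀ u v : ModSpace W p s, ‖u.mul v‖ ≤ D * (‖u‖ * ‖v‖)) ∧
      ∀ u : ModSpace W p s, ‖u.conj‖ ≤ D * ‖u‖ := by
  obtain ⟨D₁, hD₁, h₁⟩ := exists_modNorm_mul_le W hp.out hs.out
  obtain ⟨D₂, hD₂, h₂⟩ := exists_modNorm_star_le W hp.out hs.out
  refine ⟨D₁.toReal + D₂.toReal, by positivity, fun u v => ?_, fun u => ?_⟩
  · have h := h₁ u.bcf v.bcf u.mem v.mem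
    rw [u.modNorm_eq_ofReal, v.modNorm_eq_ofReal, ← ENNReal.ofReal_mul (norm_nonneg _)] at h
    refine (ModSpace.norm_le_of_enorm_le (u := u.mul v) hD₁ (by positivity) h).trans ?_
    gcongr
    exact le_add_of_nonneg_right ENNReal.toReal_nonneg
  · have h := h₂ u.bcf u.mem
    rw [u.modNorm_eq_ofReal] at h
    refine (ModSpace.norm_le_of_enorm_le (u := u.conj) hD₂ (by positivity) h).trans ?_
    gcongr
    exact le_add_of_nonneg_left ENNReal.toReal_nonneg

/-- The map `u ↦ |u|^{2m} u`. -/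
def ModSpace.gauge : ℕ → ModSpace W p s → ModSpace W p s
  | 0, u => u
  | m + 1, u => (u.mul u.conj).mul (ModSpace.gauge m u)

theorem ModSpace.gauge_apply (m : ℕ) (u : ModSpace W p s) (x : Rd d) :
    (ModSpace.gauge m u).bcf x = ((‖u.bcf x‖ ^ (2 * m) : ℝ) : ℂ) * u.bcf x := by
  induction m with
  | zero => simp [ModSpace.gauge]
  | succ m ih =>
    rw [ModSpace.gauge, ModSpace.bcf_mul, ModSpace.bcf_mul, ModSpace.bcf_conj,
      BoundedContinuousFunction.mul_apply, BoundedContinuousFunction.mul_apply, ih]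
    have h : (star u.bcf) x = (starRingEnd ℂ) (u.bcf x) := rfl
    rw [h, Complex.mul_conj, Complex.normSq_eq_norm_sq, mul_add, pow_add]
    push_cast
    ring

theorem ModSpace.sub_mul' (u v w : ModSpace W p s) : (u - v).mul w = u.mul w - v.mul w := by
  refine ModSpace.ext fun x => ?_
  simp only [ModSpace.bcf_mul, map_sub, BoundedContinuousFunction.mul_apply,
    BoundedContinuousFunction.sub_apply]
  ring

theorem ModSpace.mul_sub' (u v w : ModSpace W p s) : u.mul (v - w) = u.mul v - u.mul w := by
  refine ModSpace.ext fun x => ?_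
  simp only [ModSpace.bcf_mul, map_sub, BoundedContinuousFunction.mul_apply,
    BoundedContinuousFunction.sub_apply]
  ring

theorem ModSpace.conj_sub (u v : ModSpace W p s) : (u - v).conj = u.conj - v.conj := by
  refine ModSpace.bcf_injective ?_
  rw [ModSpace.bcf_conj, map_sub, map_sub, ModSpace.bcf_conj, ModSpace.bcf_conj, star_sub]

/-- Induction through `|u|^{2m+2} u = (u ū) · |u|^{2m} u`. Each step costs `D` for the outer product
and `D²` for `u ū`, whence `D³`. The growth in `m` is geometric up to the factor `2m + 1` counting
the factors, so series with infinite radius of convergence still converge. -/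
theorem ModSpace.exists_norm_gauge_le (W : Window d) (p : ℝ≥0∞) (s : ℝ) [hp : Fact (1 ≤ p)]
    [hs : Fact (0 ≤ s)] : ∃ A : ℝ, 0 ≤ A ∧ ∀ (R : ℝ) (m : ℕ) (u v : ModSpace W p s), ‖u‖ ≤ R →
      ‖v‖ ≤ R → ‖u.gauge m‖ ≤ (A * R ^ 2) ^ m * R ∧
        ‖u.gauge m - v.gauge m‖ ≤ (2 * m + 1) * (A * R ^ 2) ^ m * ‖u - v‖ := by
  obtain ⟨D, hD, hm, hc⟩ := ModSpace.exists_norm_mul_conj_le W p s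
  refine ⟨D ^ 3, by positivity, fun R m u v hu hv => ?_⟩
  have hR : 0 ≤ R := (norm_nonneg _).trans hu
  have hQ : ∀ w : ModSpace W p s, ‖w‖ ≤ R → ‖w.mul w.conj‖ ≤ D ^ 2 * R ^ 2 := fun w hw => by
    calc ‖w.mul w.conj‖ ≤ D * (‖w‖ * (D * ‖w‖)) := (hm _ _).trans (by gcongr; exact hc w)
      _ ≤ D * (R * (D * R)) := by gcongr
      _ = _ := by ring
  have hQd : ‖u.mul u.conj - v.mul v.conj‖ ≤ 2 * D ^ 2 * R * ‖u - v‖ := by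
    have h1 : u.mul u.conj - v.mul v.conj = (u - v).mul u.conj + v.mul (u - v).conj := by
      rw [ModSpace.conj_sub, ModSpace.sub_mul', ModSpace.mul_sub']; abel
    rw [h1]
    calc _ ≤ D * (‖u - v‖ * (D * ‖u‖)) + D * (‖v‖ * (D * ‖u - v‖)) := by
          refine (norm_add_le _ _).trans (add_le_add ((hm _ _).trans ?_) ((hm _ _).trans ?_))
          · gcongr; exact hc u
          · gcongr; exact hc _
      _ ≤ D * (‖u - v‖ * (D * R)) + D * (R * (D * ‖u - v‖)) := by gcongr
      _ = _ := by ring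
  induction m with
  | zero => simpa [ModSpace.gauge] using hu
  | succ m ih =>
    obtain ⟨ih1, ih2⟩ := ih
    refine ⟨?_, ?_⟩
    · rw [ModSpace.gauge]
      calc _ ≤ D * ((D ^ 2 * R ^ 2) * ((D ^ 3 * R ^ 2) ^ m * R)) :=
            (hm _ _).trans (by gcongr; exact hQ u hu)
        _ = _ := by ring
    · have h1 : u.gauge (m + 1) - v.gauge (m + 1) =
          (u.mul u.conj - v.mul v.conj).mul (u.gauge m) + (v.mul v.conj).mul (u.gauge m - v.gauge m) := by
        rw [ModSpace.gauge, ModSpace.gauge, ModSpace.sub_mul', ModSpace.mul_sub']; abel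
      rw [h1]
      calc _ ≤ D * ((2 * D ^ 2 * R * ‖u - v‖) * ((D ^ 3 * R ^ 2) ^ m * R)) +
            D * ((D ^ 2 * R ^ 2) * ((2 * m + 1) * (D ^ 3 * R ^ 2) ^ m * ‖u - v‖)) := by
            refine (norm_add_le _ _).trans (add_le_add ((hm _ _).trans ?_) ((hm _ _).trans ?_))
            · gcongr
            · gcongr; exact hQ v hv
        _ = _ := by push_cast; ring

/-- The expansion `F(z) = ∑ c_m |z|^{2m} z` of a gauge invariant entire nonlinearity. -/
structure IsGaugeSeries (c : ℕ → ℝ) (F : ℂ → ℂ) : Prop where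
  summable : ∀ r : ℝ, 0 ≤ r → Summable fun m => |c m| * r ^ m
  hasSum : ∀ z, HasSum (fun m => ((c m : ℝ) : ℂ) * (((‖z‖ ^ (2 * m) : ℝ) : ℂ) * z)) (F z)

theorem isGaugeSeries_powNl (a : ℝ) (k : ℕ) : IsGaugeSeries (Pi.single k a) (powNl a k) where
  summable r _ := summable_of_hasFiniteSupport <| (Set.finite_singleton k).subset fun m hm => by
    by_contra h
    exact hm (by simp [Pi.single_eq_of_ne (show m ≠ k from h)])
  hasSum z := by
    have h := hasSum_single (f := fun m => (((Pi.single k a : ℕ → ℝ) m : ℝ) : ℂ) *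
      (((‖z‖ ^ (2 * m) : ℝ) : ℂ) * z)) k fun m hm => by simp [Pi.single_eq_of_ne hm]
    convert h using 1
    rw [powNl, Pi.single_eq_same]
    push_cast
    ring

/-- The Taylor coefficients of the exponential nonlinearity. -/
def expCoeff (a ρ : ℝ) (m : ℕ) : ℝ := if m = 0 then 0 else a * (ρ ^ m / m.factorial)

theorem isGaugeSeries_expNl (a ρ : ℝ) : IsGaugeSeries (expCoeff a ρ) (expNl a ρ) where
  summable r hr := by
    refine Summable.of_nonneg_of_le (fun m => by positivity) (fun m => ?_)
      ((Real.summable_pow_div_factorial (|ρ| * r)).mul_left |a|)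
    by_cases hm : m = 0
    · simp [expCoeff, hm]
    · rw [expCoeff, if_neg hm, abs_mul, abs_div, abs_pow, Nat.abs_cast, mul_pow]
      exact le_of_eq (by ring)
  hasSum z := by
    have h1 : HasSum (fun m : ℕ => (ρ * ‖z‖ ^ 2) ^ m / m.factorial) (Real.exp (ρ * ‖z‖ ^ 2)) := by
      rw [Real.exp_eq_exp_ℝ]
      exact NormedSpace.expSeries_div_hasSum_exp (ρ * ‖z‖ ^ 2)
    have h2 : HasSum (fun m : ℕ => if m = 0 then (1 : ℝ) else 0) 1 := hasSum_ite_eq 0 1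
    have h3 := ((Complex.hasSum_ofReal.2 ((h1.sub h2).mul_left a)).mul_right z)
    refine (congrArg (fun f => HasSum f (expNl a ρ z)) (funext fun m => ?_)).mpr h3
    by_cases hm : m = 0
    · simp [expCoeff, hm]
    · rw [expCoeff, if_neg hm, if_neg hm, sub_zero, mul_pow, ← pow_mul]
      push_cast
      ring

theorem IsGaugeSeries.summable_mul {c : ℕ → ℝ} {F : ℂ → ℂ} (h : IsGaugeSeries c F) {r : ℝ}
    (hr : 0 ≤ r) : Summable fun m : ℕ => |c m| * ((2 * m + 1) * r ^ m) := by
  refine Summable.of_nonneg_of_le (fun m => by positivity) (fun m => ?_) (h.summable (3 * r) (by positivity))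
  rw [mul_pow]
  have : ∀ m : ℕ, (2 * m + 1 : ℝ) ≤ 3 ^ m := fun m => by
    have := one_add_mul_le_pow (a := (2 : ℝ)) (by norm_num) m
    norm_num at this
    linarith
  gcongr
  exact this m

/-- The nonlinearity as a map of the modulation space. -/
def ModSpace.nonlin (c : ℕ → ℝ) (u : ModSpace W p s) : ModSpace W p s :=
  ∑' m, ((c m : ℝ) : ℂ) • u.gauge m

theorem ModSpace.summable_gauge {c : ℕ → ℝ} {F : ℂ → ℂ} (h : IsGaugeSeries c F)
    (u : ModSpace W p s) : Summable fun m => ((c m : ℝ) : ℂ) • u.gauge m := by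
  obtain ⟨A, hA, hg⟩ := ModSpace.exists_norm_gauge_le W p s
  refine Summable.of_norm_bounded ((h.summable (A * ‖u‖ ^ 2) (by positivity)).mul_right ‖u‖) fun m => ?_
  rw [norm_smul, Complex.norm_real, Real.norm_eq_abs, mul_assoc]
  exact mul_le_mul_of_nonneg_left (hg _ m u u le_rfl le_rfl).1 (abs_nonneg _)

/-- Point evaluation is continuous on the modulation space, so the abstract series is the pointwise
one. -/
theorem ModSpace.nonlin_apply {c : ℕ → ℝ} {F : ℂ → ℂ} (h : IsGaugeSeries c F)
    (u : ModSpace W p s) (x : Rd d) : (u.nonlin c).bcf x = F (u.bcf x) := by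
  have h1 := ((BoundedContinuousFunction.evalCLM ℂ x).comp (ModSpace.toBCF W p s)).hasSum
    (ModSpace.summable_gauge h u).hasSum
  refine h1.unique ?_
  convert h.hasSum (u.bcf x) using 1
  funext m
  rw [← ModSpace.gauge_apply]
  change (((c m : ℝ) : ℂ) • u.gauge m).bcf x = _
  rw [map_smul]
  rfl

theorem ModSpace.exists_lipschitz_nonlin {c : ℕ → ℝ} {F : ℂ → ℂ} (h : IsGaugeSeries c F)
    (W : Window d) (p : ℝ≥0∞) (s : ℝ) [hp : Fact (1 ≤ p)] [hs : Fact (0 ≤ s)] (R : ℝ) :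
    ∃ L : ℝ, 0 ≤ L ∧ ∀ u v : ModSpace W p s, ‖u‖ ≤ R → ‖v‖ ≤ R →
      ‖u.nonlin c - v.nonlin c‖ ≤ L * ‖u - v‖ := by
  obtain ⟨A, hA, hg⟩ := ModSpace.exists_norm_gauge_le W p s
  have hsum := h.summable_mul (r := A * R ^ 2) (by positivity)
  refine ⟨∑' m : ℕ, |c m| * ((2 * m + 1) * (A * R ^ 2) ^ m), tsum_nonneg fun m => by positivity,
    fun u v hu hv => ?_⟩
  rw [ModSpace.nonlin, ModSpace.nonlin,
    ← (ModSpace.summable_gauge h u).tsum_sub (ModSpace.summable_gauge h v), ← tsum_mul_right]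
  refine tsum_of_norm_bounded (hsum.mul_right ‖u - v‖).hasSum fun m => ?_
  rw [← smul_sub, norm_smul, Complex.norm_real, Real.norm_eq_abs, mul_assoc]
  exact mul_le_mul_of_nonneg_left (hg R m u v hu hv).2 (abs_nonneg _)

theorem exists_prop_ofBdd (u : ModSpace W p s) (t : ℝ) :
    ∃ g : Rd d →ᵇ ℂ, prop t (ofBdd u.bcf) = ofBdd g := by
  obtain ⟨b, -, -, h⟩ := exists_bcf_blocks W (half_le_of_one_le hp.out) hs.out
    (memMod_prop (half_le_of_one_le hp.out) u.mem t)
  exact ⟨_, h⟩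

/-- The function representing the evolution of an element of the modulation space. -/
def ModSpace.propBCF (t : ℝ) (u : ModSpace W p s) : Rd d →ᵇ ℂ := (exists_prop_ofBdd u t).choose

theorem ModSpace.ofBdd_propBCF (t : ℝ) (u : ModSpace W p s) :
    ofBdd (u.propBCF t) = prop t (ofBdd u.bcf) := (exists_prop_ofBdd u t).choose_spec.symm

/-- The Schrödinger group on the modulation space, as a linear map. -/
def ModSpace.schrₗ (t : ℝ) : ModSpace W p s →ₗ[ℂ] ModSpace W p s where
  toFun u := ModSpace.of (u.propBCF t) <| by
    rw [ModSpace.ofBdd_propBCF]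
    exact memMod_prop (half_le_of_one_le hp.out) u.mem t
  map_add' u v := ModSpace.bcf_injective <| ofBdd_injective <| by
    change ofBdd ((u + v).propBCF t) = ofBdd (u.propBCF t + v.propBCF t)
    rw [ofBdd_add, ModSpace.ofBdd_propBCF, ModSpace.ofBdd_propBCF, ModSpace.ofBdd_propBCF, map_add,
      ofBdd_add, prop_add']
  map_smul' c u := ModSpace.bcf_injective <| ofBdd_injective <| by
    change ofBdd ((c • u).propBCF t) = ofBdd (c • u.propBCF t)
    rw [ofBdd_smul, ModSpace.ofBdd_propBCF, ModSpace.ofBdd_propBCF, map_smul, ofBdd_smul,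
      prop_smul]

theorem ModSpace.ofBdd_schrₗ (t : ℝ) (u : ModSpace W p s) :
    ofBdd (ModSpace.schrₗ t u).bcf = prop t (ofBdd u.bcf) := u.ofBdd_propBCF t

theorem ModSpace.exists_norm_schrₗ_le (W : Window d) (p : ℝ≥0∞) (s : ℝ) [hp : Fact (1 ≤ p)]
    [hs : Fact (0 ≤ s)] (T : ℝ) : ∃ C : ℝ, 0 ≤ C ∧ ∀ t : ℝ, |t| ≤ T → ∀ u : ModSpace W p s,
      ‖ModSpace.schrₗ t u‖ ≤ C * ‖u‖ := by
  obtain ⟨C, hC, h⟩ := exists_modNorm_prop_le W T (half_le_of_one_le hp.out) s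
  refine ⟨C.toReal, ENNReal.toReal_nonneg, fun t ht u => ?_⟩
  refine ModSpace.norm_le_of_enorm_le hC (norm_nonneg _) ?_
  rw [ModSpace.ofBdd_schrₗ, ← ModSpace.modNorm_eq_ofReal]
  exact h _ t ht

/-- The Schrödinger group on the modulation space. -/
def ModSpace.schr (t : ℝ) : ModSpace W p s →L[ℂ] ModSpace W p s :=
  (ModSpace.schrₗ t).mkContinuousOfExistsBound <| by
    obtain ⟨C, -, h⟩ := ModSpace.exists_norm_schrₗ_le W p s |t|
    exact ⟨C, fun u => h t le_rfl u⟩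

theorem ModSpace.ofBdd_schr (t : ℝ) (u : ModSpace W p s) :
    ofBdd (ModSpace.schr t u).bcf = prop t (ofBdd u.bcf) := u.ofBdd_propBCF t

theorem ModSpace.exists_norm_schr_le (W : Window d) (p : ℝ≥0∞) (s : ℝ) [Fact (1 ≤ p)]
    [Fact (0 ≤ s)] (T : ℝ) : ∃ C : ℝ, 0 ≤ C ∧ ∀ t : ℝ, |t| ≤ T → ∀ u : ModSpace W p s,
      ‖ModSpace.schr t u‖ ≤ C * ‖u‖ := ModSpace.exists_norm_schrₗ_le W p s T

theorem ModSpace.schr_zero (u : ModSpace W p s) : ModSpace.schr 0 u = u :=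
  ModSpace.eq_of_ofBdd (by rw [ModSpace.ofBdd_schr, prop_zero])

theorem ModSpace.schr_add (t t' : ℝ) (u : ModSpace W p s) :
    ModSpace.schr (t + t') u = ModSpace.schr t (ModSpace.schr t' u) :=
  ModSpace.eq_of_ofBdd (by
    rw [ModSpace.ofBdd_schr, ModSpace.ofBdd_schr, ModSpace.ofBdd_schr, prop_add])

theorem ModSpace.schr_neg_schr (t : ℝ) (u : ModSpace W p s) :
    ModSpace.schr (-t) (ModSpace.schr t u) = u := by
  rw [← ModSpace.schr_add, neg_add_cancel, ModSpace.schr_zero]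

theorem ModSpace.schr_schr_neg (t : ℝ) (u : ModSpace W p s) :
    ModSpace.schr t (ModSpace.schr (-t) u) = u := by
  rw [← ModSpace.schr_add, add_neg_cancel, ModSpace.schr_zero]

theorem ModSpace.continuous_schr (u : ModSpace W p s) : Continuous fun t => ModSpace.schr t u := by
  refine continuous_iff_continuousAt.2 fun t₀ => tendsto_iff_norm_sub_tendsto_zero.2 ?_
  have h1 := tendsto_modNorm_prop_sub W (half_le_of_one_le hp.out) hs.out (ModSpace.schr t₀ u).mem
  have h2 : Tendsto (fun t : ℝ => t - t₀) (𝓝 t₀) (𝓝 0) := by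
    have : Continuous fun t : ℝ => t - t₀ := by fun_prop
    simpa using this.tendsto t₀
  have h3 := (ENNReal.tendsto_toReal ENNReal.zero_ne_top).comp (h1.comp h2)
  refine h3.congr fun t => ?_
  rw [Function.comp_apply, Function.comp_apply, ModSpace.norm_eq, map_sub, ofBdd_sub,
    ModSpace.ofBdd_schr, ModSpace.ofBdd_schr, ← prop_add, sub_add_cancel]

/-- Local uniform boundedness together with strong continuity; continuity of the group in operator
norm is not used. -/
theorem ModSpace.continuous_schr_of_continuousOn {J : Set ℝ} {w : ℝ → ModSpace W p s}
    (hw : ContinuousOn w J) {τ : ℝ → ℝ} (hτ : Continuous τ) :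
    ContinuousOn (fun t => ModSpace.schr (τ t) (w t)) J := by
  intro t₀ ht₀
  obtain ⟨C, hC, h⟩ := ModSpace.exists_norm_schr_le W p s (|τ t₀| + 1)
  refine tendsto_iff_norm_sub_tendsto_zero.2 ?_
  have h1 : Tendsto (fun t => C * ‖w t - w t₀‖ +
      ‖ModSpace.schr (τ t) (w t₀) - ModSpace.schr (τ t₀) (w t₀)‖) (𝓝[J] t₀) (𝓝 0) := by
    have h2 := (tendsto_iff_norm_sub_tendsto_zero.1 (hw t₀ ht₀)).const_mul C
    have h3 := tendsto_iff_norm_sub_tendsto_zero.1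
      ((((ModSpace.continuous_schr (w t₀)).comp hτ).tendsto t₀).mono_left (nhdsWithin_le_nhds (s := J)))
    simpa using h2.add h3
  have hev : ∀ᶠ t in 𝓝[J] t₀, |τ t| ≤ |τ t₀| + 1 := by
    have h4 : Tendsto (fun t => |τ t|) (𝓝[J] t₀) (𝓝 |τ t₀|) :=
      (hτ.abs.tendsto t₀).mono_left nhdsWithin_le_nhds
    exact (h4.eventually (gt_mem_nhds (lt_add_one _))).mono fun t ht => ht.le
  refine squeeze_zero' (Eventually.of_forall fun _ => norm_nonneg _) (hev.mono fun t ht => ?_) h1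
  have h5 : ModSpace.schr (τ t) (w t) - ModSpace.schr (τ t₀) (w t₀) =
      ModSpace.schr (τ t) (w t - w t₀) +
        (ModSpace.schr (τ t) (w t₀) - ModSpace.schr (τ t₀) (w t₀)) := by
    rw [map_sub]; abel
  rw [h5]
  exact (norm_add_le _ _).trans (add_le_add (h _ ht _) le_rfl)

end ModSpace

/-! ### Differentiating pairings with evolving test functions -/

section WeakDerivative

variable {d : ℕ}

/-- A product rule in which `y` is merely continuous, with `c t ∘ y` differentiable for the frozen
`t`. The other contribution comes from `c`, whose second-order error is uniform on bounded sets. -/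
theorem hasDerivWithinAt_apply_of_taylor {E : Type*} [NormedAddCommGroup E]
    {F : Type*} [NormedAddCommGroup F] [NormedSpace ℝ F] {c : ℝ → E → F}
    {c' : E → F} {y : ℝ → E} {D : F} {J : Set ℝ} {t C : ℝ}
    (hc : ∀ᶠ τ in 𝓝 t, ∀ e, ‖c τ e - c t e - (τ - t) • c' e‖ ≤ C * |τ - t| ^ 2 * ‖e‖)
    (hc' : Continuous c') (hy : ContinuousWithinAt y J t)
    (hD : HasDerivWithinAt (fun τ => c t (y τ)) D J t) :
    HasDerivWithinAt (fun τ => c τ (y τ)) (c' (y t) + D) J t := by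
  have h1 : HasDerivWithinAt (fun τ => c τ (y τ) - c t (y τ)) (c' (y t)) J t := by
    rw [hasDerivWithinAt_iff_isLittleO]
    have hb : y =O[𝓝[J] t] fun _ => (1 : ℝ) := hy.isBigO_one ℝ
    have h2 : (fun τ => c τ (y τ) - c t (y τ) - (τ - t) • c' (y τ)) =o[𝓝[J] t]
        fun τ => (τ - t) := by
      have h3 : (fun τ : ℝ => ‖τ - t‖ ^ 2) =o[𝓝[J] t] fun τ => (τ - t) :=
        (Asymptotics.isLittleO_pow_sub_sub t (m := 2) (by norm_num)).mono nhdsWithin_le_nhds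
      have h4 := h3.mul_isBigO hb.norm_left
      simp only [mul_one] at h4
      refine Asymptotics.IsBigO.trans_isLittleO ?_ h4
      refine Asymptotics.IsBigO.of_bound C ((hc.filter_mono nhdsWithin_le_nhds).mono fun τ hτ => ?_)
      refine (hτ (y τ)).trans_eq ?_
      rw [norm_mul, norm_pow, norm_norm, norm_norm, Real.norm_eq_abs, mul_assoc]
    have h4 : (fun τ => (τ - t) • (c' (y τ) - c' (y t))) =o[𝓝[J] t] fun τ => (τ - t) := by
      have h5 : (fun τ => c' (y τ) - c' (y t)) =o[𝓝[J] t] fun _ => (1 : ℝ) := by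
        rw [Asymptotics.isLittleO_one_iff, tendsto_sub_nhds_zero_iff]
        exact hc'.continuousAt.comp_continuousWithinAt hy
      simpa using (Asymptotics.isBigO_refl (fun τ : ℝ => τ - t) (𝓝[J] t)).smul_isLittleO h5
    refine (h2.add h4).congr (fun τ => ?_) fun _ => rfl
    rw [smul_sub, sub_self, sub_zero]
    abel
  refine (h1.add hD).congr (fun τ _ => ?_) ?_ <;> simp

theorem exists_ofBdd_propS_taylor_le (T : ℝ) (φ : 𝓢(Rd d, ℂ)) : ∃ C : ℝ, ∀ t t' : ℝ,
    |t| ≤ T → |t'| ≤ T → ∀ g : Rd d →ᵇ ℂ, ‖ofBdd g (propS t φ) - ofBdd g (propS t' φ) -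
      (t - t') • ofBdd g (propS t' (gen φ))‖ ≤ C * |t - t'| ^ 2 * ‖g‖ := by
  obtain ⟨C, hC, h⟩ := norm_propS_taylor_le (d + 1) T φ
  have hI : Integrable fun x : Rd d => ((1 + ‖x‖) ^ (d + 1))⁻¹ := by
    have := integrable_one_add_norm (E := Rd d) (μ := volume) (r := (d + 1 : ℕ)) (by simp)
    refine this.congr (Eventually.of_forall fun x => ?_)
    change (1 + ‖x‖) ^ (-((d + 1 : ℕ) : ℝ)) = _
    rw [Real.rpow_neg (by positivity), Real.rpow_natCast]
  refine ⟨C * ∫ x : Rd d, ((1 + ‖x‖) ^ (d + 1))⁻¹, fun t t' ht ht' g => ?_⟩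
  have h1 : ofBdd g (propS t φ) - ofBdd g (propS t' φ) - (t - t') • ofBdd g (propS t' (gen φ)) =
      ofBdd g (propS t φ - propS t' φ - ((t - t' : ℝ) : ℂ) • propS t' (gen φ)) := by
    rw [map_sub, map_sub, map_smul]; rfl
  rw [h1]
  refine (norm_ofBdd_apply_le _ _).trans ?_
  rw [mul_comm]
  refine mul_le_mul_of_nonneg_right ?_ (norm_nonneg _)
  have h2 : ∀ x, ‖(propS t φ - propS t' φ - ((t - t' : ℝ) : ℂ) • propS t' (gen φ)) x‖ ≤
      C * |t - t'| ^ 2 * ((1 + ‖x‖) ^ (d + 1))⁻¹ := fun x => by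
    refine le_trans (le_of_eq ?_) ((h t t' ht ht' x).trans_eq (by ring))
    rfl
  refine (integral_mono (SchwartzMap.integrable _).norm (hI.const_mul _) h2).trans_eq ?_
  rw [integral_const_mul]
  ring

/-- The product rule for the pairing of a curve of functions with an evolving Schwartz function. -/
theorem hasDerivWithinAt_ofBdd_propS (φ : 𝓢(Rd d, ℂ)) {y : ℝ → Rd d →ᵇ ℂ} {D : ℂ} {J : Set ℝ}
    {t σ : ℝ} (hσ : |σ| = 1) (hy : ContinuousWithinAt y J t)
    (hD : HasDerivWithinAt (fun τ => ofBdd (y τ) (propS (σ * t) φ)) D J t) :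
    HasDerivWithinAt (fun τ => ofBdd (y τ) (propS (σ * τ) φ))
      (σ * ofBdd (y t) (propS (σ * t) (gen φ)) + D) J t := by
  obtain ⟨C, h⟩ := exists_ofBdd_propS_taylor_le (|t| + 1) φ
  have hev : ∀ᶠ τ in 𝓝 t, |τ| ≤ |t| + 1 := by
    have h4 : Tendsto (fun τ : ℝ => |τ|) (𝓝 t) (𝓝 |t|) := continuous_abs.tendsto t
    exact (h4.eventually (gt_mem_nhds (lt_add_one _))).mono fun t ht => ht.le
  have hs : ∀ τ, |σ * τ| = |τ| := fun τ => by rw [abs_mul, hσ, one_mul]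
  refine hasDerivWithinAt_apply_of_taylor (c := fun τ g => ofBdd g (propS (σ * τ) φ))
    (c' := fun g => (σ : ℂ) * ofBdd g (propS (σ * t) (gen φ))) (C := C) ?_
    (((pairing (propS (σ * t) (gen φ))).continuous).const_mul (σ : ℂ)) hy hD
  refine hev.mono fun τ hτ g => ?_
  have h1 := h (σ * τ) (σ * t) (by rwa [hs]) (by rw [hs]; linarith) g
  rw [← mul_sub, hs] at h1
  refine le_trans (le_of_eq ?_) h1
  congr 2
  simp only [Complex.real_smul, Complex.ofReal_mul]
  ring

theorem propS_gen (t : ℝ) (φ : 𝓢(Rd d, ℂ)) : propS t (gen φ) = gen (propS t φ) :=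
  fourier_ext fun ξ => by
    rw [fourier_propS, fourier_gen, fourier_gen, fourier_propS]; ring

end WeakDerivative

/-! ### Equivalence of the equation with the interaction representation -/

section Duhamel

variable {d : ℕ} {W : Window d} {p : ℝ≥0∞} {s : ℝ} [hp : Fact (1 ≤ p)] [hs : Fact (0 ≤ s)]
  {c : ℕ → ℝ} {F : ℂ → ℂ}

theorem ModSpace.continuous_nonlin (h : IsGaugeSeries c F) :
    Continuous (ModSpace.nonlin c : ModSpace W p s → ModSpace W p s) := by
  refine continuous_iff_continuousAt.2 fun u => tendsto_iff_norm_sub_tendsto_zero.2 ?_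
  obtain ⟨L, hL, hl⟩ := ModSpace.exists_lipschitz_nonlin h W p s (‖u‖ + 1)
  have hev : ∀ᶠ v in 𝓝 u, ‖v‖ ≤ ‖u‖ + 1 :=
    ((continuous_norm.tendsto u).eventually (gt_mem_nhds (lt_add_one _))).mono fun t ht => ht.le
  refine squeeze_zero' (Eventually.of_forall fun _ => norm_nonneg _)
    (hev.mono fun v hv => hl v u hv (by linarith)) ?_
  simpa using (tendsto_iff_norm_sub_tendsto_zero.1 (tendsto_id (x := 𝓝 u))).const_mul L

/-- The vector field of the equation in the interaction representation. -/
def ModSpace.field (c : ℕ → ℝ) (t : ℝ) (w : ModSpace W p s) : ModSpace W p s :=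
  Complex.I • ModSpace.schr (-t) ((ModSpace.schr t w).nonlin c)

theorem ModSpace.exists_lipschitz_field (h : IsGaugeSeries c F) (R T : ℝ) :
    ∃ K : ℝ≥0, ∀ t ∈ Set.Icc 0 T,
      LipschitzOnWith K (ModSpace.field c t : ModSpace W p s → _) (Metric.closedBall 0 R) := by
  obtain ⟨C, hC, hS⟩ := ModSpace.exists_norm_schr_le W p s T
  obtain ⟨L, hL, hl⟩ := ModSpace.exists_lipschitz_nonlin h W p s (C * R)
  refine ⟨⟨C * (L * C), by positivity⟩, fun t ht => LipschitzOnWith.of_dist_le_mul fun u hu v hv => ?_⟩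
  have ht1 : |t| ≤ T := abs_le.2 ⟨by linarith [ht.1, ht.2], ht.2⟩
  have hb : ∀ w ∈ Metric.closedBall (0 : ModSpace W p s) R, ‖ModSpace.schr t w‖ ≤ C * R :=
    fun w hw => (hS t ht1 w).trans (by gcongr; simpa using hw)
  rw [dist_eq_norm, dist_eq_norm, ModSpace.field, ModSpace.field, ← smul_sub, norm_smul,
    Complex.norm_I, one_mul, ← map_sub]
  calc _ ≤ C * (L * (C * ‖u - v‖)) := by
        refine (hS (-t) (by rwa [abs_neg]) _).trans ?_
        gcongr
        refine (hl _ _ (hb u hu) (hb v hv)).trans ?_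
        gcongr
        rw [← map_sub]
        exact hS t ht1 _
    _ = C * (L * C) * ‖u - v‖ := by ring

theorem ModSpace.continuousOn_field (h : IsGaugeSeries c F) {J : Set ℝ} {w : ℝ → ModSpace W p s}
    (hw : ContinuousOn w J) : ContinuousOn (fun t => ModSpace.field c t (w t)) J := by
  have h1 := (ModSpace.continuous_nonlin h).comp_continuousOn
    (ModSpace.continuous_schr_of_continuousOn hw continuous_id)
  exact (ModSpace.continuous_schr_of_continuousOn h1 continuous_neg).const_smul Complex.I

theorem ModSpace.continuous_field (h : IsGaugeSeries c F) (w : ModSpace W p s) :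
    Continuous fun t => ModSpace.field c t w :=
  continuousOn_univ.1 (ModSpace.continuousOn_field h continuousOn_const)

theorem ModSpace.exists_of_memMod {v : 𝓢'(Rd d, ℂ)} (hv : MemMod W p s v) :
    ∃ u : ModSpace W p s, ofBdd u.bcf = v := by
  obtain ⟨b, -, -, h⟩ := exists_bcf_blocks W (half_le_of_one_le hp.out) hs.out hv
  exact ⟨ModSpace.of _ (h ▸ hv), h.symm⟩

theorem ModSpace.ofBdd_field (h : IsGaugeSeries c F) (t : ℝ) (w : ModSpace W p s)
    (φ : 𝓢(Rd d, ℂ)) : ofBdd (ModSpace.field c t w).bcf φ =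
      Complex.I * ∫ x, F ((ModSpace.schr t w).bcf x) * propS (-t) φ x := by
  rw [ModSpace.field, map_smul, ofBdd_smul]
  change Complex.I * ofBdd _ φ = _
  rw [ModSpace.ofBdd_schr, prop_apply, ofBdd_apply]
  simp only [ModSpace.nonlin_apply h]

/-- A differentiable curve in the interaction representation solves the equation in the sense of
distributions. -/
theorem ModSpace.weak_eqn (h : IsGaugeSeries c F) {J : Set ℝ} {w : ℝ → ModSpace W p s} {t : ℝ}
    (hw : HasDerivWithinAt w (ModSpace.field c t (w t)) J t) :
    ∃ g : Rd d →ᵇ ℂ, (∀ φ : 𝓢(Rd d, ℂ), prop t (ofBdd (w t).bcf) φ = ∫ x, g x * φ x) ∧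
    ∀ φ : 𝓢(Rd d, ℂ), ∃ D : ℂ,
      HasDerivWithinAt (fun τ => prop τ (ofBdd (w τ).bcf) φ) D J t ∧
      Complex.I * D + (Δ (prop t (ofBdd (w t).bcf))) φ + ∫ x, F (g x) * φ x = 0 := by
  refine ⟨(ModSpace.schr t (w t)).bcf, fun φ => ?_, fun φ => ?_⟩
  · rw [← ofBdd_apply, ModSpace.ofBdd_schr]
  · have h0 : HasDerivWithinAt (fun τ => (w τ).bcf) (ModSpace.field c t (w t)).bcf J t :=
      ((ModSpace.toBCF W p s).restrictScalars ℝ).hasFDerivAt.comp_hasDerivWithinAt t hw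
    have h1 : HasDerivWithinAt (fun τ => ofBdd (w τ).bcf (propS (1 * t) φ))
        (ofBdd (ModSpace.field c t (w t)).bcf (propS (1 * t) φ)) J t :=
      ((pairing (propS (1 * t) φ)).restrictScalars ℝ).hasFDerivAt.comp_hasDerivWithinAt t h0
    -- Here `σ = 1`: the derivative of the evolving test function gives the Laplacian, that of the
    -- curve gives the nonlinearity.
    have h2 := hasDerivWithinAt_ofBdd_propS φ (by simp) h0.continuousWithinAt h1
    simp only [one_mul, Complex.ofReal_one] at h2
    refine ⟨_, h2, ?_⟩
    rw [ModSpace.ofBdd_field h, TemperedDistribution.laplacian_apply_apply,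
      prop_apply, propS_gen, gen, map_smul, ← propS_add, neg_add_cancel, propS_zero]
    have hΔ : Δ (propS t φ) = propS t (Δ φ) := by
      have h2 := propS_gen t φ
      rw [gen, gen, map_smul] at h2
      exact (smul_right_injective _ Complex.I_ne_zero h2).symm
    rw [hΔ, smul_eq_mul]
    linear_combination (ofBdd (w t).bcf (propS t (Δ φ)) +
      ∫ x, F ((ModSpace.schr t (w t)).bcf x) * φ x) * Complex.I_mul_I

theorem ModSpace.isSolution (h : IsGaugeSeries c F) {J : Set ℝ} {w : ℝ → ModSpace W p s}
    (hw : ∀ t ∈ J, HasDerivWithinAt w (ModSpace.field c t (w t)) J t) :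
    IsSolution W p s F (ofBdd (w 0).bcf) J fun t => prop t (ofBdd (w t).bcf) where
  mem t _ := memMod_prop (half_le_of_one_le hp.out) (w t).mem t
  cont t ht := by
    have h1 := ModSpace.continuous_schr_of_continuousOn
      (fun t ht => (hw t ht).continuousWithinAt) continuous_id t ht
    have h2 := (ENNReal.continuous_ofReal.tendsto _).comp (tendsto_iff_norm_sub_tendsto_zero.1 h1)
    rw [ENNReal.ofReal_zero] at h2
    refine h2.congr fun τ => ?_
    rw [Function.comp_apply, ← ModSpace.modNorm_eq_ofReal, map_sub, ofBdd_sub, ModSpace.ofBdd_schr,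
      ModSpace.ofBdd_schr]
    rfl
  init := prop_zero _
  eqn t ht := ModSpace.weak_eqn h (hw t ht)

/-- A solution in the sense of distributions is a solution in the interaction representation. -/
theorem ModSpace.exists_isOdeSol (h : IsGaugeSeries c F) {T : ℝ} (hT : 0 < T) {u₀ : ModSpace W p s}
    {v : ℝ → 𝓢'(Rd d, ℂ)} (hv : IsSolution W p s F (ofBdd u₀.bcf) (Set.Icc 0 T) v) :
    ∃ w : ℝ → ModSpace W p s, IsOdeSol (ModSpace.field c) u₀ T w ∧
      ∀ t ∈ Set.Icc 0 T, v t = prop t (ofBdd (w t).bcf) := by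
  have hex : ∀ t, ∃ u : ModSpace W p s, t ∈ Set.Icc 0 T → ofBdd u.bcf = v t := fun t => by
    by_cases ht : t ∈ Set.Icc 0 T
    · obtain ⟨u, hu⟩ := ModSpace.exists_of_memMod (hv.mem t ht)
      exact ⟨u, fun _ => hu⟩
    · exact ⟨0, fun h => (ht h).elim⟩
  choose u hu using hex
  set w : ℝ → ModSpace W p s := fun t => ModSpace.schr (-t) (u t) with hw
  have hwu : ∀ t, ModSpace.schr t (w t) = u t := fun t => ModSpace.schr_schr_neg t _
  have hcu : ContinuousOn u (Set.Icc 0 T) := by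
    intro t ht
    refine tendsto_iff_norm_sub_tendsto_zero.2 ?_
    refine ((ENNReal.tendsto_toReal ENNReal.zero_ne_top).comp (hv.cont t ht)).congr' ?_
    filter_upwards [self_mem_nhdsWithin] with τ hτ
    rw [Function.comp_apply, ModSpace.norm_eq, map_sub, ofBdd_sub, hu τ hτ, hu t ht]
  have hcw : ContinuousOn w (Set.Icc 0 T) :=
    ModSpace.continuous_schr_of_continuousOn hcu continuous_neg
  have h0 : (0 : ℝ) ∈ Set.Icc 0 T := ⟨le_rfl, hT.le⟩
  have hw0 : w 0 = u₀ := by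
    refine ModSpace.eq_of_ofBdd ?_
    rw [hw, ModSpace.ofBdd_schr, neg_zero, prop_zero, hu 0 h0, hv.init]
  -- the weak derivative
  have hweak : ∀ φ : 𝓢(Rd d, ℂ), ∀ t ∈ Set.Icc 0 T, HasDerivWithinAt (fun τ => ofBdd (w τ).bcf φ)
      (ofBdd (ModSpace.field c t (w t)).bcf φ) (Set.Icc 0 T) t := by
    intro φ t ht
    obtain ⟨g, hg, he⟩ := hv.eqn t ht
    -- The bounded function that represents the solution in the equation is unique, so it is the one
    -- given by the modulation space.
    have hgu : (u t).bcf = g := ofBdd_injective <| DFunLike.ext _ _ fun φ => by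
      rw [hu t ht, hg, ofBdd_apply]
    obtain ⟨D, hD, hDe⟩ := he (propS (-t) φ)
    have hc2 : ContinuousWithinAt (fun τ => (u τ).bcf) (Set.Icc 0 T) t :=
      (ModSpace.toBCF W p s).continuous.continuousAt.comp_continuousWithinAt (hcu t ht)
    have hc3 : HasDerivWithinAt (fun τ => ofBdd (u τ).bcf (propS (-1 * t) φ)) D (Set.Icc 0 T) t := by
      rw [neg_one_mul]
      exact hD.congr (fun τ hτ => by rw [hu τ hτ]) (by rw [hu t ht])
    -- Here `σ = -1`: the Laplacian produced by the backward evolving test function cancels the one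
    -- in the equation.
    have h1 := hasDerivWithinAt_ofBdd_propS φ (by simp) hc2 hc3
    have h2 : ∀ τ, ofBdd (u τ).bcf (propS (-1 * τ) φ) = ofBdd (w τ).bcf φ := fun τ => by
      rw [hw, ModSpace.ofBdd_schr, prop_apply, neg_one_mul]
    simp only [h2] at h1
    refine h1.congr_deriv ?_
    rw [ModSpace.ofBdd_field h, hwu, hgu]
    have hgv : ofBdd g = v t := by rw [← hgu, hu t ht]
    rw [neg_one_mul, propS_gen, gen, map_smul, hgv, smul_eq_mul, Complex.ofReal_neg,
      Complex.ofReal_one]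
    rw [TemperedDistribution.laplacian_apply_apply] at hDe
    linear_combination -Complex.I * hDe + D * Complex.I_mul_I
  -- compare with the integral
  set H : ℝ → ModSpace W p s :=
    Set.IccExtend hT.le (fun t : Set.Icc (0 : ℝ) T => ModSpace.field c (t : ℝ) (w t)) with hH
  have hHc : Continuous H := (continuousOn_iff_continuous_domRestrict.1
    (ModSpace.continuousOn_field h hcw)).Icc_extend'
  have hHt : ∀ t ∈ Set.Icc 0 T, H t = ModSpace.field c t (w t) := fun t ht => by
    rw [hH, Set.IccExtend_of_mem _ _ ht]
  set q : ℝ → ModSpace W p s := fun t => u₀ + ∫ τ in (0 : ℝ)..t, H τ with hq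
  have hqd : ∀ t, HasDerivAt q (H t) t := fun t =>
    (hHc.integral_hasStrictDerivAt 0 t).hasDerivAt.const_add u₀
  have heq : Set.EqOn w q (Set.Icc 0 T) := by
    intro t ht
    refine ModSpace.eq_of_ofBdd (DFunLike.ext _ _ fun φ => ?_)
    set ℓ : ModSpace W p s →L[ℝ] ℂ :=
      ((pairing φ).comp (ModSpace.toBCF W p s)).restrictScalars ℝ with hℓ
    -- `w` is so far only weakly differentiable. Tested against any `φ` it has the same derivative
    -- as the integral `q` of a continuous curve, so it equals `q` and is differentiable in norm.
    have hd : ∀ t ∈ Set.Icc 0 T, HasDerivWithinAt (fun τ => ℓ (w τ) - ℓ (q τ)) 0 (Set.Icc 0 T) t := by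
      intro t ht
      have h3 : HasDerivWithinAt (fun τ => ℓ (q τ)) (ℓ (H t)) (Set.Icc 0 T) t :=
        ℓ.hasFDerivAt.comp_hasDerivWithinAt t (hqd t).hasDerivWithinAt
      refine ((hweak φ t ht).sub h3).congr_deriv ?_
      rw [hHt t ht]
      exact sub_self _
    have h4 := (convex_Icc 0 T).norm_image_sub_le_of_norm_hasDerivWithin_le (C := 0) hd
      (fun _ _ => by simp) h0 ht
    rw [zero_mul, norm_le_zero_iff] at h4
    have h5 : ℓ (w 0) - ℓ (q 0) = 0 := by simp [hq, hw0]
    rw [h5, sub_zero, sub_eq_zero] at h4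
    exact h4
  refine ⟨w, ⟨hw0, fun t ht => ?_⟩, fun t ht => ?_⟩
  · rw [← hHt t ht]
    exact (hqd t).hasDerivWithinAt.congr heq (heq ht)
  · rw [← ModSpace.ofBdd_schr, hwu, hu t ht]

theorem IsOdeSol.hasDerivWithinAt_of_lt {E : Type*} [NormedAddCommGroup E] [NormedSpace ℝ E]
    {G : ℝ → E → E} {x₀ : E} {Tmax : ℝ≥0∞} {w : ℝ → E}
    (hw : ∀ T, ENNReal.ofReal T < Tmax → IsOdeSol G x₀ T w) {t : ℝ} (ht : 0 ≤ t)
    (htm : ENNReal.ofReal t < Tmax) :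
    HasDerivWithinAt w (G t (w t)) {t : ℝ | 0 ≤ t ∧ ENNReal.ofReal t < Tmax} t := by
  obtain ⟨T, hT, htT, hTm⟩ := ENNReal.lt_iff_exists_real_btwn.1 htm
  have htT' : t < T := (ENNReal.ofReal_lt_ofReal_iff_of_nonneg ht).1 htT
  refine ((hw T hTm).deriv t ⟨ht, htT'.le⟩).mono_of_mem_nhdsWithin ?_
  filter_upwards [self_mem_nhdsWithin, nhdsWithin_le_nhds (gt_mem_nhds htT')] with τ hτ hτT
  exact ⟨hτ.1, hτT.le⟩

/-- The maximal solution in the modulation spaces that are Banach spaces. -/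
theorem ModSpace.exists_maximal_solution (h : IsGaugeSeries c F) (W : Window d) (p : ℝ≥0∞) (s : ℝ)
    [hp : Fact (1 ≤ p)] [hs : Fact (0 ≤ s)] :
    ∃ T₀ : ℝ≥0 → ℝ, Antitone T₀ ∧ (∀ r, 0 < T₀ r) ∧ ∀ u₀ : ModSpace W p s,
      ∃ Tmax : ℝ≥0∞, ENNReal.ofReal (T₀ (modNorm W p s (ofBdd u₀.bcf)).toNNReal) < Tmax ∧
        ∃ w : ℝ → ModSpace W p s, w 0 = u₀ ∧
          (∀ t ∈ {t : ℝ | 0 ≤ t ∧ ENNReal.ofReal t < Tmax}, HasDerivWithinAt w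
            (ModSpace.field c t (w t)) {t : ℝ | 0 ≤ t ∧ ENNReal.ofReal t < Tmax} t) ∧
          (∀ T, 0 < T → ∀ v, IsSolution W p s F (ofBdd u₀.bcf) (Set.Icc 0 T) v →
            ENNReal.ofReal T < Tmax ∧
              Set.EqOn v (fun t => prop t (ofBdd (w t).bcf)) (Set.Icc 0 T)) ∧
          (Tmax < ∞ → ∀ C : ℝ≥0∞, C ≠ ∞ → ∃ᶠ t in 𝓝[<] Tmax.toReal,
            C < modNorm W p s (prop t (ofBdd (w t).bcf))) := by
  obtain ⟨T₀, hanti, hpos, hmain⟩ := exists_maximal_odeSol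
    (ModSpace.exists_lipschitz_field (W := W) (p := p) (s := s) h) (ModSpace.continuous_field h)
  refine ⟨T₀, hanti, hpos, fun u₀ => ?_⟩
  obtain ⟨Tmax, hT, w, hw, huniq, hblow⟩ := hmain u₀
  have hnn : (modNorm W p s (ofBdd u₀.bcf)).toNNReal = ‖u₀‖₊ := by
    rw [← ModSpace.enorm_eq]; rfl
  refine ⟨Tmax, hnn ▸ hT, w, (hw 0 (by simpa using zero_le.trans_lt hT)).init, fun t ht =>
    IsOdeSol.hasDerivWithinAt_of_lt hw ht.1 ht.2, fun T hT v hv => ?_, fun hTm C hC => ?_⟩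
  · obtain ⟨w', hw', hv'⟩ := ModSpace.exists_isOdeSol h hT hv
    obtain ⟨h1, h2⟩ := huniq T hT w' hw'
    exact ⟨h1, fun t ht => by rw [hv' t ht, h2 ht]⟩
  -- On a bounded time interval the norm of `w` is at most `M` times that of the solution, so
  -- blow-up of the former forces that of the latter.
  · obtain ⟨M, hM, hS⟩ := ModSpace.exists_norm_schr_le W p s (Tmax.toReal + 1)
    have hev : ∀ᶠ t in 𝓝[<] Tmax.toReal, -(Tmax.toReal + 1) < t ∧ t < Tmax.toReal := by
      filter_upwards [self_mem_nhdsWithin, nhdsWithin_le_nhds (lt_mem_nhds (show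
        -(Tmax.toReal + 1) < Tmax.toReal by linarith [ENNReal.toReal_nonneg (a := Tmax)]))] with t h1 h2
      exact ⟨h2, h1⟩
    refine ((hblow hTm (M * C.toReal)).and_eventually hev).mono fun t ht => ?_
    rw [← ModSpace.ofBdd_schr, ← ModSpace.enorm_eq, ← ofReal_norm,
      ENNReal.lt_ofReal_iff_toReal_lt hC]
    by_contra hcon
    have h1 := hS (-t) (by rw [abs_neg]; exact abs_le.2 ⟨by linarith [ht.2.1], by linarith [ht.2.2]⟩)
      (ModSpace.schr t (w t))
    rw [ModSpace.schr_neg_schr] at h1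
    have h2 : M * ‖ModSpace.schr t (w t)‖ ≤ M * C.toReal := by
      gcongr
      exact not_lt.1 hcon
    linarith [ht.1]

theorem limsup_eq_top_of_frequently {f : ℝ → ℝ≥0∞} {l : Filter ℝ}
    (h : ∀ C : ℝ≥0∞, C ≠ ∞ → ∃ᶠ t in l, C < f t) : limsup f l = ∞ := by
  refine ENNReal.eq_top_of_forall_nnreal_le fun r => ?_
  exact le_limsup_of_frequently_le ((h r ENNReal.coe_ne_top).mono fun t ht => ht.le)
    (by isBoundedDefault)

end Duhamel

/-- Well-posedness in the modulation spaces that are Banach spaces. -/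
theorem exists_solution_of_one_le {d : ℕ} {p : ℝ≥0∞} (hp : 1 ≤ p) {s : ℝ} (hs : 0 ≤ s)
    {c : ℕ → ℝ} {F : ℂ → ℂ} (h : IsGaugeSeries c F) (W : Window d) :
    ∃ T₀ : ℝ≥0 → ℝ, Antitone T₀ ∧ (∀ r, 0 < T₀ r) ∧
      ∀ u₀ : 𝓢'(Rd d, ℂ), MemMod W p s u₀ →
        ∃ Tmax : ℝ≥0∞, ENNReal.ofReal (T₀ (modNorm W p s u₀).toNNReal) < Tmax ∧
          ∃ u : ℝ → 𝓢'(Rd d, ℂ),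
            IsSolution W p s F u₀ {t : ℝ | 0 ≤ t ∧ ENNReal.ofReal t < Tmax} u ∧
            (∀ T : ℝ, 0 < T → ∀ v : ℝ → 𝓢'(Rd d, ℂ),
              IsSolution W p s F u₀ (Set.Icc 0 T) v →
                ENNReal.ofReal T < Tmax ∧ Set.EqOn v u (Set.Icc 0 T)) ∧
            (Tmax < ∞ →
              limsup (fun t : ℝ => modNorm W p s (u t)) (𝓝[<] Tmax.toReal) = ∞) := by
  have := Fact.mk hp
  have := Fact.mk hs
  obtain ⟨T₀, hanti, hpos, hmain⟩ := ModSpace.exists_maximal_solution h W p s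
  refine ⟨T₀, hanti, hpos, fun u₀ hu₀ => ?_⟩
  obtain ⟨v₀, rfl⟩ := ModSpace.exists_of_memMod hu₀
  obtain ⟨Tmax, hT, w, hw0, hw, huniq, hblow⟩ := hmain v₀
  refine ⟨Tmax, hT, fun t => prop t (ofBdd (w t).bcf), ?_, huniq, fun hTm =>
    limsup_eq_top_of_frequently (hblow hTm)⟩
  rw [← hw0]
  exact ModSpace.isSolution h hw

/-! ### Transversality of tubes in space-time -/

section Tubes

variable {d : ℕ}

/-- Slowly varying weights. -/
def Moderate (N : ℕ) (a : Rd d → ℝ≥0∞) : Prop := ∀ x y, a x * bump N (x - y) ≤ a y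

theorem Moderate.le_two_pow_mul {N : ℕ} {a : Rd d → ℝ≥0∞} (h : Moderate N a) {x y : Rd d}
    (hxy : ‖x - y‖ ≤ 1) : a x ≤ 2 ^ N * a y := by
  calc a x = a x * 1 := (mul_one _).symm
    _ ≤ a x * (2 ^ N * bump N (x - y)) := mul_le_mul_right (two_pow_mul_bump_ge hxy) _
    _ = 2 ^ N * (a x * bump N (x - y)) := by ring
    _ ≤ _ := mul_le_mul_right (h x y) _

theorem Moderate.mul_lintegral_bump_le {N : ℕ} {a : Rd d → ℝ≥0∞} (h : Moderate N a) (x : Rd d) :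
    a x * ∫⁻ y : Rd d, bump N y ≤ ∫⁻ y, a y := by
  have hm : Measurable fun y : Rd d => bump N (x - y) :=
    (measurable_bump N).comp (measurable_const.sub measurable_id)
  rw [← lintegral_comp_sub_left (bump N) x, ← lintegral_const_mul _ hm]
  exact lintegral_mono fun y => h x y

/-- Line integrals of slowly varying weights. -/
theorem exists_lintegral_line_le (d N : ℕ) : ∃ C : ℝ≥0∞, C ≠ ∞ ∧ ∀ a : Rd d → ℝ≥0∞, Measurable a →
    Moderate N a → ∀ (T : ℝ) (y v : Rd d), (1 + ENNReal.ofReal ‖v‖) *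
      ∫⁻ τ in Set.Icc 0 T, a (y + τ • v) ≤ C * ((ENNReal.ofReal T + 2) * ∫⁻ x, a x) := by
  set V := volume (Metric.closedBall (0 : Rd d) 1) with hV
  have hV0 : V ≠ 0 := (Metric.measure_closedBall_pos _ _ one_pos).ne'
  have hVt : V ≠ ∞ := measure_closedBall_lt_top.ne
  refine ⟨V⁻¹ * 2 ^ N, by finiteness, fun a ha hmod T y v => ?_⟩
  set q : Rd d → Set ℝ := fun x => {τ | ‖y + τ • v - x‖ ≤ 1} with hq
  have hqm : MeasurableSet {z : ℝ × Rd d | ‖y + z.1 • v - z.2‖ ≤ 1} :=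
    measurableSet_le (by fun_prop) measurable_const
  have h1 : ∀ τ : ℝ, V * a (y + τ • v) ≤ 2 ^ N * ∫⁻ x, (q x).indicator 1 τ * a x := by
    intro τ
    have h2 : V = volume (Metric.closedBall (y + τ • v) 1) := by
      rw [hV, Measure.addHaar_closedBall_center (μ := volume) (y + τ • v) 1]
    rw [h2, mul_comm, ← setLIntegral_const]
    calc _ ≤ ∫⁻ x in Metric.closedBall (y + τ • v) 1, 2 ^ N * ((q x).indicator 1 τ * a x) := by
          refine setLIntegral_mono' measurableSet_closedBall fun x hx => ?_
          have h3 : ‖y + τ • v - x‖ ≤ 1 := by rwa [mem_closedBall_iff_norm'] at hx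
          rw [Set.indicator_of_mem (s := q x) h3, Pi.one_apply, one_mul]
          exact hmod.le_two_pow_mul h3
      _ ≤ ∫⁻ x, 2 ^ N * ((q x).indicator 1 τ * a x) := setLIntegral_le_lintegral _ _
      _ = _ := by rw [lintegral_const_mul' _ _ (by finiteness)]
  have hind : Measurable fun z : ℝ × Rd d => (q z.2).indicator (1 : ℝ → ℝ≥0∞) z.1 := by
    have : (fun z : ℝ × Rd d => (q z.2).indicator (1 : ℝ → ℝ≥0∞) z.1) =
        {z : ℝ × Rd d | ‖y + z.1 • v - z.2‖ ≤ 1}.indicator 1 := by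
      funext z; rfl
    rw [this]
    exact measurable_one.indicator hqm
  -- A particle of speed `|v|` spends at most the time `min(T, 2/|v|)` in a given unit ball.
  have hmeas : ∀ x, (1 + ENNReal.ofReal ‖v‖) * volume (q x ∩ Set.Icc 0 T) ≤ ENNReal.ofReal T + 2 := by
    intro x
    rw [add_mul, one_mul]
    refine add_le_add ((measure_mono Set.inter_subset_right).trans_eq (by simp)) ?_
    rcases eq_or_ne v 0 with rfl | hv
    · simp
    have hv' : 0 < ‖v‖ := norm_pos_iff.2 hv
    have h3 : volume (q x ∩ Set.Icc 0 T) ≤ ENNReal.ofReal (2 / ‖v‖) := by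
      refine (Real.volume_le_diam _).trans (Metric.ediam_le fun τ₁ h₁ τ₂ h₂ => ?_)
      rw [edist_dist, Real.dist_eq]
      refine ENNReal.ofReal_le_ofReal ?_
      rw [le_div_iff₀ hv', ← Real.norm_eq_abs, ← norm_smul]
      have h4 : (τ₁ - τ₂) • v = (y + τ₁ • v - x) - (y + τ₂ • v - x) := by rw [sub_smul]; abel
      rw [h4]
      refine (norm_sub_le _ _).trans ?_
      have := h₁.1
      have := h₂.1
      simp only [hq, Set.mem_ofPred_eq] at *
      linarith
    refine (mul_le_mul_right h3 _).trans_eq ?_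
    rw [← ENNReal.ofReal_mul (norm_nonneg _), mul_div_cancel₀ _ hv'.ne']
    simp
  have h5 : V * ∫⁻ τ in Set.Icc 0 T, a (y + τ • v) ≤
      2 ^ N * ∫⁻ x, volume (q x ∩ Set.Icc 0 T) * a x := by
    rw [← lintegral_const_mul' _ _ hVt]
    refine (lintegral_mono fun τ => h1 τ).trans_eq ?_
    rw [lintegral_const_mul' _ _ (by finiteness), lintegral_lintegral_swap]
    · congr 1
      refine lintegral_congr fun x => ?_
      have hqx : MeasurableSet (q x) := measurableSet_le (by fun_prop) measurable_const
      rw [lintegral_mul_const _ (measurable_one.indicator hqx), lintegral_indicator_one hqx,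
        Measure.restrict_apply hqx]
    · exact (hind.mul (ha.comp measurable_snd)).aemeasurable
  calc (1 + ENNReal.ofReal ‖v‖) * ∫⁻ τ in Set.Icc 0 T, a (y + τ • v)
      = V⁻¹ * ((1 + ENNReal.ofReal ‖v‖) * (V * ∫⁻ τ in Set.Icc 0 T, a (y + τ • v))) := by
        rw [mul_left_comm _ V, ← mul_assoc V⁻¹, ENNReal.inv_mul_cancel hV0 hVt, one_mul]
    _ ≤ V⁻¹ * ((1 + ENNReal.ofReal ‖v‖) * (2 ^ N * ∫⁻ x, volume (q x ∩ Set.Icc 0 T) * a x)) := by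
        gcongr
    _ = V⁻¹ * 2 ^ N * ∫⁻ x, (1 + ENNReal.ofReal ‖v‖) * volume (q x ∩ Set.Icc 0 T) * a x := by
        rw [mul_left_comm _ (2 ^ N), ← mul_assoc, ← lintegral_const_mul' _ _ (by finiteness)]
        simp only [mul_assoc]
    _ ≤ V⁻¹ * 2 ^ N * ∫⁻ x, (ENNReal.ofReal T + 2) * a x :=
        mul_le_mul_right (lintegral_mono fun x => mul_le_mul_left (hmeas x) _) _
    _ = _ := by rw [lintegral_const_mul _ ha]

/-- Transversality of two tubes. -/
theorem exists_lintegral_tube_mul_tube_le (d N : ℕ) : ∃ C : ℝ≥0∞, C ≠ ∞ ∧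
    ∀ a b : Rd d → ℝ≥0∞, Measurable a → Measurable b → Moderate N b → ∀ (T : ℝ) (v v' : Rd d),
      (1 + ENNReal.ofReal ‖v - v'‖) * ∫⁻ τ in Set.Icc 0 T, ∫⁻ y, a (y - τ • v) * b (y - τ • v') ≤
        C * ((ENNReal.ofReal T + 2) * ((∫⁻ x, a x) * ∫⁻ x, b x)) := by
  obtain ⟨C, hC, h⟩ := exists_lintegral_line_le d N
  refine ⟨C, hC, fun a b ha hb hmod T v v' => ?_⟩
  -- In the frame moving with the first tube, the second is traversed along a line with the relative
  -- velocity.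
  have h1 : ∀ τ : ℝ, ∫⁻ y, a (y - τ • v) * b (y - τ • v') = ∫⁻ y, a y * b (y + τ • (v - v')) := by
    intro τ
    rw [← lintegral_comp_sub_right (fun y => a y * b (y + τ • (v - v'))) (τ • v)]
    refine lintegral_congr fun y => ?_
    rw [smul_sub, sub_add_sub_cancel]
  have hm : Measurable fun z : ℝ × Rd d => a z.2 * b (z.2 + z.1 • (v - v')) :=
    (ha.comp measurable_snd).mul (hb.comp (by fun_prop))
  have hm2 : ∀ y, Measurable fun τ : ℝ => b (y + τ • (v - v')) := fun y => hb.comp (by fun_prop)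
  simp_rw [h1]
  rw [lintegral_lintegral_swap hm.aemeasurable]
  simp_rw [fun y => lintegral_const_mul (μ := volume.restrict (Set.Icc 0 T)) (a y) (hm2 y)]
  rw [← lintegral_const_mul']
  · calc _ ≤ ∫⁻ y, a y * (C * ((ENNReal.ofReal T + 2) * ∫⁻ x, b x)) := by
          refine lintegral_mono fun y => ?_
          rw [mul_left_comm]
          exact mul_le_mul_right (h b hb hmod T y (v - v')) _
      _ = _ := by rw [lintegral_mul_const _ ha]; ring
  · finiteness

end Tubes

/-! ### The mass of the tubes met by a moving particle -/

section TubeMass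

variable {d : ℕ} {K : Type*}

/-- The mass of all tubes met by a tube of velocity `v k`. -/
def tubeMass (v : K → Rd d) (a : K → Rd d → ℝ≥0∞) (T : ℝ) (k : K) (x : Rd d) : ℝ≥0∞ :=
  ∫⁻ τ in Set.Icc 0 T, ∑' k', a k' (x + τ • (v k - v k'))

variable {v : K → Rd d} {a : K → Rd d → ℝ≥0∞} {N : ℕ}

theorem measurable_tubes [Countable K] (ha : ∀ k, Measurable (a k)) (k : K) :
    Measurable fun z : ℝ × Rd d => ∑' k', a k' (z.2 + z.1 • (v k - v k')) :=
  Measurable.tsum fun k' => (ha k').comp (by fun_prop)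

theorem measurable_tubeMass [Countable K] (ha : ∀ k, Measurable (a k)) (T : ℝ) (k : K) :
    Measurable (tubeMass v a T k) :=
  (measurable_tubes ha k).lintegral_prod_left'

theorem moderate_tubeMass (hmod : ∀ k, Moderate N (a k)) (T : ℝ) (k : K) :
    Moderate N (tubeMass v a T k) := by
  intro x y
  rw [tubeMass, ← lintegral_mul_const' _ _ (bump_ne_top _ _)]
  refine lintegral_mono fun τ => ?_
  rw [← ENNReal.tsum_mul_right]
  refine ENNReal.tsum_le_tsum fun k' => ?_
  have := hmod k' (x + τ • (v k - v k')) (y + τ • (v k - v k'))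
  rwa [add_sub_add_right_eq_sub] at this

/-- By translation invariance the total mass does not depend on `k`, which is what makes it a good
weight for Cauchy–Schwarz. -/
theorem lintegral_tubeMass [Countable K] (ha : ∀ k, Measurable (a k)) (T : ℝ) (k : K) :
    ∫⁻ x, tubeMass v a T k x = ENNReal.ofReal T * ∑' k', ∫⁻ x, a k' x := by
  unfold tubeMass
  rw [lintegral_lintegral_swap (f := fun x (τ : ℝ) => ∑' k', a k' (x + τ • (v k - v k')))
    ((measurable_tubes ha k).comp measurable_swap).aemeasurable]
  have h : ∀ τ : ℝ, ∫⁻ x, ∑' k', a k' (x + τ • (v k - v k')) = ∑' k', ∫⁻ x, a k' x := by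
    intro τ
    have hm : ∀ k', Measurable fun x => a k' (x + τ • (v k - v k')) := fun k' =>
      (ha k').comp (by fun_prop)
    rw [lintegral_tsum fun k' => (hm k').aemeasurable]
    refine tsum_congr fun k' => ?_
    exact lintegral_add_right_eq_self (a k') _
  simp_rw [h]
  rw [setLIntegral_const, Real.volume_Icc, sub_zero, mul_comm]

/-- A tube has mass comparable with the tubes of similar velocity that pass through one of its
points. -/
theorem tsum_indicator_le_tubeMass (hmod : ∀ k, Moderate N (a k)) {T : ℝ} (hT : 0 < T) {L : ℝ}
    (hL : 0 ≤ L) {k : K} {τ : ℝ} (hτ : τ ∈ Set.Icc 0 T) (y : Rd d) {f : K → ℝ≥0∞} (hf : ∀ k', f k' ≤ 1)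
    (hfL : ∀ k', f k' ≠ 0 → ‖v k - v k'‖ ≤ L) :
    ∑' k', f k' * a k' (y - τ • v k') ≤
      2 ^ N * ENNReal.ofReal (1 / T + L) * tubeMass v a T k (y - τ • v k) := by
  -- Chosen so that `δ ≤ T` and `δ L ≤ 1`. During a time `δ` around `τ`, tubes of relative speed at
  -- most `L` stay within distance `1`, so slow variation keeps their values comparable. The window
  -- `J` still has length at least `δ` after intersection with `[0, T]`.
  set δ : ℝ := (1 / T + L)⁻¹ with hδ
  have hpos : 0 < 1 / T + L := by positivity
  have hδ0 : 0 < δ := inv_pos.2 hpos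
  have hδT : δ ≤ T := by
    rw [hδ, inv_le_comm₀ hpos hT, inv_eq_one_div]
    linarith
  have hδL : δ * L ≤ 1 := by
    rw [hδ, inv_mul_le_iff₀ hpos]
    have : 0 < 1 / T := by positivity
    linarith
  set J := Set.Icc (max 0 (τ - δ)) (min T (τ + δ)) with hJ
  have hJm : ENNReal.ofReal δ ≤ volume J := by
    rw [Real.volume_Icc]
    refine ENNReal.ofReal_le_ofReal ?_
    rcases max_cases 0 (τ - δ) with ⟨h1, _⟩ | ⟨h1, _⟩ <;>
      rcases min_cases T (τ + δ) with ⟨h2, _⟩ | ⟨h2, _⟩ <;> rw [h1, h2] <;>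
      linarith [hτ.1, hτ.2]
  have hJs : J ⊆ Set.Icc 0 T := Set.Icc_subset_Icc (le_max_left _ _) (min_le_left _ _)
  set S := ∑' k', f k' * a k' (y - τ • v k') with hS
  have h1 : S * ENNReal.ofReal δ ≤ 2 ^ N * tubeMass v a T k (y - τ • v k) := by
    calc S * ENNReal.ofReal δ ≤ S * volume J := mul_le_mul_right hJm _
      _ = ∫⁻ _τ' in J, S := (setLIntegral_const _ _).symm
      _ ≤ ∫⁻ τ' in J, 2 ^ N * ∑' k', a k' (y - τ • v k + τ' • (v k - v k')) := by
          refine setLIntegral_mono' measurableSet_Icc fun τ' hτ' => ?_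
          rw [hS, ← ENNReal.tsum_mul_left]
          refine ENNReal.tsum_le_tsum fun k' => ?_
          by_cases hk : f k' = 0
          · rw [hk, zero_mul]; exact zero_le
          refine (mul_le_mul_left (hf k') _).trans ?_
          rw [one_mul]
          refine (hmod k').le_two_pow_mul ?_
          have h2 : y - τ • v k' - (y - τ • v k + τ' • (v k - v k')) = (τ - τ') • (v k - v k') := by
            rw [sub_smul, smul_sub τ]; abel
          rw [h2, norm_smul, Real.norm_eq_abs]
          have h3 : |τ - τ'| ≤ δ := by
            rw [abs_le]
            constructor
            · linarith [hτ'.2.trans (min_le_right _ _)]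
            · linarith [(le_max_right _ _).trans hτ'.1]
          exact (mul_le_mul h3 (hfL k' hk) (norm_nonneg _) hδ0.le).trans hδL
      _ ≤ ∫⁻ τ' in Set.Icc 0 T, 2 ^ N * ∑' k', a k' (y - τ • v k + τ' • (v k - v k')) :=
          lintegral_mono_set hJs
      _ = _ := by rw [lintegral_const_mul' _ _ (by finiteness)]; rfl
  have h4 : ENNReal.ofReal δ * ENNReal.ofReal (1 / T + L) = 1 := by
    rw [← ENNReal.ofReal_mul hδ0.le, hδ, inv_mul_cancel₀ hpos.ne', ENNReal.ofReal_one]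
  calc S = S * ENNReal.ofReal δ * ENNReal.ofReal (1 / T + L) := by rw [mul_assoc, h4, mul_one]
    _ ≤ 2 ^ N * tubeMass v a T k (y - τ • v k) * ENNReal.ofReal (1 / T + L) := mul_le_mul_left h1 _
    _ = _ := by ring

/-- Compare at time `0` with the single tube `k₀`: a vanishing mass would force its profile to
vanish at `x`. -/
theorem tubeMass_pos (hmod : ∀ k, Moderate N (a k)) {T : ℝ} (hT : 0 < T) {k₀ : K}
    (h₀ : ∀ x, a k₀ x ≠ 0) (k : K) (x : Rd d) : tubeMass v a T k x ≠ 0 := by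
  classical
  intro h
  have h1 := tsum_indicator_le_tubeMass hmod hT (norm_nonneg (v k - v k₀)) (k := k) (τ := 0)
    ⟨le_rfl, hT.le⟩ x (f := Pi.single k₀ 1)
    (fun k' => by by_cases hk : k' = k₀ <;> simp [hk])
    (fun k' hk => by
      have : k' = k₀ := by
        by_contra hne
        exact hk (by simp [hne])
      rw [this])
  rw [zero_smul, sub_zero, h, mul_zero, nonpos_iff_eq_zero, ENNReal.tsum_eq_zero] at h1
  have h2 := h1 k₀
  rw [zero_smul, sub_zero, Pi.single_eq_same, one_mul] at h2
  exact h₀ x h2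

/-- A slowly varying function is bounded pointwise by a multiple of its integral, which is finite
here. -/
theorem tubeMass_ne_top [Countable K] (ha : ∀ k, Measurable (a k)) (hmod : ∀ k, Moderate N (a k)) (T : ℝ)
    (hfin : ∑' k, ∫⁻ x, a k x ≠ ∞) (k : K) (x : Rd d) : tubeMass v a T k x ≠ ∞ := by
  intro h
  have h1 := (moderate_tubeMass (v := v) hmod T k).mul_lintegral_bump_le x
  rw [lintegral_tubeMass ha, h, ENNReal.top_mul (lintegral_bump_pos N).ne', top_le_iff] at h1
  exact (ENNReal.mul_ne_top ENNReal.ofReal_ne_top hfin) h1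

end TubeMass

/-! ### Absorbing one factor in the output tube and using transversality of two others -/

section TubeLemma

variable {d : ℕ}

/-- The group velocity of a frequency block. -/
def Window.vel (W : Window d) (k : Fin d → ℤ) : Rd d := (4 * Real.pi) • W.pt k

theorem Window.norm_vel_sub (W : Window d) (k k' : Fin d → ℤ) :
    ‖W.vel k - W.vel k'‖ = 4 * Real.pi * ‖W.pt k - W.pt k'‖ := by
  rw [Window.vel, Window.vel, ← smul_sub, norm_smul, Real.norm_eq_abs, abs_of_pos (by positivity)]

/-- The frequencies `κ` lie within the distance of the frequencies `j₀` and `j₁` from the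
frequency `j₀`. -/
def Spread (W : Window d) {n : ℕ} (l : Fin (n + 1)) (j₀ j₁ : Fin n) (κ : Fin (n + 1) → Fin d → ℤ) :
    Prop :=
  ∀ i, ‖W.pt (κ i) - W.pt (κ (l.succAbove j₀))‖ ≤
    ‖W.pt (κ (l.succAbove j₁)) - W.pt (κ (l.succAbove j₀))‖

/-- The indicator of `Spread`. -/
def spreadInd (W : Window d) {n : ℕ} (l : Fin (n + 1)) (j₀ j₁ : Fin n)
    (κ : Fin (n + 1) → Fin d → ℤ) : ℝ≥0∞ := {κ | Spread W l j₀ j₁ κ}.indicator 1 κ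

theorem spreadInd_of {W : Window d} {n : ℕ} {l : Fin (n + 1)} {j₀ j₁ : Fin n}
    {κ : Fin (n + 1) → Fin d → ℤ} (h : Spread W l j₀ j₁ κ) : spreadInd W l j₀ j₁ κ = 1 :=
  Set.indicator_of_mem (s := {κ | Spread W l j₀ j₁ κ}) h _

theorem spreadInd_of_not {W : Window d} {n : ℕ} {l : Fin (n + 1)} {j₀ j₁ : Fin n}
    {κ : Fin (n + 1) → Fin d → ℤ} (h : ¬ Spread W l j₀ j₁ κ) : spreadInd W l j₀ j₁ κ = 0 :=
  Set.indicator_of_notMem (s := {κ | Spread W l j₀ j₁ κ}) h _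

/-- Start from the frequency with index `0` and take the one farthest from it; at least three
factors leave an index `l` different from both. -/
theorem exists_spread (W : Window d) {n : ℕ} (hn : 2 ≤ n) (κ : Fin (n + 1) → Fin d → ℤ) :
    ∃ l j₀ j₁, j₀ ≠ j₁ ∧ Spread W l j₀ j₁ κ := by
  obtain ⟨i₁, hi₁, hmax⟩ := Finset.exists_max_image (Finset.univ.erase (0 : Fin (n + 1)))
    (fun i => ‖W.pt (κ i) - W.pt (κ 0)‖) ⟨Fin.last n, by
      rw [Finset.mem_erase]
      exact ⟨by rw [Ne, Fin.ext_iff]; simp; omega, Finset.mem_univ _⟩⟩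
  rw [Finset.mem_erase] at hi₁
  obtain ⟨l, hl⟩ : ∃ l : Fin (n + 1), l ∉ ({0, i₁} : Finset (Fin (n + 1))) := by
    by_contra! h
    have h1 := Finset.card_le_card (fun x _ => h x : Finset.univ ⊆ ({0, i₁} : Finset (Fin (n + 1))))
    rw [Finset.card_univ, Fintype.card_fin] at h1
    have h2 := Finset.card_le_two (a := (0 : Fin (n + 1))) (b := i₁)
    omega
  simp only [Finset.mem_insert, Finset.mem_singleton, not_or] at hl
  obtain ⟨j₀, hj₀⟩ := Fin.exists_succAbove_eq (Ne.symm hl.1)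
  obtain ⟨j₁, hj₁⟩ := Fin.exists_succAbove_eq (Ne.symm hl.2)
  refine ⟨l, j₀, j₁, ?_, fun i => ?_⟩
  · rintro rfl
    exact hi₁.1 (hj₁.symm.trans hj₀)
  · rw [hj₀, hj₁]
    rcases eq_or_ne i 0 with rfl | hi
    · simp
    · exact hmax i (by simp [hi])

/-- Because the signs add up to one, the signed sum stays near the cluster. This is where gauge
invariance enters: the output velocity is comparable to the input velocities. -/
theorem norm_sum_smul_sub_le {n : ℕ} {σ : Fin n → ℝ} (hσ : ∀ i, |σ i| = 1) (hσ1 : ∑ i, σ i = 1)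
    {x : Fin n → Rd d} {c : Rd d} {R : ℝ} (h : ∀ i, ‖x i - c‖ ≤ R) :
    ‖∑ i, σ i • x i - c‖ ≤ n * R := by
  have h1 : ∑ i, σ i • x i - c = ∑ i, σ i • (x i - c) := by
    simp_rw [smul_sub]
    rw [Finset.sum_sub_distrib, ← Finset.sum_smul, hσ1, one_smul]
  rw [h1]
  refine (norm_sum_le _ _).trans ?_
  calc ∑ i, ‖σ i • (x i - c)‖ ≤ ∑ _i : Fin n, R := Finset.sum_le_sum fun i _ => by
        rw [norm_smul, Real.norm_eq_abs, hσ, one_mul]; exact h i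
    _ = n * R := by simp

variable {W : Window d} {a : (Fin d → ℤ) → Rd d → ℝ≥0∞} {N : ℕ}

theorem inv_le_mul_inv_of_le {S G m : ℝ≥0∞} (h : S ≤ G * m) (hG : G ≠ ∞) (hG0 : G ≠ 0) :
    m⁻¹ ≤ G * S⁻¹ := by
  have h1 := ENNReal.inv_le_inv.2 h
  rw [ENNReal.mul_inv (Or.inl hG0) (Or.inl hG)] at h1
  calc m⁻¹ = G * (G⁻¹ * m⁻¹) := by rw [← mul_assoc, ENNReal.mul_inv_cancel hG0 hG, one_mul]
    _ ≤ _ := mul_le_mul_right h1 _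

/-- The constant in the summation over one factor. -/
def tubeConst (N n : ℕ) (T : ℝ) : ℝ≥0∞ :=
  2 ^ N * ENNReal.ofReal (1 / T + 4 * Real.pi * (2 * n + 1))

/-- One factor is absorbed by the mass of the output tube. -/
theorem exists_tsum_tsum_div_tubeMass_le (W : Window d) : ∃ C : ℝ≥0∞, C ≠ ∞ ∧ ∀ (N : ℕ)
    (a : (Fin d → ℤ) → Rd d → ℝ≥0∞), (∀ k, Moderate N (a k)) → ∀ (T : ℝ), 0 < T →
    ∀ (n : ℕ) (σ : Fin (n + 1) → ℝ), (∀ i, |σ i| = 1) → ∑ i, σ i = 1 →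
    ∀ (l : Fin (n + 1)) (j₀ j₁ : Fin n) (κ : Fin n → Fin d → ℤ), ∀ τ ∈ Set.Icc 0 T, ∀ y,
    ∑' q, ∑' k, spreadInd W l j₀ j₁ (l.insertNth q κ) *
      near W (2 * (n + 1 : ℕ) + 1) (∑ i, σ i • W.pt ((l.insertNth q κ : Fin (n + 1) → Fin d → ℤ) i)) k *
        (a q (y - τ • W.vel q) * (tubeMass W.vel a T k (y - τ • W.vel k))⁻¹) ≤
      C * (2 * (n + 1 : ℕ) + 2) ^ d * tubeConst N (n + 1) T *
        (1 + ENNReal.ofReal ‖W.vel (κ j₀) - W.vel (κ j₁)‖) := by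
  obtain ⟨C, hC, hCn⟩ := exists_tsum_near_le W
  refine ⟨C, hC, fun N a hmod T hT n σ hσ hσ1 l j₀ j₁ κ τ hτ y => ?_⟩
  set R := ‖W.pt (κ j₁) - W.pt (κ j₀)‖ with hR
  have hR0 : 0 ≤ R := norm_nonneg _
  -- `S` is the mass at `(τ, y)` of all tubes in the cluster of radius `R`. It contains every
  -- admissible `q`, and each admissible output tube has mass at least `S / G` there, so the sum
  -- over `q` is at most `G · S · S⁻¹` times a count.
  set S := ∑' k', near W R (W.pt (κ j₀)) k' * a k' (y - τ • W.vel k') with hS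
  -- Bounds the relative speed of output and cluster: `2(n+1) + 1` for the spectral width of the
  -- product, `(n+1)R` for the signed sum, `R` for the cluster itself.
  set L : ℝ := 4 * Real.pi * ((2 * (n + 1 : ℕ) + 1) * (1 + R)) with hL
  have hpi := Real.pi_pos
  have hL0 : 0 ≤ L := by positivity
  set G : ℝ≥0∞ := 2 ^ N * ENNReal.ofReal (1 / T + L) with hG
  have hT' : 0 < 1 / T := by positivity
  have hGle : G ≤ tubeConst N (n + 1) T * (1 + ENNReal.ofReal ‖W.vel (κ j₀) - W.vel (κ j₁)‖) := by
    have h1 : (1 : ℝ≥0∞) + ENNReal.ofReal ‖W.vel (κ j₀) - W.vel (κ j₁)‖ =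
        ENNReal.ofReal (1 + ‖W.vel (κ j₀) - W.vel (κ j₁)‖) := by
      rw [ENNReal.ofReal_add zero_le_one (norm_nonneg _), ENNReal.ofReal_one]
    rw [h1, hG, tubeConst, mul_assoc, ← ENNReal.ofReal_mul (by positivity), W.norm_vel_sub,
      norm_sub_rev, ← hR]
    refine mul_le_mul_right (ENNReal.ofReal_le_ofReal ?_) _
    have h2 : R ≤ 4 * Real.pi * R := by nlinarith [Real.pi_gt_three]
    have h3 : 1 + R ≤ 1 + 4 * Real.pi * R := by linarith
    calc 1 / T + L ≤ 1 / T * (1 + R) + L := by nlinarith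
      _ = (1 / T + 4 * Real.pi * (2 * (n + 1 : ℕ) + 1)) * (1 + R) := by rw [hL]; ring
      _ ≤ _ := by gcongr
  have hterm : ∀ q k, spreadInd W l j₀ j₁ (l.insertNth q κ) *
      near W (2 * (n + 1 : ℕ) + 1) (∑ i, σ i • W.pt ((l.insertNth q κ : Fin (n + 1) → Fin d → ℤ) i)) k *
        (a q (y - τ • W.vel q) * (tubeMass W.vel a T k (y - τ • W.vel k))⁻¹) ≤
      near W (2 * (n + 1 : ℕ) + 1) (∑ i, σ i • W.pt ((l.insertNth q κ : Fin (n + 1) → Fin d → ℤ) i)) k *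
        (near W R (W.pt (κ j₀)) q * a q (y - τ • W.vel q) * (G * S⁻¹)) := by
    intro q k
    by_cases hsp : Spread W l j₀ j₁ (l.insertNth q κ)
    swap
    · rw [spreadInd_of_not hsp, zero_mul, zero_mul]; exact zero_le
    rw [spreadInd_of hsp]
    rcases le_or_gt ‖W.pt k - ∑ i, σ i • W.pt ((l.insertNth q κ : Fin (n + 1) → Fin d → ℤ) i)‖
      (2 * (n + 1 : ℕ) + 1) with hk | hk
    swap
    · rw [near_of_lt hk, mul_zero, zero_mul]; exact zero_le
    have hsp' : ∀ i, ‖W.pt ((l.insertNth q κ : Fin (n + 1) → Fin d → ℤ) i) - W.pt (κ j₀)‖ ≤ R := by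
      intro i
      have := hsp i
      simpa using this
    have hq : ‖W.pt q - W.pt (κ j₀)‖ ≤ R := by simpa using hsp' l
    rw [near_of_le hq, one_mul, one_mul]
    refine mul_le_mul_right (mul_le_mul_right (inv_le_mul_inv_of_le ?_ (by finiteness) ?_) _) _
    · refine tsum_indicator_le_tubeMass hmod hT hL0 hτ y (fun k' => near_le_one _ _ _ _) ?_
      intro k' hk'
      have hk'' : ‖W.pt k' - W.pt (κ j₀)‖ ≤ R := by
        by_contra hcon
        exact hk' (near_of_lt (not_le.1 hcon))
      rw [W.norm_vel_sub, hL]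
      refine mul_le_mul_of_nonneg_left ?_ (by positivity)
      have h1 := norm_sum_smul_sub_le hσ hσ1 hsp'
      set Z := ∑ i, σ i • W.pt ((l.insertNth q κ : Fin (n + 1) → Fin d → ℤ) i)
      calc ‖W.pt k - W.pt k'‖ = ‖(W.pt k - Z) + (Z - W.pt (κ j₀)) - (W.pt k' - W.pt (κ j₀))‖ := by
            congr 1; abel
        _ ≤ (2 * (n + 1 : ℕ) + 1) + (n + 1 : ℕ) * R + R :=
            (norm_sub_le _ _).trans (add_le_add ((norm_add_le _ _).trans (add_le_add hk h1)) hk'')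
        _ ≤ _ := by
            push_cast
            nlinarith [mul_nonneg (Nat.cast_nonneg (α := ℝ) n) hR0]
    · have : 0 < ENNReal.ofReal (1 / T + L) := ENNReal.ofReal_pos.2 (by positivity)
      positivity
  calc _ ≤ ∑' q, ∑' k, near W (2 * (n + 1 : ℕ) + 1)
          (∑ i, σ i • W.pt ((l.insertNth q κ : Fin (n + 1) → Fin d → ℤ) i)) k *
        (near W R (W.pt (κ j₀)) q * a q (y - τ • W.vel q) * (G * S⁻¹)) :=
        ENNReal.tsum_le_tsum fun q => ENNReal.tsum_le_tsum fun k => hterm q k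
    _ ≤ ∑' q, C * (2 * (n + 1 : ℕ) + 2) ^ d *
        (near W R (W.pt (κ j₀)) q * a q (y - τ • W.vel q) * (G * S⁻¹)) := by
        refine ENNReal.tsum_le_tsum fun q => ?_
        rw [ENNReal.tsum_mul_right]
        refine mul_le_mul_left ((hCn _ _ (by positivity)).trans_eq ?_) _
        have h1 : (1 + (2 * ((n + 1 : ℕ) : ℝ) + 1)) = ((2 * (n + 1) + 2 : ℕ) : ℝ) := by push_cast; ring
        rw [h1, ENNReal.ofReal_pow (by positivity), ENNReal.ofReal_natCast]
        push_cast
        rfl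
    _ = C * (2 * (n + 1 : ℕ) + 2) ^ d * G * (S * S⁻¹) := by
        rw [ENNReal.tsum_mul_left, ENNReal.tsum_mul_right]; ring
    -- This holds also when `S` is `0` or `∞`.
    _ ≤ C * (2 * (n + 1 : ℕ) + 2) ^ d * G * 1 := mul_le_mul_right (ENNReal.mul_inv_le_one _) _
    _ ≤ _ := by
        rw [mul_one, mul_assoc (C * _)]
        exact mul_le_mul_right hGle _

/-- The remaining factors are controlled by the transversality of two of them. -/
theorem exists_lintegral_prod_le {d N : ℕ} (hN : d < N) : ∃ C : ℝ≥0∞, C ≠ ∞ ∧ 1 ≤ C ∧ ∀ (W : Window d)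
    (a : (Fin d → ℤ) → Rd d → ℝ≥0∞), (∀ k, Measurable (a k)) → (∀ k, Moderate N (a k)) → ∀ (T : ℝ)
    (n : ℕ) (j₀ j₁ : Fin n) (_ : j₀ ≠ j₁) (κ : Fin n → Fin d → ℤ),
    (1 + ENNReal.ofReal ‖W.vel (κ j₀) - W.vel (κ j₁)‖) *
      ∫⁻ τ in Set.Icc 0 T, ∫⁻ y, ∏ j, a (κ j) (y - τ • W.vel (κ j)) ≤
      C ^ n * (ENNReal.ofReal T + 2) * ∏ j, ∫⁻ x, a (κ j) x := by
  obtain ⟨C, hC, h⟩ := exists_lintegral_tube_mul_tube_le d N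
  set I := ∫⁻ y : Rd d, bump N y with hI
  have hI0 : I ≠ 0 := (lintegral_bump_pos N).ne'
  have hIt : I ≠ ∞ := (lintegral_bump_lt_top hN).ne
  refine ⟨C + I⁻¹ + 1, by finiteness, le_add_self, fun W a ha hmod T n j₀ j₁ hj κ => ?_⟩
  set D := C + I⁻¹ + 1 with hD
  have hD1 : 1 ≤ D := le_add_self
  -- All factors other than `j₀` and `j₁` are estimated in sup norm by their integrals, thanks to
  -- slow variation.
  have hsup : ∀ k x, a k x ≤ D * ∫⁻ x, a k x := by
    intro k x
    have h1 := (hmod k).mul_lintegral_bump_le x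
    have h2 : a k x ≤ (∫⁻ x, a k x) / I :=
      (ENNReal.le_div_iff_mul_le (Or.inl hI0) (Or.inl hIt)).2 h1
    refine h2.trans ?_
    rw [ENNReal.div_eq_inv_mul]
    exact mul_le_mul_left (le_add_self.trans le_self_add) _
  have hj' : j₁ ∈ Finset.univ.erase j₀ := by simp [hj.symm]
  have hsplit : ∀ f : Fin n → ℝ≥0∞, ∏ j, f j =
      f j₀ * f j₁ * ∏ j ∈ (Finset.univ.erase j₀).erase j₁, f j := fun f => by
    rw [mul_assoc, Finset.mul_prod_erase _ f hj', Finset.mul_prod_erase _ f (Finset.mem_univ _)]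
  set P := ∏ j ∈ (Finset.univ.erase j₀).erase j₁, ∫⁻ x, a (κ j) x with hP
  set E : ℝ≥0∞ := D ^ ((Finset.univ.erase j₀).erase j₁).card with hE
  have hcard : ((Finset.univ.erase j₀).erase j₁).card + 2 = n := by
    rw [Finset.card_erase_of_mem hj', Finset.card_erase_of_mem (Finset.mem_univ _), Finset.card_univ,
      Fintype.card_fin]
    have := j₀.2
    have := j₁.2
    have : (j₀ : ℕ) ≠ j₁ := fun h => hj (Fin.ext h)
    omega
  have hm : Measurable fun z : ℝ × Rd d =>
      a (κ j₀) (z.2 - z.1 • W.vel (κ j₀)) * a (κ j₁) (z.2 - z.1 • W.vel (κ j₁)) :=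
    ((ha _).comp (by fun_prop)).mul ((ha _).comp (by fun_prop))
  calc _ ≤ (1 + ENNReal.ofReal ‖W.vel (κ j₀) - W.vel (κ j₁)‖) * ∫⁻ τ in Set.Icc 0 T, ∫⁻ y,
        a (κ j₀) (y - τ • W.vel (κ j₀)) * a (κ j₁) (y - τ • W.vel (κ j₁)) * (E * P) := by
        refine mul_le_mul_right (lintegral_mono fun τ => lintegral_mono fun y => ?_) _
        rw [hsplit]
        refine mul_le_mul_right ?_ _
        rw [hE, hP, ← Finset.prod_const, ← Finset.prod_mul_distrib]
        exact Finset.prod_le_prod' fun j _ => hsup _ _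
    _ = (1 + ENNReal.ofReal ‖W.vel (κ j₀) - W.vel (κ j₁)‖) * (∫⁻ τ in Set.Icc 0 T, ∫⁻ y,
        a (κ j₀) (y - τ • W.vel (κ j₀)) * a (κ j₁) (y - τ • W.vel (κ j₁))) * (E * P) := by
        have h1 : ∀ τ : ℝ, ∫⁻ y, a (κ j₀) (y - τ • W.vel (κ j₀)) * a (κ j₁) (y - τ • W.vel (κ j₁)) *
            (E * P) = (∫⁻ y, a (κ j₀) (y - τ • W.vel (κ j₀)) * a (κ j₁) (y - τ • W.vel (κ j₁))) *
            (E * P) := fun τ => lintegral_mul_const _ (hm.comp measurable_prodMk_left)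
        simp_rw [h1]
        rw [lintegral_mul_const _ hm.lintegral_prod_right', mul_assoc]
    _ ≤ C * ((ENNReal.ofReal T + 2) * ((∫⁻ x, a (κ j₀) x) * ∫⁻ x, a (κ j₁) x)) * (E * P) :=
        mul_le_mul_left (h _ _ (ha _) (ha _) (hmod _) T _ _) _
    _ = C * E * (ENNReal.ofReal T + 2) * ∏ j, ∫⁻ x, a (κ j) x := by rw [hsplit]; ring
    _ ≤ _ := by
        gcongr
        rw [← hcard, pow_add, mul_comm]
        gcongr
        calc C ≤ D * 1 := by rw [mul_one, hD, add_assoc]; exact le_self_add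
          _ ≤ D * D := by gcongr
          _ = D ^ 2 := (sq D).symm

end TubeLemma

/-! ### The multilinear estimate in `L^{1/2}` -/

section TubeSum

variable {d : ℕ} {W : Window d} {a : (Fin d → ℤ) → Rd d → ℝ≥0∞} {N : ℕ}

/-- A product of tubes. -/
def tubeProd (W : Window d) (a : (Fin d → ℤ) → Rd d → ℝ≥0∞) {n : ℕ} (κ : Fin n → Fin d → ℤ)
    (z : ℝ × Rd d) : ℝ≥0∞ := ∏ i, a (κ i) (z.2 - z.1 • W.vel (κ i))

theorem measurable_tube (ha : ∀ k, Measurable (a k)) (k k' : Fin d → ℤ) :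
    Measurable fun z : ℝ × Rd d => a k (z.2 - z.1 • W.vel k') := (ha k).comp (by fun_prop)

theorem measurable_tubeProd (ha : ∀ k, Measurable (a k)) {n : ℕ} (κ : Fin n → Fin d → ℤ) :
    Measurable (tubeProd W a κ) :=
  Finset.measurable_prod _ fun _ _ => measurable_tube ha _ _

/-- The centre of the frequencies of a product. -/
def Window.centre (W : Window d) {n : ℕ} (σ : Fin n → ℝ) (κ : Fin n → Fin d → ℤ) : Rd d :=
  ∑ i, σ i • W.pt (κ i)

/-- The sum of the products that contribute to an output frequency. -/
def tubeSum (W : Window d) (a : (Fin d → ℤ) → Rd d → ℝ≥0∞) {n : ℕ} (σ : Fin n → ℝ)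
    (k : Fin d → ℤ) (z : ℝ × Rd d) : ℝ≥0∞ :=
  ∑' κ : Fin n → Fin d → ℤ, near W (2 * n + 1) (W.centre σ κ) k * tubeProd W a κ z

theorem measurable_tubeSum (ha : ∀ k, Measurable (a k)) {n : ℕ} (σ : Fin n → ℝ) (k : Fin d → ℤ) :
    Measurable (tubeSum W a σ k) :=
  Measurable.tsum fun κ => (measurable_tubeProd ha κ).const_mul _

/-- The measure of space-time on a time interval. -/
def slab (d : ℕ) (T : ℝ) : Measure (ℝ × Rd d) := (volume.restrict (Set.Icc 0 T)).prod volume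

instance (T : ℝ) : SFinite (slab d T) := by unfold slab; infer_instance

theorem ae_slab (T : ℝ) : ∀ᵐ z ∂slab d T, z.1 ∈ Set.Icc 0 T := by
  have h : ∀ᵐ τ ∂(volume.restrict (Set.Icc (0 : ℝ) T)), τ ∈ Set.Icc 0 T :=
    ae_restrict_mem measurableSet_Icc
  exact Measure.quasiMeasurePreserving_fst.ae h

theorem lintegral_slab {f : ℝ × Rd d → ℝ≥0∞} (hf : Measurable f) (T : ℝ) :
    ∫⁻ z, f z ∂slab d T = ∫⁻ τ in Set.Icc 0 T, ∫⁻ y, f (τ, y) :=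
  lintegral_prod _ hf.aemeasurable

/-- The bound for the multilinear form. -/
def tubeBound (N d n : ℕ) (T : ℝ) (C₁ C₂ A : ℝ≥0∞) : ℝ≥0∞ :=
  (n + 1 : ℕ) ^ 3 * (C₁ * (2 * (n + 1 : ℕ) + 2) ^ d * tubeConst N (n + 1) T *
    (C₂ ^ n * (ENNReal.ofReal T + 2) * A ^ n))

/-- The multilinear estimate: products of at least three tubes, divided by the mass of the output
tube. -/
theorem exists_tubeSum_div_le (W : Window d) {N : ℕ} (hN : d < N) : ∃ C₁ C₂ : ℝ≥0∞, C₁ ≠ ∞ ∧ C₂ ≠ ∞ ∧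
    1 ≤ C₂ ∧ ∀ a : (Fin d → ℤ) → Rd d → ℝ≥0∞, (∀ k, Measurable (a k)) → (∀ k, Moderate N (a k)) →
    ∀ T : ℝ, 0 < T → ∀ n : ℕ, 2 ≤ n → ∀ σ : Fin (n + 1) → ℝ, (∀ i, |σ i| = 1) → ∑ i, σ i = 1 →
    ∫⁻ z, ∑' k, tubeSum W a σ k z * (tubeMass W.vel a T k (z.2 - z.1 • W.vel k))⁻¹ ∂slab d T ≤
      tubeBound N d n T C₁ C₂ (∑' k, ∫⁻ x, a k x) := by
  obtain ⟨C₁, hC₁, h₁⟩ := exists_tsum_tsum_div_tubeMass_le W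
  obtain ⟨C₂, hC₂, hC₂1, h₂⟩ := exists_lintegral_prod_le hN
  refine ⟨C₁, C₂, hC₁, hC₂, hC₂1, fun a ha hmod T hT n hn σ hσ hσ1 => ?_⟩
  set Q : ℝ≥0∞ := C₁ * (2 * (n + 1 : ℕ) + 2) ^ d * tubeConst N (n + 1) T with hQ
  set X : Fin n → Fin n → (Fin n → Fin d → ℤ) → ℝ≥0∞ := fun j₀ j₁ κ =>
    1 + ENNReal.ofReal ‖W.vel (κ j₀) - W.vel (κ j₁)‖ with hX
  set S : Finset (Fin (n + 1) × Fin n × Fin n) := Finset.univ.filter fun t => t.2.1 ≠ t.2.2 with hS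
  -- pointwise bound
  have hpt : ∀ z : ℝ × Rd d, z.1 ∈ Set.Icc 0 T →
      ∑' k, tubeSum W a σ k z * (tubeMass W.vel a T k (z.2 - z.1 • W.vel k))⁻¹ ≤
        ∑ t ∈ S, ∑' κ : Fin n → Fin d → ℤ, Q * X t.2.1 t.2.2 κ * tubeProd W a κ z := by
    intro z hz
    set M : (Fin d → ℤ) → ℝ≥0∞ := fun k => (tubeMass W.vel a T k (z.2 - z.1 • W.vel k))⁻¹ with hM
    calc ∑' k, tubeSum W a σ k z * M k
        = ∑' κ : Fin (n + 1) → Fin d → ℤ, ∑' k,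
            near W (2 * (n + 1 : ℕ) + 1) (W.centre σ κ) k * (tubeProd W a κ z * M k) := by
          simp_rw [tubeSum, ← ENNReal.tsum_mul_right, mul_assoc]
          exact ENNReal.tsum_comm
      _ ≤ ∑' κ : Fin (n + 1) → Fin d → ℤ, ∑ t ∈ S, ∑' k,
            spreadInd W t.1 t.2.1 t.2.2 κ *
              near W (2 * (n + 1 : ℕ) + 1) (W.centre σ κ) k * (tubeProd W a κ z * M k) := by
          refine ENNReal.tsum_le_tsum fun κ => ?_
          -- Every multi-index is admissible for at least one triple; summing over all triples costs
          -- at most `(n+1)^3`.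
          obtain ⟨l, j₀, j₁, hj, hsp⟩ := exists_spread W hn κ
          refine le_trans ?_ (Finset.single_le_sum (fun _ _ => zero_le)
            (show (l, j₀, j₁) ∈ S by simp [hS, hj]))
          simp only [spreadInd_of hsp, one_mul]
          exact le_rfl
      _ = ∑ t ∈ S, ∑' κ : Fin (n + 1) → Fin d → ℤ, ∑' k,
            spreadInd W t.1 t.2.1 t.2.2 κ *
              near W (2 * (n + 1 : ℕ) + 1) (W.centre σ κ) k * (tubeProd W a κ z * M k) :=
          Summable.tsum_finsetSum fun _ _ => ENNReal.summable
      _ ≤ _ := by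
          refine Finset.sum_le_sum fun t _ => ?_
          obtain ⟨l, j₀, j₁⟩ := t
          simp only
          -- The multi-index splits into its `l`-th entry `q`, absorbed together with the output
          -- `k`, and the remaining entries.
          rw [← (Fin.insertNthEquiv (fun _ => Fin d → ℤ) l).tsum_eq, ENNReal.tsum_prod',
            ENNReal.tsum_comm]
          refine ENNReal.tsum_le_tsum fun κ => ?_
          have h3 := h₁ N a hmod T hT n σ hσ hσ1 l j₀ j₁ κ z.1 hz z.2
          refine le_trans (le_of_eq ?_) ((mul_le_mul_left h3 (tubeProd W a κ z)).trans_eq ?_)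
          · rw [← ENNReal.tsum_mul_right]
            refine tsum_congr fun q => ?_
            rw [← ENNReal.tsum_mul_right]
            refine tsum_congr fun k => ?_
            have h4 : tubeProd W a (Fin.insertNthEquiv (fun _ => Fin d → ℤ) l (q, κ)) z =
                a q (z.2 - z.1 • W.vel q) * tubeProd W a κ z := by
              rw [tubeProd, Fin.prod_univ_succAbove _ l, tubeProd]
              simp [Fin.insertNthEquiv]
            rw [h4, hM]
            simp only [Fin.insertNthEquiv, Equiv.coe_fn_mk, Window.centre]
            ring
          · rfl
  have hmeas : ∀ (c : (Fin n → Fin d → ℤ) → ℝ≥0∞), Measurable fun z : ℝ × Rd d =>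
      ∑' κ : Fin n → Fin d → ℤ, c κ * tubeProd W a κ z := fun c =>
    Measurable.tsum fun κ => (measurable_tubeProd ha κ).const_mul _
  calc _ ≤ ∫⁻ z, ∑ t ∈ S, ∑' κ : Fin n → Fin d → ℤ, Q * X t.2.1 t.2.2 κ * tubeProd W a κ z
          ∂slab d T := lintegral_mono_ae ((ae_slab T).mono hpt)
    _ = ∑ t ∈ S, ∑' κ : Fin n → Fin d → ℤ, Q * (X t.2.1 t.2.2 κ *
          ∫⁻ z, tubeProd W a κ z ∂slab d T) := by
        rw [lintegral_finsetSum _ fun t _ => hmeas _]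
        refine Finset.sum_congr rfl fun t _ => ?_
        rw [lintegral_tsum fun κ => ((measurable_tubeProd ha κ).const_mul _).aemeasurable]
        refine tsum_congr fun κ => ?_
        rw [lintegral_const_mul _ (measurable_tubeProd ha κ), mul_assoc]
    _ ≤ ∑ t ∈ S, Q * (C₂ ^ n * (ENNReal.ofReal T + 2) * (∑' k, ∫⁻ x, a k x) ^ n) := by
        refine Finset.sum_le_sum fun t ht => ?_
        rw [ENNReal.tsum_mul_left]
        refine mul_le_mul_right ?_ _
        have hpow : (∑' k, ∫⁻ x, a k x) ^ n = ∑' κ : Fin n → Fin d → ℤ, ∏ j, ∫⁻ x, a (κ j) x := by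
          rw [ennreal_tsum_pi_prod n fun _ k => ∫⁻ x, a k x]
          simp
        rw [hpow, ← ENNReal.tsum_mul_left]
        refine ENNReal.tsum_le_tsum fun κ => ?_
        rw [lintegral_slab (measurable_tubeProd ha κ)]
        exact h₂ W a ha hmod T n t.2.1 t.2.2 (by simpa [hS] using ht) κ
    _ ≤ _ := by
        rw [Finset.sum_const, nsmul_eq_mul, tubeBound]
        refine mul_le_mul_left ?_ _
        have hcard : S.card ≤ (n + 1) ^ 3 := by
          refine (Finset.card_le_univ S).trans ?_
          rw [Fintype.card_prod, Fintype.card_prod, Fintype.card_fin, Fintype.card_fin]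
          calc (n + 1) * (n * n) ≤ (n + 1) * ((n + 1) * (n + 1)) := by gcongr <;> omega
            _ = (n + 1) ^ 3 := by ring
        exact_mod_cast hcard

/-- The multilinear form with a kernel attached to the output tube. -/
def tubeForm (W : Window d) (N : ℕ) (a : (Fin d → ℤ) → Rd d → ℝ≥0∞) {n : ℕ} (σ : Fin n → ℝ) (T : ℝ)
    (k : Fin d → ℤ) (x : Rd d) : ℝ≥0∞ :=
  ∫⁻ z, tubeSum W a σ k z * bump (N + (d + 1)) (x - (z.2 - z.1 • W.vel k)) ∂slab d T

theorem measurable_tubeForm_integrand (ha : ∀ k, Measurable (a k)) {n : ℕ} (σ : Fin n → ℝ)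
    (k : Fin d → ℤ) : Measurable fun q : Rd d × (ℝ × Rd d) =>
      tubeSum W a σ k q.2 * bump (N + (d + 1)) (q.1 - (q.2.2 - q.2.1 • W.vel k)) :=
  ((measurable_tubeSum ha σ k).comp measurable_snd).mul ((measurable_bump _).comp (by fun_prop))

theorem measurable_tubeForm (ha : ∀ k, Measurable (a k)) {n : ℕ} (σ : Fin n → ℝ) (T : ℝ)
    (k : Fin d → ℤ) : Measurable (tubeForm W N a σ T k) :=
  (measurable_tubeForm_integrand ha σ k).lintegral_prod_right'

/-- The inverse of a slowly varying weight is slowly varying too: exponent `N` of the kernel moves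
the weight from `x` to `z`, and the exponent `d + 1` left over is integrable. -/
theorem lintegral_inv_mul_bump_le {m : Rd d → ℝ≥0∞} (hm : Moderate N m) (z : Rd d) :
    ∫⁻ x, (m x)⁻¹ * bump (N + (d + 1)) (x - z) ≤ (m z)⁻¹ * ∫⁻ x : Rd d, bump (d + 1) x := by
  have hmeas : Measurable fun x : Rd d => bump (d + 1) (x - z) :=
    (measurable_bump _).comp (measurable_id.sub_const z)
  rw [← lintegral_comp_sub_right (bump (d + 1)) z, ← lintegral_const_mul _ hmeas]
  refine lintegral_mono fun x => ?_
  have h0 := (bump_pos N (z - x)).ne'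
  have ht := bump_ne_top N (z - x)
  have h1 : m z ≤ (bump N (z - x))⁻¹ * m x := by
    calc m z = (bump N (z - x))⁻¹ * (m z * bump N (z - x)) := by
          rw [mul_comm (m z), ← mul_assoc, ENNReal.inv_mul_cancel h0 ht, one_mul]
      _ ≤ _ := mul_le_mul_right (hm z x) _
  have h2 := inv_le_mul_inv_of_le h1 (ENNReal.inv_ne_top.2 h0) (ENNReal.inv_ne_zero.2 ht)
  calc (m x)⁻¹ * bump (N + (d + 1)) (x - z)
      ≤ ((bump N (z - x))⁻¹ * (m z)⁻¹) * (bump N (z - x) * bump (d + 1) (x - z)) := by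
        rw [bump_add, bump_sub_comm N x z]
        exact mul_le_mul_left h2 _
    _ = ((bump N (z - x))⁻¹ * bump N (z - x)) * ((m z)⁻¹ * bump (d + 1) (x - z)) := by ring
    _ = _ := by rw [ENNReal.inv_mul_cancel h0 ht, one_mul]

theorem lintegral_kernel_mul_inv_le {Z : Type*} [MeasurableSpace Z] {Q : Z → ℝ≥0∞}
    (hQ : Measurable Q) {m : Rd d → ℝ≥0∞} (hm : Measurable m) (hmod : Moderate N m) {e : Z → Rd d}
    (he : Measurable e) (μ : Measure Z) [SFinite μ] :
    ∫⁻ x, (∫⁻ z, Q z * bump (N + (d + 1)) (x - e z) ∂μ) * (m x)⁻¹ ≤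
      (∫⁻ x : Rd d, bump (d + 1) x) * ∫⁻ z, Q z * (m (e z))⁻¹ ∂μ := by
  have hb : Measurable fun q : Rd d × Z => bump (N + (d + 1)) (q.1 - e q.2) :=
    (measurable_bump _).comp (measurable_fst.sub (he.comp measurable_snd))
  have hz : ∀ x, Measurable fun z => Q z * bump (N + (d + 1)) (x - e z) := fun x =>
    hQ.mul ((measurable_bump _).comp (he.const_sub x))
  have hx : ∀ z, Measurable fun x => (m x)⁻¹ * bump (N + (d + 1)) (x - e z) := fun z =>
    hm.inv.mul ((measurable_bump _).comp (measurable_id.sub_const _))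
  have hxz : Measurable fun q : Rd d × Z => Q q.2 * ((m q.1)⁻¹ * bump (N + (d + 1)) (q.1 - e q.2)) :=
    (hQ.comp measurable_snd).mul ((hm.inv.comp measurable_fst).mul hb)
  have hme : Measurable fun z => Q z * (m (e z))⁻¹ := hQ.mul (hm.comp he).inv
  calc _ = ∫⁻ x, ∫⁻ z, Q z * ((m x)⁻¹ * bump (N + (d + 1)) (x - e z)) ∂μ := by
        refine lintegral_congr fun x => ?_
        rw [← lintegral_mul_const _ (hz x)]
        exact lintegral_congr fun z => by rw [mul_assoc, mul_comm (bump _ _)]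
    _ = ∫⁻ z, Q z * (∫⁻ x, (m x)⁻¹ * bump (N + (d + 1)) (x - e z)) ∂μ := by
        rw [lintegral_lintegral_swap hxz.aemeasurable]
        exact lintegral_congr fun z => lintegral_const_mul _ (hx z)
    _ ≤ ∫⁻ z, (∫⁻ x : Rd d, bump (d + 1) x) * (Q z * (m (e z))⁻¹) ∂μ := by
        refine lintegral_mono fun z => ?_
        refine (mul_le_mul_right (lintegral_inv_mul_bump_le hmod (e z)) _).trans_eq ?_
        rw [← mul_assoc, mul_comm]
    _ = _ := lintegral_const_mul _ hme

/-- The kernel that spreads the output tube costs only a constant, so the estimate reduces to that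
for the bare products. -/
theorem exists_tubeForm_div_le (W : Window d) {N : ℕ} (hN : d < N) : ∃ C₁ C₂ : ℝ≥0∞, C₁ ≠ ∞ ∧
    C₂ ≠ ∞ ∧ 1 ≤ C₂ ∧ ∀ a : (Fin d → ℤ) → Rd d → ℝ≥0∞, (∀ k, Measurable (a k)) →
    (∀ k, Moderate N (a k)) →
    ∀ T : ℝ, 0 < T → ∀ n : ℕ, 2 ≤ n → ∀ σ : Fin (n + 1) → ℝ, (∀ i, |σ i| = 1) → ∑ i, σ i = 1 →
    ∑' k, ∫⁻ x, tubeForm W N a σ T k x * (tubeMass W.vel a T k x)⁻¹ ≤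
      tubeBound N d n T C₁ C₂ (∑' k, ∫⁻ x, a k x) := by
  obtain ⟨C₁, C₂, hC₁, hC₂, h1C, h⟩ := exists_tubeSum_div_le W hN
  set I := ∫⁻ x : Rd d, bump (d + 1) x with hI
  have hIt : I ≠ ∞ := (lintegral_bump_lt_top (Nat.lt_succ_self d)).ne
  refine ⟨I * C₁, C₂, by finiteness, hC₂, h1C, fun a ha hmod T hT n hn σ hσ hσ1 => ?_⟩
  have hm := fun k => measurable_tubeMass (v := W.vel) ha T k
  have hmz : ∀ k, Measurable fun z : ℝ × Rd d => (tubeMass W.vel a T k (z.2 - z.1 • W.vel k))⁻¹ :=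
    fun k => ((hm k).comp (by fun_prop)).inv
  have hk : ∀ k, ∫⁻ x, tubeForm W N a σ T k x * (tubeMass W.vel a T k x)⁻¹ ≤
      I * ∫⁻ z, tubeSum W a σ k z * (tubeMass W.vel a T k (z.2 - z.1 • W.vel k))⁻¹ ∂slab d T :=
    fun k => lintegral_kernel_mul_inv_le (measurable_tubeSum ha σ k) (hm k)
      (moderate_tubeMass hmod T k) (e := fun z : ℝ × Rd d => z.2 - z.1 • W.vel k) (by fun_prop) _
  calc _ ≤ ∑' k, I * ∫⁻ z, tubeSum W a σ k z *
          (tubeMass W.vel a T k (z.2 - z.1 • W.vel k))⁻¹ ∂slab d T := ENNReal.tsum_le_tsum hk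
    _ = I * ∫⁻ z, ∑' k, tubeSum W a σ k z *
          (tubeMass W.vel a T k (z.2 - z.1 • W.vel k))⁻¹ ∂slab d T := by
        have hk' : ∀ k, Measurable fun z : ℝ × Rd d => tubeSum W a σ k z *
            (tubeMass W.vel a T k (z.2 - z.1 • W.vel k))⁻¹ := fun k =>
          (measurable_tubeSum ha σ k).mul (hmz k)
        rw [ENNReal.tsum_mul_left, lintegral_tsum fun k => (hk' k).aemeasurable]
    _ ≤ I * tubeBound N d n T C₁ C₂ (∑' k, ∫⁻ x, a k x) :=
        mul_le_mul_right (h a ha hmod T hT n hn σ hσ hσ1) _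
    _ = _ := by rw [tubeBound, tubeBound]; ring

/-- Cauchy–Schwarz against a positive weight. -/
theorem eLpNorm_half_le {f : Rd d → ℂ} {b m : Rd d → ℝ≥0∞} (hb : Measurable b) (hm : Measurable m)
    (hm0 : ∀ x, m x ≠ 0) (hmt : ∀ x, m x ≠ ∞) (hf : ∀ x, ‖f x‖ₑ ≤ b x) :
    eLpNorm f (1 / 2) volume ≤ (∫⁻ x, m x) * ∫⁻ x, b x * (m x)⁻¹ := by
  have h2 : ((1 / 2 : ℝ≥0∞)).toReal = 1 / 2 := by simp
  rw [eLpNorm_eq_lintegral_rpow_enorm_toReal (by simp) (by simp), h2, one_div_one_div]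
  -- The positivity and finiteness of `m` allow insertion of `m · m⁻¹ = 1`.
  have h3 : ∀ x, ‖f x‖ₑ ^ (1 / 2 : ℝ) ≤ m x ^ (1 / 2 : ℝ) * (b x * (m x)⁻¹) ^ (1 / 2 : ℝ) := by
    intro x
    rw [← ENNReal.mul_rpow_of_nonneg _ _ (by norm_num), mul_left_comm,
      ENNReal.mul_inv_cancel (hm0 x) (hmt x), mul_one]
    exact ENNReal.rpow_le_rpow (hf x) (by norm_num)
  have h4 := ENNReal.lintegral_mul_le_Lp_mul_Lq volume Real.HolderConjugate.two_two
    (f := fun x => m x ^ (1 / 2 : ℝ)) (g := fun x => (b x * (m x)⁻¹) ^ (1 / 2 : ℝ))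
    (hm.pow_const _).aemeasurable ((hb.mul hm.inv).pow_const _).aemeasurable
  have h5 : ∀ y : ℝ≥0∞, (y ^ (1 / 2 : ℝ)) ^ (2 : ℝ) = y := fun y => by
    rw [← ENNReal.rpow_mul]; norm_num
  simp_rw [h5, Pi.mul_apply] at h4
  calc _ ≤ ((∫⁻ x, m x) ^ (1 / 2 : ℝ) * (∫⁻ x, b x * (m x)⁻¹) ^ (1 / 2 : ℝ)) ^ (2 : ℝ) :=
        ENNReal.rpow_le_rpow ((lintegral_mono h3).trans h4) (by norm_num)
    _ = _ := by rw [ENNReal.mul_rpow_of_nonneg _ _ (by norm_num), h5, h5]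

end TubeSum

/-! ### Blocks of the nonlinearity in terms of tubes -/

section NonlinearBlocks

variable {d : ℕ}

/-- The signs of the frequencies in `|u|^{2m} u`. -/
def altSign {n : ℕ} (i : Fin n) : ℝ := (-1) ^ (i : ℕ)

theorem abs_altSign {n : ℕ} (i : Fin n) : |altSign i| = 1 := by
  rw [altSign, abs_pow, abs_neg, abs_one, one_pow]

theorem sum_altSign (m : ℕ) : ∑ i : Fin (2 * m + 1), altSign i = 1 := by
  simp only [altSign]
  rw [Fin.sum_univ_eq_sum_range (fun i => (-1 : ℝ) ^ i)]
  induction m with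
  | zero => simp
  | succ m ih =>
    rw [show 2 * (m + 1) + 1 = 2 * m + 1 + 1 + 1 by ring, Finset.sum_range_succ,
      Finset.sum_range_succ, ih, (odd_two_mul_add_one m).neg_one_pow,
      (show Even (2 * m + 1 + 1) from ⟨m + 1, by ring⟩).neg_one_pow]
    norm_num

/-- The conjugations in `|u|^{2m} u`. -/
def altConj (f : Rd d →ᵇ ℂ) (i : ℕ) : Rd d →ᵇ ℂ := if Even i then f else star f

theorem prod_altConj (f : Rd d →ᵇ ℂ) (m : ℕ) (x : Rd d) :
    (∏ i : Fin (2 * m + 1), altConj f i) x = ((‖f x‖ ^ (2 * m) : ℝ) : ℂ) * f x := by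
  rw [bcf_prod_apply, Fin.prod_univ_eq_prod_range (fun i => altConj f i x)]
  induction m with
  | zero => simp [altConj]
  | succ m ih =>
    have h1 : altConj f (2 * m + 1) x = (starRingEnd ℂ) (f x) := by
      rw [altConj, if_neg (by rw [Nat.not_even_iff_odd]; exact odd_two_mul_add_one m)]
      rfl
    have h2 : altConj f (2 * m + 1 + 1) x = f x := by
      rw [altConj, if_pos ⟨m + 1, by ring⟩]
    rw [show 2 * (m + 1) + 1 = 2 * m + 1 + 1 + 1 by ring, Finset.prod_range_succ,
      Finset.prod_range_succ, ih, h1, h2, mul_assoc, mul_assoc, ← mul_assoc (f x) _ (f x),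
      Complex.mul_conj, Complex.normSq_eq_norm_sq, mul_add, pow_add]
    push_cast
    ring

theorem altConj_tsum {K : Type*} (b : K → Rd d →ᵇ ℂ) (i : ℕ) :
    altConj (∑' k, b k) i = ∑' k, altConj (b k) i := by
  unfold altConj
  split_ifs
  · rfl
  · exact tsum_star_bcf.symm

theorem enorm_altConj_apply (f : Rd d →ᵇ ℂ) (i : ℕ) (x : Rd d) : ‖altConj f i x‖ₑ = ‖f x‖ₑ := by
  unfold altConj
  split_ifs
  · rfl
  · exact enorm_star_apply f x

theorem norm_altConj (f : Rd d →ᵇ ℂ) (i : ℕ) : ‖altConj f i‖ = ‖f‖ := by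
  unfold altConj
  split_ifs
  · rfl
  · exact norm_star f

theorem BandLimited.altConj {c : Rd d} {r : ℝ} {f : Rd d →ᵇ ℂ} (h : BandLimited c r f) {n : ℕ}
    (i : Fin n) : BandLimited (altSign i • c) r (altConj f i) := by
  unfold NLSMod.altConj altSign
  split_ifs with hi
  · rw [hi.neg_one_pow, one_smul]; exact h
  · rw [(Nat.not_even_iff_odd.1 hi).neg_one_pow, neg_one_smul]; exact h.star

variable {W : Window d} {p : ℝ≥0∞} {s : ℝ} [hp : Fact (1 ≤ p)] [hs : Fact (0 ≤ s)]

/-- Expand `|u|^{2m} u` as a product of `2m + 1` block series, every second one conjugated;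
conjugation flips the sign of the frequency and keeps absolute values. -/
theorem ModSpace.absBlock_gauge_le (u : ModSpace W p s) (m : ℕ) (k : Fin d → ℤ) (x : Rd d) :
    absBlock W (ofBdd (u.gauge m).bcf) k x ≤ ∑' κ : Fin (2 * m + 1) → Fin d → ℤ,
      near W (2 * (2 * m + 1 : ℕ) + 1) (W.centre altSign κ) k *
        ∫⁻ y, (∏ i, absBlock W (ofBdd u.bcf) (κ i) y) * ‖W.χ (x - y)‖ₑ := by
  obtain ⟨b, hbx, hbs, hub⟩ := exists_bcf_blocks W (half_le_of_one_le hp.out) hs.out u.mem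
  have h1 : (u.gauge m).bcf = ∏ i : Fin (2 * m + 1), ∑' κ, altConj (b κ) i := by
    refine BoundedContinuousFunction.ext fun y => ?_
    rw [ModSpace.gauge_apply, ← prod_altConj, ofBdd_injective hub]
    simp_rw [altConj_tsum]
  rw [h1]
  refine (absBlock_prod_le W (σ := altSign) (fun i κ =>
    (bandLimited_of_block W _ κ _ (hbx κ)).altConj i) (fun i => ?_) k x).trans_eq ?_
  · simpa only [norm_altConj] using hbs
  · simp only [enorm_altConj_apply, hbx]
    rfl

theorem ModSpace.absBlock_nonlin_le {c : ℕ → ℝ} {F : ℂ → ℂ} (h : IsGaugeSeries c F)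
    (u : ModSpace W p s) (k : Fin d → ℤ) (x : Rd d) :
    absBlock W (ofBdd (u.nonlin c).bcf) k x ≤
      ∑' m, ‖c m‖ₑ * absBlock W (ofBdd (u.gauge m).bcf) k x := by
  have h1 := ((pairing (reflectAt x (modulate (W.pt k) W.χ))).comp (ModSpace.toBCF W p s)).map_tsum
    (ModSpace.summable_gauge h u)
  have h2 : block W (ofBdd (u.nonlin c).bcf) k x =
      ∑' m, ((c m : ℝ) : ℂ) * block W (ofBdd (u.gauge m).bcf) k x := by
    refine h1.trans (tsum_congr fun m => ?_)
    rw [map_smul]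
    rfl
  rw [absBlock, h2]
  refine enorm_tsum_le_tsum_enorm.trans (ENNReal.tsum_le_tsum fun m => ?_)
  rw [enorm_mul, absBlock]
  refine mul_le_mul_left (le_of_eq ?_) _
  rw [← ofReal_norm, ← ofReal_norm, Complex.norm_real]

/-- The transport estimate in integral form, which unlike its maximal function version keeps the
profile linear. -/
theorem exists_absBlock_prop_le_lintegral (d M : ℕ) (T : ℝ) : ∃ C : ℝ≥0∞, C ≠ ∞ ∧
    ∀ (W : Window d) (v : 𝓢'(Rd d, ℂ)) (k : Fin d → ℤ) (t : ℝ), |t| ≤ T → ∀ x,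
      absBlock W (prop t v) k x ≤
        C * ∫⁻ z, absBlock W v k z * bump M (x - t • W.vel k - z) := by
  obtain ⟨C, hC, h⟩ := enorm_propS_decay M T (fat d)
  refine ⟨C, hC, fun W v k t ht x => ?_⟩
  have hm : Measurable fun z => absBlock W v k z * bump M (x - t • W.vel k - z) :=
    (measurable_absBlock W v k).mul ((measurable_bump _).comp (measurable_const.sub measurable_id))
  rw [absBlock, block_prop, ← lintegral_const_mul _ hm]
  refine (enorm_integral_le_lintegral_enorm _).trans (lintegral_mono fun z => ?_)
  rw [enorm_mul, enorm_propS_modulate, mul_left_comm]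
  refine mul_le_mul_right ((h t ht _).trans_eq ?_) _
  rw [Window.vel, smul_smul, mul_comm t, sub_right_comm]

theorem lintegral_bump_mul_bump_le (M : ℕ) (x y : Rd d) :
    ∫⁻ z, bump (M + (d + 1)) (z - y) * bump M (x - z) ≤
      (∫⁻ z : Rd d, bump (d + 1) z) * bump M (x - y) := by
  have hm : Measurable fun z : Rd d => bump (d + 1) (z - y) :=
    (measurable_bump _).comp (measurable_id.sub_const y)
  rw [← lintegral_comp_sub_right (bump (d + 1)) y, ← lintegral_mul_const _ hm]
  refine lintegral_mono fun z => ?_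
  rw [bump_add, mul_right_comm, mul_comm (bump (d + 1) _)]
  refine mul_le_mul_left ?_ _
  rw [mul_comm]
  refine (bump_mul_le _ _ _).trans_eq ?_
  rw [sub_add_sub_cancel]

/-- The blocks of the vector field in terms of the tubes that carry the solution. -/
theorem ModSpace.exists_absBlock_field_le (W : Window d) (N : ℕ) (T : ℝ) (p : ℝ≥0∞) {s : ℝ}
    [hp : Fact (1 ≤ p)] [hs : Fact (0 ≤ s)] : ∃ D B : ℝ≥0∞, D ≠ ∞ ∧ B ≠ ∞ ∧ ∀ {c : ℕ → ℝ} {F : ℂ → ℂ},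
    IsGaugeSeries c F → ∀ (a : (Fin d → ℤ) → Rd d → ℝ≥0∞) (E : ℝ≥0∞), (∀ k, Measurable (a k)) →
    ∀ τ ∈ Set.Icc 0 T, ∀ w : ModSpace W p s,
    (∀ k y, wt W s k * absBlock W (prop τ (ofBdd w.bcf)) k y ≤ E * a k (y - τ • W.vel k)) →
    ∀ k x, wt W s k * absBlock W (ofBdd (ModSpace.field c τ w).bcf) k x ≤
      D * ∑' m, ‖c m‖ₑ * (B * E) ^ (2 * m + 1) *
        ∫⁻ y, tubeSum W a (altSign : Fin (2 * m + 1) → ℝ) k (τ, y) *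
          bump (N + (d + 1)) (x - (y - τ • W.vel k)) := by
  obtain ⟨C₁, hC₁, h₁⟩ := exists_absBlock_prop_le_lintegral d (N + (d + 1)) T
  obtain ⟨C₂, hC₂, h₂⟩ := enorm_schwartz_decay (N + (d + 1) + (d + 1)) W.χ
  obtain ⟨B, hB, -, hBn⟩ := wt_le_of_near W hs.out
  set I := ∫⁻ x : Rd d, bump (d + 1) x with hI
  have hIt : I ≠ ∞ := (lintegral_bump_lt_top (Nat.lt_succ_self d)).ne
  set M := N + (d + 1) with hM
  refine ⟨C₁ * C₂ * I, B, by finiteness, hB, fun {c F} hc a E ha τ hτ w hw k x => ?_⟩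
  set u := ModSpace.schr τ w with hu
  -- The backward evolution carries the output block along its tube, from `x'` at time `τ` to `x` at
  -- time `0`.
  set x' := x + τ • W.vel k with hx'
  have hfield : absBlock W (ofBdd (ModSpace.field c τ w).bcf) k x =
      absBlock W (prop (-τ) (ofBdd (u.nonlin c).bcf)) k x := by
    rw [ModSpace.field, map_smul, ofBdd_smul, absBlock, block_smul, Pi.smul_apply, enorm_smul,
      ModSpace.ofBdd_schr, absBlock, ← ofReal_norm Complex.I, Complex.norm_I, ENNReal.ofReal_one,
      one_mul]
  have hmbk : ∀ κ, Measurable (absBlock W (ofBdd u.bcf) κ) := measurable_absBlock W _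
  have hprod : ∀ (m : ℕ) (κ : Fin (2 * m + 1) → Fin d → ℤ),
      Measurable fun y => ∏ i, absBlock W (ofBdd u.bcf) (κ i) y := fun m κ =>
    Finset.measurable_prod _ fun i _ => hmbk _
  have hmz : ∀ x : Rd d, Measurable fun z : Rd d => bump M (x - z) := fun x =>
    (measurable_bump _).comp (measurable_const.sub measurable_id)
  have hmχ : Measurable fun y => ‖W.χ y‖ₑ := W.χ.continuous.measurable.enorm
  -- one product
  have hone : ∀ (m : ℕ) (κ : Fin (2 * m + 1) → Fin d → ℤ),
      ∫⁻ z, (∫⁻ y, (∏ i, absBlock W (ofBdd u.bcf) (κ i) y) * ‖W.χ (z - y)‖ₑ) * bump M (x' - z) ≤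
        C₂ * I * ∫⁻ y, (∏ i, absBlock W (ofBdd u.bcf) (κ i) y) * bump M (x' - y) := by
    intro m κ
    have hzy : Measurable fun q : Rd d × Rd d => (∏ i, absBlock W (ofBdd u.bcf) (κ i) q.2) *
        ‖W.χ (q.1 - q.2)‖ₑ * bump M (x' - q.1) :=
      (((hprod m κ).comp measurable_snd).mul (hmχ.comp (measurable_fst.sub measurable_snd))).mul
        ((hmz x').comp measurable_fst)
    have hy : ∀ z : Rd d, Measurable fun y => (∏ i, absBlock W (ofBdd u.bcf) (κ i) y) *
        ‖W.χ (z - y)‖ₑ := fun z =>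
      (hprod m κ).mul (hmχ.comp (measurable_const.sub measurable_id))
    calc _ = ∫⁻ z, ∫⁻ y, (∏ i, absBlock W (ofBdd u.bcf) (κ i) y) * ‖W.χ (z - y)‖ₑ *
            bump M (x' - z) := lintegral_congr fun z => (lintegral_mul_const _ (hy z)).symm
      _ = ∫⁻ y, ∫⁻ z, (∏ i, absBlock W (ofBdd u.bcf) (κ i) y) * ‖W.χ (z - y)‖ₑ *
            bump M (x' - z) := lintegral_lintegral_swap hzy.aemeasurable
      _ ≤ ∫⁻ y, C₂ * I * ((∏ i, absBlock W (ofBdd u.bcf) (κ i) y) * bump M (x' - y)) := by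
          refine lintegral_mono fun y => ?_
          have hbb : Measurable fun z : Rd d => bump (M + (d + 1)) (z - y) * bump M (x' - z) :=
            ((measurable_bump _).comp (measurable_id.sub_const y)).mul (hmz x')
          calc _ ≤ ∫⁻ z, (∏ i, absBlock W (ofBdd u.bcf) (κ i) y) * C₂ *
                (bump (M + (d + 1)) (z - y) * bump M (x' - z)) := by
                refine lintegral_mono fun z => ?_
                rw [mul_assoc, mul_assoc]
                refine mul_le_mul_right ?_ _
                rw [← mul_assoc]
                exact mul_le_mul_left (h₂ _) _
            _ ≤ (∏ i, absBlock W (ofBdd u.bcf) (κ i) y) * C₂ * (I * bump M (x' - y)) := by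
                rw [lintegral_const_mul _ hbb]
                exact mul_le_mul_right (lintegral_bump_mul_bump_le M x' y) _
            _ = _ := by ring
      _ = _ := lintegral_const_mul _ ((hprod m κ).mul (hmz x'))
  -- weights
  have hweight : ∀ (m : ℕ) (κ : Fin (2 * m + 1) → Fin d → ℤ) (y : Rd d),
      wt W s k * (near W (2 * (2 * m + 1 : ℕ) + 1) (W.centre altSign κ) k *
        ∏ i, absBlock W (ofBdd u.bcf) (κ i) y) ≤ (B * E) ^ (2 * m + 1) *
        (near W (2 * (2 * m + 1 : ℕ) + 1) (W.centre altSign κ) k * tubeProd W a κ (τ, y)) := by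
    intro m κ y
    rcases le_or_gt ‖W.pt k - W.centre altSign κ‖ (2 * (2 * m + 1 : ℕ) + 1) with h | h
    swap
    · rw [near_of_lt h]; simp
    rw [near_of_le h, one_mul, one_mul]
    calc _ ≤ B ^ (2 * m + 1) * (∏ i, wt W s (κ i)) * ∏ i, absBlock W (ofBdd u.bcf) (κ i) y :=
          mul_le_mul_left (hBn _ altSign κ k (by omega) abs_altSign h) _
      _ = B ^ (2 * m + 1) * ∏ i, (wt W s (κ i) * absBlock W (ofBdd u.bcf) (κ i) y) := by
          rw [mul_assoc, Finset.prod_mul_distrib]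
      _ ≤ B ^ (2 * m + 1) * ∏ i, (E * a (κ i) (y - τ • W.vel (κ i))) := by
          refine mul_le_mul_right (Finset.prod_le_prod' fun i _ => ?_) _
          rw [hu, ModSpace.ofBdd_schr]
          exact hw _ _
      _ = _ := by
          rw [Finset.prod_mul_distrib, Finset.prod_const, Finset.card_univ, Fintype.card_fin, mul_pow,
            tubeProd, mul_assoc]
  have hmI : ∀ (m : ℕ) (κ : Fin (2 * m + 1) → Fin d → ℤ),
      Measurable fun z => ∫⁻ y, (∏ i, absBlock W (ofBdd u.bcf) (κ i) y) * ‖W.χ (z - y)‖ₑ := fun m κ =>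
    (((hprod m κ).comp measurable_snd).mul
      (hmχ.comp (measurable_fst.sub measurable_snd))).lintegral_prod_right'
  have htp : ∀ (m : ℕ) (κ : Fin (2 * m + 1) → Fin d → ℤ),
      Measurable fun y : Rd d => tubeProd W a κ (τ, y) := fun m κ =>
    (measurable_tubeProd ha κ).comp measurable_prodMk_left
  have hxx : ∀ y : Rd d, x - (y - τ • W.vel k) = x' - y := fun y => by rw [hx']; abel
  simp only [hxx]
  -- assemble
  have hlow : absBlock W (ofBdd (ModSpace.field c τ w).bcf) k x ≤ C₁ * ∑' m, ‖c m‖ₑ *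
      ∑' κ : Fin (2 * m + 1) → Fin d → ℤ, near W (2 * (2 * m + 1 : ℕ) + 1) (W.centre altSign κ) k *
        (C₂ * I * ∫⁻ y, (∏ i, absBlock W (ofBdd u.bcf) (κ i) y) * bump M (x' - y)) := by
    rw [hfield]
    have hx'' : x - (-τ) • W.vel k = x' := by rw [neg_smul, sub_neg_eq_add]
    have h3 := h₁ W (ofBdd (u.nonlin c).bcf) k (-τ)
      (by rw [abs_neg]; exact abs_le.2 ⟨by linarith [hτ.1, hτ.2], hτ.2⟩) x
    rw [hx''] at h3
    refine h3.trans (mul_le_mul_right ?_ _)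
    calc _ ≤ ∫⁻ z, ∑' m, ‖c m‖ₑ * ∑' κ : Fin (2 * m + 1) → Fin d → ℤ,
          near W (2 * (2 * m + 1 : ℕ) + 1) (W.centre altSign κ) k *
          ((∫⁻ y, (∏ i, absBlock W (ofBdd u.bcf) (κ i) y) * ‖W.χ (z - y)‖ₑ) * bump M (x' - z)) := by
          refine lintegral_mono fun z => ?_
          refine (mul_le_mul_left (ModSpace.absBlock_nonlin_le hc u k z) _).trans ?_
          rw [← ENNReal.tsum_mul_right]
          refine ENNReal.tsum_le_tsum fun m => ?_
          rw [mul_assoc]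
          refine mul_le_mul_right ((mul_le_mul_left (u.absBlock_gauge_le m k z) _).trans_eq ?_) _
          rw [← ENNReal.tsum_mul_right]
          exact tsum_congr fun κ => mul_assoc _ _ _
      _ = ∑' m, ‖c m‖ₑ * ∑' κ : Fin (2 * m + 1) → Fin d → ℤ,
          near W (2 * (2 * m + 1 : ℕ) + 1) (W.centre altSign κ) k *
          ∫⁻ z, (∫⁻ y, (∏ i, absBlock W (ofBdd u.bcf) (κ i) y) * ‖W.χ (z - y)‖ₑ) *
            bump M (x' - z) := by
          have hκ : ∀ (m : ℕ) (κ : Fin (2 * m + 1) → Fin d → ℤ), Measurable fun z =>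
              near W (2 * (2 * m + 1 : ℕ) + 1) (W.centre altSign κ) k *
              ((∫⁻ y, (∏ i, absBlock W (ofBdd u.bcf) (κ i) y) * ‖W.χ (z - y)‖ₑ) * bump M (x' - z)) :=
            fun m κ => ((hmI m κ).mul (hmz x')).const_mul _
          have hκ' : ∀ m : ℕ, Measurable fun z => ∑' κ : Fin (2 * m + 1) → Fin d → ℤ,
              near W (2 * (2 * m + 1 : ℕ) + 1) (W.centre altSign κ) k *
              ((∫⁻ y, (∏ i, absBlock W (ofBdd u.bcf) (κ i) y) * ‖W.χ (z - y)‖ₑ) * bump M (x' - z)) :=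
            fun m => Measurable.tsum (hκ m)
          rw [lintegral_tsum fun m => ((hκ' m).const_mul _).aemeasurable]
          refine tsum_congr fun m => ?_
          rw [lintegral_const_mul _ (hκ' m), lintegral_tsum fun κ => (hκ m κ).aemeasurable]
          congr 1
          exact tsum_congr fun κ => lintegral_const_mul _ ((hmI m κ).mul (hmz x'))
      _ ≤ _ := ENNReal.tsum_le_tsum fun m => mul_le_mul_right (ENNReal.tsum_le_tsum fun κ =>
          mul_le_mul_right (hone m κ) _) _
  calc _ ≤ wt W s k * (C₁ * ∑' m, ‖c m‖ₑ *
      ∑' κ : Fin (2 * m + 1) → Fin d → ℤ, near W (2 * (2 * m + 1 : ℕ) + 1) (W.centre altSign κ) k *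
        (C₂ * I * ∫⁻ y, (∏ i, absBlock W (ofBdd u.bcf) (κ i) y) * bump M (x' - y))) :=
        mul_le_mul_right hlow _
    _ = C₁ * C₂ * I * ∑' m, ‖c m‖ₑ * ∑' κ : Fin (2 * m + 1) → Fin d → ℤ, ∫⁻ y, wt W s k *
        (near W (2 * (2 * m + 1 : ℕ) + 1) (W.centre altSign κ) k *
          ∏ i, absBlock W (ofBdd u.bcf) (κ i) y) * bump M (x' - y) := by
        have h5 : ∀ (m : ℕ) (κ : Fin (2 * m + 1) → Fin d → ℤ), ∫⁻ y, wt W s k *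
            (near W (2 * (2 * m + 1 : ℕ) + 1) (W.centre altSign κ) k *
            ∏ i, absBlock W (ofBdd u.bcf) (κ i) y) * bump M (x' - y) =
            wt W s k * near W (2 * (2 * m + 1 : ℕ) + 1) (W.centre altSign κ) k *
            ∫⁻ y, (∏ i, absBlock W (ofBdd u.bcf) (κ i) y) * bump M (x' - y) := fun m κ => by
          have hpm : Measurable fun y : Rd d => (∏ i, absBlock W (ofBdd u.bcf) (κ i) y) *
            bump M (x' - y) := (hprod m κ).mul (hmz x')
          rw [← lintegral_const_mul _ hpm]
          exact lintegral_congr fun y => by ring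
        simp_rw [h5]
        simp_rw [← ENNReal.tsum_mul_left]
        refine tsum_congr fun m => tsum_congr fun κ => ?_
        ring
    _ ≤ C₁ * C₂ * I * ∑' m, ‖c m‖ₑ * ∑' κ : Fin (2 * m + 1) → Fin d → ℤ, ∫⁻ y,
        (B * E) ^ (2 * m + 1) * (near W (2 * (2 * m + 1 : ℕ) + 1) (W.centre altSign κ) k *
          tubeProd W a κ (τ, y) * bump M (x' - y)) := by
        refine mul_le_mul_right (ENNReal.tsum_le_tsum fun m => mul_le_mul_right
          (ENNReal.tsum_le_tsum fun κ => lintegral_mono fun y => ?_) _) _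
        rw [← mul_assoc ((B * E) ^ _)]
        exact mul_le_mul_left (hweight m κ y) _
    _ = _ := by
        congr 1
        refine tsum_congr fun m => ?_
        rw [mul_assoc]
        congr 1
        have h6 : ∀ κ : Fin (2 * m + 1) → Fin d → ℤ, Measurable fun y =>
            near W (2 * (2 * m + 1 : ℕ) + 1) (W.centre altSign κ) k *
            tubeProd W a κ (τ, y) * bump M (x' - y) := fun κ =>
          ((htp m κ).const_mul _).mul (hmz x')
        rw [tsum_congr fun κ => lintegral_const_mul ((B * E) ^ (2 * m + 1)) (h6 κ),
          ENNReal.tsum_mul_left, ← lintegral_tsum fun κ => (h6 κ).aemeasurable]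
        congr 1
        refine lintegral_congr fun y => ?_
        rw [tubeSum, ENNReal.tsum_mul_right]

end NonlinearBlocks

/-! ### Convergence of the series of multilinear bounds -/

section Series

theorem IsGaugeSeries.tsum_ne_top {c : ℕ → ℝ} {F : ℂ → ℂ} (h : IsGaugeSeries c F) {R : ℝ≥0∞}
    (hR : R ≠ ∞) : ∑' m, ‖c m‖ₑ * R ^ m ≠ ∞ := by
  have h1 : ∀ m, ‖c m‖ₑ * R ^ m = ENNReal.ofReal (|c m| * R.toReal ^ m) := fun m => by
    rw [ENNReal.ofReal_mul (abs_nonneg _), ENNReal.ofReal_pow ENNReal.toReal_nonneg,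
      ENNReal.ofReal_toReal hR, ← Real.norm_eq_abs, ofReal_norm]
  rw [tsum_congr h1, ← ENNReal.ofReal_tsum_of_nonneg (fun m => by positivity)
    (h.summable _ ENNReal.toReal_nonneg)]
  exact ENNReal.ofReal_ne_top

/-- Dropping the linear term leaves only products of at least three factors, as the multilinear
estimate requires. -/
theorem IsGaugeSeries.update_zero {c : ℕ → ℝ} {F : ℂ → ℂ} (h : IsGaugeSeries c F) :
    IsGaugeSeries (Function.update c 0 0) fun z => F z - c 0 * z where
  summable r hr := by
    refine (h.summable r hr).of_nonneg_of_le (fun m => by positivity) fun m => ?_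
    rcases eq_or_ne m 0 with rfl | hm
    · simp
    · rw [Function.update_of_ne hm]
  hasSum z := by
    have h1 := (h.hasSum z).sub (hasSum_ite_eq 0 ((c 0 : ℂ) * z))
    refine (congrArg (fun f => HasSum f (F z - c 0 * z)) (funext fun m => ?_)).mpr h1
    rcases eq_or_ne m 0 with rfl | hm
    · simp
    · rw [Function.update_of_ne hm, if_neg hm, sub_zero]

theorem tubeConst_succ_le (N n : ℕ) {T : ℝ} (hT : 0 < T) :
    tubeConst N (n + 1) T ≤ 2 ^ N * ENNReal.ofReal (1 / T + 12 * Real.pi) * 2 ^ n := by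
  have h2 : ∀ n : ℕ, (n + 1 : ℝ) ≤ 2 ^ n := fun n => by exact_mod_cast Nat.lt_two_pow_self (n := n)
  rw [tubeConst, mul_assoc ((2 : ℝ≥0∞) ^ N)]
  refine mul_le_mul' (le_refl ((2 : ℝ≥0∞) ^ N)) ?_
  rw [show (2 : ℝ≥0∞) = ENNReal.ofReal 2 by simp, ← ENNReal.ofReal_pow (by norm_num),
    ← ENNReal.ofReal_mul (by positivity)]
  refine ENNReal.ofReal_le_ofReal ?_
  have h3 : (1 : ℝ) ≤ 2 ^ n := one_le_pow₀ (by norm_num)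
  have h4 : 1 / T ≤ 1 / T * 2 ^ n := le_mul_of_one_le_right (by positivity) h3
  have h5 : 4 * Real.pi * (2 * ((n + 1 : ℕ) : ℝ) + 1) ≤ 12 * Real.pi * 2 ^ n := by
    have := h2 n
    push_cast
    nlinarith [Real.pi_pos]
  rw [add_mul]
  exact add_le_add h4 h5

/-- Every polynomial factor in `n` is bounded by a power of `2^n`: exponent `3` for the triples, `d`
for the lattice count, `1` for the velocity constant, together `d + 4`. -/
theorem tubeBound_le (N d n : ℕ) {T : ℝ} (hT : 0 < T) (C₁ C₂ A : ℝ≥0∞) :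
    tubeBound N d n T C₁ C₂ A ≤ C₁ * 4 ^ d * (2 ^ N * ENNReal.ofReal (1 / T + 12 * Real.pi)) *
      (ENNReal.ofReal T + 2) * (2 ^ (d + 4) * C₂ * A) ^ n := by
  have h1 : ((n + 1 : ℕ) : ℝ≥0∞) ≤ 2 ^ n := by exact_mod_cast Nat.lt_two_pow_self (n := n)
  have h2 : (2 * ((n + 1 : ℕ) : ℝ≥0∞) + 2) ≤ 4 * 2 ^ n := by
    have h3 : (1 : ℝ≥0∞) ≤ 2 ^ n := one_le_pow₀ (by norm_num)
    calc (2 * ((n + 1 : ℕ) : ℝ≥0∞) + 2) ≤ 2 * 2 ^ n + 2 * 2 ^ n := by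
          refine add_le_add (mul_le_mul_right h1 _) ?_
          simpa using mul_le_mul_right h3 2
      _ = _ := by ring
  calc tubeBound N d n T C₁ C₂ A ≤ (2 ^ n) ^ 3 * (C₁ * (4 * 2 ^ n) ^ d *
        (2 ^ N * ENNReal.ofReal (1 / T + 12 * Real.pi) * 2 ^ n) *
        (C₂ ^ n * (ENNReal.ofReal T + 2) * A ^ n)) := by
        rw [tubeBound]
        gcongr
        exact tubeConst_succ_le N n hT
    _ = _ := by
        rw [mul_pow 4, mul_pow, mul_pow, pow_add, mul_pow, ← pow_mul 2 n d, ← pow_mul 2 d n,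
          mul_comm n d, ← pow_mul 2 4 n, mul_comm 4 n, ← pow_mul 2 n 3]
        ring

/-- The series of the bounds for the multilinear terms converges. -/
theorem IsGaugeSeries.tsum_tubeBound_ne_top {c : ℕ → ℝ} {F : ℂ → ℂ} (h : IsGaugeSeries c F)
    (N d : ℕ) {T : ℝ} (hT : 0 < T) {C₁ C₂ A R : ℝ≥0∞} (hC₁ : C₁ ≠ ∞) (hC₂ : C₂ ≠ ∞) (hA : A ≠ ∞)
    (hR : R ≠ ∞) :
    ∑' m, ‖c m‖ₑ * R ^ (2 * m + 1) * tubeBound N d (2 * m) T C₁ C₂ A ≠ ∞ := by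
  set K := C₁ * 4 ^ d * (2 ^ N * ENNReal.ofReal (1 / T + 12 * Real.pi)) * (ENNReal.ofReal T + 2)
    with hK
  set Q := 2 ^ (d + 4) * C₂ * A with hQ
  have hKt : K ≠ ∞ := by finiteness
  have hQt : Q ≠ ∞ := by finiteness
  refine ne_top_of_le_ne_top (ENNReal.mul_ne_top (ENNReal.mul_ne_top hKt hR)
    (h.tsum_ne_top (R := (R * Q) ^ 2) (by finiteness))) ?_
  rw [← ENNReal.tsum_mul_left]
  refine ENNReal.tsum_le_tsum fun m => ?_
  refine (mul_le_mul_right (tubeBound_le N d (2 * m) hT C₁ C₂ A) _).trans_eq ?_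
  rw [← hK, ← hQ, ← pow_mul, mul_pow, pow_succ]
  ring

end Series

/-! ### Blocks along differentiable curves -/

section TimeBlocks

variable {d : ℕ} {W : Window d} {p : ℝ≥0∞} {s : ℝ} [hp : Fact (1 ≤ p)] [hs : Fact (0 ≤ s)]

theorem absBlock_ofBdd_le_enorm (W : Window d) (f : Rd d →ᵇ ℂ) (k : Fin d → ℤ) (x : Rd d) :
    absBlock W (ofBdd f) k x ≤ ‖f‖ₑ * ∫⁻ y, ‖W.χ y‖ₑ := by
  have hm : Measurable fun y => ‖W.χ (x - y)‖ₑ :=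
    W.χ.continuous.measurable.enorm.comp (measurable_const.sub measurable_id)
  refine (absBlock_ofBdd_le W f k x).trans ?_
  rw [← lintegral_comp_sub_left (fun y => ‖W.χ y‖ₑ) x, ← lintegral_const_mul _ hm]
  refine lintegral_mono fun y => mul_le_mul_left ?_ _
  rw [← ofReal_norm, ← ofReal_norm]
  exact ENNReal.ofReal_le_ofReal (f.norm_coe_le_norm y)

/-- Joint continuity holds because a block is Lipschitz in the function, uniformly in the point; it
supplies measurability in space-time. -/
theorem ModSpace.continuous_block_bcf {g : ℝ → ModSpace W p s} (hg : Continuous g)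
    (k : Fin d → ℤ) : Continuous fun z : ℝ × Rd d => block W (ofBdd (g z.1).bcf) k z.2 := by
  have h1 : Continuous fun z : (Rd d →ᵇ ℂ) × Rd d => block W (ofBdd z.1) k z.2 := by
    refine continuous_prod_of_continuous_lipschitzWith _ (∫⁻ y, ‖W.χ y‖ₑ).toNNReal
      (fun f => continuous_block W (ofBdd f) k) fun x f f' => ?_
    change edist (block W (ofBdd f) k x) (block W (ofBdd f') k x) ≤ _
    rw [edist_eq_enorm_sub, edist_eq_enorm_sub, ENNReal.coe_toNNReal (lintegral_schwartz_ne_top _),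
      mul_comm, ← Pi.sub_apply, ← block_sub, ← ofBdd_sub]
    exact absBlock_ofBdd_le_enorm W (f - f') k x
  have h2 : Continuous fun t => (g t).bcf := (ModSpace.toBCF W p s).continuous.comp hg
  have h3 : Continuous fun z : ℝ × Rd d => ((g z.1).bcf, z.2) :=
    (h2.comp continuous_fst).prodMk continuous_snd
  have h4 := Continuous.comp h1 h3
  exact h4

theorem ModSpace.measurable_absBlock_bcf {g : ℝ → ModSpace W p s} (hg : Continuous g)
    (k : Fin d → ℤ) : Measurable fun z : ℝ × Rd d => absBlock W (ofBdd (g z.1).bcf) k z.2 :=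
  (ModSpace.continuous_block_bcf hg k).measurable.enorm

theorem ModSpace.measurable_lintegral_absBlock {g : ℝ → ModSpace W p s} (hg : Continuous g)
    (T : ℝ) (k : Fin d → ℤ) :
    Measurable fun x => ∫⁻ τ in Set.Icc 0 T, absBlock W (ofBdd (g τ).bcf) k x :=
  (ModSpace.measurable_absBlock_bcf hg k).lintegral_prod_left'

/-- The increment of a curve in terms of its derivative, block by block. -/
theorem ModSpace.absBlock_sub_le_lintegral {T : ℝ} {w g : ℝ → ModSpace W p s} (hg : Continuous g)
    (hw : ∀ t ∈ Set.Icc 0 T, HasDerivWithinAt w (g t) (Set.Icc 0 T) t) {t t' : ℝ}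
    (ht : t ∈ Set.Icc 0 T) (ht' : t' ∈ Set.Icc 0 T) (k : Fin d → ℤ) (x : Rd d) :
    absBlock W (ofBdd (w t' - w t).bcf) k x ≤
      ∫⁻ τ in Set.Icc 0 T, absBlock W (ofBdd (g τ).bcf) k x := by
  wlog htt : t ≤ t' generalizing t t'
  · refine le_trans (le_of_eq ?_) (this ht' ht (le_of_not_ge htt))
    rw [map_sub, map_sub, ofBdd_sub, ofBdd_sub, absBlock, absBlock, block_sub, block_sub,
      Pi.sub_apply, Pi.sub_apply, enorm_sub_rev]
  set L := ((pairing (reflectAt x (modulate (W.pt k) W.χ))).comp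
    (ModSpace.toBCF W p s)).restrictScalars ℝ with hL
  have hd : ∀ τ ∈ Set.Icc 0 T, HasDerivWithinAt (fun τ => L (w τ)) (L (g τ)) (Set.Icc 0 T) τ :=
    fun τ hτ => L.hasFDerivAt.comp_hasDerivWithinAt τ (hw τ hτ)
  have hsub : Set.Icc t t' ⊆ Set.Icc 0 T := Set.Icc_subset_Icc ht.1 ht'.2
  have hftc := intervalIntegral.integral_eq_sub_of_hasDeriv_right_of_le htt
    (fun τ hτ => ((hd τ (hsub hτ)).continuousWithinAt.mono hsub)) (f' := fun τ => L (g τ))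
    (fun τ hτ => ((hd τ (hsub (Set.Ioo_subset_Icc_self hτ))).hasDerivAt
      (Icc_mem_nhds (ht.1.trans_lt hτ.1) (hτ.2.trans_le ht'.2))).hasDerivWithinAt)
    (L.continuous.comp hg).continuousOn.intervalIntegrable
  have h1 : block W (ofBdd (w t' - w t).bcf) k x = L (w t') - L (w t) := by
    rw [map_sub, ofBdd_sub, block_sub]
    rfl
  rw [absBlock, h1, ← hftc, intervalIntegral.integral_of_le htt]
  refine (enorm_integral_le_lintegral_enorm _).trans ?_
  exact lintegral_mono_set (Set.Ioc_subset_Icc_self.trans hsub)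

/-- For `p = 1` Tonelli interchanges space, time and frequency, and the quantity is the time
integral of the norm of `g`. -/
theorem ModSpace.tsum_lintegral_absBlock_ne_top {g : ℝ → ModSpace W 1 s} (hg : Continuous g) (T : ℝ) :
    ∑' k, wt W s k * ∫⁻ x, ∫⁻ τ in Set.Icc 0 T, absBlock W (ofBdd (g τ).bcf) k x ≠ ∞ := by
  have hm := fun k => ModSpace.measurable_absBlock_bcf hg k (W := W)
  have hτ : ∀ k, Measurable fun τ => ∫⁻ x, absBlock W (ofBdd (g τ).bcf) k x := fun k =>
    (hm k).lintegral_prod_right'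
  have h1 : ∑' k, wt W s k * ∫⁻ x, ∫⁻ τ in Set.Icc 0 T, absBlock W (ofBdd (g τ).bcf) k x =
      ∫⁻ τ in Set.Icc 0 T, ‖g τ‖ₑ := by
    calc _ = ∑' k, ∫⁻ τ in Set.Icc 0 T, wt W s k * ∫⁻ x, absBlock W (ofBdd (g τ).bcf) k x := by
          refine tsum_congr fun k => ?_
          rw [lintegral_const_mul _ (hτ k)]
          congr 1
          exact lintegral_lintegral_swap ((hm k).comp measurable_swap).aemeasurable
      _ = _ := by
          rw [← lintegral_tsum fun k => ((hτ k).const_mul _).aemeasurable]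
          refine lintegral_congr fun τ => ?_
          rw [ModSpace.enorm_eq, modNorm_eq]
          refine tsum_congr fun k => ?_
          rw [eLpNorm_one_eq_lintegral_enorm]
          rfl
  rw [h1]
  exact (hg.integrableOn_Icc (a := 0) (b := T)).2.ne

end TimeBlocks

/-! ### Tubes carrying a solution in `M^{1,1}` -/

section Envelope

variable {d : ℕ} {W : Window d} {s : ℝ} [hs : Fact (0 ≤ s)]

/-- The blocks of a differentiable curve in `M^{1,1}_{0,s}` are transported along tubes below an
integrable profile. -/
theorem ModSpace.exists_envelope {N : ℕ} (hN : d < N) {T : ℝ} {w g : ℝ → ModSpace W 1 s}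
    (hg : Continuous g) (hw : ∀ t ∈ Set.Icc 0 T, HasDerivWithinAt w (g t) (Set.Icc 0 T) t) :
    ∃ (a : (Fin d → ℤ) → Rd d → ℝ≥0∞) (E : ℝ≥0∞), E ≠ ∞ ∧ (∀ k, Measurable (a k)) ∧
      (∀ k, Moderate N (a k)) ∧ ∑' k, ∫⁻ x, a k x ≠ ∞ ∧ (∃ k₀, ∀ x, a k₀ x ≠ 0) ∧
      ∀ τ ∈ Set.Icc 0 T, ∀ k y, wt W s k * absBlock W (prop τ (ofBdd (w τ).bcf)) k y ≤
        E * a k (y - τ • W.vel k) := by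
  classical
  obtain ⟨C, hC, h⟩ := exists_absBlock_prop_le_lintegral d N T
  set G : (Fin d → ℤ) → Rd d → ℝ≥0∞ := fun k x =>
    ∫⁻ τ in Set.Icc 0 T, absBlock W (ofBdd (g τ).bcf) k x with hG
  -- An artificial positive contribution at frequency `0`, so that the tube mass vanishes nowhere
  -- and can be divided by.
  set P : (Fin d → ℤ) → Rd d → ℝ≥0∞ := fun k x => if k = 0 then bump (d + 1) x else 0 with hP
  -- The initial block plus the time integral of the derivative dominates the block of `w` at all
  -- times at once.
  set A : (Fin d → ℤ) → Rd d → ℝ≥0∞ := fun k x =>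
    absBlock W (ofBdd (w 0).bcf) k x + G k x + P k x with hA
  have hmG : ∀ k, Measurable (G k) := fun k => ModSpace.measurable_lintegral_absBlock hg T k
  have hmP : ∀ k, Measurable (P k) := fun k => by
    by_cases hk : k = 0
    · simpa only [hP, if_pos hk] using measurable_bump (d + 1)
    · simp only [hP, if_neg hk, measurable_const]
  have hm0 : ∀ k, Measurable (absBlock W (ofBdd (w 0).bcf) k) := measurable_absBlock W _
  have hmA : ∀ k, Measurable (A k) := fun k => ((hm0 k).add (hmG k)).add (hmP k)
  have hAfin : ∑' k, wt W s k * ∫⁻ x, A k x ≠ ∞ := by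
    have h1 : ∀ k, wt W s k * ∫⁻ x, A k x = wt W s k * (∫⁻ x, absBlock W (ofBdd (w 0).bcf) k x) +
        wt W s k * (∫⁻ x, G k x) + wt W s k * ∫⁻ x, P k x := fun k => by
      rw [← mul_add, ← mul_add, ← lintegral_add_left (hm0 k), ← lintegral_add_left]
      exact (hm0 k).add (hmG k)
    rw [tsum_congr h1, ENNReal.tsum_add, ENNReal.tsum_add]
    refine ENNReal.add_ne_top.2 ⟨ENNReal.add_ne_top.2 ⟨?_,
      ModSpace.tsum_lintegral_absBlock_ne_top hg T⟩, ?_⟩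
    · refine ne_of_eq_of_ne (tsum_congr fun k => ?_) (w 0).mem.ne
      rw [eLpNorm_one_eq_lintegral_enorm]
      rfl
    · rw [tsum_eq_single 0 fun k hk => by simp [hP, hk]]
      simp only [hP, if_true]
      exact ENNReal.mul_ne_top (wt_ne_top W s 0) (lintegral_bump_lt_top (Nat.lt_succ_self d)).ne
  have hle : ∀ τ ∈ Set.Icc 0 T, ∀ k x, absBlock W (ofBdd (w τ).bcf) k x ≤ A k x := by
    intro τ hτ k x
    have h0 : (0 : ℝ) ∈ Set.Icc 0 T := ⟨le_rfl, hτ.1.trans hτ.2⟩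
    have h1 := ModSpace.absBlock_sub_le_lintegral hg hw h0 hτ k x
    have h2 : block W (ofBdd (w τ).bcf) k x =
        block W (ofBdd (w 0).bcf) k x + block W (ofBdd (w τ - w 0).bcf) k x := by
      rw [map_sub, ofBdd_sub, block_sub, Pi.sub_apply]; ring
    calc absBlock W (ofBdd (w τ).bcf) k x ≤ absBlock W (ofBdd (w 0).bcf) k x + G k x := by
          rw [absBlock, h2]
          exact (enorm_add_le _ _).trans (add_le_add_right h1 _)
      _ ≤ A k x := le_self_add
  have hbz : ∀ x : Rd d, Measurable fun z : Rd d => bump N (x - z) := fun x =>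
    (measurable_bump N).comp (measurable_const.sub measurable_id)
  have hmj : ∀ k, Measurable fun q : Rd d × Rd d => A k q.2 * bump N (q.1 - q.2) := fun k =>
    ((hmA k).comp measurable_snd).mul ((measurable_bump N).comp (measurable_fst.sub measurable_snd))
  -- Convolution with the polynomial weight makes the profile slowly varying, and is also what the
  -- transport estimate produces.
  refine ⟨fun k x => wt W s k * ∫⁻ z, A k z * bump N (x - z), C, hC,
    fun k => (hmj k).lintegral_prod_right'.const_mul _, fun k x y => ?_, ?_, ⟨0, fun x => ?_⟩,
    fun τ hτ k y => ?_⟩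
  · rw [mul_assoc, ← lintegral_mul_const' _ _ (bump_ne_top _ _)]
    refine mul_le_mul_right (lintegral_mono fun z => ?_) _
    rw [mul_assoc]
    refine mul_le_mul_right ?_ _
    rw [mul_comm, bump_sub_comm]
    refine (bump_mul_le _ _ _).trans_eq ?_
    rw [sub_add_sub_cancel]
  · have h1 : ∀ k, ∫⁻ x, wt W s k * ∫⁻ z, A k z * bump N (x - z) =
        wt W s k * (∫⁻ x, A k x) * ∫⁻ x : Rd d, bump N x := fun k => by
      rw [lintegral_const_mul _ (hmj k).lintegral_prod_right',
        lintegral_lintegral_mul_sub (hmA k) (measurable_bump N), mul_assoc]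
    rw [tsum_congr h1, ENNReal.tsum_mul_right]
    exact ENNReal.mul_ne_top hAfin (lintegral_bump_lt_top hN).ne
  · refine mul_ne_zero (zero_lt_one.trans_le (one_le_wt W hs.out 0)).ne' fun h0 => ?_
    have hz : Measurable fun z => A 0 z * bump N (x - z) := (hmA 0).mul (hbz x)
    have h1 : ∀ᵐ z : Rd d, False := ((lintegral_eq_zero_iff hz).1 h0).mono fun z hz => by
      have h2 : A 0 z ≠ 0 := by
        simp only [hA, hP, if_true]
        exact (lt_of_lt_of_le (bump_pos _ z) le_add_self).ne'
      exact mul_ne_zero h2 (bump_pos _ _).ne' hz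
    exact h1.exists.choose_spec
  · rw [mul_left_comm]
    refine mul_le_mul_right ((h W _ k τ (abs_le.2 ⟨by linarith [hτ.1, hτ.2], hτ.2⟩) y).trans ?_) _
    refine mul_le_mul_right (lintegral_mono fun z => mul_le_mul_left (hle τ hτ k z) _) _

end Envelope

/-! ### Duhamel terms in `M^{1/2,1}` -/

section HalfNorm

variable {d : ℕ} {W : Window d} {s : ℝ} [hs : Fact (0 ≤ s)] {c : ℕ → ℝ} {F : ℂ → ℂ}

/-- The Duhamel terms of a solution in `M^{1,1}_{0,s}`, without the linear part of the nonlinearity,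
lie in `M^{1/2,1}_{0,s}`. -/
theorem ModSpace.exists_eLpNorm_half_le (h : IsGaugeSeries c F) {T : ℝ} (hT : 0 < T)
    {w : ℝ → ModSpace W 1 s} (hwc : Continuous w)
    (hw : ∀ t ∈ Set.Icc 0 T, HasDerivWithinAt w (ModSpace.field c t (w t)) (Set.Icc 0 T) t) :
    ∃ M : (Fin d → ℤ) → ℝ≥0∞, ∑' k, M k ≠ ∞ ∧ ∀ k (f : Rd d → ℂ), (∀ x, ‖f x‖ₑ ≤
      ∫⁻ τ in Set.Icc 0 T,
        absBlock W (ofBdd (ModSpace.field (Function.update c 0 0) τ (w τ)).bcf) k x) →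
      wt W s k * eLpNorm f (1 / 2) volume ≤ M k := by
  set c' := Function.update c 0 0 with hc'
  have h' := h.update_zero
  have hcont : ∀ {c : ℕ → ℝ} {F : ℂ → ℂ}, IsGaugeSeries c F →
      Continuous fun t => ModSpace.field c t (w t) := fun h =>
    continuousOn_univ.1 (ModSpace.continuousOn_field h hwc.continuousOn)
  set N := d + 1 with hN
  obtain ⟨a, E, hE, ha, hmod, hfin, ⟨k₀, hk₀⟩, haw⟩ :=
    ModSpace.exists_envelope (N := N) (Nat.lt_succ_self d) (hcont h) hw
  obtain ⟨D, B, hD, hB, hfield⟩ := ModSpace.exists_absBlock_field_le W N T 1 (s := s)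
  obtain ⟨C₁, C₂, hC₁, hC₂, -, hform⟩ := exists_tubeForm_div_le W (N := N) (Nat.lt_succ_self d)
  set m := tubeMass W.vel a T with hm
  have hmm : ∀ k, Measurable (m k) := fun k => measurable_tubeMass ha T k
  set Φ : ℕ → (Fin d → ℤ) → Rd d → ℝ≥0∞ := fun n k x =>
    tubeForm W N a (altSign : Fin (2 * n + 1) → ℝ) T k x with hΦ
  have hmΦ : ∀ n k, Measurable (Φ n k) := fun n k => measurable_tubeForm ha _ T k
  set b : (Fin d → ℤ) → Rd d → ℝ≥0∞ := fun k x =>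
    D * ∑' n, ‖c' n‖ₑ * (B * E) ^ (2 * n + 1) * Φ n k x with hb
  set β : (Fin d → ℤ) → Rd d → ℝ≥0∞ := fun k x =>
    ∫⁻ τ in Set.Icc 0 T, absBlock W (ofBdd (ModSpace.field c' τ (w τ)).bcf) k x with hβ
  have hmβ : ∀ k, Measurable (β k) := fun k => ModSpace.measurable_lintegral_absBlock (hcont h') T k
  have hβb : ∀ k x, wt W s k * β k x ≤ b k x := by
    intro k x
    have hj : ∀ n, Measurable fun z : ℝ × Rd d => tubeSum W a (altSign : Fin (2 * n + 1) → ℝ) k z *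
        bump (N + (d + 1)) (x - (z.2 - z.1 • W.vel k)) := fun n =>
      (measurable_tubeSum ha _ k).mul ((measurable_bump _).comp (by fun_prop))
    have hjt : ∀ n, Measurable fun τ : ℝ => ∫⁻ y : Rd d,
        tubeSum W a (altSign : Fin (2 * n + 1) → ℝ) k (τ, y) *
        bump (N + (d + 1)) (x - (y - τ • W.vel k)) := fun n => (hj n).lintegral_prod_right'
    calc wt W s k * β k x = ∫⁻ τ in Set.Icc 0 T, wt W s k *
          absBlock W (ofBdd (ModSpace.field c' τ (w τ)).bcf) k x :=
          (lintegral_const_mul' _ _ (wt_ne_top W s k)).symm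
      _ ≤ ∫⁻ τ in Set.Icc 0 T, D * ∑' n, ‖c' n‖ₑ * (B * E) ^ (2 * n + 1) *
          ∫⁻ y, tubeSum W a (altSign : Fin (2 * n + 1) → ℝ) k (τ, y) *
            bump (N + (d + 1)) (x - (y - τ • W.vel k)) :=
          setLIntegral_mono' measurableSet_Icc fun τ hτ =>
            hfield h' a E ha τ hτ (w τ) (haw τ hτ) k x
      _ = b k x := by
          rw [lintegral_const_mul' _ _ hD, lintegral_tsum fun n => ((hjt n).const_mul _).aemeasurable]
          simp only [hb]
          congr 1
          refine tsum_congr fun n => ?_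
          rw [lintegral_const_mul _ (hjt n)]
          simp only [hΦ, tubeForm]
          rw [lintegral_slab (hj n)]
  set S := ∑' k, ∫⁻ x, a k x with hS
  have hmass : ∀ k, ∫⁻ x, m k x = ENNReal.ofReal T * S := fun k => lintegral_tubeMass ha T k
  -- The bound of Cauchy–Schwarz against the tube mass, whose integral is `T · S` for every `k`.
  refine ⟨fun k => ENNReal.ofReal T * S * ∫⁻ x, b k x * (m k x)⁻¹, ?_, fun k f hf => ?_⟩
  · rw [ENNReal.tsum_mul_left]
    refine ENNReal.mul_ne_top (by finiteness) ?_
    have h1 : ∀ k, ∫⁻ x, b k x * (m k x)⁻¹ =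
        D * ∑' n, ‖c' n‖ₑ * (B * E) ^ (2 * n + 1) * ∫⁻ x, Φ n k x * (m k x)⁻¹ := fun k => by
      have hmp : ∀ n, Measurable fun x => Φ n k x * (m k x)⁻¹ := fun n => (hmΦ n k).mul (hmm k).inv
      have h2 : ∀ x, b k x * (m k x)⁻¹ =
          D * ∑' n, ‖c' n‖ₑ * (B * E) ^ (2 * n + 1) * (Φ n k x * (m k x)⁻¹) := fun x => by
        simp only [hb]
        rw [mul_assoc, ← ENNReal.tsum_mul_right]
        congr 1
        exact tsum_congr fun n => mul_assoc _ _ _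
      rw [lintegral_congr h2, lintegral_const_mul' _ _ hD,
        lintegral_tsum fun n => ((hmp n).const_mul _).aemeasurable]
      congr 1
      exact tsum_congr fun n => lintegral_const_mul _ (hmp n)
    rw [tsum_congr h1, ENNReal.tsum_mul_left, ENNReal.tsum_comm]
    refine ENNReal.mul_ne_top hD (ne_top_of_le_ne_top
      (h'.tsum_tubeBound_ne_top N d hT hC₁ hC₂ hfin (R := B * E) (by finiteness))
      (ENNReal.tsum_le_tsum fun n => ?_))
    rw [ENNReal.tsum_mul_left]
    -- The linear term has coefficient zero; all others have at least three factors.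
    rcases Nat.eq_zero_or_pos n with rfl | hn
    · simp [hc']
    · exact mul_le_mul_right (hform a ha hmod T hT (2 * n) (by omega) altSign abs_altSign
        (sum_altSign n)) _
  · calc wt W s k * eLpNorm f (1 / 2) volume
        ≤ wt W s k * ((∫⁻ x, m k x) * ∫⁻ x, β k x * (m k x)⁻¹) := mul_le_mul_right
          (eLpNorm_half_le (hmβ k) (hmm k) (tubeMass_pos hmod hT hk₀ k)
            (tubeMass_ne_top ha hmod T hfin k) hf) _
      _ = ENNReal.ofReal T * S * ∫⁻ x, wt W s k * (β k x * (m k x)⁻¹) := by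
          rw [hmass, lintegral_const_mul' _ _ (wt_ne_top W s k)]
          ring
      _ ≤ _ := by
          refine mul_le_mul_right (lintegral_mono fun x => ?_) _
          rw [← mul_assoc]
          exact mul_le_mul_left (hβb k x) _

end HalfNorm

/-! ### Persistence of `M^{p,1}` regularity for `1/2 < p ≤ 1` -/

section Persistence

variable {d : ℕ} {W : Window d}

/-- Interpolation between `L^{1/2}` and `L^∞`: `|f|^p ≤ R^{p - 1/2} |f|^{1/2}`. -/
theorem eLpNorm_le_rpow_mul_half {f : Rd d → ℂ} (hf : Measurable f) {R : ℝ≥0∞}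
    (hR : ∀ x, ‖f x‖ₑ ≤ R) {p : ℝ≥0∞} (hp : 1 / 2 ≤ p) (hp' : p ≠ ∞) :
    eLpNorm f p volume ≤
      R ^ (1 - 1 / (2 * p.toReal)) * eLpNorm f (1 / 2) volume ^ (1 / (2 * p.toReal)) := by
  have hp0 : p ≠ 0 := by rintro rfl; simp at hp
  have hr : 1 / 2 ≤ p.toReal := by simpa using ENNReal.toReal_mono hp' hp
  set r := p.toReal with hrdef
  have h2 : ((1 / 2 : ℝ≥0∞)).toReal = 1 / 2 := by simp
  have hX : ∫⁻ x, ‖f x‖ₑ ^ (1 / 2 : ℝ) = eLpNorm f (1 / 2) volume ^ (1 / 2 : ℝ) := by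
    rw [eLpNorm_eq_lintegral_rpow_enorm_toReal (by simp) (by simp), h2, one_div_one_div,
      ← ENNReal.rpow_mul]
    norm_num
  have hle : ∫⁻ x, ‖f x‖ₑ ^ r ≤ R ^ (r - 1 / 2) * eLpNorm f (1 / 2) volume ^ (1 / 2 : ℝ) := by
    rw [← hX, ← lintegral_const_mul _ (hf.enorm.pow_const _)]
    refine lintegral_mono fun x => ?_
    calc ‖f x‖ₑ ^ r = ‖f x‖ₑ ^ (r - 1 / 2) * ‖f x‖ₑ ^ (1 / 2 : ℝ) := by
          rw [← ENNReal.rpow_add_of_nonneg _ _ (by linarith) (by norm_num), sub_add_cancel]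
      _ ≤ _ := mul_le_mul_left (ENNReal.rpow_le_rpow (hR x) (by linarith)) _
  rw [eLpNorm_eq_lintegral_rpow_enorm_toReal hp0 hp', ← hrdef]
  refine (ENNReal.rpow_le_rpow hle (by positivity)).trans_eq ?_
  rw [ENNReal.mul_rpow_of_nonneg _ _ (by positivity), ← ENNReal.rpow_mul, ← ENNReal.rpow_mul]
  have hr0 : r ≠ 0 := by linarith
  congr 2 <;> field_simp

variable {s : ℝ} [hs : Fact (0 ≤ s)] {c : ℕ → ℝ} {F : ℂ → ℂ}

/-- The linear part of the nonlinearity is a scalar and commutes with the group, so in the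
interaction representation it is a mere phase. -/
theorem ModSpace.field_eq_add {p : ℝ≥0∞} [hp : Fact (1 ≤ p)] (h : IsGaugeSeries c F) (t : ℝ)
    (w : ModSpace W p s) : ModSpace.field c t w =
      (Complex.I * (c 0 : ℂ)) • w + ModSpace.field (Function.update c 0 0) t w := by
  have h1 : (ModSpace.schr t w).nonlin c =
      (c 0 : ℂ) • ModSpace.schr t w + (ModSpace.schr t w).nonlin (Function.update c 0 0) := by
    refine ModSpace.ext fun x => ?_
    rw [ModSpace.nonlin_apply h, map_add, map_smul, BoundedContinuousFunction.add_apply,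
      ModSpace.nonlin_apply h.update_zero, BoundedContinuousFunction.smul_apply, smul_eq_mul]
    ring
  rw [ModSpace.field, h1, map_add, map_smul, ModSpace.schr_neg_schr, smul_add, smul_smul,
    ModSpace.field]

/-- The linear part of the nonlinearity is removed by a rotation. -/
theorem ModSpace.hasDerivWithinAt_rotate {p : ℝ≥0∞} [hp : Fact (1 ≤ p)] (h : IsGaugeSeries c F)
    {w : ℝ → ModSpace W p s} {J : Set ℝ} {t : ℝ}
    (hw : HasDerivWithinAt w (ModSpace.field c t (w t)) J t) :
    HasDerivWithinAt (fun t : ℝ => Complex.exp (-(Complex.I * (c 0 : ℂ) * t)) • w t)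
      (Complex.exp (-(Complex.I * (c 0 : ℂ) * t)) •
        ModSpace.field (Function.update c 0 0) t (w t)) J t := by
  have h1 : HasDerivWithinAt (fun t : ℝ => Complex.exp (-(Complex.I * (c 0 : ℂ) * t)))
      (-(Complex.I * (c 0 : ℂ)) * Complex.exp (-(Complex.I * (c 0 : ℂ) * t))) J t := by
    have h2 : HasDerivAt (fun t : ℝ => -(Complex.I * (c 0 : ℂ) * t)) (-(Complex.I * (c 0 : ℂ))) t := by
      simpa [neg_mul] using (Complex.ofRealCLM.hasDerivAt (x := t)).const_mul (-(Complex.I * (c 0 : ℂ)))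
    exact (h2.cexp.congr_deriv (mul_comm _ _)).hasDerivWithinAt
  refine (h1.smul hw).congr_deriv ?_
  rw [ModSpace.field_eq_add h, smul_add, smul_smul, add_right_comm, ← add_smul]
  simp [mul_comm]

theorem norm_rotation (a t : ℝ) : ‖Complex.exp (-(Complex.I * (a : ℂ) * t))‖ = 1 := by
  rw [Complex.norm_exp]
  simp

/-- The increments of a solution in `M^{1,1}_{0,s}`, after removal of the linear part of the
nonlinearity, are small in `M^{p,1}_{0,s}`, `p > 1/2`. -/
theorem ModSpace.rotate_sub_bounds (h : IsGaugeSeries c F) {p : ℝ≥0∞} (hp : 1 / 2 < p)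
    (hp' : p ≠ ∞) {T : ℝ} (hT : 0 < T) {w z : ℝ → ModSpace W 1 s} (hwc : Continuous w)
    (hw : ∀ t ∈ Set.Icc 0 T, HasDerivWithinAt w (ModSpace.field c t (w t)) (Set.Icc 0 T) t)
    (hz : ∀ t : ℝ, z t = Complex.exp (-(Complex.I * (c 0 : ℂ) * t)) • w t) :
    (∀ t ∈ Set.Icc 0 T, ∀ t' ∈ Set.Icc 0 T, modNorm W p s (ofBdd (z t' - z t).bcf) < ∞) ∧
    ∀ t ∈ Set.Icc 0 T, Tendsto (fun t' => modNorm W p s (ofBdd (z t' - z t).bcf))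
      (𝓝[Set.Icc 0 T] t) (𝓝 0) := by
  obtain ⟨M, hM, hhalf⟩ := ModSpace.exists_eLpNorm_half_le h hT hwc hw
  obtain ⟨C, hC, hbern⟩ := exists_absBlock_le d (p := 1 / 2) le_rfl
  set e : ℝ → ℂ := fun t => Complex.exp (-(Complex.I * (c 0 : ℂ) * t)) with he
  have hec : Continuous e := by fun_prop
  have hz' : z = fun t => e t • w t := funext hz
  have hzc : Continuous z := by rw [hz']; exact hec.smul hwc
  set g : ℝ → ModSpace W 1 s := fun t => e t • ModSpace.field (Function.update c 0 0) t (w t) with hg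
  have hgc : Continuous g := hec.smul
    (continuousOn_univ.1 (ModSpace.continuousOn_field h.update_zero hwc.continuousOn))
  have hzd : ∀ t ∈ Set.Icc 0 T, HasDerivWithinAt z (g t) (Set.Icc 0 T) t := fun t ht => by
    rw [hz']
    exact ModSpace.hasDerivWithinAt_rotate h (hw t ht)
  have hgb : ∀ τ k x, absBlock W (ofBdd (g τ).bcf) k x =
      absBlock W (ofBdd (ModSpace.field (Function.update c 0 0) τ (w τ)).bcf) k x := by
    intro τ k x
    rw [hg, map_smul, ofBdd_smul, absBlock, block_smul, Pi.smul_apply, enorm_smul, ← ofReal_norm,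
      norm_rotation, ENNReal.ofReal_one, one_mul, absBlock]
  have hX : ∀ t ∈ Set.Icc 0 T, ∀ t' ∈ Set.Icc 0 T, ∀ k, wt W s k *
      eLpNorm (block W (ofBdd (z t' - z t).bcf) k) (1 / 2) volume ≤ M k := by
    intro t ht t' ht' k
    refine hhalf k _ fun x => ?_
    have h1 := ModSpace.absBlock_sub_le_lintegral hgc hzd ht ht' k x
    simp only [hgb] at h1
    exact h1
  have hr : 1 / 2 < p.toReal := by
    simpa using (ENNReal.toReal_lt_toReal (by simp) hp').2 hp
  set θ : ℝ := 1 / (2 * p.toReal) with hθ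
  have hθ0 : 0 ≤ θ := by positivity
  have hθ1 : 0 < 1 - θ := by
    rw [hθ, sub_pos, div_lt_one (by linarith)]
    linarith
  have hmeas : ∀ v k, Measurable (block W v k) := fun v k => (continuous_block W v k).measurable
  set K := C ^ (1 - θ) with hK
  have hKt : K ≠ ∞ := ENNReal.rpow_ne_top_of_nonneg hθ1.le hC
  -- With the sup bound `C X` from Bernstein at exponent `1/2`, interpolation returns `X^{1-θ} X^θ =
  -- X`. This is the majorant for dominated convergence.
  have hdom : ∀ t ∈ Set.Icc 0 T, ∀ t' ∈ Set.Icc 0 T, ∀ k, wt W s k *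
      eLpNorm (block W (ofBdd (z t' - z t).bcf) k) p volume ≤ K * M k := by
    intro t ht t' ht' k
    set X := eLpNorm (block W (ofBdd (z t' - z t).bcf) k) (1 / 2) volume with hXdef
    calc _ ≤ wt W s k * (K * X) := by
          refine mul_le_mul_right ?_ _
          refine (eLpNorm_le_rpow_mul_half (hmeas _ k) (hbern W _ k) hp.le hp').trans_eq ?_
          rw [← hXdef, ← hθ, ENNReal.mul_rpow_of_nonneg _ _ hθ1.le, mul_assoc,
            ← ENNReal.rpow_add_of_nonneg _ _ hθ1.le hθ0, sub_add_cancel, ENNReal.rpow_one]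
      _ = K * (wt W s k * X) := mul_left_comm _ _ _
      _ ≤ _ := mul_le_mul_right (hX t ht t' ht' k) _
  have hsum : ∑' k, K * M k ≠ ∞ := by
    rw [ENNReal.tsum_mul_left]
    exact ENNReal.mul_ne_top hKt hM
  refine ⟨fun t ht t' ht' => ?_, fun t ht => ?_⟩
  · rw [modNorm_eq]
    exact (ENNReal.tsum_le_tsum (hdom t ht t' ht')).trans_lt hsum.lt_top
  · simp_rw [modNorm_eq]
    refine tendsto_tsum_zero_of_dominated hsum
      (eventually_mem_nhdsWithin.mono fun t' ht' => hdom t ht t' ht') fun k => ?_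
    set L := ∫⁻ y, ‖W.χ y‖ₑ with hL
    have hLt : L ≠ ∞ := lintegral_schwartz_ne_top _
    have hMk : M k ≠ ∞ := ENNReal.ne_top_of_tsum_ne_top hM k
    -- For convergence of a single block the sup norm is used instead, since it tends to zero while
    -- the `L^{1/2}` norm stays bounded. Its exponent `1 - θ` is positive because `p > 1/2`.
    have hle : ∀ᶠ t' in 𝓝[Set.Icc 0 T] t, wt W s k *
        eLpNorm (block W (ofBdd (z t' - z t).bcf) k) p volume ≤
        wt W s k * ((‖(z t' - z t).bcf‖ₑ * L) ^ (1 - θ) * M k ^ θ) := by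
      refine eventually_mem_nhdsWithin.mono fun t' ht' => mul_le_mul_right ?_ _
      refine (eLpNorm_le_rpow_mul_half (hmeas _ k)
        (absBlock_ofBdd_le_enorm W (z t' - z t).bcf k) hp.le hp').trans ?_
      refine mul_le_mul_right (ENNReal.rpow_le_rpow ?_ hθ0) _
      refine le_trans ?_ (hX t ht t' ht' k)
      exact (one_mul _).symm.le.trans (mul_le_mul_left (one_le_wt W hs.out k) _)
    refine tendsto_of_tendsto_of_tendsto_of_le_of_le' tendsto_const_nhds ?_
      (Eventually.of_forall fun _ => zero_le) hle
    have h1 : Tendsto (fun t' => ‖(z t' - z t).bcf‖ₑ) (𝓝[Set.Icc 0 T] t) (𝓝 0) := by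
      have h2 : Continuous fun t' => ‖(ModSpace.toBCF W 1 s) (z t' - z t)‖ₑ :=
        ((ModSpace.toBCF W 1 s).continuous.comp (hzc.sub continuous_const)).enorm
      have h3 := (h2.tendsto t).mono_left (nhdsWithin_le_nhds (s := Set.Icc 0 T))
      rw [sub_self, map_zero, enorm_zero] at h3
      exact h3
    have h2 := ENNReal.Tendsto.mul_const h1 (Or.inr hLt)
    rw [zero_mul] at h2
    have h3 := (ENNReal.continuous_rpow_const (y := 1 - θ)).tendsto 0 |>.comp h2
    rw [ENNReal.zero_rpow_of_pos hθ1] at h3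
    have h4 := ENNReal.Tendsto.const_mul (ENNReal.Tendsto.mul_const h3
      (Or.inr (ENNReal.rpow_ne_top_of_nonneg hθ0 hMk))) (Or.inr (wt_ne_top W s k))
    rwa [zero_mul, mul_zero] at h4

/-- Solutions in `M^{1,1}_{0,s}` with data in `M^{p,1}_{0,s}`, `p > 1/2`, are continuous curves in
`M^{p,1}_{0,s}`. -/
theorem ModSpace.persistence (h : IsGaugeSeries c F) {p : ℝ≥0∞} (hp : 1 / 2 < p) (hp' : p ≠ ∞)
    {T : ℝ} (hT : 0 < T) {w : ℝ → ModSpace W 1 s}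
    (hw : ∀ t ∈ Set.Icc 0 T, HasDerivWithinAt w (ModSpace.field c t (w t)) (Set.Icc 0 T) t)
    (h0 : MemMod W p s (ofBdd (w 0).bcf)) :
    (∀ t ∈ Set.Icc 0 T, MemMod W p s (prop t (ofBdd (w t).bcf))) ∧
    ∀ t ∈ Set.Icc 0 T, Tendsto (fun τ => modNorm W p s
      (prop τ (ofBdd (w τ).bcf) - prop t (ofBdd (w t).bcf))) (𝓝[Set.Icc 0 T] t) (𝓝 0) := by
  -- Composition with the projection `π` of the line onto `[0, T]` makes `w` continuous everywhere
  -- without changing it on the interval.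
  wlog hwc : Continuous w generalizing w
  · set π : ℝ → ℝ := fun t => max 0 (min t T) with hπ
    have hπI : ∀ t, π t ∈ Set.Icc 0 T := fun t => ⟨le_max_left _ _, max_le hT.le (min_le_right _ _)⟩
    have hπe : ∀ t ∈ Set.Icc 0 T, π t = t := fun t ht => by
      rw [hπ]; simp only [min_eq_left ht.2, max_eq_right ht.1]
    have hwπ : ∀ t ∈ Set.Icc 0 T, w (π t) = w t := fun t ht => by rw [hπe t ht]
    have hwo : ContinuousOn w (Set.Icc 0 T) := fun t ht => (hw t ht).continuousWithinAt
    obtain ⟨h1, h2⟩ := this (w := fun t => w (π t)) (fun t ht => by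
        simp only [hwπ t ht]
        exact (hw t ht).congr (fun τ hτ => hwπ τ hτ) (hwπ t ht))
      (by simpa only [hwπ 0 ⟨le_rfl, hT.le⟩] using h0)
      (hwo.comp_continuous (by fun_prop) hπI)
    refine ⟨fun t ht => by simpa only [hwπ t ht] using h1 t ht, fun t ht => ?_⟩
    refine (h2 t ht).congr' (eventually_mem_nhdsWithin.mono fun τ hτ => ?_)
    simp only [hwπ t ht, hwπ τ hτ]
  set e : ℝ → ℂ := fun t => Complex.exp (-(Complex.I * (c 0 : ℂ) * t)) with he
  have hec : Continuous e := by fun_prop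
  have he0 : ∀ t, e t ≠ 0 := fun t => Complex.exp_ne_zero _
  have hen : ∀ t, ‖(e t)⁻¹‖ₑ = 1 := fun t => by
    rw [← ofReal_norm, norm_inv, norm_rotation, inv_one, ENNReal.ofReal_one]
  obtain ⟨hfin, htend⟩ := ModSpace.rotate_sub_bounds h hp hp' hT hwc hw
    (z := fun t => e t • w t) (fun t => rfl)
  set Z : ℝ → 𝓢'(Rd d, ℂ) := fun t => ofBdd (e t • w t).bcf with hZ
  have hsub : ∀ t t', ofBdd (e t' • w t' - e t • w t).bcf = Z t' - Z t := fun t t' => by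
    rw [map_sub, ofBdd_sub]
  have hwZ : ∀ t, ofBdd (w t).bcf = (e t)⁻¹ • Z t := fun t => by
    rw [hZ]
    simp only
    rw [← ofBdd_smul, ← map_smul, smul_smul, inv_mul_cancel₀ (he0 t), one_smul]
  have h0T : (0 : ℝ) ∈ Set.Icc 0 T := ⟨le_rfl, hT.le⟩
  have hZ0 : MemMod W p s (Z 0) := by
    have : Z 0 = ofBdd (w 0).bcf := by simp [hZ, he]
    rwa [this]
  have hZm : ∀ t ∈ Set.Icc 0 T, MemMod W p s (Z t) := fun t ht => by
    have h1 := modNorm_add_le' W p s (Z t - Z 0) (Z 0)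
    rw [sub_add_cancel] at h1
    refine h1.trans_lt (ENNReal.mul_lt_top (LpAddConst_ne_top p).lt_top
      (ENNReal.add_lt_top.2 ⟨?_, hZ0⟩))
    rw [← hsub]
    exact hfin 0 h0T t ht
  have hprop : ∀ t, prop t (ofBdd (w t).bcf) = (e t)⁻¹ • prop t (Z t) := fun t => by
    rw [hwZ, prop_smul]
  have hmem : ∀ t ∈ Set.Icc 0 T, MemMod W p s (prop t (Z t)) := fun t ht =>
    memMod_prop hp.le (hZm t ht) t
  refine ⟨fun t ht => ?_, fun t ht => ?_⟩
  · rw [hprop, MemMod, modNorm_smul, hen, one_mul]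
    exact hmem t ht
  · obtain ⟨C, hC, hCp⟩ := exists_modNorm_prop_le W T hp.le s
    set K := ENNReal.LpAddConst p with hK
    have hKt : K ≠ ∞ := LpAddConst_ne_top p
    -- The increment splits into that of `Z`, that of the group applied to the fixed `Z t`, and that
    -- of the phase; each addition costs the quasi-triangle constant `K`.
    have hle : ∀ τ ∈ Set.Icc 0 T,
        modNorm W p s (prop τ (ofBdd (w τ).bcf) - prop t (ofBdd (w t).bcf)) ≤
        K * (C * modNorm W p s (Z τ - Z t) + K * (modNorm W p s
          (prop (τ - t) (prop t (Z t)) - prop t (Z t)) +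
          ‖(e τ)⁻¹ - (e t)⁻¹‖ₑ * modNorm W p s (prop t (Z t)))) := by
      intro τ hτ
      have h1 : prop τ (ofBdd (w τ).bcf) - prop t (ofBdd (w t).bcf) =
          (e τ)⁻¹ • prop τ (Z τ - Z t) + ((e τ)⁻¹ • (prop τ (Z t) - prop t (Z t)) +
            ((e τ)⁻¹ - (e t)⁻¹) • prop t (Z t)) := by
        rw [hprop, hprop, prop_sub]
        refine DFunLike.ext _ _ fun φ => ?_
        change (e τ)⁻¹ * prop τ (Z τ) φ - (e t)⁻¹ * prop t (Z t) φ =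
          (e τ)⁻¹ * (prop τ (Z τ) φ - prop τ (Z t) φ) +
            ((e τ)⁻¹ * (prop τ (Z t) φ - prop t (Z t) φ) + ((e τ)⁻¹ - (e t)⁻¹) * prop t (Z t) φ)
        ring
      rw [h1]
      refine (modNorm_add_le' W p s _ _).trans (mul_le_mul_right (add_le_add ?_ ?_) _)
      · rw [modNorm_smul, hen, one_mul]
        exact hCp _ τ (abs_le.2 ⟨by linarith [hτ.1, hτ.2], hτ.2⟩)
      · refine (modNorm_add_le' W p s _ _).trans (mul_le_mul_right ?_ _)
        rw [modNorm_smul, modNorm_smul, hen, one_mul, ← prop_add, sub_add_cancel]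
    refine tendsto_of_tendsto_of_tendsto_of_le_of_le' tendsto_const_nhds ?_
      (Eventually.of_forall fun _ => zero_le) (eventually_mem_nhdsWithin.mono hle)
    have h1 : Tendsto (fun τ => modNorm W p s (Z τ - Z t)) (𝓝[Set.Icc 0 T] t) (𝓝 0) :=
      (htend t ht).congr fun τ => by rw [hsub]
    have h2 : Tendsto (fun τ => modNorm W p s (prop (τ - t) (prop t (Z t)) - prop t (Z t)))
        (𝓝[Set.Icc 0 T] t) (𝓝 0) := by
      have h3 : Tendsto (fun τ : ℝ => τ - t) (𝓝[Set.Icc 0 T] t) (𝓝 0) :=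
        Tendsto.mono_left (by simpa using (continuous_sub_right t).tendsto t) nhdsWithin_le_nhds
      exact (tendsto_modNorm_prop_sub W hp.le hs.out (hmem t ht)).comp h3
    have h3 : Tendsto (fun τ => ‖(e τ)⁻¹ - (e t)⁻¹‖ₑ) (𝓝[Set.Icc 0 T] t) (𝓝 0) := by
      have h4 : Continuous fun τ => ‖(e τ)⁻¹ - (e t)⁻¹‖ₑ :=
        ((hec.inv₀ he0).sub continuous_const).enorm
      exact Tendsto.mono_left (by simpa using h4.tendsto t) nhdsWithin_le_nhds
    have h4 := ENNReal.Tendsto.const_mul (a := K) ((ENNReal.Tendsto.const_mul (a := C) h1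
      (Or.inr hC)).add (ENNReal.Tendsto.const_mul (a := K)
        (h2.add (ENNReal.Tendsto.mul_const h3 (Or.inr (hmem t ht).ne))) (Or.inr hKt))) (Or.inr hKt)
    simpa using h4

end Persistence

/-- Well-posedness in the quasi-Banach modulation spaces. -/
theorem exists_solution_of_le_one {d : ℕ} {p : ℝ≥0∞} (hp : 1 / 2 < p) (hp1 : p ≤ 1) {s : ℝ}
    (hs : 0 ≤ s) {c : ℕ → ℝ} {F : ℂ → ℂ} (h : IsGaugeSeries c F) (W : Window d) :
    ∃ T₀ : ℝ≥0 → ℝ, Antitone T₀ ∧ (∀ r, 0 < T₀ r) ∧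
      ∀ u₀ : 𝓢'(Rd d, ℂ), MemMod W p s u₀ →
        ∃ Tmax : ℝ≥0∞, ENNReal.ofReal (T₀ (modNorm W p s u₀).toNNReal) < Tmax ∧
          ∃ u : ℝ → 𝓢'(Rd d, ℂ),
            IsSolution W p s F u₀ {t : ℝ | 0 ≤ t ∧ ENNReal.ofReal t < Tmax} u ∧
            (∀ T : ℝ, 0 < T → ∀ v : ℝ → 𝓢'(Rd d, ℂ),
              IsSolution W p s F u₀ (Set.Icc 0 T) v →
                ENNReal.ofReal T < Tmax ∧ Set.EqOn v u (Set.Icc 0 T)) ∧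
            (Tmax < ∞ →
              limsup (fun t : ℝ => modNorm W p s (u t)) (𝓝[<] Tmax.toReal) = ∞) := by
  have := Fact.mk hs
  have hp' : p ≠ ∞ := (hp1.trans_lt ENNReal.one_lt_top).ne
  obtain ⟨C, hC, hC1⟩ := exists_modNorm_one_le W hp.le hp1 s
  have hmem : ∀ {v : 𝓢'(Rd d, ℂ)}, MemMod W p s v → MemMod W 1 s v := fun {v} hv =>
    (hC1 v).trans_lt (ENNReal.mul_lt_top hC.lt_top hv)
  obtain ⟨T₀, hanti, hpos, hmain⟩ := ModSpace.exists_maximal_solution h W 1 s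
  -- The lifespan is that of the solution in `M^{1,1}`, whose datum has norm at most `C` times the
  -- norm in `M^{p,1}`.
  refine ⟨fun r => T₀ (C.toNNReal * r), fun r r' hr => hanti (by gcongr), fun r => hpos _,
    fun u₀ hu₀ => ?_⟩
  obtain ⟨v₀, rfl⟩ := ModSpace.exists_of_memMod (hmem hu₀)
  obtain ⟨Tmax, hT, w, hw0, hw, huniq, hblow⟩ := hmain v₀
  set J := {t : ℝ | 0 ≤ t ∧ ENNReal.ofReal t < Tmax} with hJ
  have hlt : ENNReal.ofReal (T₀ (C.toNNReal * (modNorm W p s (ofBdd v₀.bcf)).toNNReal)) < Tmax := by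
    refine lt_of_le_of_lt (ENNReal.ofReal_le_ofReal (hanti ?_)) hT
    rw [← ENNReal.toNNReal_mul]
    exact ENNReal.toNNReal_mono (ENNReal.mul_ne_top hC hu₀.ne) (hC1 _)
  have hpers : ∀ t ∈ J, ∃ T, t < T ∧ (∀ t ∈ Set.Icc 0 T, MemMod W p s (prop t (ofBdd (w t).bcf))) ∧
      ∀ t ∈ Set.Icc 0 T, Tendsto (fun τ => modNorm W p s
        (prop τ (ofBdd (w τ).bcf) - prop t (ofBdd (w t).bcf))) (𝓝[Set.Icc 0 T] t) (𝓝 0) := by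
    intro t ht
    obtain ⟨T, htT, hTm⟩ := ENNReal.lt_iff_exists_nnreal_btwn.1 ht.2
    have htT' : t < T := by
      rw [← ENNReal.ofReal_coe_nnreal, ENNReal.ofReal_lt_ofReal_iff_of_nonneg ht.1] at htT
      exact htT
    refine ⟨T, htT', ModSpace.persistence h hp hp' (ht.1.trans_lt htT') (fun τ hτ => ?_)
      (by rwa [hw0])⟩
    have hsub : Set.Icc 0 (T : ℝ) ⊆ J := fun τ hτ => ⟨hτ.1, lt_of_le_of_lt
      (ENNReal.ofReal_le_ofReal hτ.2) (by rwa [ENNReal.ofReal_coe_nnreal])⟩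
    exact (hw τ (hsub hτ)).mono hsub
  refine ⟨Tmax, hlt, fun t => prop t (ofBdd (w t).bcf),
    ⟨fun t ht => ?_, fun t ht => ?_, ?_, fun t ht => ModSpace.weak_eqn h (hw t ht)⟩,
    fun T hT v hv => huniq T hT v ⟨fun t ht => hmem (hv.mem t ht), fun t ht => ?_, hv.init, hv.eqn⟩,
    fun hTm => limsup_eq_top_of_frequently fun R hR => ?_⟩
  · obtain ⟨T, htT, h1, -⟩ := hpers t ht
    exact h1 t ⟨ht.1, htT.le⟩
  · obtain ⟨T, htT, -, h2⟩ := hpers t ht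
    refine (h2 t ⟨ht.1, htT.le⟩).mono_left (nhdsWithin_le_iff.2 ?_)
    filter_upwards [self_mem_nhdsWithin, nhdsWithin_le_nhds (Iio_mem_nhds htT)] with τ h3 h4
    exact ⟨h3.1, h4.le⟩
  · rw [prop_zero, hw0]
  -- A competing solution in `M^{p,1}` is also one in `M^{1,1}`, where uniqueness and maximality are
  -- known; only its continuity there uses the embedding constant.
  · have h1 := ENNReal.Tendsto.const_mul (a := C) (hv.cont t ht) (Or.inr hC)
    rw [mul_zero] at h1
    exact tendsto_of_tendsto_of_tendsto_of_le_of_le tendsto_const_nhds h1 (fun _ => zero_le)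
      fun τ => hC1 _
  -- Blow-up of the smaller norm in `M^{1,1}` forces blow-up in `M^{p,1}`.
  · refine (hblow hTm (C * R) (ENNReal.mul_ne_top hC hR)).mono fun t ht => ?_
    by_contra hcon
    exact absurd (ht.trans_le (hC1 _)) (not_lt.2 (mul_le_mul_right (not_lt.1 hcon) C))

end NLSMod
end

theorem theorem1p1 (d : ℕ) (hd : 1 ≤ d) (p : ℝ≥0∞) (hp : (d : ℝ≥0∞) / (d + 1) < p)
    (s : ℝ) (hs : 0 ≤ s) (F : ℂ → ℂ)
    (hF : (∃ (a : ℝ) (k : ℕ), F = NLSMod.powNl a k) ∨ (∃ a ρ : ℝ, F = NLSMod.expNl a ρ))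
    (W : NLSMod.Window d) :
    ∃ T₀ : ℝ≥0 → ℝ, Antitone T₀ ∧ (∀ r, 0 < T₀ r) ∧
      ∀ u₀ : 𝓢'(NLSMod.Rd d, ℂ), NLSMod.MemMod W p s u₀ →
        ∃ Tmax : ℝ≥0∞, ENNReal.ofReal (T₀ (NLSMod.modNorm W p s u₀).toNNReal) < Tmax ∧
          ∃ u : ℝ → 𝓢'(NLSMod.Rd d, ℂ),
            NLSMod.IsSolution W p s F u₀ {t : ℝ | 0 ≤ t ∧ ENNReal.ofReal t < Tmax} u ∧
            (∀ T : ℝ, 0 < T → ∀ v : ℝ → 𝓢'(NLSMod.Rd d, ℂ),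
              NLSMod.IsSolution W p s F u₀ (Set.Icc 0 T) v →
                ENNReal.ofReal T < Tmax ∧ Set.EqOn v u (Set.Icc 0 T)) ∧
            (Tmax < ∞ →
              limsup (fun t : ℝ => NLSMod.modNorm W p s (u t)) (𝓝[<] Tmax.toReal) = ∞) := by
  obtain ⟨c, hc⟩ : ∃ c, NLSMod.IsGaugeSeries c F := by
    rcases hF with ⟨a, k, rfl⟩ | ⟨a, ρ, rfl⟩
    · exact ⟨_, NLSMod.isGaugeSeries_powNl a k⟩
    · exact ⟨_, NLSMod.isGaugeSeries_expNl a ρ⟩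
  rcases le_total 1 p with h1 | h1
  · exact NLSMod.exists_solution_of_one_le h1 hs hc W
  · refine NLSMod.exists_solution_of_le_one (lt_of_le_of_lt ?_ hp) h1 hs hc W
    -- `d ≥ 1` gives `d/(d+1) ≥ 1/2`; beyond this the argument does not use the lower bound on `p`.
    have hd' : (1 : ℝ≥0∞) ≤ d := by exact_mod_cast hd
    rw [ENNReal.le_div_iff_mul_le (Or.inl (by simp)) (Or.inl (by finiteness))]
    calc (1 / 2 : ℝ≥0∞) * (d + 1) ≤ 1 / 2 * (d + d) := by gcongr
      _ = d := by
        rw [← two_mul, ← mul_assoc, one_div, ENNReal.inv_mul_cancel (by norm_num) (by norm_num),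
          one_mul]
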